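/- Let $m>0$, $s\neq 0$, $n\ge 4$, $1\le r<[n/2]$, and let $\kappa$ be the skew-symmetric matrix of the form $\sum_{i\le [n/2]}\kappa_{2i-1,2i}\,d\gamma_{2i-1}\wedge d\gamma_{2i}$ with $\kappa_{12}=\dots=\kappa_{2r-1,2r}\neq 0$ and $\kappa_{2r+1,2r+2}=\dots=\kappa_{2[n/2]-1,2[n/2]}=0$. On $T^*S^{n-1}=\{(\gamma,p)\in\mathbb R^{2n}: \langle\gamma,\gamma\rangle=1,\ \langle p,\gamma\rangle=0\}$, with the twisted symplectic form $\sum_i dp_i\wedge d\gamma_i+s\sum_{i<j}\kappa_{ij}\,d\gamma_i\wedge d\gamma_j$, whose Poisson bracket is the Dirac bracket, consider the magnetic geodesic flow $$\dot\gamma=\tfrac1m p,\qquad \dot p=\tfrac sm\kappa p+\mu\gamma,\qquad \mu=\tfrac1m\big(s\langle p,\kappa\gamma\rangle-\langle p,p\rangle\big).$$ Put $$H=\tfrac1{2m}\langle p,p\rangle,\qquad J=\tfrac{s^2}{m^2}\sum_{i=1}^{[n/2]}\kappa_{2i-1,2i}^2(p_{2i-1}^2+p_{2i}^2)-\mu^2,$$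 $$\Phi_{2k-1,2k}=\gamma_{2k-1}p_{2k}-\gamma_{2k}p_{2k-1}+\tfrac{s\kappa_{2k-1,2k}}2(\gamma_{2k-1}^2+\gamma_{2k}^2)\quad (1\le k\le r),$$ $$\Phi_{ij}=\gamma_ip_j-\gamma_jp_i\quad (2r+1\le i<j\le n),$$ and, for $1\le i<j\le r$, $$\Psi^1_{2i-1,2i;2j-1,2j}=(\gamma_{2i}p_{2j-1}-\gamma_{2j-1}p_{2i})-(\gamma_{2i-1}p_{2j}-\gamma_{2j}p_{2i-1})-s\kappa_{2i-1,2i}(\gamma_{2i-1}\gamma_{2j-1}+\gamma_{2i}\gamma_{2j}),$$ $$\Psi^2_{2i-1,2i;2j-1,2j}=(\gamma_{2i-1}p_{2j-1}-\gamma_{2j-1}p_{2i-1})+(\gamma_{2i}p_{2j}-\gamma_{2j}p_{2i})-s\kappa_{2i-1,2i}(\gamma_{2i-1}\gamma_{2j}-\gamma_{2i}\gamma_{2j-1}).$$ Let $\mathcal F$ be the set of all these functions, and let $d=4$ if $r\ge 2$ and $d=3$ if $r=1$. (1) The flow is integrable in the noncommutative sense by means of $\mathcal F$: the elements of $\mathcal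 F$ are first integrals, the algebra they generate is closed under the Poisson bracket, and on an open dense subset of $T^*S^{n-1}$ the span of the differentials of $\mathcal F$ has dimension $2(n-1)-d$, while the kernel of the Poisson structure on this span has dimension $d$. (2) Generic motions are quasi-periodic over $d$-dimensional invariant isotropic tori: for every $x$ in an open dense subset of $T^*S^{n-1}$, the connected component through $x$ of the common level set of $\mathcal F$ is a smoothly embedded isotropic torus $\mathbb R^d/\mathbb Z^d$ on which the flow is linear. (3) The flow is Liouville integrable: the functions $H$, $J$, $\Phi_{2k-1,2k}$ ($1\le k\le r$), $\Phi_{2r+1,2r+2}$, $$I_k=\sum_{1\le i<j\le k}\big((\Psi^1_{2i-1,2i;2j-1,2j})^2+(\Psi^2_{2i-1,2i;2j-1,2j})^2\big)\ (2\le k\le r),\qquad I_{r+k}=\sum_{2r+1\le i<j\le 2r+2+k}(\Phi_{ij})^2\ (1\le k\le n-2r-2)$$ are pairwise Poisson commuting first integrals on $T^*S^{n-1}$, and $n-1$ of them are functionally independent at every point of an open dense subset. If $n=2r+2$, the same holds with $\Phi_{2r+1,2r+2}$ omitted. -/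

import Mathlib

open scoped ContDiff Matrix

namespace MagneticSphere

/-- The space `ℝ²ⁿ` of pairs `(γ, p)`. (Coordinates are indexed from `0`, so that `γ₁, …, γₙ`
are `x.1 0, …, x.1 (n - 1)`. Only the topology of this space is used, not its norm.) -/
abbrev Ph (n : ℕ) : Type := (Fin n → ℝ) × (Fin n → ℝ)

/-- The (zero-based) position of the coordinate `γ_{2i-1}` of the `i`-th coordinate plane. -/
def od {n : ℕ} (i : Fin (n / 2)) : Fin n := ⟨2 * i.1, by have := i.2; omega⟩

/-- The (zero-based) position of the coordinate `γ_{2i}` of the `i`-th coordinate plane. -/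
def ev {n : ℕ} (i : Fin (n / 2)) : Fin n := ⟨2 * i.1 + 1, by have := i.2; omega⟩

/-- The cotangent bundle of the sphere `Sⁿ⁻¹` inside `ℝ²ⁿ`: `⟨γ, γ⟩ = 1`, `⟨p, γ⟩ = 0`. -/
def cotangentSphere (n : ℕ) : Set (Ph n) :=
  {x | x.1 ⬝ᵥ x.1 = 1 ∧ x.2 ⬝ᵥ x.1 = 0}

/-- A property holds at the generic point of the phase space: on an open dense subset of it. -/
def Generically {n : ℕ} (P : Ph n → Prop) : Prop :=
  ∃ O : Set (Ph n), IsOpen O ∧ cotangentSphere n ⊆ closure (O ∩ cotangentSphere n) ∧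
    ∀ x ∈ O ∩ cotangentSphere n, P x

/-- The tangent space at `x` of the phase space, i.e. the common kernel of the differentials of
the two constraints. -/
def tangentAt {n : ℕ} (x : Ph n) : Submodule ℝ (Ph n) where
  carrier := {v | x.1 ⬝ᵥ v.1 = 0 ∧ x.2 ⬝ᵥ v.1 + x.1 ⬝ᵥ v.2 = 0}
  add_mem' := by
    rintro u v ⟨h1, h2⟩ ⟨h3, h4⟩
    refine ⟨?_, ?_⟩
    · simp [dotProduct_add, h1, h3]
    · simp only [Prod.fst_add, Prod.snd_add, dotProduct_add]; linarith
  zero_mem' := by simp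
  smul_mem' := by
    rintro c v ⟨h1, h2⟩
    refine ⟨?_, ?_⟩
    · simp [dotProduct_smul, h1]
    · simp only [Prod.smul_fst, Prod.smul_snd, dotProduct_smul, ← smul_add, h2, smul_zero]

/-- The skew-symmetric matrix of the magnetic field
`κ₁₂ dγ₁ ∧ dγ₂ + κ₃₄ dγ₃ ∧ dγ₄ + …`; the number `κ_{2i-1,2i}` is `κ i` (with `i` from `0`). -/
def fieldMatrix {n : ℕ} (κ : Fin (n / 2) → ℝ) : Matrix (Fin n) (Fin n) ℝ := fun a b =>
  ∑ i, κ i * ((if a = od i ∧ b = ev i then 1 else 0) - (if a = ev i ∧ b = od i then 1 else 0))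

/-- The twisted symplectic form `∑ dpᵢ ∧ dγᵢ + s ∑_{i<j} κᵢⱼ dγᵢ ∧ dγⱼ`. -/
def twistedForm {n : ℕ} (s : ℝ) (κ : Fin (n / 2) → ℝ) (u v : Ph n) : ℝ :=
  (u.2 ⬝ᵥ v.1 - u.1 ⬝ᵥ v.2) + s * (u.1 ⬝ᵥ (fieldMatrix κ *ᵥ v.1))

/-- The magnetic Poisson bivector on covectors of `ℝ²ⁿ`. -/
def magneticBivector {n : ℕ} (s : ℝ) (κ : Fin (n / 2) → ℝ) (α β : Module.Dual ℝ (Ph n)) : ℝ :=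
  ∑ i, (α (Pi.single i 1, 0) * β (0, Pi.single i 1) - α (0, Pi.single i 1) * β (Pi.single i 1, 0))
    + s * ∑ i, ∑ j, fieldMatrix κ i j * α (0, Pi.single i 1) * β (0, Pi.single j 1)

/-- The differential of a function on `ℝ²ⁿ` at a point. -/
noncomputable def diff {n : ℕ} (f : Ph n → ℝ) (x : Ph n) : Module.Dual ℝ (Ph n) :=
  (fderiv ℝ f x).toLinearMap

/-- The constraint `φ₁ = ⟨γ, γ⟩`. -/
def phi1 {n : ℕ} (x : Ph n) : ℝ := x.1 ⬝ᵥ x.1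

/-- The constraint `φ₂ = ⟨p, γ⟩`. -/
def phi2 {n : ℕ} (x : Ph n) : ℝ := x.2 ⬝ᵥ x.1

/-- The Dirac magnetic Poisson bivector at the point `x`. -/
noncomputable def diracBivector {n : ℕ} (s : ℝ) (κ : Fin (n / 2) → ℝ) (x : Ph n)
    (α β : Module.Dual ℝ (Ph n)) : ℝ :=
  magneticBivector s κ α β -
    (magneticBivector s κ α (diff phi1 x) * magneticBivector s κ β (diff phi2 x) -
      magneticBivector s κ α (diff phi2 x) * magneticBivector s κ β (diff phi1 x)) /
      magneticBivector s κ (diff phi1 x) (diff phi2 x)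

/-- The Dirac magnetic Poisson bracket `{f, g}_d`. -/
noncomputable def diracBracket {n : ℕ} (s : ℝ) (κ : Fin (n / 2) → ℝ) (f g : Ph n → ℝ)
    (x : Ph n) : ℝ :=
  diracBivector s κ x (diff f x) (diff g x)

/-- The Lagrange multiplier `μ = (s ⟨p, κγ⟩ - ⟨p, p⟩) / m`. -/
noncomputable def multiplier {n : ℕ} (m s : ℝ) (κ : Fin (n / 2) → ℝ) (x : Ph n) : ℝ :=
  (s * (x.2 ⬝ᵥ (fieldMatrix κ *ᵥ x.1)) - x.2 ⬝ᵥ x.2) / m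

/-- The vector field of the magnetic flow: `γ' = p / m`, `p' = (s / m) κ p + μ γ`. -/
noncomputable def magneticField {n : ℕ} (m s : ℝ) (κ : Fin (n / 2) → ℝ) (x : Ph n) : Ph n :=
  ((1 / m) • x.2, (s / m) • (fieldMatrix κ *ᵥ x.2) + multiplier m s κ x • x.1)

/-- A smooth function that is constant along the magnetic flow on the phase space. -/
def IsFirstIntegral {n : ℕ} (m s : ℝ) (κ : Fin (n / 2) → ℝ) (f : Ph n → ℝ) : Prop :=
  ContDiff ℝ ∞ f ∧ ∀ x ∈ cotangentSphere n, diff f x (magneticField m s κ x) = 0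

/-- The span at `x` of the differentials of the functions of a family. -/
def diffSpan {n : ℕ} (𝓕 : Set (Ph n → ℝ)) (x : Ph n) : Submodule ℝ (Module.Dual ℝ (Ph n)) :=
  Submodule.span ℝ ((fun f => diff f x) '' 𝓕)

/-- The differential dimension at `x`: the number of functions of the family, restricted to the
phase space, that are independent at `x`. -/
noncomputable def ddimAt {n : ℕ} (𝓕 : Set (Ph n → ℝ)) (x : Ph n) : ℕ :=
  Module.finrank ℝ ((diffSpan 𝓕 x).map (tangentAt x).dualRestrict)

/-- The differential index at `x`: the dimension of the kernel of the Poisson bivector on the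
span of the differentials (restricted to the phase space) of the family. -/
noncomputable def dindAt {n : ℕ} (s : ℝ) (κ : Fin (n / 2) → ℝ) (𝓕 : Set (Ph n → ℝ))
    (x : Ph n) : ℕ :=
  Module.finrank ℝ ((Submodule.span ℝ
    {α | α ∈ diffSpan 𝓕 x ∧ ∀ β ∈ diffSpan 𝓕 x, diracBivector s κ x α β = 0}).map
      (tangentAt x).dualRestrict)

/-- Integrability in the noncommutative sense by means of the first integrals `𝓕`, with
`k`-dimensional generic invariant manifolds: the algebra generated by `𝓕` is closed under the
bracket, and generically `ddim 𝓕 + dind 𝓕 = dim T*Sⁿ⁻¹` with `dind 𝓕 = k`. -/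
def IsNoncommutativelyIntegrable {n : ℕ} (m s : ℝ) (κ : Fin (n / 2) → ℝ)
    (𝓕 : Set (Ph n → ℝ)) (k : ℕ) : Prop :=
  (∀ f ∈ 𝓕, IsFirstIntegral m s κ f) ∧
  (∀ f ∈ 𝓕, ∀ g ∈ 𝓕, ∃ h ∈ Algebra.adjoin ℝ 𝓕, ∀ x ∈ cotangentSphere n,
    diracBracket s κ f g x = h x) ∧
  Generically fun x => ddimAt 𝓕 x + dindAt s κ 𝓕 x = 2 * (n - 1) ∧ dindAt s κ 𝓕 x = k

/-- Liouville integrability by means of the Poisson commuting first integrals `𝓕`, of which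
`n - 1 = dim Sⁿ⁻¹` are generically independent. -/
def IsLiouvilleIntegrable {n : ℕ} (m s : ℝ) (κ : Fin (n / 2) → ℝ)
    (𝓕 : Set (Ph n → ℝ)) : Prop :=
  (∀ f ∈ 𝓕, IsFirstIntegral m s κ f) ∧
  (∀ f ∈ 𝓕, ∀ g ∈ 𝓕, ∀ x ∈ cotangentSphere n, diracBracket s κ f g x = 0) ∧
  Generically (n := n) fun x => ddimAt 𝓕 x = n - 1

/-- `T` is an isotropic `k`-dimensional torus in the phase space, smoothly embedded through a
parametrization `Θ` by `ℝᵏ / ℤᵏ` in which the magnetic flow is linear. -/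
def IsQuasiPeriodicIsotropicTorus {n : ℕ} (m s : ℝ) (κ : Fin (n / 2) → ℝ) (k : ℕ)
    (T : Set (Ph n)) : Prop :=
  T ⊆ cotangentSphere n ∧
  ∃ Θ : (Fin k → ℝ) → Ph n, ContDiff ℝ ∞ Θ ∧ Set.range Θ = T ∧
    (∀ a b, Θ a = Θ b ↔ ∃ z : Fin k → ℤ, ∀ i, b i = a i + (z i : ℝ)) ∧
    (∀ a, Function.Injective (fderiv ℝ Θ a)) ∧
    (∀ a u v, twistedForm s κ (fderiv ℝ Θ a u) (fderiv ℝ Θ a v) = 0) ∧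
    ∃ c : Fin k → ℝ, ∀ a, ∀ t : ℝ,
      HasDerivAt (fun τ : ℝ => Θ (a + τ • c)) (magneticField m s κ (Θ (a + t • c))) t

/-- Generic motions are quasi-periodic over `k`-dimensional invariant isotropic tori, which are
the connected components of the common level sets of the functions in `𝓕`. -/
def GenericMotionsOnTori {n : ℕ} (m s : ℝ) (κ : Fin (n / 2) → ℝ)
    (𝓕 : Set (Ph n → ℝ)) (k : ℕ) : Prop :=
  Generically fun x => IsQuasiPeriodicIsotropicTorus m s κ k
    (connectedComponentIn {y | y ∈ cotangentSphere n ∧ ∀ f ∈ 𝓕, f y = f x} x)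

/-- The Hamiltonian `H = ⟨p, p⟩ / (2m)`. -/
noncomputable def energy {n : ℕ} (m : ℝ) (x : Ph n) : ℝ := 1 / (2 * m) * (x.2 ⬝ᵥ x.2)

/-- The first integral `J`. -/
noncomputable def integralJ {n : ℕ} (m s : ℝ) (κ : Fin (n / 2) → ℝ) (x : Ph n) : ℝ :=
  s ^ 2 / m ^ 2 * ∑ i, κ i ^ 2 * (x.2 (od i) ^ 2 + x.2 (ev i) ^ 2) - multiplier m s κ x ^ 2

/-- The angular momentum `Φ_{ij} = γᵢ pⱼ - γⱼ pᵢ`. -/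
def angular {n : ℕ} (i j : Fin n) (x : Ph n) : ℝ := x.1 i * x.2 j - x.1 j * x.2 i

/-- The gauge Noether integral `Φ_{2i-1,2i}`. -/
noncomputable def Phi {n : ℕ} (s : ℝ) (κ : Fin (n / 2) → ℝ) (i : Fin (n / 2)) (x : Ph n) : ℝ :=
  x.1 (od i) * x.2 (ev i) - x.1 (ev i) * x.2 (od i)
    + s * (κ i / 2) * (x.1 (od i) ^ 2 + x.1 (ev i) ^ 2)

/-- The function `Ψ¹_{2i-1,2i;2j-1,2j}`. -/
def Psi1 {n : ℕ} (s : ℝ) (κ : Fin (n / 2) → ℝ) (i j : Fin (n / 2)) (x : Ph n) : ℝ :=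
  (x.1 (ev i) * x.2 (od j) - x.1 (od j) * x.2 (ev i))
    - (x.1 (od i) * x.2 (ev j) - x.1 (ev j) * x.2 (od i))
    - s * κ i * (x.1 (od i) * x.1 (od j) + x.1 (ev i) * x.1 (ev j))

/-- The function `Ψ²_{2i-1,2i;2j-1,2j}`. -/
def Psi2 {n : ℕ} (s : ℝ) (κ : Fin (n / 2) → ℝ) (i j : Fin (n / 2)) (x : Ph n) : ℝ :=
  (x.1 (od i) * x.2 (od j) - x.1 (od j) * x.2 (od i))
    + (x.1 (ev i) * x.2 (ev j) - x.1 (ev j) * x.2 (ev i))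
    - s * κ i * (x.1 (od i) * x.1 (ev j) - x.1 (ev i) * x.1 (od j))

/-- `∑_{1 ≤ i < j ≤ k} (Ψ¹_{2i-1,2i;2j-1,2j})² + (Ψ²_{2i-1,2i;2j-1,2j})²`. -/
def unitaryCasimir {n : ℕ} (s : ℝ) (κ : Fin (n / 2) → ℝ) (k : ℕ) (x : Ph n) : ℝ :=
  ∑ i, ∑ j, if i < j ∧ j.1 < k then Psi1 s κ i j x ^ 2 + Psi2 s κ i j x ^ 2 else 0

/-- `∑_{2r+1 ≤ i < j ≤ 2r+2+k} (Φ_{ij})²` (with one-based `i`, `j`). -/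
def orthogonalCasimir {n : ℕ} (r k : ℕ) (x : Ph n) : ℝ :=
  ∑ i : Fin n, ∑ j : Fin n,
    if 2 * r ≤ i.1 ∧ i < j ∧ j.1 < 2 * r + 2 + k then angular i j x ^ 2 else 0

/-- The first integrals `H`, `J`, `Φ_{2k-1,2k}` (`k ≤ r`), `Ψ¹`, `Ψ²` (`i < j ≤ r`) and `Φ_{ij}`
(`2r + 1 ≤ i < j ≤ n`). -/
def noncommutativeFamily {n : ℕ} (m s : ℝ) (κ : Fin (n / 2) → ℝ) (r : ℕ) : Set (Ph n → ℝ) :=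
  {energy m, integralJ m s κ} ∪
  {f | ∃ k : Fin (n / 2), k.1 < r ∧ f = Phi s κ k} ∪
  {f | ∃ i j : Fin (n / 2), i < j ∧ j.1 < r ∧ (f = Psi1 s κ i j ∨ f = Psi2 s κ i j)} ∪
  {f | ∃ i j : Fin n, 2 * r ≤ i.1 ∧ i < j ∧ f = angular i j}

/-- The functions `H`, `J`, `Φ_{2k-1,2k}` (`k ≤ r`), `I_k` (`2 ≤ k ≤ r`) and `I_{r+k}`
(`1 ≤ k ≤ n - 2r - 2`). -/
def filtrationFamily {n : ℕ} (m s : ℝ) (κ : Fin (n / 2) → ℝ) (r : ℕ) : Set (Ph n → ℝ) :=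
  {energy m, integralJ m s κ} ∪
  {f | ∃ k : Fin (n / 2), k.1 < r ∧ f = Phi s κ k} ∪
  {f | ∃ k : ℕ, 2 ≤ k ∧ k ≤ r ∧ f = unitaryCasimir s κ k} ∪
  {f | ∃ k : ℕ, 1 ≤ k ∧ k ≤ n - 2 * r - 2 ∧ f = orthogonalCasimir r k}

end MagneticSphere

open MagneticSphere

namespace MagneticSphere

variable {n : ℕ}

/-! Collect the coordinates of the magnetic planes into z ∈ ℂ^r. The field acts on z as
multiplication by -iκ₀ and kills the other n - 2r coordinates, so the rotations in u(r) ⊕ o(n - 2r)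
preserve it. Their cotangent lifts are Hamiltonian. In terms of the gauge momentum v = p_z + (iε/2)
z with ε = sκ₀, their Noether integrals are the entries of conj(z_i) v_j - conj(v_i) z_j, which
contain all Φ_{2k-1,2k}, Ψ¹ and Ψ², and the ordinary angular momenta of the remaining coordinates. H
is invariant under these rotations, so the moments are first integrals. The bracket of two moments
is a moment of a commutator, and H and J commute with everything, so the algebra closes. On the
phase space J is a polynomial in H and the moments (`integralJ_relation`).

Invariant tori. The matrix of unitary moments is skew-Hermitian of rank at most two. Fixing it
forces z = √a ∑ exp(iθ_k) A_k with fixed orthogonal modes A_k: one if r = 1 and two for generic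
points with r ≥ 2 (`IsModes.exists_phase`). The angular momenta likewise fix a real plane and leave
one phase (`IsPlane.exists_phase`). The constraints express the radial data of the real part through
a = |z|² and c = Re⟨z, v⟩, and the energy becomes c² = f(a) for a cubic f. It is negative at 0 and 1
and positive at a generic starting point, so over (0, 1) the curve is a single oval
(`exists_isOscillation`). A generic common level set is thus a circle times the circles of phases.
The phases advance at rates periodic in the radial time; subtracting their oscillating parts makes
the flow linear. The torus is isotropic because rotations of orthogonal modes pair to zero and H is
constant on it.

Ranks. Once the common kernel of the differentials is isotropic, the kernel of the bivector on their
span has the same dimension (`finrank_kernel_of_isotropic`). That common kernel contains the tangent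
space of the torus. It lies in the kernel of the linearized moments, of dimension at most d + 3, on
which the two constraints and H are independent. So it equals the tangent space of the torus.

Commuting family. The sums I_k belong to the chains u(1) ⊂ u(2) ⊂ … and o(2) ⊂ o(3) ⊂ …. Up to
squares of diagonal moments they are quadratic Casimir functions, invariant under every smaller
algebra of the chain, hence they commute. Test vectors that touch one coordinate at a time give a
triangular system, which proves independence (`coefficients_eq_zero`).

Genericity. Every condition is the nonvanishing of an even analytic function. Such a function,
nonzero at one explicit point, is nonzero on an open dense set, by the identity theorem along curves
joining points of the phase space. -/

/-! ### The twisted symplectic form and the Hamiltonian vectors of the Dirac bivector -/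

theorem fieldMatrix_transpose (κ : Fin (n / 2) → ℝ) :
    (fieldMatrix κ)ᵀ = -fieldMatrix κ := by
  ext a b
  simp only [Matrix.transpose_apply, fieldMatrix, Matrix.neg_apply, ← Finset.sum_neg_distrib]
  refine Finset.sum_congr rfl fun i _ => ?_
  rw [← mul_neg, neg_sub]
  congr 2 <;> simp only [and_comm]

theorem dot_fieldMatrix (κ : Fin (n / 2) → ℝ) (u v : Fin n → ℝ) :
    u ⬝ᵥ (fieldMatrix κ *ᵥ v) = -((fieldMatrix κ *ᵥ u) ⬝ᵥ v) := by
  rw [Matrix.dotProduct_mulVec, ← Matrix.mulVec_transpose, fieldMatrix_transpose,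
    Matrix.neg_mulVec, neg_dotProduct]

theorem twistedForm_antisymm (s : ℝ) (κ : Fin (n / 2) → ℝ) (u v : Ph n) :
    twistedForm s κ u v = -twistedForm s κ v u := by
  simp only [twistedForm]
  rw [dot_fieldMatrix κ u.1 v.1, dotProduct_comm (fieldMatrix κ *ᵥ u.1), dotProduct_comm u.2,
    dotProduct_comm u.1 v.2]
  ring

theorem twistedForm_add_left (s : ℝ) (κ : Fin (n / 2) → ℝ) (u u' v : Ph n) :
    twistedForm s κ (u + u') v = twistedForm s κ u v + twistedForm s κ u' v := by
  simp only [twistedForm, Prod.fst_add, Prod.snd_add, add_dotProduct]; ring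

theorem twistedForm_smul_left (s : ℝ) (κ : Fin (n / 2) → ℝ) (c : ℝ) (u v : Ph n) :
    twistedForm s κ (c • u) v = c * twistedForm s κ u v := by
  simp only [twistedForm, Prod.smul_fst, Prod.smul_snd, smul_dotProduct, smul_eq_mul]; ring

theorem twistedForm_add_right (s : ℝ) (κ : Fin (n / 2) → ℝ) (u v v' : Ph n) :
    twistedForm s κ u (v + v') = twistedForm s κ u v + twistedForm s κ u v' := by
  rw [twistedForm_antisymm, twistedForm_add_left, twistedForm_antisymm s κ v,
    twistedForm_antisymm s κ v']; ring

theorem twistedForm_smul_right (s : ℝ) (κ : Fin (n / 2) → ℝ) (c : ℝ) (u v : Ph n) :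
    twistedForm s κ u (c • v) = c * twistedForm s κ u v := by
  rw [twistedForm_antisymm, twistedForm_smul_left, twistedForm_antisymm s κ v]; ring

/-- The twisted symplectic form as a bilinear form. -/
def twistedBilin (s : ℝ) (κ : Fin (n / 2) → ℝ) : Ph n →ₗ[ℝ] Ph n →ₗ[ℝ] ℝ :=
  LinearMap.mk₂ ℝ (twistedForm s κ) (twistedForm_add_left s κ) (twistedForm_smul_left s κ)
    (twistedForm_add_right s κ) (twistedForm_smul_right s κ)

@[simp] theorem twistedBilin_apply (s : ℝ) (κ : Fin (n / 2) → ℝ) (u v : Ph n) :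
    twistedBilin s κ u v = twistedForm s κ u v := rfl

/-- The `γ`-components of a covector. -/
def covFst (α : Module.Dual ℝ (Ph n)) : Fin n → ℝ := fun i => α (Pi.single i 1, 0)

/-- The `p`-components of a covector. -/
def covSnd (α : Module.Dual ℝ (Ph n)) : Fin n → ℝ := fun i => α (0, Pi.single i 1)

theorem covector_apply (α : Module.Dual ℝ (Ph n)) (v : Ph n) :
    α v = covFst α ⬝ᵥ v.1 + covSnd α ⬝ᵥ v.2 := by
  have h : v = ∑ i, (v.1 i • ((Pi.single i 1, 0) : Ph n) + v.2 i • ((0, Pi.single i 1) : Ph n)) := by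
    rw [Finset.sum_add_distrib]
    ext i <;> simp [Prod.fst_sum, Prod.snd_sum, Finset.sum_apply, Pi.single_apply]
  conv_lhs => rw [h]
  simp only [map_sum, map_add, map_smul, smul_eq_mul, dotProduct, covFst, covSnd,
    ← Finset.sum_add_distrib]
  exact Finset.sum_congr rfl fun i _ => by ring

/-- The Hamiltonian vector of a covector for the magnetic bivector of `ℝ²ⁿ`. -/
def freeHam (s : ℝ) (κ : Fin (n / 2) → ℝ) (α : Module.Dual ℝ (Ph n)) : Ph n :=
  (covSnd α, -covFst α + s • (fieldMatrix κ *ᵥ covSnd α))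

theorem magneticBivector_eq (s : ℝ) (κ : Fin (n / 2) → ℝ) (α β : Module.Dual ℝ (Ph n)) :
    magneticBivector s κ α β = -β (freeHam s κ α) := by
  rw [covector_apply β]
  have h : ∑ i, ∑ j, fieldMatrix κ i j * covSnd α i * covSnd β j
      = covSnd α ⬝ᵥ (fieldMatrix κ *ᵥ covSnd β) := by
    simp only [dotProduct, Matrix.mulVec, Finset.mul_sum]
    exact Finset.sum_congr rfl fun i _ => Finset.sum_congr rfl fun j _ => by ring
  have h1 : magneticBivector s κ α β = (covFst α ⬝ᵥ covSnd β - covSnd α ⬝ᵥ covFst β)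
      + s * ∑ i, ∑ j, fieldMatrix κ i j * covSnd α i * covSnd β j := by
    simp only [magneticBivector, Finset.sum_sub_distrib, dotProduct]; rfl
  rw [h1, h, dot_fieldMatrix]
  simp only [freeHam, dotProduct_add, dotProduct_neg, dotProduct_smul, smul_eq_mul]
  rw [dotProduct_comm (covFst β), dotProduct_comm (covSnd β) (covFst α),
    dotProduct_comm (covSnd β)]
  ring

/-- The term s κ added in `freeHam` to the canonical Hamiltonian vector is what cancels the magnetic
term of the form, by skewness of κ. -/
theorem twistedForm_freeHam (s : ℝ) (κ : Fin (n / 2) → ℝ) (α : Module.Dual ℝ (Ph n)) (v : Ph n) :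
    twistedForm s κ (freeHam s κ α) v = -α v := by
  rw [covector_apply α]
  simp only [freeHam, twistedForm, add_dotProduct, neg_dotProduct, smul_dotProduct, smul_eq_mul]
  rw [dot_fieldMatrix]; ring

theorem magneticBivector_antisymm (s : ℝ) (κ : Fin (n / 2) → ℝ) (α β : Module.Dual ℝ (Ph n)) :
    magneticBivector s κ α β = -magneticBivector s κ β α := by
  rw [magneticBivector_eq, magneticBivector_eq, ← twistedForm_freeHam s κ β,
    twistedForm_antisymm, twistedForm_freeHam]

theorem hasFDerivAt_dot (A B : Ph n →L[ℝ] (Fin n → ℝ)) (x : Ph n) :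
    ∃ f' : Ph n →L[ℝ] ℝ, HasFDerivAt (fun y => A y ⬝ᵥ B y) f' x ∧
      ∀ v, f' v = A x ⬝ᵥ B v + A v ⬝ᵥ B x := by
  have h : ∀ i, HasFDerivAt (fun y => A y i * B y i)
      (A x i • (ContinuousLinearMap.proj i ∘L B) + B x i • (ContinuousLinearMap.proj i ∘L A)) x := by
    intro i
    have hA : HasFDerivAt (fun y => A y i) (ContinuousLinearMap.proj i ∘L A) x :=
      (ContinuousLinearMap.proj (R := ℝ) (φ := fun _ : Fin n => ℝ) i ∘L A).hasFDerivAt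
    have hB : HasFDerivAt (fun y => B y i) (ContinuousLinearMap.proj i ∘L B) x :=
      (ContinuousLinearMap.proj (R := ℝ) (φ := fun _ : Fin n => ℝ) i ∘L B).hasFDerivAt
    exact hA.mul hB
  refine ⟨_, HasFDerivAt.fun_sum fun i _ => h i, fun v => ?_⟩
  simp only [sum_apply, add_apply, smul_apply, ContinuousLinearMap.comp_apply, ContinuousLinearMap.proj_apply,
    smul_eq_mul, dotProduct, ← Finset.sum_add_distrib]
  exact Finset.sum_congr rfl fun i _ => by ring

theorem diff_dot (A B : Ph n →L[ℝ] (Fin n → ℝ)) (x v : Ph n) :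
    diff (fun y => A y ⬝ᵥ B y) x v = A x ⬝ᵥ B v + A v ⬝ᵥ B x := by
  obtain ⟨f', hf, h⟩ := hasFDerivAt_dot A B x
  simp only [diff, hf.fderiv, ContinuousLinearMap.coe_coe, h]

theorem diff_phi1 (x v : Ph n) : diff phi1 x v = 2 * (x.1 ⬝ᵥ v.1) := by
  have := diff_dot (ContinuousLinearMap.fst ℝ (Fin n → ℝ) (Fin n → ℝ))
    (ContinuousLinearMap.fst ℝ (Fin n → ℝ) (Fin n → ℝ)) x v
  refine this.trans ?_
  simp only [ContinuousLinearMap.coe_fst', dotProduct_comm v.1]; ring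

theorem diff_phi2 (x v : Ph n) : diff phi2 x v = x.2 ⬝ᵥ v.1 + x.1 ⬝ᵥ v.2 := by
  have := diff_dot (ContinuousLinearMap.snd ℝ (Fin n → ℝ) (Fin n → ℝ))
    (ContinuousLinearMap.fst ℝ (Fin n → ℝ) (Fin n → ℝ)) x v
  refine this.trans ?_
  simp only [ContinuousLinearMap.coe_fst', ContinuousLinearMap.coe_snd', dotProduct_comm v.2]

theorem mem_tangentAt {x v : Ph n} :
    v ∈ tangentAt x ↔ x.1 ⬝ᵥ v.1 = 0 ∧ x.2 ⬝ᵥ v.1 + x.1 ⬝ᵥ v.2 = 0 := Iff.rfl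

theorem covFst_diff_phi1 (x : Ph n) : covFst (diff phi1 x) = (2 : ℝ) • x.1 := by
  ext i; simp [covFst, diff_phi1]

theorem covSnd_diff_phi1 (x : Ph n) : covSnd (diff phi1 x) = 0 := by
  ext i; simp [covSnd, diff_phi1]

/-- On the phase space the denominator of the Dirac bracket is constant; this is the source of the
halves in `diracHam`. -/
theorem magneticBivector_phi (s : ℝ) (κ : Fin (n / 2) → ℝ) {x : Ph n}
    (hx : x ∈ cotangentSphere n) : magneticBivector s κ (diff phi1 x) (diff phi2 x) = 2 := by
  rw [magneticBivector_eq, diff_phi2]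
  simp [freeHam, covFst_diff_phi1, covSnd_diff_phi1, hx.1]

/-- The Hamiltonian vector of a covector for the Dirac bivector. -/
noncomputable def diracHam (s : ℝ) (κ : Fin (n / 2) → ℝ) (x : Ph n)
    (α : Module.Dual ℝ (Ph n)) : Ph n :=
  freeHam s κ α + ((magneticBivector s κ α (diff phi1 x) / 2) • freeHam s κ (diff phi2 x)
    - (magneticBivector s κ α (diff phi2 x) / 2) • freeHam s κ (diff phi1 x))

theorem diracBivector_eq (s : ℝ) (κ : Fin (n / 2) → ℝ) {x : Ph n} (hx : x ∈ cotangentSphere n)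
    (α β : Module.Dual ℝ (Ph n)) : diracBivector s κ x α β = -β (diracHam s κ x α) := by
  rw [diracBivector, magneticBivector_phi s κ hx, magneticBivector_antisymm s κ β (diff phi1 x),
    magneticBivector_antisymm s κ β (diff phi2 x), magneticBivector_eq s κ α β,
    magneticBivector_eq s κ (diff phi1 x) β, magneticBivector_eq s κ (diff phi2 x) β]
  simp only [diracHam, map_add, map_sub, map_smul, smul_eq_mul]
  ring

theorem diracBivector_antisymm (s : ℝ) (κ : Fin (n / 2) → ℝ) (x : Ph n)
    (α β : Module.Dual ℝ (Ph n)) :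
    diracBivector s κ x α β = -diracBivector s κ x β α := by
  rw [diracBivector, diracBivector, magneticBivector_antisymm s κ α β]; ring

/-- The bracket of a constraint with itself vanishes and their mutual bracket is ±2. Hence each
correction term in `diracHam` moves only one of the two constraints, by exactly the amount by which
the free Hamiltonian vector violates it. -/
theorem diracHam_mem (s : ℝ) (κ : Fin (n / 2) → ℝ) {x : Ph n} (hx : x ∈ cotangentSphere n)
    (α : Module.Dual ℝ (Ph n)) : diracHam s κ x α ∈ tangentAt x := by
  have h12 := magneticBivector_phi s κ hx
  have h21 := magneticBivector_antisymm s κ (diff phi2 x) (diff phi1 x)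
  have h11 := magneticBivector_antisymm s κ (diff phi1 x) (diff phi1 x)
  have h22 := magneticBivector_antisymm s κ (diff phi2 x) (diff phi2 x)
  have ha1 := magneticBivector_eq s κ α (diff phi1 x)
  have ha2 := magneticBivector_eq s κ α (diff phi2 x)
  have h1 : diff phi1 x (diracHam s κ x α) = 0 := by
    rw [magneticBivector_eq s κ (diff phi2 x) (diff phi1 x), h12] at h21
    rw [magneticBivector_eq s κ (diff phi1 x) (diff phi1 x)] at h11
    simp only [diracHam, map_add, map_sub, map_smul, smul_eq_mul]
    have e1 : diff phi1 x (freeHam s κ (diff phi2 x)) = 2 := by linarith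
    have e2 : diff phi1 x (freeHam s κ (diff phi1 x)) = 0 := by linarith
    rw [e1, e2]; linarith
  have h2 : diff phi2 x (diracHam s κ x α) = 0 := by
    rw [magneticBivector_eq s κ (diff phi1 x) (diff phi2 x)] at h12
    rw [magneticBivector_eq s κ (diff phi2 x) (diff phi2 x)] at h22
    simp only [diracHam, map_add, map_sub, map_smul, smul_eq_mul]
    have e1 : diff phi2 x (freeHam s κ (diff phi1 x)) = -2 := by linarith
    have e2 : diff phi2 x (freeHam s κ (diff phi2 x)) = 0 := by linarith
    rw [e1, e2]; linarith
  rw [diff_phi1] at h1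
  rw [diff_phi2] at h2
  exact ⟨by linarith, h2⟩

/-- The correction terms are free Hamiltonian vectors of the constraints, and the form pairs these
to zero with tangent vectors. -/
theorem twistedForm_diracHam (s : ℝ) (κ : Fin (n / 2) → ℝ) (x : Ph n)
    (α : Module.Dual ℝ (Ph n)) {v : Ph n} (hv : v ∈ tangentAt x) :
    twistedForm s κ (diracHam s κ x α) v = -α v := by
  have h1 : diff phi1 x v = 0 := by rw [diff_phi1, hv.1, mul_zero]
  have h2 : diff phi2 x v = 0 := by rw [diff_phi2, hv.2]
  rw [diracHam, sub_eq_add_neg, ← neg_smul]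
  simp only [twistedForm_add_left, twistedForm_smul_left, twistedForm_freeHam, h1, h2]
  ring

/-- A tangent vector that represents a covector on the phase space computes its Dirac brackets. -/
theorem diracBivector_of_hamiltonian (s : ℝ) (κ : Fin (n / 2) → ℝ) {x : Ph n}
    (hx : x ∈ cotangentSphere n) {α : Module.Dual ℝ (Ph n)} {Y : Ph n} (hY : Y ∈ tangentAt x)
    (h : ∀ v ∈ tangentAt x, twistedForm s κ Y v = -α v) (β : Module.Dual ℝ (Ph n)) :
    diracBivector s κ x α β = -β Y := by
  rw [diracBivector_antisymm, diracBivector_eq s κ hx, neg_neg, ← neg_neg (α _),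
    ← h _ (diracHam_mem s κ hx β), twistedForm_antisymm, neg_neg, twistedForm_diracHam s κ x β hY]

theorem diracHam_add (s : ℝ) (κ : Fin (n / 2) → ℝ) {x : Ph n}
    (α β : Module.Dual ℝ (Ph n)) :
    diracHam s κ x (α + β) = diracHam s κ x α + diracHam s κ x β := by
  have h : freeHam s κ (α + β) = freeHam s κ α + freeHam s κ β := by
    have h1 : covFst (α + β) = covFst α + covFst β := rfl
    have h2 : covSnd (α + β) = covSnd α + covSnd β := rfl
    ext i
    · simp [freeHam, h2]
    · simp [freeHam, h1, h2, Matrix.mulVec_add]; ring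
  have hm : ∀ δ, magneticBivector s κ (α + β) δ
      = magneticBivector s κ α δ + magneticBivector s κ β δ := fun δ => by
    rw [magneticBivector_eq, magneticBivector_eq, magneticBivector_eq, h, map_add]; ring
  simp only [diracHam, h, hm]
  module

theorem diracHam_smul (s : ℝ) (κ : Fin (n / 2) → ℝ) {x : Ph n} (c : ℝ)
    (α : Module.Dual ℝ (Ph n)) :
    diracHam s κ x (c • α) = c • diracHam s κ x α := by
  have h : freeHam s κ (c • α) = c • freeHam s κ α := by
    have h1 : covFst (c • α) = c • covFst α := rfl
    have h2 : covSnd (c • α) = c • covSnd α := rfl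
    ext i
    · simp [freeHam, h2]
    · simp [freeHam, h1, h2, Matrix.mulVec_smul]; ring
  have hm : ∀ δ, magneticBivector s κ (c • α) δ
      = c * magneticBivector s κ α δ := fun δ => by
    rw [magneticBivector_eq, magneticBivector_eq, h, map_smul, smul_eq_mul]; ring
  simp only [diracHam, h, hm]
  module

/-- `diracHam` as a linear map. -/
noncomputable def diracHamLin (s : ℝ) (κ : Fin (n / 2) → ℝ) (x : Ph n) :
    Module.Dual ℝ (Ph n) →ₗ[ℝ] Ph n where
  toFun := diracHam s κ x
  map_add' := diracHam_add s κ
  map_smul' := diracHam_smul s κ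

/-! ### Dimension counts for spans of differentials and their common kernels -/

theorem finrank_tangentAt {x : Ph n} (hx : x ∈ cotangentSphere n) :
    Module.finrank ℝ (tangentAt x) = 2 * (n - 1) := by
  let L : Ph n →ₗ[ℝ] ℝ × ℝ := ((diff phi1 x)).prod (diff phi2 x)
  have hker : LinearMap.ker L = tangentAt x := by
    ext v
    change (diff phi1 x v, diff phi2 x v) = 0 ↔ _
    simp only [Prod.mk_eq_zero, diff_phi1,
      diff_phi2, mem_tangentAt, mul_eq_zero, OfNat.ofNat_ne_zero, false_or]
  have hsurj : Function.Surjective L := by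
    rintro ⟨a, b⟩
    refine ⟨((a / 2) • x.1, b • x.1 - (a / 2) • x.2), ?_⟩
    have h2 : x.1 ⬝ᵥ x.2 = 0 := by rw [dotProduct_comm]; exact hx.2
    change (diff phi1 x _, diff phi2 x _) = (a, b)
    simp only [diff_phi1, diff_phi2, dotProduct_smul,
      dotProduct_sub, hx.1, hx.2, h2, smul_eq_mul]
    exact Prod.ext (by ring) (by ring)
  have := LinearMap.finrank_range_add_finrank_ker L
  rw [hker, LinearMap.range_eq_top.2 hsurj, finrank_top] at this
  simp only [Module.finrank_prod, Module.finrank_fin_fun, Module.finrank_self] at this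
  omega

/-- The tangent vectors that are annihilated by all covectors of `W`. -/
def commonKernel (x : Ph n) (W : Submodule ℝ (Module.Dual ℝ (Ph n))) : Submodule ℝ (Ph n) :=
  tangentAt x ⊓ W.dualCoannihilator

theorem mem_commonKernel {x : Ph n} {W : Submodule ℝ (Module.Dual ℝ (Ph n))} {v : Ph n} :
    v ∈ commonKernel x W ↔ v ∈ tangentAt x ∧ ∀ α ∈ W, α v = 0 := by
  simp [commonKernel, Submodule.mem_dualCoannihilator]

/-- Moves the common kernel into the tangent space, where finite-dimensional duality between
subspaces and annihilators applies. -/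
theorem commonKernel_eq_map (x : Ph n) (W : Submodule ℝ (Module.Dual ℝ (Ph n))) :
    commonKernel x W =
      (W.map (tangentAt x).dualRestrict).dualCoannihilator.map (tangentAt x).subtype := by
  ext v
  simp only [mem_commonKernel, Submodule.mem_map, Submodule.mem_dualCoannihilator]
  constructor
  · rintro ⟨hv, h⟩
    refine ⟨⟨v, hv⟩, ?_, rfl⟩
    rintro _ ⟨α, hα, rfl⟩
    exact h α hα
  · rintro ⟨w, hw, rfl⟩
    exact ⟨w.2, fun α hα => hw _ ⟨α, hα, rfl⟩⟩

theorem finrank_restrict_add_commonKernel {x : Ph n} (hx : x ∈ cotangentSphere n)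
    (W : Submodule ℝ (Module.Dual ℝ (Ph n))) :
    Module.finrank ℝ (W.map (tangentAt x).dualRestrict) + Module.finrank ℝ (commonKernel x W)
      = 2 * (n - 1) := by
  rw [commonKernel_eq_map, Submodule.finrank_map_subtype_eq,
    Subspace.finrank_add_finrank_dualCoannihilator_eq, finrank_tangentAt hx]

/-- The covectors of `W` are, up to covectors that vanish on the phase space, those that vanish on
the common kernel of `W`. -/
theorem exists_mem_of_vanish {x : Ph n} (W : Submodule ℝ (Module.Dual ℝ (Ph n)))
    (α : Module.Dual ℝ (Ph n)) (h : ∀ v ∈ commonKernel x W, α v = 0) :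
    ∃ β ∈ W, ∀ v ∈ tangentAt x, β v = α v := by
  have h1 : (tangentAt x).dualRestrict α ∈
      (W.map (tangentAt x).dualRestrict).dualCoannihilator.dualAnnihilator := by
    rw [Submodule.mem_dualAnnihilator]
    intro w hw
    refine h w ?_
    rw [commonKernel_eq_map]
    exact ⟨w, hw, rfl⟩
  rw [Subspace.dualCoannihilator_dualAnnihilator_eq] at h1
  obtain ⟨β, hβ, hβα⟩ := h1
  refine ⟨β, hβ, fun v hv => ?_⟩
  exact DFunLike.congr_fun hβα ⟨v, hv⟩

/-- A covector of W is in the kernel of the bivector exactly when its Hamiltonian vector is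
annihilated by W, that is, lies in the common kernel. Contraction with the form inverts this
correspondence: for u in an isotropic common kernel the covector ω(u, ·) vanishes on that kernel, so
up to constraints it belongs to W. -/
theorem finrank_kernel_of_isotropic (s : ℝ) (κ : Fin (n / 2) → ℝ) {x : Ph n}
    (hx : x ∈ cotangentSphere n) (W : Submodule ℝ (Module.Dual ℝ (Ph n)))
    (hiso : ∀ u ∈ commonKernel x W, ∀ v ∈ commonKernel x W, twistedForm s κ u v = 0) :
    Module.finrank ℝ ((Submodule.span ℝ
      {α | α ∈ W ∧ ∀ β ∈ W, diracBivector s κ x α β = 0}).map (tangentAt x).dualRestrict)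
      = Module.finrank ℝ (commonKernel x W) := by
  let φ : commonKernel x W →ₗ[ℝ] Module.Dual ℝ (tangentAt x) :=
    (tangentAt x).dualRestrict ∘ₗ twistedBilin s κ ∘ₗ (commonKernel x W).subtype
  -- Nondegeneracy on the tangent space: a vector orthogonal to all Dirac Hamiltonian vectors is
  -- killed by every covector.
  have hinj : Function.Injective φ := by
    rw [injective_iff_map_eq_zero]
    rintro ⟨u, hu⟩ h0
    have hz : ∀ v ∈ tangentAt x, twistedForm s κ u v = 0 := fun v hv =>
      DFunLike.congr_fun h0 ⟨v, hv⟩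
    have hu' : u = 0 := by
      by_contra hne
      obtain ⟨β, hβ⟩ : ∃ β : Module.Dual ℝ (Ph n), β u ≠ 0 := by
        by_contra hcon
        push Not at hcon
        exact hne ((Module.forall_dual_apply_eq_zero_iff ℝ u).1 hcon)
      apply hβ
      have := twistedForm_diracHam s κ x β (mem_commonKernel.1 hu).1
      rw [twistedForm_antisymm, hz _ (diracHam_mem s κ hx β)] at this
      linarith
    exact Subtype.ext hu'
  have hrange : LinearMap.range φ = (Submodule.span ℝ
      {α | α ∈ W ∧ ∀ β ∈ W, diracBivector s κ x α β = 0}).map (tangentAt x).dualRestrict := by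
    apply le_antisymm
    · rintro _ ⟨⟨u, hu⟩, rfl⟩
      -- Isotropy enters here and only here.
      obtain ⟨β, hβ, hβu⟩ := exists_mem_of_vanish W (twistedBilin s κ u) (fun v hv => hiso u hu v hv)
      refine ⟨β, Submodule.subset_span ⟨hβ, fun δ hδ => ?_⟩, LinearMap.ext fun w => hβu w w.2⟩
      have hu' := mem_commonKernel.1 hu
      rw [diracBivector_of_hamiltonian s κ hx (Y := -u) ((tangentAt x).neg_mem hu'.1)
        (fun v hv => ?_) δ, map_neg, hu'.2 δ hδ, neg_zero, neg_zero]
      rw [hβu v hv, ← neg_one_smul ℝ u, twistedForm_smul_left, twistedBilin_apply]; ring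
    · rw [Submodule.map_le_iff_le_comap, Submodule.span_le]
      rintro α ⟨hα, h⟩
      have hmem : diracHam s κ x α ∈ commonKernel x W := by
        rw [mem_commonKernel]
        refine ⟨diracHam_mem s κ hx α, fun β hβ => ?_⟩
        have := h β hβ
        rw [diracBivector_eq s κ hx] at this
        linarith
      refine ⟨-⟨_, hmem⟩, LinearMap.ext fun w => ?_⟩
      have := twistedForm_diracHam s κ x α w.2
      rw [map_neg]
      change -(twistedForm s κ (diracHam s κ x α) w) = α w
      rw [this, neg_neg]
  rw [← hrange, LinearMap.finrank_range_of_inj hinj]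

/-- A family whose common kernel is isotropic of dimension `k` has the ranks required for
integrability in the noncommutative sense. -/
theorem ddimAt_add_dindAt (s : ℝ) (κ : Fin (n / 2) → ℝ) {x : Ph n} (hx : x ∈ cotangentSphere n)
    (𝓕 : Set (Ph n → ℝ)) {k : ℕ} (hk : Module.finrank ℝ (commonKernel x (diffSpan 𝓕 x)) = k)
    (hiso : ∀ u ∈ commonKernel x (diffSpan 𝓕 x), ∀ v ∈ commonKernel x (diffSpan 𝓕 x),
      twistedForm s κ u v = 0) :
    ddimAt 𝓕 x + dindAt s κ 𝓕 x = 2 * (n - 1) ∧ dindAt s κ 𝓕 x = k := by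
  have h1 := finrank_kernel_of_isotropic s κ hx _ hiso
  have h2 := finrank_restrict_add_commonKernel hx (diffSpan 𝓕 x)
  exact ⟨by rw [ddimAt, dindAt, h1, h2], by rw [dindAt, h1, hk]⟩

theorem mem_diffSpan_commonKernel {𝓕 : Set (Ph n → ℝ)} {x v : Ph n} :
    v ∈ commonKernel x (diffSpan 𝓕 x) ↔ v ∈ tangentAt x ∧ ∀ f ∈ 𝓕, diff f x v = 0 := by
  rw [mem_commonKernel]
  refine and_congr_right fun _ => ⟨fun h f hf => h _ (Submodule.subset_span ⟨f, hf, rfl⟩), ?_⟩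
  intro h α hα
  induction hα using Submodule.span_induction with
  | mem α hα => obtain ⟨f, hf, rfl⟩ := hα; exact h f hf
  | zero => simp
  | add α β _ _ h1 h2 => simp [h1, h2]
  | smul c α _ h1 => simp [h1]

/-- Commutation puts the Hamiltonian vectors of W into the common kernel of W. The restricted
covectors are recovered from these vectors by contraction, so dim W ≤ dim(common kernel) = 2(n - 1)
- dim W, with W restricted to the phase space. -/
theorem ddimAt_le_of_commute (s : ℝ) (κ : Fin (n / 2) → ℝ) {x : Ph n}
    (hx : x ∈ cotangentSphere n) (𝓕 : Set (Ph n → ℝ))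
    (h : ∀ f ∈ 𝓕, ∀ g ∈ 𝓕, diracBracket s κ f g x = 0) : ddimAt 𝓕 x ≤ n - 1 := by
  set W := diffSpan 𝓕 x with hW
  have hsub : W.map (diracHamLin s κ x) ≤ commonKernel x W := by
    rw [Submodule.map_le_iff_le_comap, hW, diffSpan, Submodule.span_le]
    rintro _ ⟨f, hf, rfl⟩
    change diracHam s κ x (diff f x) ∈ commonKernel x (diffSpan 𝓕 x)
    rw [mem_diffSpan_commonKernel]
    refine ⟨diracHam_mem s κ hx _, fun g hg => ?_⟩
    have := h f hf g hg
    rw [diracBracket, diracBivector_eq s κ hx] at this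
    linarith
  let ψ : Ph n →ₗ[ℝ] Module.Dual ℝ (tangentAt x) :=
    -((tangentAt x).dualRestrict ∘ₗ twistedBilin s κ)
  have hψ : (W.map (diracHamLin s κ x)).map ψ = W.map (tangentAt x).dualRestrict := by
    rw [← Submodule.map_comp]
    congr 1
    refine LinearMap.ext fun α => LinearMap.ext fun w => ?_
    change -(twistedForm s κ (diracHam s κ x α) w) = α w
    rw [twistedForm_diracHam s κ x α w.2, neg_neg]
  have h1 := Submodule.finrank_map_le ψ (W.map (diracHamLin s κ x))
  have h2 := Submodule.finrank_mono hsub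
  have h3 := finrank_restrict_add_commonKernel hx W
  rw [hψ] at h1
  have : ddimAt 𝓕 x = Module.finrank ℝ (W.map (tangentAt x).dualRestrict) := rfl
  omega

/-! ### Generic points through analytic continuation on the cotangent bundle of the sphere -/

/-- The retraction of `{(γ, p) | γ ≠ 0}` onto the cotangent bundle of the sphere. -/
noncomputable def toSphere (y : Ph n) : Ph n :=
  ((Real.sqrt (y.1 ⬝ᵥ y.1))⁻¹ • y.1, y.2 - ((y.2 ⬝ᵥ y.1) / (y.1 ⬝ᵥ y.1)) • y.1)

theorem dot_self_pos {v : Fin n → ℝ} (hv : v ≠ 0) : 0 < v ⬝ᵥ v :=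
  lt_of_le_of_ne (Finset.sum_nonneg fun i _ => mul_self_nonneg (v i))
    (fun h => hv (dotProduct_self_eq_zero.1 h.symm))

theorem toSphere_mem {y : Ph n} (hy : y.1 ≠ 0) : toSphere y ∈ cotangentSphere n := by
  have h := dot_self_pos hy
  have hs : Real.sqrt (y.1 ⬝ᵥ y.1) ≠ 0 := (Real.sqrt_pos.2 h).ne'
  refine ⟨?_, ?_⟩
  · simp only [toSphere, smul_dotProduct, dotProduct_smul, smul_eq_mul]
    field_simp
    rw [Real.sq_sqrt h.le]
  · simp only [toSphere, sub_dotProduct, smul_dotProduct, dotProduct_smul, smul_eq_mul]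
    field_simp
    ring

theorem toSphere_of_mem {y : Ph n} (hy : y ∈ cotangentSphere n) : toSphere y = y := by
  have h1 : y.1 ⬝ᵥ y.1 = 1 := hy.1
  have h2 : y.2 ⬝ᵥ y.1 = 0 := hy.2
  simp [toSphere, h1, h2]

theorem contDiff_dot {k : WithTop ℕ∞} {E : Type*} [NormedAddCommGroup E] [NormedSpace ℝ E]
    {f g : E → Fin n → ℝ} (hf : ContDiff ℝ k f) (hg : ContDiff ℝ k g) :
    ContDiff ℝ k fun x => f x ⬝ᵥ g x := by
  simp only [dotProduct]
  exact ContDiff.sum fun i _ => (contDiff_pi.1 hf i).mul (contDiff_pi.1 hg i)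

/-- The segment from x to y avoids γ = 0 when the base points are not antipodal, so its retraction
is an analytic curve in the phase space. If f vanished along it near x, it would vanish along all of
it, and in particular at y. -/
theorem frequently_path {f : Ph n → ℝ} (hf : ContDiff ℝ ω f) {x y : Ph n}
    (hx : x ∈ cotangentSphere n) (hy : y ∈ cotangentSphere n) (hxy : x.1 + y.1 ≠ 0)
    (hfy : f y ≠ 0) : x ∈ closure ({z | f z ≠ 0} ∩ cotangentSphere n) := by
  -- Both ends are unit vectors, so γ can vanish only at the midpoint, and then the ends are
  -- antipodal.
  have hne : ∀ t : ℝ, ((1 - t) • x + t • y).1 ≠ 0 := by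
    intro t h0
    have h0' : (1 - t) • x.1 = -(t • y.1) := eq_neg_of_add_eq_zero_left h0
    have h1 : ((1 - t) • x.1) ⬝ᵥ ((1 - t) • x.1) = (-(t • y.1)) ⬝ᵥ (-(t • y.1)) := by rw [h0']
    have hx1 : x.1 ⬝ᵥ x.1 = 1 := hx.1
    have hy1 : y.1 ⬝ᵥ y.1 = 1 := hy.1
    simp only [smul_dotProduct, dotProduct_smul, neg_dotProduct_neg, hx1, hy1, smul_eq_mul] at h1
    have ht : t = 1 / 2 := by linarith
    subst ht
    apply hxy
    have h2 : (1 / 2 : ℝ) • (x.1 + y.1) = 0 := by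
      rw [smul_add]
      have : (1 - 1 / 2 : ℝ) = 1 / 2 := by norm_num
      rw [this] at h0'
      rw [h0']; simp
    exact (smul_eq_zero.1 h2).resolve_left (by norm_num)
  have hline : ContDiff ℝ ω fun t : ℝ => (1 - t) • x + t • y := by fun_prop
  have hpath : ContDiff ℝ ω fun t : ℝ => toSphere ((1 - t) • x + t • y) := by
    have h1 := hline.fst
    have h2 := hline.snd
    have hd := contDiff_dot h1 h1
    have hpos : ∀ t : ℝ, ((1 - t) • x + t • y).1 ⬝ᵥ ((1 - t) • x + t • y).1 ≠ 0 :=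
      fun t => (dot_self_pos (hne t)).ne'
    refine ContDiff.prodMk ?_ ?_
    · refine ContDiff.smul (ContDiff.inv (hd.sqrt hpos) fun t => ?_) h1
      exact (Real.sqrt_pos.2 (dot_self_pos (hne t))).ne'
    · exact h2.sub (((contDiff_dot h2 h1).div hd hpos).smul h1)
  have hh : AnalyticOnNhd ℝ (fun t : ℝ => f (toSphere ((1 - t) • x + t • y))) Set.univ :=
    (hf.comp hpath).analyticOnNhd
  have hfreq : ∃ᶠ t in nhds (0 : ℝ), f (toSphere ((1 - t) • x + t • y)) ≠ 0 := by
    intro hev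
    have hev' : (fun t : ℝ => f (toSphere ((1 - t) • x + t • y))) =ᶠ[nhds 0] 0 := by
      filter_upwards [hev] with t ht
      simpa using ht
    have := congrFun (hh.eq_of_eventuallyEq (fun _ _ => analyticAt_const) hev') 1
    simp only [sub_self, zero_smul, one_smul, zero_add, toSphere_of_mem hy, Pi.zero_apply] at this
    exact hfy this
  rw [mem_closure_iff_frequently]
  have hc : Filter.Tendsto (fun t : ℝ => toSphere ((1 - t) • x + t • y)) (nhds 0) (nhds x) := by
    have := hpath.continuous.tendsto 0
    simpa [toSphere_of_mem hx] using this
  exact hc.frequently (hfreq.mono fun t ht => ⟨ht, toSphere_mem (hne t)⟩)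

/-- Finitely many even analytic functions that do not vanish at a point of the phase space do not
vanish at the generic point. -/
theorem generically_of_witness {ι : Type*} [Fintype ι] (f : ι → Ph n → ℝ)
    (hf : ∀ i, ContDiff ℝ ω (f i)) (heven : ∀ i x, f i (-x) = f i x) {y : Ph n}
    (hy : y ∈ cotangentSphere n) (hfy : ∀ i, f i y ≠ 0) :
    Generically fun x => ∀ i, f i x ≠ 0 := by
  let F : Ph n → ℝ := fun x => ∏ i, f i x
  have hF : ContDiff ℝ ω F := contDiff_prod fun i _ => hf i
  have hFy : F y ≠ 0 := Finset.prod_ne_zero_iff.2 fun i _ => hfy i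
  refine ⟨{x | F x ≠ 0}, isOpen_ne_fun hF.continuous continuous_const, fun x hx => ?_,
    fun x hx i => Finset.prod_ne_zero_iff.1 hx.1 i (Finset.mem_univ i)⟩
  -- If y lies over the antipode of x, the segment to -y is used instead; evenness gives the same
  -- nonzero value there.
  by_cases hxy : x.1 + y.1 = 0
  · refine frequently_path hF hx (y := -y) ?_ ?_ ?_
    · exact ⟨by simpa using hy.1, by simpa using hy.2⟩
    · intro h
      have h0 : x.1 = 0 := by
        have : (2 : ℝ) • x.1 = (x.1 + y.1) + (x.1 + (-y).1) := by
          rw [Prod.fst_neg]; module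
        rw [hxy, h, add_zero] at this
        exact (smul_eq_zero.1 this).resolve_left (by norm_num)
      have := hx.1
      rw [h0] at this
      simp at this
    · simpa only [F, heven] using hFy
  · exact frequently_path hF hx hy hxy hFy

theorem Generically.mono {P Q : Ph n → Prop} (h : Generically P)
    (hPQ : ∀ x ∈ cotangentSphere n, P x → Q x) : Generically Q := by
  obtain ⟨O, h1, h2, h3⟩ := h
  exact ⟨O, h1, h2, fun x hx => hPQ x hx.2 (h3 x hx)⟩

/-! ### The magnetic field in coordinates; the differentials of H and J -/

theorem dot_mulVec_field (κ : Fin (n / 2) → ℝ) (u v : Fin n → ℝ) :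
    u ⬝ᵥ (fieldMatrix κ *ᵥ v) = ∑ i, κ i * (u (od i) * v (ev i) - u (ev i) * v (od i)) := by
  simp only [dotProduct, Matrix.mulVec, fieldMatrix, Finset.sum_mul, Finset.mul_sum]
  have : ∀ a : Fin n, ∑ b : Fin n, ∑ i : Fin (n / 2), u a * (κ i *
      ((if a = od i ∧ b = ev i then (1 : ℝ) else 0) - if a = ev i ∧ b = od i then 1 else 0) * v b)
      = ∑ i : Fin (n / 2), ((if a = od i then κ i * (u a * v (ev i)) else 0)
        - if a = ev i then κ i * (u a * v (od i)) else 0) := by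
    intro a
    rw [Finset.sum_comm]
    refine Finset.sum_congr rfl fun i _ => ?_
    have h : ∀ b : Fin n, u a * (κ i *
      ((if a = od i ∧ b = ev i then (1 : ℝ) else 0) - if a = ev i ∧ b = od i then 1 else 0) * v b)
      = (if b = ev i then (if a = od i then κ i * (u a * v b) else 0) else 0)
        - (if b = od i then (if a = ev i then κ i * (u a * v b) else 0) else 0) := by
      intro b
      simp only [ite_and]
      split_ifs <;> ring
    simp only [h, Finset.sum_sub_distrib, Finset.sum_ite_eq', Finset.mem_univ, if_true]
  simp only [this]
  rw [Finset.sum_comm]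
  refine Finset.sum_congr rfl fun i _ => ?_
  simp only [Finset.sum_sub_distrib, Finset.sum_ite_eq', Finset.mem_univ, if_true]
  ring

theorem od_injective : Function.Injective (od : Fin (n / 2) → Fin n) := by
  intro i j h
  have := congrArg Fin.val h
  simp only [od] at this
  exact Fin.ext (by omega)

theorem ev_injective : Function.Injective (ev : Fin (n / 2) → Fin n) := by
  intro i j h
  have := congrArg Fin.val h
  simp only [ev] at this
  exact Fin.ext (by omega)

theorem od_ne_ev (i j : Fin (n / 2)) : od i ≠ ev j := by
  intro h
  have := congrArg Fin.val h
  simp only [od, ev] at this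
  omega

theorem mulVec_field_od (κ : Fin (n / 2) → ℝ) (v : Fin n → ℝ) (i : Fin (n / 2)) :
    (fieldMatrix κ *ᵥ v) (od i) = κ i * v (ev i) := by
  have := dot_mulVec_field κ (Pi.single (od i) 1) v
  rw [single_dotProduct, one_mul] at this
  rw [this]
  rw [Finset.sum_eq_single i]
  · simp [Pi.single_apply, (od_ne_ev i i).symm]
  · intro j _ hj
    simp [Pi.single_apply, od_injective.eq_iff, hj, (od_ne_ev i j).symm]
  · simp

theorem mulVec_field_ev (κ : Fin (n / 2) → ℝ) (v : Fin n → ℝ) (i : Fin (n / 2)) :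
    (fieldMatrix κ *ᵥ v) (ev i) = -(κ i * v (od i)) := by
  have := dot_mulVec_field κ (Pi.single (ev i) 1) v
  rw [single_dotProduct, one_mul] at this
  rw [this]
  rw [Finset.sum_eq_single i]
  · simp [Pi.single_apply, od_ne_ev]
  · intro j _ hj
    simp [Pi.single_apply, ev_injective.eq_iff, hj, od_ne_ev]
  · simp

theorem mulVec_field_of_ne (κ : Fin (n / 2) → ℝ) (v : Fin n → ℝ) (a : Fin n)
    (ha : ∀ i, a = od i ∨ a = ev i → κ i = 0) : (fieldMatrix κ *ᵥ v) a = 0 := by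
  have := dot_mulVec_field κ (Pi.single a 1) v
  rw [single_dotProduct, one_mul] at this
  rw [this]
  refine Finset.sum_eq_zero fun i _ => ?_
  by_cases h : a = od i ∨ a = ev i
  · rw [ha i h, zero_mul]
  · push Not at h
    simp [Pi.single_apply, h.1.symm, h.2.symm]

/-- The weighted sum in J is |κp|², which turns computations with J into identities for the skew
matrix κ. -/
theorem integralJ_eq (m s : ℝ) (κ : Fin (n / 2) → ℝ) (x : Ph n) :
    integralJ m s κ x = s ^ 2 / m ^ 2 * ((fieldMatrix κ *ᵥ x.2) ⬝ᵥ (fieldMatrix κ *ᵥ x.2))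
      - multiplier m s κ x ^ 2 := by
  rw [dot_mulVec_field, integralJ]
  simp only [mulVec_field_od, mulVec_field_ev]
  congr 2
  exact Finset.sum_congr rfl fun i _ => by ring

theorem diff_of_hasFDerivAt {f : Ph n → ℝ} {x : Ph n} {f' : Ph n →L[ℝ] ℝ}
    (h : HasFDerivAt f f' x) (v : Ph n) : diff f x v = f' v := by
  rw [diff, h.fderiv]; rfl

theorem diff_add {f g : Ph n → ℝ} {x : Ph n} (hf : DifferentiableAt ℝ f x)
    (hg : DifferentiableAt ℝ g x) (v : Ph n) :
    diff (fun y => f y + g y) x v = diff f x v + diff g x v :=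
  diff_of_hasFDerivAt (hf.hasFDerivAt.add hg.hasFDerivAt) v

theorem diff_sub {f g : Ph n → ℝ} {x : Ph n} (hf : DifferentiableAt ℝ f x)
    (hg : DifferentiableAt ℝ g x) (v : Ph n) :
    diff (fun y => f y - g y) x v = diff f x v - diff g x v :=
  diff_of_hasFDerivAt (hf.hasFDerivAt.sub hg.hasFDerivAt) v

theorem diff_const_mul {f : Ph n → ℝ} {x : Ph n} (hf : DifferentiableAt ℝ f x) (c : ℝ)
    (v : Ph n) : diff (fun y => c * f y) x v = c * diff f x v :=
  diff_of_hasFDerivAt (hf.hasFDerivAt.const_mul c) v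

theorem diff_mul {f g : Ph n → ℝ} {x : Ph n} (hf : DifferentiableAt ℝ f x)
    (hg : DifferentiableAt ℝ g x) (v : Ph n) :
    diff (fun y => f y * g y) x v = f x * diff g x v + diff f x v * g x := by
  rw [diff_of_hasFDerivAt (hf.hasFDerivAt.fun_mul hg.hasFDerivAt) v]
  simp only [add_apply, smul_apply, smul_eq_mul, diff,
    ContinuousLinearMap.coe_coe]
  ring

theorem diff_sq {f : Ph n → ℝ} {x : Ph n} (hf : DifferentiableAt ℝ f x)
    (v : Ph n) : diff (fun y => f y ^ 2) x v = 2 * f x * diff f x v := by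
  simp only [pow_two]
  rw [diff_mul hf hf]; ring

theorem diff_sum {ι : Type*} (S : Finset ι) {f : ι → Ph n → ℝ} {x : Ph n}
    (hf : ∀ i ∈ S, DifferentiableAt ℝ (f i) x) (v : Ph n) :
    diff (fun y => ∑ i ∈ S, f i y) x v = ∑ i ∈ S, diff (f i) x v := by
  rw [diff_of_hasFDerivAt (HasFDerivAt.fun_sum fun i hi => (hf i hi).hasFDerivAt) v]
  simp only [sum_apply]; rfl

theorem contDiff_mulVec {k : WithTop ℕ∞} (B : Matrix (Fin n) (Fin n) ℝ) {f : Ph n → Fin n → ℝ}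
    (hf : ContDiff ℝ k f) : ContDiff ℝ k fun x => B *ᵥ f x := by
  rw [contDiff_pi]
  intro i
  exact contDiff_dot contDiff_const hf

/-- The field matrix, acting on momenta or positions, as a continuous linear map. -/
noncomputable def fieldCLM (κ : Fin (n / 2) → ℝ) : (Fin n → ℝ) →L[ℝ] (Fin n → ℝ) :=
  LinearMap.toContinuousLinearMap (Matrix.mulVecLin (fieldMatrix κ))

@[simp] theorem fieldCLM_apply (κ : Fin (n / 2) → ℝ) (v : Fin n → ℝ) :
    fieldCLM κ v = fieldMatrix κ *ᵥ v := rfl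

theorem contDiff_energy {k : WithTop ℕ∞} (m : ℝ) : ContDiff ℝ k (energy m : Ph n → ℝ) :=
  contDiff_const.mul (contDiff_dot contDiff_snd contDiff_snd)

theorem contDiff_multiplier {k : WithTop ℕ∞} (m s : ℝ) (κ : Fin (n / 2) → ℝ) :
    ContDiff ℝ k (multiplier m s κ) :=
  ((contDiff_const.mul (contDiff_dot contDiff_snd (contDiff_mulVec _ contDiff_fst))).sub
    (contDiff_dot contDiff_snd contDiff_snd)).div_const m

theorem contDiff_integralJ {k : WithTop ℕ∞} (m s : ℝ) (κ : Fin (n / 2) → ℝ) :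
    ContDiff ℝ k (integralJ m s κ) := by
  have : integralJ m s κ = fun x => s ^ 2 / m ^ 2 *
      ((fieldMatrix κ *ᵥ x.2) ⬝ᵥ (fieldMatrix κ *ᵥ x.2)) - multiplier m s κ x ^ 2 :=
    funext (integralJ_eq m s κ)
  rw [this]
  exact (contDiff_const.mul (contDiff_dot (contDiff_mulVec _ contDiff_snd)
    (contDiff_mulVec _ contDiff_snd))).sub ((contDiff_multiplier m s κ).pow 2)

theorem diff_energy (m : ℝ) (x v : Ph n) : diff (energy m) x v = 1 / m * (x.2 ⬝ᵥ v.2) := by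
  have h := diff_dot (ContinuousLinearMap.snd ℝ (Fin n → ℝ) (Fin n → ℝ))
    (ContinuousLinearMap.snd ℝ (Fin n → ℝ) (Fin n → ℝ)) x v
  have hd : DifferentiableAt ℝ (fun y : Ph n => y.2 ⬝ᵥ y.2) x :=
    (contDiff_dot (k := 1) contDiff_snd contDiff_snd).differentiable one_ne_zero x
  have e : (energy m : Ph n → ℝ) = fun y => 1 / (2 * m) * (y.2 ⬝ᵥ y.2) := rfl
  simp only [ContinuousLinearMap.coe_snd'] at h
  rw [e, diff_const_mul hd, h, dotProduct_comm v.2]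
  ring

theorem diff_multiplier (m s : ℝ) (κ : Fin (n / 2) → ℝ) (x v : Ph n) :
    diff (multiplier m s κ) x v =
      (s * (x.2 ⬝ᵥ (fieldMatrix κ *ᵥ v.1) + v.2 ⬝ᵥ (fieldMatrix κ *ᵥ x.1))
        - 2 * (x.2 ⬝ᵥ v.2)) / m := by
  have h := diff_dot (ContinuousLinearMap.snd ℝ (Fin n → ℝ) (Fin n → ℝ))
    (ContinuousLinearMap.snd ℝ (Fin n → ℝ) (Fin n → ℝ)) x v
  have h' := diff_dot (ContinuousLinearMap.snd ℝ (Fin n → ℝ) (Fin n → ℝ))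
    (fieldCLM κ ∘L ContinuousLinearMap.fst ℝ (Fin n → ℝ) (Fin n → ℝ)) x v
  have hd : DifferentiableAt ℝ (fun y : Ph n => y.2 ⬝ᵥ y.2) x :=
    (contDiff_dot (k := 1) contDiff_snd contDiff_snd).differentiable one_ne_zero x
  have hd' : DifferentiableAt ℝ (fun y : Ph n => y.2 ⬝ᵥ (fieldMatrix κ *ᵥ y.1)) x :=
    (contDiff_dot (k := 1) contDiff_snd (contDiff_mulVec _ contDiff_fst)).differentiable
      one_ne_zero x
  have e : multiplier m s κ = fun y => m⁻¹ * (s * (y.2 ⬝ᵥ (fieldMatrix κ *ᵥ y.1))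
      - y.2 ⬝ᵥ y.2) := by
    funext y; rw [multiplier]; ring
  simp only [ContinuousLinearMap.coe_snd', ContinuousLinearMap.coe_fst', fieldCLM_apply,
    ContinuousLinearMap.comp_apply] at h h'
  rw [e, diff_const_mul ((hd'.const_mul s).fun_sub hd), diff_sub (hd'.const_mul s) hd,
    diff_const_mul hd', h, h', dotProduct_comm v.2 x.2]
  ring

theorem diff_integralJ (m s : ℝ) (κ : Fin (n / 2) → ℝ) (x v : Ph n) :
    diff (integralJ m s κ) x v =
      s ^ 2 / m ^ 2 * (2 * ((fieldMatrix κ *ᵥ x.2) ⬝ᵥ (fieldMatrix κ *ᵥ v.2)))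
        - 2 * multiplier m s κ x * diff (multiplier m s κ) x v := by
  have h := diff_dot (fieldCLM κ ∘L ContinuousLinearMap.snd ℝ (Fin n → ℝ) (Fin n → ℝ))
    (fieldCLM κ ∘L ContinuousLinearMap.snd ℝ (Fin n → ℝ) (Fin n → ℝ)) x v
  have hd : DifferentiableAt ℝ
      (fun y : Ph n => (fieldMatrix κ *ᵥ y.2) ⬝ᵥ (fieldMatrix κ *ᵥ y.2)) x :=
    (contDiff_dot (k := 1) (contDiff_mulVec _ contDiff_snd)
      (contDiff_mulVec _ contDiff_snd)).differentiable one_ne_zero x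
  have hm : DifferentiableAt ℝ (multiplier m s κ) x :=
    (contDiff_multiplier (k := 1) m s κ).differentiable one_ne_zero x
  simp only [ContinuousLinearMap.coe_snd', fieldCLM_apply, ContinuousLinearMap.comp_apply] at h
  have e : integralJ m s κ = fun y => s ^ 2 / m ^ 2 *
      ((fieldMatrix κ *ᵥ y.2) ⬝ᵥ (fieldMatrix κ *ᵥ y.2)) - multiplier m s κ y ^ 2 :=
    funext (integralJ_eq m s κ)
  rw [e, diff_sub (hd.const_mul _) (hm.fun_pow 2), diff_const_mul hd, diff_sq hm, h,
    dotProduct_comm (fieldMatrix κ *ᵥ v.2)]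
  ring

theorem dot_field_self (κ : Fin (n / 2) → ℝ) (u : Fin n → ℝ) :
    u ⬝ᵥ (fieldMatrix κ *ᵥ u) = 0 := by
  have := dot_fieldMatrix κ u u
  rw [dotProduct_comm (fieldMatrix κ *ᵥ u)] at this
  linarith

theorem magneticField_mem {m : ℝ} (hm : m ≠ 0) (s : ℝ) (κ : Fin (n / 2) → ℝ) {x : Ph n}
    (hx : x ∈ cotangentSphere n) : magneticField m s κ x ∈ tangentAt x := by
  have h1 : x.1 ⬝ᵥ x.1 = 1 := hx.1
  have h2 : x.1 ⬝ᵥ x.2 = 0 := by rw [dotProduct_comm]; exact hx.2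
  have h3 : x.1 ⬝ᵥ (fieldMatrix κ *ᵥ x.2) = -(x.2 ⬝ᵥ (fieldMatrix κ *ᵥ x.1)) := by
    rw [dot_fieldMatrix, dotProduct_comm]
  rw [mem_tangentAt]
  simp only [magneticField, dotProduct_smul, dotProduct_add, smul_eq_mul, h1, h2, h3, multiplier]
  exact ⟨by ring, by field_simp; ring⟩

/-- The magnetic part of the form cancels the Lorentz force, and the multiplier term is proportional
to γ, which is orthogonal to the base component of a tangent vector. -/
theorem twistedForm_magneticField (m s : ℝ) (κ : Fin (n / 2) → ℝ) {x v : Ph n}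
    (hv : v ∈ tangentAt x) :
    twistedForm s κ (magneticField m s κ x) v = -diff (energy m) x v := by
  have h1 : x.1 ⬝ᵥ v.1 = 0 := hv.1
  have h3 := dot_fieldMatrix κ x.2 v.1
  rw [diff_energy]
  simp only [twistedForm, magneticField, smul_dotProduct, add_dotProduct, smul_eq_mul, h1, h3]
  ring

theorem isFirstIntegral_energy {m : ℝ} (s : ℝ) (κ : Fin (n / 2) → ℝ) :
    IsFirstIntegral m s κ (energy m) := by
  refine ⟨contDiff_energy m, fun x hx => ?_⟩
  have h2 : x.2 ⬝ᵥ x.1 = 0 := hx.2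
  rw [diff_energy]
  simp [magneticField, dotProduct_add, dotProduct_smul, h2, dot_field_self]

/-- By skewness and ⟨p, γ⟩ = 0 the multiplier changes at the rate (s²/m²)⟨κp, κγ⟩. In the derivative
of |κp|² only the force μγ contributes, giving 2μ⟨κp, κγ⟩. The two contributions to J cancel. -/
theorem isFirstIntegral_integralJ {m : ℝ} (s : ℝ) (κ : Fin (n / 2) → ℝ) :
    IsFirstIntegral m s κ (integralJ m s κ) := by
  refine ⟨contDiff_integralJ m s κ, fun x hx => ?_⟩
  have h2 : x.2 ⬝ᵥ x.1 = 0 := hx.2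
  have h3 : x.1 ⬝ᵥ (fieldMatrix κ *ᵥ x.1) = 0 := dot_field_self κ _
  have h4 : x.2 ⬝ᵥ (fieldMatrix κ *ᵥ x.2) = 0 := dot_field_self κ _
  have h5 := dot_field_self κ (fieldMatrix κ *ᵥ x.2)
  rw [diff_integralJ, diff_multiplier]
  simp only [magneticField, dotProduct_add, dotProduct_smul, smul_eq_mul, Matrix.mulVec_add,
    Matrix.mulVec_smul, add_dotProduct, smul_dotProduct, h2, h3, h4, h5]
  ring

/-! ### Rotations preserving the field and their Noether integrals -/

/-- An infinitesimal rotation that preserves the magnetic field. -/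
structure IsGaugeRotation (κ : Fin (n / 2) → ℝ) (ρ : (Fin n → ℝ) →ₗ[ℝ] (Fin n → ℝ)) : Prop where
  skew : ∀ u v, u ⬝ᵥ ρ v = -(ρ u ⬝ᵥ v)
  comm : ∀ u, ρ (fieldMatrix κ *ᵥ u) = fieldMatrix κ *ᵥ ρ u

/-- The gauge Noether integral of an infinitesimal rotation. -/
noncomputable def gaugeMoment (s : ℝ) (κ : Fin (n / 2) → ℝ)
    (ρ : (Fin n → ℝ) →ₗ[ℝ] (Fin n → ℝ)) (x : Ph n) : ℝ :=
  x.2 ⬝ᵥ ρ x.1 + s / 2 * (x.1 ⬝ᵥ ρ (fieldMatrix κ *ᵥ x.1))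

/-- The cotangent lift of an infinitesimal rotation. -/
def cotLift (ρ : (Fin n → ℝ) →ₗ[ℝ] (Fin n → ℝ)) (x : Ph n) : Ph n := (ρ x.1, ρ x.2)

theorem contDiff_gaugeMoment {k : WithTop ℕ∞} (s : ℝ) (κ : Fin (n / 2) → ℝ)
    (ρ : (Fin n → ℝ) →ₗ[ℝ] (Fin n → ℝ)) : ContDiff ℝ k (gaugeMoment s κ ρ) := by
  have hρ : ContDiff ℝ k ρ := (LinearMap.toContinuousLinearMap ρ).contDiff
  exact (contDiff_dot contDiff_snd (hρ.comp contDiff_fst)).add (contDiff_const.mul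
    (contDiff_dot contDiff_fst (hρ.comp (contDiff_mulVec _ contDiff_fst))))

theorem diff_gaugeMoment (s : ℝ) {κ : Fin (n / 2) → ℝ} {ρ : (Fin n → ℝ) →ₗ[ℝ] (Fin n → ℝ)}
    (hρ : IsGaugeRotation κ ρ) (x v : Ph n) :
    diff (gaugeMoment s κ ρ) x v = x.2 ⬝ᵥ ρ v.1 + v.2 ⬝ᵥ ρ x.1
      + s * (x.1 ⬝ᵥ ρ (fieldMatrix κ *ᵥ v.1)) := by
  let R : (Fin n → ℝ) →L[ℝ] (Fin n → ℝ) := LinearMap.toContinuousLinearMap ρ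
  have hR : ContDiff ℝ 1 ρ := R.contDiff
  have h := diff_dot (ContinuousLinearMap.snd ℝ (Fin n → ℝ) (Fin n → ℝ))
    (R ∘L ContinuousLinearMap.fst ℝ (Fin n → ℝ) (Fin n → ℝ)) x v
  have h' := diff_dot (ContinuousLinearMap.fst ℝ (Fin n → ℝ) (Fin n → ℝ))
    (R ∘L fieldCLM κ ∘L ContinuousLinearMap.fst ℝ (Fin n → ℝ) (Fin n → ℝ)) x v
  have hd : DifferentiableAt ℝ (fun y : Ph n => y.2 ⬝ᵥ ρ y.1) x :=
    (contDiff_dot (k := 1) contDiff_snd (hR.comp contDiff_fst)).differentiable one_ne_zero x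
  have hd' : DifferentiableAt ℝ (fun y : Ph n => y.1 ⬝ᵥ ρ (fieldMatrix κ *ᵥ y.1)) x :=
    (contDiff_dot (k := 1) contDiff_fst
      (hR.comp (contDiff_mulVec _ contDiff_fst))).differentiable one_ne_zero x
  simp only [ContinuousLinearMap.coe_snd', ContinuousLinearMap.coe_fst', fieldCLM_apply,
    ContinuousLinearMap.comp_apply, R, LinearMap.coe_toContinuousLinearMap'] at h h'
  have e : gaugeMoment s κ ρ = fun y => y.2 ⬝ᵥ ρ y.1 + s / 2 * (y.1 ⬝ᵥ ρ (fieldMatrix κ *ᵥ y.1)) :=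
    rfl
  -- The form ⟨γ, ρκγ⟩ is symmetric, because ρ and κ are commuting skew maps; its two partial
  -- derivatives agree and absorb the factor s / 2.
  have hsym : v.1 ⬝ᵥ ρ (fieldMatrix κ *ᵥ x.1) = x.1 ⬝ᵥ ρ (fieldMatrix κ *ᵥ v.1) := by
    rw [hρ.skew, dot_fieldMatrix, neg_neg, ← hρ.comm, dotProduct_comm]
  rw [e, diff_add hd (hd'.const_mul _), diff_const_mul hd', h, h', hsym]
  ring

theorem cotLift_mem {κ : Fin (n / 2) → ℝ} {ρ : (Fin n → ℝ) →ₗ[ℝ] (Fin n → ℝ)}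
    (hρ : IsGaugeRotation κ ρ) (x : Ph n) : cotLift ρ x ∈ tangentAt x := by
  have h := hρ.skew x.1 x.1
  have h2 := hρ.skew x.2 x.1
  rw [dotProduct_comm] at h
  rw [dotProduct_comm (ρ x.2)] at h2
  rw [mem_tangentAt]
  refine ⟨?_, ?_⟩
  · change x.1 ⬝ᵥ ρ x.1 = 0
    rw [dotProduct_comm]; linarith
  · change x.2 ⬝ᵥ ρ x.1 + x.1 ⬝ᵥ ρ x.2 = 0
    linarith

/-- The quadratic term of `gaugeMoment` is a potential for the contraction of the magnetic two-form
with the rotation; it exists because the rotation commutes with κ. -/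
theorem twistedForm_cotLift (s : ℝ) {κ : Fin (n / 2) → ℝ} {ρ : (Fin n → ℝ) →ₗ[ℝ] (Fin n → ℝ)}
    (hρ : IsGaugeRotation κ ρ) (x v : Ph n) :
    twistedForm s κ (cotLift ρ x) v = -diff (gaugeMoment s κ ρ) x v := by
  rw [diff_gaugeMoment s hρ]
  simp only [twistedForm, cotLift]
  rw [hρ.skew x.2 v.1, hρ.skew x.1, dotProduct_comm (ρ x.1) v.2]
  ring

theorem diracBracket_gaugeMoment (s : ℝ) {κ : Fin (n / 2) → ℝ}
    {ρ : (Fin n → ℝ) →ₗ[ℝ] (Fin n → ℝ)} (hρ : IsGaugeRotation κ ρ) {x : Ph n}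
    (hx : x ∈ cotangentSphere n) (g : Ph n → ℝ) :
    diracBracket s κ (gaugeMoment s κ ρ) g x = -diff g x (cotLift ρ x) :=
  diracBivector_of_hamiltonian s κ hx (cotLift_mem hρ x)
    (fun v _ => twistedForm_cotLift s hρ x v) _

theorem diracBracket_energy {m : ℝ} (hm : m ≠ 0) (s : ℝ) {κ : Fin (n / 2) → ℝ} {x : Ph n}
    (hx : x ∈ cotangentSphere n) (g : Ph n → ℝ) :
    diracBracket s κ (energy m) g x = -diff g x (magneticField m s κ x) :=
  diracBivector_of_hamiltonian s κ hx (magneticField_mem hm s κ hx)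
    (fun _ hv => twistedForm_magneticField m s κ hv) _

theorem diracBracket_antisymm (s : ℝ) (κ : Fin (n / 2) → ℝ) (f g : Ph n → ℝ) (x : Ph n) :
    diracBracket s κ f g x = -diracBracket s κ g f x :=
  diracBivector_antisymm s κ x _ _

theorem diff_energy_cotLift (m : ℝ) {κ : Fin (n / 2) → ℝ} {ρ : (Fin n → ℝ) →ₗ[ℝ] (Fin n → ℝ)}
    (hρ : IsGaugeRotation κ ρ) (x : Ph n) : diff (energy m) x (cotLift ρ x) = 0 := by
  have h := hρ.skew x.2 x.2
  rw [dotProduct_comm (ρ x.2)] at h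
  have : x.2 ⬝ᵥ ρ x.2 = 0 := by linarith
  rw [diff_energy, cotLift, this, mul_zero]

/-- J is built from scalar products of γ, p and their images under κ, all invariant under rotations
that commute with κ. -/
theorem diff_integralJ_cotLift (m s : ℝ) {κ : Fin (n / 2) → ℝ}
    {ρ : (Fin n → ℝ) →ₗ[ℝ] (Fin n → ℝ)} (hρ : IsGaugeRotation κ ρ) (x : Ph n) :
    diff (integralJ m s κ) x (cotLift ρ x) = 0 := by
  have h := hρ.skew x.2 x.2
  rw [dotProduct_comm (ρ x.2)] at h
  have h1 : x.2 ⬝ᵥ ρ x.2 = 0 := by linarith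
  have h2 := hρ.skew (fieldMatrix κ *ᵥ x.2) (fieldMatrix κ *ᵥ x.2)
  rw [dotProduct_comm (ρ _)] at h2
  have h3 : (fieldMatrix κ *ᵥ x.2) ⬝ᵥ ρ (fieldMatrix κ *ᵥ x.2) = 0 := by linarith
  have h4 := hρ.skew x.2 (fieldMatrix κ *ᵥ x.1)
  rw [diff_integralJ, diff_multiplier]
  simp only [cotLift, ← hρ.comm, h1, h3, h4]
  ring

/-- Noether's argument: both the derivative of the moment along the flow and the derivative of H
along the lift equal the bracket of the two up to sign, and H is invariant. -/
theorem isFirstIntegral_gaugeMoment {m : ℝ} (hm : m ≠ 0) (s : ℝ) {κ : Fin (n / 2) → ℝ}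
    {ρ : (Fin n → ℝ) →ₗ[ℝ] (Fin n → ℝ)} (hρ : IsGaugeRotation κ ρ) :
    IsFirstIntegral m s κ (gaugeMoment s κ ρ) := by
  refine ⟨contDiff_gaugeMoment s κ ρ, fun x hx => ?_⟩
  have h1 := diracBracket_energy hm s (κ := κ) hx (gaugeMoment s κ ρ)
  have h2 := diracBracket_gaugeMoment s hρ hx (energy m)
  rw [diracBracket_antisymm, h1, diff_energy_cotLift m hρ] at h2
  linarith

end MagneticSphere

namespace MagneticSphere

open scoped ComplexConjugate

variable {n r : ℕ}

/-! ### Complex block coordinates -/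

/-- The magnetic field is `κ₀` on the first `r` coordinate planes and zero on the others. -/
structure IsBlockField (r : ℕ) (κ : Fin (n / 2) → ℝ) (κ₀ : ℝ) : Prop where
  lt : r < n / 2
  eq : ∀ i : Fin (n / 2), i.1 < r → κ i = κ₀
  eq_zero : ∀ i : Fin (n / 2), r ≤ i.1 → κ i = 0

theorem IsBlockField.le {κ : Fin (n / 2) → ℝ} {κ₀ : ℝ} (h : IsBlockField r κ κ₀) : 2 * r ≤ n := by
  have := h.lt; omega

/-- The complex coordinates `y₁ + i y₂, y₃ + i y₄, …` in the magnetic planes and the remaining real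
coordinates of a vector. -/
noncomputable def blockEquiv (h : 2 * r ≤ n) :
    (Fin n → ℝ) ≃ₗ[ℝ] (Fin r → ℂ) × (Fin (n - 2 * r) → ℝ) where
  toFun y := (fun i => ⟨y ⟨2 * i.1, by omega⟩, y ⟨2 * i.1 + 1, by omega⟩⟩,
    fun j => y ⟨2 * r + j.1, by omega⟩)
  map_add' u v := by
    refine Prod.ext (funext fun i => ?_) (funext fun j => rfl)
    exact Complex.ext rfl rfl
  map_smul' c v := by
    refine Prod.ext (funext fun i => ?_) (funext fun j => rfl)
    apply Complex.ext <;> simp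
  invFun Y a := if ha : a.1 < 2 * r then
      (if a.1 % 2 = 0 then (Y.1 ⟨a.1 / 2, by omega⟩).re else (Y.1 ⟨a.1 / 2, by omega⟩).im)
    else Y.2 ⟨a.1 - 2 * r, by omega⟩
  left_inv y := by
    funext a
    by_cases ha : a.1 < 2 * r
    · by_cases h2 : a.1 % 2 = 0
      · simp only [ha, h2, dif_pos, if_true]
        congr 1; exact Fin.ext (by simp only; omega)
      · simp only [ha, h2, dif_pos, if_false]
        congr 1; exact Fin.ext (by simp only; omega)
    · simp only [ha, dif_neg, not_false_eq_true]
      congr 1; exact Fin.ext (by simp only; omega)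
  right_inv Y := by
    refine Prod.ext (funext fun i => ?_) (funext fun j => ?_)
    · have h1 : 2 * i.1 < 2 * r := by omega
      have h2 : 2 * i.1 + 1 < 2 * r := by omega
      have h3 : 2 * i.1 / 2 = i.1 := by omega
      have h4 : (2 * i.1 + 1) / 2 = i.1 := by omega
      have h5 : (2 * i.1 + 1) % 2 = 1 := by omega
      apply Complex.ext <;> simp [h1, h2, h3, h4, h5]
    · simp

/-- The complex coordinates of a vector. -/
noncomputable def cz (h : 2 * r ≤ n) (y : Fin n → ℝ) : Fin r → ℂ := (blockEquiv h y).1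

/-- The real coordinates of a vector outside of the magnetic planes. -/
noncomputable def ct (h : 2 * r ≤ n) (y : Fin n → ℝ) : Fin (n - 2 * r) → ℝ := (blockEquiv h y).2

section
variable (h : 2 * r ≤ n)

theorem block_ext {u v : Fin n → ℝ} (h1 : cz h u = cz h v) (h2 : ct h u = ct h v) : u = v :=
  (blockEquiv h).injective (Prod.ext h1 h2)

@[simp] theorem cz_add (u v : Fin n → ℝ) : cz h (u + v) = cz h u + cz h v := by
  simp [cz]

@[simp] theorem ct_add (u v : Fin n → ℝ) : ct h (u + v) = ct h u + ct h v := by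
  simp [ct]

@[simp] theorem cz_sub (u v : Fin n → ℝ) : cz h (u - v) = cz h u - cz h v := by
  simp [cz]

@[simp] theorem ct_sub (u v : Fin n → ℝ) : ct h (u - v) = ct h u - ct h v := by
  simp [ct]

@[simp] theorem cz_smul (c : ℝ) (v : Fin n → ℝ) : cz h (c • v) = c • cz h v := by
  simp [cz]

@[simp] theorem ct_smul (c : ℝ) (v : Fin n → ℝ) : ct h (c • v) = c • ct h v := by
  simp [ct]

@[simp] theorem cz_zero : cz h (0 : Fin n → ℝ) = 0 := by
  simp [cz]

@[simp] theorem ct_zero : ct h (0 : Fin n → ℝ) = 0 := by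
  simp [ct]

theorem cz_re (y : Fin n → ℝ) (i : Fin r) : (cz h y i).re = y ⟨2 * i.1, by omega⟩ := rfl

theorem cz_im (y : Fin n → ℝ) (i : Fin r) : (cz h y i).im = y ⟨2 * i.1 + 1, by omega⟩ := rfl

theorem ct_apply (y : Fin n → ℝ) (j : Fin (n - 2 * r)) :
    ct h y j = y ⟨2 * r + j.1, by omega⟩ := rfl

/-- The vector with given coordinates. -/
noncomputable def ofBlock (z : Fin r → ℂ) (g : Fin (n - 2 * r) → ℝ) : Fin n → ℝ := (blockEquiv h).symm (z, g)

@[simp] theorem cz_ofBlock (z : Fin r → ℂ) (g : Fin (n - 2 * r) → ℝ) :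
    cz h (ofBlock h z g) = z := by simp [cz, ofBlock]

@[simp] theorem ct_ofBlock (z : Fin r → ℂ) (g : Fin (n - 2 * r) → ℝ) :
    ct h (ofBlock h z g) = g := by simp [ct, ofBlock]

theorem sum_block (F : Fin n → ℝ) : ∑ a, F a =
    ∑ i : Fin r, (F ⟨2 * i.1, by omega⟩ + F ⟨2 * i.1 + 1, by omega⟩)
      + ∑ j : Fin (n - 2 * r), F ⟨2 * r + j.1, by omega⟩ := by
  let G : ℕ → ℝ := fun a => if ha : a < n then F ⟨a, ha⟩ else 0
  have hG : ∀ a (ha : a < n), F ⟨a, ha⟩ = G a := fun a ha => by simp [G, ha]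
  have e1 : ∑ a, F a = ∑ a ∈ Finset.range n, G a := by
    rw [Finset.sum_range]; exact Finset.sum_congr rfl fun a _ => hG a.1 a.2
  have e2 : ∀ k, ∑ a ∈ Finset.range (2 * k), G a
      = ∑ i ∈ Finset.range k, (G (2 * i) + G (2 * i + 1)) := by
    intro k
    induction k with
    | zero => simp
    | succ k ih =>
      rw [Finset.sum_range_succ, ← ih, show 2 * (k + 1) = 2 * k + 1 + 1 by ring,
        Finset.sum_range_succ, Finset.sum_range_succ]; ring
  have e3 : ∑ a ∈ Finset.range n, G a = ∑ a ∈ Finset.range (2 * r), G a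
      + ∑ j ∈ Finset.range (n - 2 * r), G (2 * r + j) := by
    rw [← Finset.sum_range_add]
    congr 2; omega
  rw [e1, e3, e2, Finset.sum_range, Finset.sum_range]
  simp only [hG]

theorem dot_block (u v : Fin n → ℝ) : u ⬝ᵥ v =
    (∑ i, conj (cz h u i) * cz h v i).re + ∑ j, ct h u j * ct h v j := by
  rw [dotProduct, sum_block h, Complex.re_sum]
  congr 1
  refine Finset.sum_congr rfl fun i _ => ?_
  simp only [Complex.mul_re, Complex.conj_re, Complex.conj_im, cz_re, cz_im]
  ring

/-- The infinitesimal rotation with given blocks. -/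
noncomputable def rot (Ξ : Matrix (Fin r) (Fin r) ℂ)
    (S : Matrix (Fin (n - 2 * r)) (Fin (n - 2 * r)) ℝ) : (Fin n → ℝ) →ₗ[ℝ] (Fin n → ℝ) where
  toFun y := ofBlock h (Ξ *ᵥ cz h y) (S *ᵥ ct h y)
  map_add' u v := block_ext h (by simp [Matrix.mulVec_add]) (by simp [Matrix.mulVec_add])
  map_smul' c v := block_ext h (by simp [Matrix.mulVec_smul]) (by simp [Matrix.mulVec_smul])

@[simp] theorem cz_rot (Ξ : Matrix (Fin r) (Fin r) ℂ)
    (S : Matrix (Fin (n - 2 * r)) (Fin (n - 2 * r)) ℝ) (y : Fin n → ℝ) :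
    cz h (rot h Ξ S y) = Ξ *ᵥ cz h y := by
  change cz h (ofBlock h _ _) = _
  rw [cz_ofBlock]

@[simp] theorem ct_rot (Ξ : Matrix (Fin r) (Fin r) ℂ)
    (S : Matrix (Fin (n - 2 * r)) (Fin (n - 2 * r)) ℝ) (y : Fin n → ℝ) :
    ct h (rot h Ξ S y) = S *ᵥ ct h y := by
  change ct h (ofBlock h _ _) = _
  rw [ct_ofBlock]

end

theorem IsBlockField.cz_mulVec {κ : Fin (n / 2) → ℝ} {κ₀ : ℝ} (hb : IsBlockField r κ κ₀)
    (y : Fin n → ℝ) (i : Fin r) :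
    cz hb.le (fieldMatrix κ *ᵥ y) i = -(Complex.I * κ₀) * cz hb.le y i := by
  have hi : i.1 < n / 2 := by have := hb.lt; omega
  have h1 := mulVec_field_od κ y ⟨i.1, hi⟩
  have h2 := mulVec_field_ev κ y ⟨i.1, hi⟩
  rw [hb.eq ⟨i.1, hi⟩ i.2] at h1 h2
  apply Complex.ext
  · simpa [cz_re, cz_im, od, ev] using h1
  · simpa [cz_re, cz_im, od, ev] using h2

theorem IsBlockField.ct_mulVec {κ : Fin (n / 2) → ℝ} {κ₀ : ℝ} (hb : IsBlockField r κ κ₀)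
    (y : Fin n → ℝ) : ct hb.le (fieldMatrix κ *ᵥ y) = 0 := by
  funext j
  rw [ct_apply]
  refine mulVec_field_of_ne κ y _ fun i hi => hb.eq_zero i ?_
  simp only [od, ev, Fin.mk.injEq] at hi
  omega

section
variable {κ : Fin (n / 2) → ℝ} {κ₀ : ℝ} (hb : IsBlockField r κ κ₀)

/-- On the magnetic planes κ is a scalar multiple of the complex structure, so complex linearity is
commutation with κ; on the remaining coordinates κ is zero and imposes nothing. Skewness is checked
block by block. -/
theorem isGaugeRotation_rot {Ξ : Matrix (Fin r) (Fin r) ℂ} (hΞ : Ξᴴ = -Ξ)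
    {S : Matrix (Fin (n - 2 * r)) (Fin (n - 2 * r)) ℝ} (hS : Sᵀ = -S) :
    IsGaugeRotation κ (rot hb.le Ξ S) := by
  refine ⟨fun u v => ?_, fun u => ?_⟩
  · rw [dot_block hb.le, dot_block hb.le, cz_rot, ct_rot, cz_rot, ct_rot]
    have e1 : ∑ i, conj (cz hb.le u i) * (Ξ *ᵥ cz hb.le v) i
        = -∑ i, conj ((Ξ *ᵥ cz hb.le u) i) * cz hb.le v i := by
      have hconj : ∀ i j, conj (Ξ i j) = -Ξ j i := fun i j => by
        have := congrFun (congrFun hΞ j) i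
        simpa [Matrix.conjTranspose_apply] using this
      simp only [Matrix.mulVec, dotProduct, map_sum, map_mul, hconj, Finset.mul_sum,
        Finset.sum_mul, ← Finset.sum_neg_distrib]
      rw [Finset.sum_comm]
      exact Finset.sum_congr rfl fun i _ => Finset.sum_congr rfl fun j _ => by ring
    have e2 : ∑ i, ct hb.le u i * (S *ᵥ ct hb.le v) i
        = -∑ i, (S *ᵥ ct hb.le u) i * ct hb.le v i := by
      have ht : ∀ i j, S i j = -S j i := fun i j => by
        have := congrFun (congrFun hS j) i
        simpa [Matrix.transpose_apply] using this
      simp only [Matrix.mulVec, dotProduct, Finset.mul_sum,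
        Finset.sum_mul, ← Finset.sum_neg_distrib]
      rw [Finset.sum_comm]
      exact Finset.sum_congr rfl fun i _ => Finset.sum_congr rfl fun j _ => by rw [ht j i]; ring
    rw [e1, e2, Complex.neg_re]; ring
  · refine block_ext hb.le ?_ ?_
    · have e : ∀ y, cz hb.le (fieldMatrix κ *ᵥ y) = (-(Complex.I * κ₀)) • cz hb.le y := fun y =>
        funext fun i => by rw [hb.cz_mulVec]; rfl
      rw [cz_rot, e, e, cz_rot, Matrix.mulVec_smul]
    · rw [ct_rot, hb.ct_mulVec, hb.ct_mulVec, Matrix.mulVec_zero]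

end

/-! ### The moments of the unitary and the orthogonal algebras -/

/-- The complex coordinates of the gauge momentum `p - (s / 2) κ γ`. -/
noncomputable def cv (h : 2 * r ≤ n) (ε : ℝ) (x : Ph n) : Fin r → ℂ :=
  fun i => cz h x.2 i + Complex.I * (ε / 2) * cz h x.1 i

/-- The entries of the momentum map of the unitary group. -/
noncomputable def umom (h : 2 * r ≤ n) (ε : ℝ) (i j : Fin r) (x : Ph n) : ℂ :=
  conj (cz h x.1 i) * cv h ε x j - conj (cv h ε x i) * cz h x.1 j

/-- The entries of the momentum map of the orthogonal group. -/
noncomputable def tmom (h : 2 * r ≤ n) (i j : Fin (n - 2 * r)) (x : Ph n) : ℝ :=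
  ct h x.1 i * ct h x.2 j - ct h x.1 j * ct h x.2 i

theorem conj_umom (h : 2 * r ≤ n) (ε : ℝ) (i j : Fin r) (x : Ph n) :
    conj (umom h ε i j x) = -umom h ε j i x := by
  simp only [umom, map_sub, map_mul, Complex.conj_conj]; ring

section
variable {κ : Fin (n / 2) → ℝ} {κ₀ : ℝ} (hb : IsBlockField r κ κ₀)

/-- The magnetic quadratic term is absorbed by replacing p with the gauge momentum, after which the
moment has the form known for zero field. -/
theorem gaugeMoment_rot (s : ℝ) (Ξ : Matrix (Fin r) (Fin r) ℂ)
    (S : Matrix (Fin (n - 2 * r)) (Fin (n - 2 * r)) ℝ) (x : Ph n) :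
    gaugeMoment s κ (rot hb.le Ξ S) x =
      (∑ i, conj (cv hb.le (s * κ₀) x i) * (Ξ *ᵥ cz hb.le x.1) i).re
        + ∑ j, ct hb.le x.2 j * (S *ᵥ ct hb.le x.1) j := by
  have e : cz hb.le (fieldMatrix κ *ᵥ x.1) = (-(Complex.I * κ₀)) • cz hb.le x.1 :=
    funext fun i => by rw [hb.cz_mulVec]; rfl
  rw [gaugeMoment, dot_block hb.le, dot_block hb.le, cz_rot, cz_rot, ct_rot, ct_rot, hb.ct_mulVec,
    e, Matrix.mulVec_smul, Matrix.mulVec_zero]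
  simp only [Pi.zero_apply, mul_zero, Finset.sum_const_zero, add_zero]
  rw [add_right_comm, ← Complex.re_ofReal_mul, ← Complex.add_re, Finset.mul_sum,
    ← Finset.sum_add_distrib]
  congr 2
  refine Finset.sum_congr rfl fun i _ => ?_
  simp only [cv, Pi.smul_apply, smul_eq_mul, map_add, map_mul, Complex.conj_I, map_div₀,
    Complex.conj_ofReal, Complex.ofReal_div, Complex.ofReal_mul, map_ofNat, Complex.ofReal_ofNat]
  ring

/-- The generators of the unitary algebra. -/
noncomputable def ugen (c : ℂ) (i j : Fin r) : Matrix (Fin r) (Fin r) ℂ :=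
  Matrix.single i j c - Matrix.single j i (conj c)

theorem ugen_conjTranspose (c : ℂ) (i j : Fin r) : (ugen c i j)ᴴ = -ugen c i j := by
  simp [ugen, Matrix.conjTranspose_sub, Matrix.conjTranspose_single]

/-- The generators of the orthogonal algebra. -/
noncomputable def tgen {q : ℕ} (i j : Fin q) : Matrix (Fin q) (Fin q) ℝ :=
  Matrix.single j i 1 - Matrix.single i j 1

theorem tgen_transpose {q : ℕ} (i j : Fin q) : (tgen i j)ᵀ = -tgen i j := by
  simp [tgen, Matrix.transpose_sub, Matrix.transpose_single]

theorem gaugeMoment_ugen (s : ℝ) (c : ℂ) (i j : Fin r) (x : Ph n) :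
    gaugeMoment s κ (rot hb.le (ugen c i j) 0) x = -(c * umom hb.le (s * κ₀) i j x).re := by
  rw [gaugeMoment_rot hb]
  simp only [ugen, Matrix.sub_mulVec, Matrix.single_mulVec, Matrix.zero_mulVec, Pi.zero_apply,
    mul_zero, Finset.sum_const_zero, add_zero, Pi.sub_apply, mul_sub, Finset.sum_sub_distrib]
  simp only [Function.update_apply, Pi.zero_apply, mul_ite, mul_zero, Finset.sum_ite_eq',
    Finset.sum_ite_eq, Finset.mem_univ, if_true, umom]
  simp only [Complex.sub_re, Complex.mul_re, Complex.conj_re, Complex.conj_im, Complex.mul_im,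
    Complex.sub_im]
  ring

theorem gaugeMoment_tgen (s : ℝ) (i j : Fin (n - 2 * r)) (x : Ph n) :
    gaugeMoment s κ (rot hb.le 0 (tgen i j)) x = tmom hb.le i j x := by
  rw [gaugeMoment_rot hb]
  simp only [tgen, Matrix.sub_mulVec, Matrix.single_mulVec, Matrix.zero_mulVec, Pi.zero_apply,
    mul_zero, Finset.sum_const_zero, Complex.zero_re, zero_add, Pi.sub_apply, mul_sub,
    Finset.sum_sub_distrib]
  simp only [Function.update_apply, Pi.zero_apply, mul_ite, mul_zero, Finset.sum_ite_eq',
    Finset.sum_ite_eq, Finset.mem_univ, if_true, tmom]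
  ring

/-- Exhibits every moment as a linear combination of matrix entries, so that moments of commutators
stay in the algebra of the family. -/
theorem gaugeMoment_rot_eq_sum (s : ℝ) {Ξ : Matrix (Fin r) (Fin r) ℂ} (hΞ : Ξᴴ = -Ξ)
    {S : Matrix (Fin (n - 2 * r)) (Fin (n - 2 * r)) ℝ} (hS : Sᵀ = -S) (x : Ph n) :
    gaugeMoment s κ (rot hb.le Ξ S) x =
      ∑ i, ∑ j, (-(1 / 2) * (Ξ i j).re * (umom hb.le (s * κ₀) i j x).re
        + 1 / 2 * (Ξ i j).im * (umom hb.le (s * κ₀) i j x).im)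
      + ∑ i, ∑ j, 1 / 2 * S i j * tmom hb.le j i x := by
  have hconj : ∀ i j, Ξ i j = -conj (Ξ j i) := fun i j => by
    have := congrFun (congrFun hΞ i) j
    have h' : conj (Ξ j i) = -Ξ i j := by simpa [Matrix.conjTranspose_apply] using this
    rw [h', neg_neg]
  have ht : ∀ i j, S i j = -S j i := fun i j => by
    have := congrFun (congrFun hS j) i
    simpa [Matrix.transpose_apply] using this
  rw [gaugeMoment_rot hb]
  congr 1
  · have e : ∑ i, conj (cv hb.le (s * κ₀) x i) * (Ξ *ᵥ cz hb.le x.1) i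
        = ∑ i, ∑ j, Ξ i j * (conj (cv hb.le (s * κ₀) x i) * cz hb.le x.1 j) := by
      simp only [Matrix.mulVec, dotProduct, Finset.mul_sum]
      exact Finset.sum_congr rfl fun i _ => Finset.sum_congr rfl fun j _ => by ring
    -- Skew-Hermitian symmetry of Ξ exchanges the roles of z and v. Averaging the two expressions
    -- produces the antisymmetric entries `umom` and the factor 1 / 2.
    have e' : (∑ i, ∑ j, Ξ i j * (conj (cv hb.le (s * κ₀) x i) * cz hb.le x.1 j)).re
        = (∑ i, ∑ j, -(Ξ i j * (conj (cz hb.le x.1 i) * cv hb.le (s * κ₀) x j))).re := by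
      rw [Finset.sum_comm]
      simp only [Complex.re_sum]
      refine Finset.sum_congr rfl fun i _ => Finset.sum_congr rfl fun j _ => ?_
      rw [hconj j i, ← Complex.conj_re]
      simp only [map_mul, map_neg, Complex.conj_conj]
      congr 1; ring
    have e2 : (∑ i, ∑ j, Ξ i j * (conj (cv hb.le (s * κ₀) x i) * cz hb.le x.1 j)).re
        = ∑ i, ∑ j, -(1 / 2) * (Ξ i j * umom hb.le (s * κ₀) i j x).re := by
      have h3 : ∑ i, ∑ j, -(1 / 2) * (Ξ i j * umom hb.le (s * κ₀) i j x).re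
        = 1 / 2 * ((∑ i, ∑ j, Ξ i j * (conj (cv hb.le (s * κ₀) x i) * cz hb.le x.1 j)).re
          + (∑ i, ∑ j, -(Ξ i j * (conj (cz hb.le x.1 i) * cv hb.le (s * κ₀) x j))).re) := by
        simp only [Complex.re_sum, ← Finset.sum_add_distrib, Finset.mul_sum]
        refine Finset.sum_congr rfl fun i _ => Finset.sum_congr rfl fun j _ => ?_
        rw [umom, mul_sub, Complex.sub_re, Complex.neg_re]; ring
      rw [h3, ← e']; ring
    rw [e, e2]
    refine Finset.sum_congr rfl fun i _ => Finset.sum_congr rfl fun j _ => ?_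
    rw [Complex.mul_re]; ring
  · have e : ∑ j, ct hb.le x.2 j * (S *ᵥ ct hb.le x.1) j
        = ∑ i, ∑ j, S i j * (ct hb.le x.2 i * ct hb.le x.1 j) := by
      simp only [Matrix.mulVec, dotProduct, Finset.mul_sum]
      exact Finset.sum_congr rfl fun i _ => Finset.sum_congr rfl fun j _ => by ring
    have e' : ∑ i, ∑ j, S i j * (ct hb.le x.2 i * ct hb.le x.1 j)
        = ∑ i, ∑ j, -(S i j * (ct hb.le x.2 j * ct hb.le x.1 i)) := by
      rw [Finset.sum_comm]
      refine Finset.sum_congr rfl fun i _ => Finset.sum_congr rfl fun j _ => ?_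
      rw [ht j i]; ring
    have h3 : ∑ i, ∑ j, 1 / 2 * S i j * tmom hb.le j i x
        = 1 / 2 * (∑ i, ∑ j, S i j * (ct hb.le x.2 i * ct hb.le x.1 j)
          + ∑ i, ∑ j, -(S i j * (ct hb.le x.2 j * ct hb.le x.1 i))) := by
      simp only [← Finset.sum_add_distrib, Finset.mul_sum]
      refine Finset.sum_congr rfl fun i _ => Finset.sum_congr rfl fun j _ => ?_
      rw [tmom]; ring
    rw [e, h3, ← e']; ring

/-- Equivariance of the momentum map. Both terms of the moment are bilinear, and moving the skew ρ
to the other side of each pairing turns ρ'ρ into ρ'ρ - ρρ'; in the magnetic term this also uses that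
both maps commute with κ. -/
theorem diff_gaugeMoment_cotLift (s : ℝ) {Ξ Ξ' : Matrix (Fin r) (Fin r) ℂ}
    {S S' : Matrix (Fin (n - 2 * r)) (Fin (n - 2 * r)) ℝ} (hΞ : Ξᴴ = -Ξ) (hS : Sᵀ = -S)
    (hΞ' : Ξ'ᴴ = -Ξ') (hS' : S'ᵀ = -S') (x : Ph n) :
    diff (gaugeMoment s κ (rot hb.le Ξ' S')) x (cotLift (rot hb.le Ξ S) x)
      = gaugeMoment s κ (rot hb.le (Ξ' * Ξ - Ξ * Ξ') (S' * S - S * S')) x := by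
  have hρ := isGaugeRotation_rot hb hΞ hS
  have hρ' := isGaugeRotation_rot hb hΞ' hS'
  set ρ := rot hb.le Ξ S
  set ρ' := rot hb.le Ξ' S'
  have hc : ∀ y, rot hb.le (Ξ' * Ξ - Ξ * Ξ') (S' * S - S * S') y = ρ' (ρ y) - ρ (ρ' y) := by
    intro y
    refine block_ext hb.le ?_ ?_
    · simp [ρ, ρ', Matrix.sub_mulVec, Matrix.mulVec_mulVec]
    · simp [ρ, ρ', Matrix.sub_mulVec, Matrix.mulVec_mulVec]
  rw [diff_gaugeMoment s hρ', gaugeMoment, hc, hc]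
  simp only [cotLift, dotProduct_sub]
  have h1 : ρ x.2 ⬝ᵥ ρ' x.1 = -(x.2 ⬝ᵥ ρ (ρ' x.1)) := by rw [hρ.skew, neg_neg]
  have h2 : x.1 ⬝ᵥ ρ (ρ' (fieldMatrix κ *ᵥ x.1)) = -(x.1 ⬝ᵥ ρ' (ρ (fieldMatrix κ *ᵥ x.1))) := by
    rw [hρ.skew, hρ'.skew x.1, hρ'.comm, dot_fieldMatrix, ← hρ.comm, neg_neg,
      dotProduct_comm, hρ.comm, neg_neg]
  rw [h1, h2, hρ.comm x.1]
  ring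

end

end MagneticSphere

namespace MagneticSphere

open scoped ComplexConjugate

variable {n r : ℕ}

/-! ### Hermitian pairings over subsets of planes and quadratic Casimir functions -/

/-- The Hermitian pairing over a set of indices. -/
noncomputable def herm {ι : Type*} (S : Finset ι) (u w : ι → ℂ) : ℂ := ∑ i ∈ S, conj (u i) * w i

theorem conj_herm {ι : Type*} (S : Finset ι) (u w : ι → ℂ) : conj (herm S u w) = herm S w u := by
  simp only [herm, map_sum, map_mul, Complex.conj_conj]
  exact Finset.sum_congr rfl fun i _ => mul_comm _ _

theorem herm_add_right {ι : Type*} (S : Finset ι) (u w w' : ι → ℂ) :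
    herm S u (w + w') = herm S u w + herm S u w' := by
  simp only [herm, Pi.add_apply, mul_add, Finset.sum_add_distrib]

theorem herm_sub_left {ι : Type*} (S : Finset ι) (u u' w : ι → ℂ) :
    herm S (u - u') w = herm S u w - herm S u' w := by
  simp only [herm, Pi.sub_apply, map_sub, sub_mul, Finset.sum_sub_distrib]

theorem herm_sub_right {ι : Type*} (S : Finset ι) (u w w' : ι → ℂ) :
    herm S u (w - w') = herm S u w - herm S u w' := by
  simp only [herm, Pi.sub_apply, mul_sub, Finset.sum_sub_distrib]

theorem herm_smul_left {ι : Type*} (S : Finset ι) (c : ℂ) (u w : ι → ℂ) :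
    herm S (c • u) w = conj c * herm S u w := by
  simp only [herm, Pi.smul_apply, smul_eq_mul, map_mul, Finset.mul_sum, mul_assoc]

theorem herm_smul_right {ι : Type*} (S : Finset ι) (c : ℂ) (u w : ι → ℂ) :
    herm S u (c • w) = c * herm S u w := by
  simp only [herm, Pi.smul_apply, smul_eq_mul, Finset.mul_sum]
  exact Finset.sum_congr rfl fun i _ => by ring

theorem herm_self_im {ι : Type*} (S : Finset ι) (u : ι → ℂ) : (herm S u u).im = 0 :=
  Complex.conj_eq_iff_im.1 (conj_herm S u u)

theorem herm_self {ι : Type*} (S : Finset ι) (u : ι → ℂ) :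
    herm S u u = ((herm S u u).re : ℂ) :=
  Complex.ext rfl (by simpa using herm_self_im S u)

theorem herm_self_re {ι : Type*} (S : Finset ι) (u : ι → ℂ) :
    (herm S u u).re = ∑ i ∈ S, Complex.normSq (u i) := by
  simp only [herm, Complex.re_sum]
  refine Finset.sum_congr rfl fun i _ => ?_
  rw [← Complex.normSq_eq_conj_mul_self, Complex.ofReal_re]

/-- Lagrange's identity for the entries of the unitary momentum map. -/
theorem sum_normSq_wedge {ι : Type*} (S : Finset ι) (z v : ι → ℂ) :
    ∑ i ∈ S, ∑ j ∈ S, Complex.normSq (conj (z i) * v j - conj (v i) * z j)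
      = 2 * ((herm S z z).re * (herm S v v).re - (herm S z v).re ^ 2 + (herm S z v).im ^ 2) := by
  have h : ∀ i j, Complex.normSq (conj (z i) * v j - conj (v i) * z j)
      = Complex.normSq (z i) * Complex.normSq (v j) + Complex.normSq (v i) * Complex.normSq (z j)
        - 2 * ((conj (z i) * v i) * (conj (z j) * v j)).re := by
    intro i j
    simp only [Complex.normSq_apply, Complex.mul_re, Complex.mul_im, Complex.sub_re,
      Complex.sub_im, Complex.conj_re, Complex.conj_im]
    ring
  have h2 : ∑ i ∈ S, ∑ j ∈ S, ((conj (z i) * v i) * (conj (z j) * v j)).re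
      = (herm S z v * herm S z v).re := by
    simp only [herm, Finset.sum_mul_sum, Complex.re_sum]
  simp only [h, Finset.sum_sub_distrib, Finset.sum_add_distrib, ← Finset.mul_sum, h2]
  simp only [← Finset.sum_mul, ← Finset.mul_sum, herm_self_re, Complex.mul_re]
  ring

/-- Lagrange's identity for the angular momenta. -/
theorem sum_sq_wedge {ι : Type*} (S : Finset ι) (g h : ι → ℝ) :
    ∑ i ∈ S, ∑ j ∈ S, (g i * h j - g j * h i) ^ 2
      = 2 * ((∑ i ∈ S, g i * g i) * (∑ i ∈ S, h i * h i) - (∑ i ∈ S, g i * h i) ^ 2) := by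
  have e : ∀ i j, (g i * h j - g j * h i) ^ 2 = (g i * g i) * (h j * h j)
      + (h i * h i) * (g j * g j) - 2 * ((g i * h i) * (g j * h j)) := fun i j => by ring
  simp only [e, Finset.sum_sub_distrib, Finset.sum_add_distrib, ← Finset.mul_sum,
    ← Finset.sum_mul]
  ring

theorem sum_symm_eq {m : ℕ} (S : Finset (Fin m)) (F : Fin m → Fin m → ℝ)
    (hF : ∀ i j, F i j = F j i) :
    ∑ i ∈ S, ∑ j ∈ S, F i j = 2 * (∑ i ∈ S, ∑ j ∈ S, if i < j then F i j else 0)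
      + ∑ i ∈ S, F i i := by
  have h : ∀ i j, F i j = (if i < j then F i j else 0) + (if j < i then F j i else 0)
      + if i = j then F i i else 0 := by
    intro i j
    rcases lt_trichotomy i j with h | h | h
    · simp [h, h.ne, h.not_gt]
    · simp [h]
    · simp [h, h.ne', h.not_gt, hF i j]
  have h1 : ∑ i ∈ S, ∑ j ∈ S, F i j = ∑ i ∈ S, ∑ j ∈ S, ((if i < j then F i j else 0)
      + (if j < i then F j i else 0) + if i = j then F i i else 0) :=
    Finset.sum_congr rfl fun i _ => Finset.sum_congr rfl fun j _ => h i j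
  have h2 : ∑ i ∈ S, ∑ j ∈ S, (if j < i then F j i else 0)
      = ∑ i ∈ S, ∑ j ∈ S, if i < j then F i j else 0 := Finset.sum_comm
  have h3 : ∑ i ∈ S, ∑ j ∈ S, (if i = j then F i i else 0) = ∑ i ∈ S, F i i :=
    Finset.sum_congr rfl fun i hi => by rw [Finset.sum_ite_eq]; simp [hi]
  simp only [Finset.sum_add_distrib] at h1
  rw [h1, h2, h3]; ring

/-- The first `k` indices. -/
def below (m k : ℕ) : Finset (Fin m) := Finset.univ.filter fun i => i.1 < k

@[simp] theorem mem_below {m k : ℕ} {i : Fin m} : i ∈ below m k ↔ i.1 < k := by simp [below]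

theorem below_self (m : ℕ) : below m m = Finset.univ := by
  ext i; simp

theorem diff_herm (T : ℂ →ₗ[ℝ] ℝ) (S : Finset (Fin r)) (a b : Ph n →ₗ[ℝ] (Fin r → ℂ)) (x v : Ph n) :
    diff (fun y => T (herm S (a y) (b y))) x v = T (herm S (a x) (b v) + herm S (a v) (b x)) := by
  have hc : ∀ c : Ph n →ₗ[ℝ] (Fin r → ℂ), ∀ i, HasFDerivAt (fun y => c y i)
      (ContinuousLinearMap.proj (R := ℝ) (φ := fun _ : Fin r => ℂ) i ∘L
        LinearMap.toContinuousLinearMap c) x := fun c i =>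
    (ContinuousLinearMap.proj (R := ℝ) (φ := fun _ : Fin r => ℂ) i ∘L
        LinearMap.toContinuousLinearMap c).hasFDerivAt
  have hp : ∀ i, ∃ L : Ph n →L[ℝ] ℂ, HasFDerivAt (fun y => conj (a y i) * b y i) L x ∧
      ∀ v, L v = conj (a x i) * b v i + conj (a v i) * b x i := by
    intro i
    have h1 : HasFDerivAt (fun y => conj (a y i)) _ x :=
      Complex.conjCLE.toContinuousLinearMap.hasFDerivAt.comp x (hc a i)
    refine ⟨_, h1.fun_mul (hc b i), fun v => ?_⟩
    simp [mul_comm]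
  choose L hL hLv using hp
  have h2 := ((LinearMap.toContinuousLinearMap T).hasFDerivAt).comp x
    (HasFDerivAt.fun_sum fun i (_ : i ∈ S) => hL i)
  refine (diff_of_hasFDerivAt h2 v).trans ?_
  change T ((∑ i ∈ S, L i) v) = T _
  congr 1
  simp only [sum_apply, hLv, herm, Finset.sum_add_distrib]

theorem contDiff_herm {k : WithTop ℕ∞} (T : ℂ →ₗ[ℝ] ℝ) (S : Finset (Fin r))
    (a b : Ph n →ₗ[ℝ] (Fin r → ℂ)) : ContDiff ℝ k fun y => T (herm S (a y) (b y)) := by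
  have hc : ∀ c : Ph n →ₗ[ℝ] (Fin r → ℂ), ∀ i, ContDiff ℝ k (fun y => c y i) := fun c i =>
    (ContinuousLinearMap.proj (R := ℝ) (φ := fun _ : Fin r => ℂ) i ∘L
        LinearMap.toContinuousLinearMap c).contDiff
  exact (LinearMap.toContinuousLinearMap T).contDiff.comp
    (ContDiff.sum fun i _ => (Complex.conjCLE.contDiff.comp (hc a i)).mul (hc b i))

theorem diff_realPairing {m : ℕ} (S : Finset (Fin m)) (a b : Ph n →ₗ[ℝ] (Fin m → ℝ)) (x v : Ph n) :
    diff (fun y => ∑ j ∈ S, a y j * b y j) x v = ∑ j ∈ S, (a x j * b v j + a v j * b x j) := by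
  have hc : ∀ c : Ph n →ₗ[ℝ] (Fin m → ℝ), ∀ i, HasFDerivAt (fun y => c y i)
      (ContinuousLinearMap.proj (R := ℝ) (φ := fun _ : Fin m => ℝ) i ∘L
        LinearMap.toContinuousLinearMap c) x := fun c i =>
    (ContinuousLinearMap.proj (R := ℝ) (φ := fun _ : Fin m => ℝ) i ∘L
        LinearMap.toContinuousLinearMap c).hasFDerivAt
  have h1 := HasFDerivAt.fun_sum fun i (_ : i ∈ S) => (hc a i).fun_mul (hc b i)
  rw [diff_of_hasFDerivAt h1 v]
  simp only [sum_apply, add_apply, smul_apply, ContinuousLinearMap.comp_apply]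
  refine Finset.sum_congr rfl fun i _ => ?_
  simp [mul_comm]

theorem contDiff_realPairing {k : WithTop ℕ∞} {m : ℕ} (S : Finset (Fin m))
    (a b : Ph n →ₗ[ℝ] (Fin m → ℝ)) : ContDiff ℝ k fun y => ∑ j ∈ S, a y j * b y j := by
  have hc : ∀ c : Ph n →ₗ[ℝ] (Fin m → ℝ), ∀ i, ContDiff ℝ k (fun y => c y i) := fun c i =>
    (ContinuousLinearMap.proj (R := ℝ) (φ := fun _ : Fin m => ℝ) i ∘L
        LinearMap.toContinuousLinearMap c).contDiff
  exact ContDiff.sum fun i _ => (hc a i).mul (hc b i)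

section
variable (h : 2 * r ≤ n) (ε : ℝ)

/-- The complex position coordinates of a phase point. -/
noncomputable def posZ : Ph n →ₗ[ℝ] (Fin r → ℂ) :=
  LinearMap.fst ℝ _ _ ∘ₗ (blockEquiv h).toLinearMap ∘ₗ LinearMap.fst ℝ _ _

/-- The complex gauge momentum coordinates of a phase point. -/
noncomputable def momZ : Ph n →ₗ[ℝ] (Fin r → ℂ) where
  toFun := cv h ε
  map_add' u v := by
    funext i; simp [cv]; ring
  map_smul' c v := by
    funext i; simp [cv]; ring

/-- The real position coordinates of a phase point outside of the magnetic planes. -/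
noncomputable def posT : Ph n →ₗ[ℝ] (Fin (n - 2 * r) → ℝ) :=
  LinearMap.snd ℝ _ _ ∘ₗ (blockEquiv h).toLinearMap ∘ₗ LinearMap.fst ℝ _ _

/-- The real momentum coordinates of a phase point outside of the magnetic planes. -/
noncomputable def momT : Ph n →ₗ[ℝ] (Fin (n - 2 * r) → ℝ) :=
  LinearMap.snd ℝ _ _ ∘ₗ (blockEquiv h).toLinearMap ∘ₗ LinearMap.snd ℝ _ _

theorem posZ_apply (x : Ph n) : posZ h x = cz h x.1 := rfl
theorem momZ_apply (x : Ph n) : momZ h ε x = cv h ε x := rfl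
theorem posT_apply (x : Ph n) : posT h x = ct h x.1 := rfl
theorem momT_apply (x : Ph n) : momT h x = ct h x.2 := rfl

/-- `|z|²` over a set of magnetic planes. -/
noncomputable def zz (S : Finset (Fin r)) (x : Ph n) : ℝ :=
  Complex.reLm (herm S (posZ h x) (posZ h x))

/-- `|v|²` over a set of magnetic planes. -/
noncomputable def vv (S : Finset (Fin r)) (x : Ph n) : ℝ :=
  Complex.reLm (herm S (momZ h ε x) (momZ h ε x))

/-- `Re ⟨z, v⟩` over a set of magnetic planes. -/
noncomputable def zv (S : Finset (Fin r)) (x : Ph n) : ℝ :=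
  Complex.reLm (herm S (posZ h x) (momZ h ε x))

/-- `Im ⟨z, v⟩` over a set of magnetic planes. -/
noncomputable def zvIm (S : Finset (Fin r)) (x : Ph n) : ℝ :=
  Complex.imLm (herm S (posZ h x) (momZ h ε x))

/-- `|γ|²` over a set of coordinates outside of the magnetic planes. -/
noncomputable def gg (S : Finset (Fin (n - 2 * r))) (x : Ph n) : ℝ :=
  ∑ j ∈ S, posT h x j * posT h x j

/-- `|p|²` over a set of coordinates outside of the magnetic planes. -/
noncomputable def hh (S : Finset (Fin (n - 2 * r))) (x : Ph n) : ℝ :=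
  ∑ j ∈ S, momT h x j * momT h x j

/-- `⟨γ, p⟩` over a set of coordinates outside of the magnetic planes. -/
noncomputable def gh (S : Finset (Fin (n - 2 * r))) (x : Ph n) : ℝ :=
  ∑ j ∈ S, posT h x j * momT h x j

/-- The quadratic Casimir function of the unitary algebra of a set of magnetic planes. -/
noncomputable def casU (S : Finset (Fin r)) (x : Ph n) : ℝ :=
  zz h S x * vv h ε S x - zv h ε S x ^ 2 + zvIm h ε S x ^ 2

/-- The quadratic Casimir function of the orthogonal algebra of a set of coordinates. -/
noncomputable def casT (S : Finset (Fin (n - 2 * r))) (x : Ph n) : ℝ :=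
  gg h S x * hh h S x - gh h S x ^ 2

theorem contDiff_zz {k : WithTop ℕ∞} (S : Finset (Fin r)) : ContDiff ℝ k (zz h S) :=
  contDiff_herm _ S _ _

theorem contDiff_vv {k : WithTop ℕ∞} (S : Finset (Fin r)) : ContDiff ℝ k (vv h ε S) :=
  contDiff_herm _ S _ _

theorem contDiff_zv {k : WithTop ℕ∞} (S : Finset (Fin r)) : ContDiff ℝ k (zv h ε S) :=
  contDiff_herm _ S _ _

theorem contDiff_zvIm {k : WithTop ℕ∞} (S : Finset (Fin r)) : ContDiff ℝ k (zvIm h ε S) :=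
  contDiff_herm _ S _ _

theorem contDiff_gg {k : WithTop ℕ∞} (S : Finset (Fin (n - 2 * r))) : ContDiff ℝ k (gg h S) :=
  contDiff_realPairing S _ _

theorem contDiff_hh {k : WithTop ℕ∞} (S : Finset (Fin (n - 2 * r))) : ContDiff ℝ k (hh h S) :=
  contDiff_realPairing S _ _

theorem contDiff_gh {k : WithTop ℕ∞} (S : Finset (Fin (n - 2 * r))) : ContDiff ℝ k (gh h S) :=
  contDiff_realPairing S _ _

theorem contDiff_casU {k : WithTop ℕ∞} (S : Finset (Fin r)) : ContDiff ℝ k (casU h ε S) :=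
  (((contDiff_zz h S).mul (contDiff_vv h ε S)).sub ((contDiff_zv h ε S).pow 2)).add
    ((contDiff_zvIm h ε S).pow 2)

theorem contDiff_casT {k : WithTop ℕ∞} (S : Finset (Fin (n - 2 * r))) : ContDiff ℝ k (casT h S) :=
  ((contDiff_gg h S).mul (contDiff_hh h S)).sub ((contDiff_gh h S).pow 2)

theorem diff_zz (S : Finset (Fin r)) (x v : Ph n) : diff (zz h S) x v =
    Complex.reLm (herm S (posZ h x) (posZ h v) + herm S (posZ h v) (posZ h x)) :=
  diff_herm _ S _ _ x v

theorem diff_vv (S : Finset (Fin r)) (x v : Ph n) : diff (vv h ε S) x v =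
    Complex.reLm (herm S (momZ h ε x) (momZ h ε v) + herm S (momZ h ε v) (momZ h ε x)) :=
  diff_herm _ S _ _ x v

theorem diff_zv (S : Finset (Fin r)) (x v : Ph n) : diff (zv h ε S) x v =
    Complex.reLm (herm S (posZ h x) (momZ h ε v) + herm S (posZ h v) (momZ h ε x)) :=
  diff_herm _ S _ _ x v

theorem diff_zvIm (S : Finset (Fin r)) (x v : Ph n) : diff (zvIm h ε S) x v =
    Complex.imLm (herm S (posZ h x) (momZ h ε v) + herm S (posZ h v) (momZ h ε x)) :=
  diff_herm _ S _ _ x v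

theorem diff_gg (S : Finset (Fin (n - 2 * r))) (x v : Ph n) : diff (gg h S) x v =
    ∑ j ∈ S, (posT h x j * posT h v j + posT h v j * posT h x j) :=
  diff_realPairing S _ _ x v

theorem diff_hh (S : Finset (Fin (n - 2 * r))) (x v : Ph n) : diff (hh h S) x v =
    ∑ j ∈ S, (momT h x j * momT h v j + momT h v j * momT h x j) :=
  diff_realPairing S _ _ x v

theorem diff_gh (S : Finset (Fin (n - 2 * r))) (x v : Ph n) : diff (gh h S) x v =
    ∑ j ∈ S, (posT h x j * momT h v j + posT h v j * momT h x j) :=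
  diff_realPairing S _ _ x v

theorem differentiableAt_of_contDiff {f : Ph n → ℝ} (hf : ContDiff ℝ 1 f) (x : Ph n) :
    DifferentiableAt ℝ f x := hf.differentiable one_ne_zero x

theorem diff_casU (S : Finset (Fin r)) (x v : Ph n) : diff (casU h ε S) x v =
    zz h S x * diff (vv h ε S) x v + diff (zz h S) x v * vv h ε S x
      - 2 * zv h ε S x * diff (zv h ε S) x v + 2 * zvIm h ε S x * diff (zvIm h ε S) x v := by
  have h1 := differentiableAt_of_contDiff (contDiff_zz h S) x
  have h2 := differentiableAt_of_contDiff (contDiff_vv h ε S) x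
  have h3 := differentiableAt_of_contDiff (contDiff_zv h ε S) x
  have h4 := differentiableAt_of_contDiff (contDiff_zvIm h ε S) x
  rw [show casU h ε S = fun x => zz h S x * vv h ε S x - zv h ε S x ^ 2 + zvIm h ε S x ^ 2 from rfl,
    diff_add ((h1.fun_mul h2).fun_sub (h3.fun_pow 2)) (h4.fun_pow 2),
    diff_sub (h1.fun_mul h2) (h3.fun_pow 2), diff_mul h1 h2, diff_sq h3, diff_sq h4]

theorem diff_casT (S : Finset (Fin (n - 2 * r))) (x v : Ph n) : diff (casT h S) x v =
    gg h S x * diff (hh h S) x v + diff (gg h S) x v * hh h S x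
      - 2 * gh h S x * diff (gh h S) x v := by
  have h1 := differentiableAt_of_contDiff (contDiff_gg h S) x
  have h2 := differentiableAt_of_contDiff (contDiff_hh h S) x
  have h3 := differentiableAt_of_contDiff (contDiff_gh h S) x
  rw [show casT h S = fun x => gg h S x * hh h S x - gh h S x ^ 2 from rfl,
    diff_sub (h1.fun_mul h2) (h3.fun_pow 2), diff_mul h1 h2, diff_sq h3]

/-- Only components in S are paired, so only the rows of Ξ in S matter; by `hS` they involve the
coordinates in S alone, and Ξ acts on these as a skew-Hermitian matrix. -/
theorem herm_mulVec_add {m : ℕ} {Ξ : Matrix (Fin m) (Fin m) ℂ} (hΞ : Ξᴴ = -Ξ) {S : Finset (Fin m)}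
    (hS : ∀ i ∈ S, ∀ j ∉ S, Ξ i j = 0) (u w : Fin m → ℂ) :
    herm S u (Ξ *ᵥ w) + herm S (Ξ *ᵥ u) w = 0 := by
  have hconj : ∀ i j, conj (Ξ i j) = -Ξ j i := fun i j => by
    have := congrFun (congrFun hΞ j) i
    simpa [Matrix.conjTranspose_apply] using this
  have hmul : ∀ y : Fin m → ℂ, ∀ i ∈ S, (Ξ *ᵥ y) i = ∑ j ∈ S, Ξ i j * y j := by
    intro y i hi
    rw [Matrix.mulVec, dotProduct]
    symm
    refine Finset.sum_subset (Finset.subset_univ S) fun j _ hj => ?_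
    rw [hS i hi j hj, zero_mul]
  have e1 : herm S u (Ξ *ᵥ w) = ∑ i ∈ S, ∑ j ∈ S, conj (u i) * (Ξ i j * w j) :=
    Finset.sum_congr rfl fun i hi => by rw [hmul w i hi, Finset.mul_sum]
  have e2 : herm S (Ξ *ᵥ u) w = ∑ i ∈ S, ∑ j ∈ S, conj (Ξ i j * u j) * w i :=
    Finset.sum_congr rfl fun i hi => by rw [hmul u i hi, map_sum, Finset.sum_mul]
  rw [e1, e2, Finset.sum_comm, ← Finset.sum_add_distrib]
  refine Finset.sum_eq_zero fun i _ => ?_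
  rw [← Finset.sum_add_distrib]
  refine Finset.sum_eq_zero fun j _ => ?_
  rw [map_mul, hconj]; ring

theorem sum_mulVec_add {m : ℕ} {A : Matrix (Fin m) (Fin m) ℝ} (hA : Aᵀ = -A) {S : Finset (Fin m)}
    (hS : ∀ i ∈ S, ∀ j ∉ S, A i j = 0) (u w : Fin m → ℝ) :
    ∑ j ∈ S, (u j * (A *ᵥ w) j + (A *ᵥ u) j * w j) = 0 := by
  have ht : ∀ i j, A i j = -A j i := fun i j => by
    have := congrFun (congrFun hA j) i
    simpa [Matrix.transpose_apply] using this
  have hmul : ∀ y : Fin m → ℝ, ∀ i ∈ S, (A *ᵥ y) i = ∑ j ∈ S, A i j * y j := by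
    intro y i hi
    rw [Matrix.mulVec, dotProduct]
    symm
    refine Finset.sum_subset (Finset.subset_univ S) fun j _ hj => ?_
    rw [hS i hi j hj, zero_mul]
  have e1 : ∑ i ∈ S, u i * (A *ᵥ w) i = ∑ i ∈ S, ∑ j ∈ S, u i * (A i j * w j) :=
    Finset.sum_congr rfl fun i hi => by rw [hmul w i hi, Finset.mul_sum]
  have e2 : ∑ i ∈ S, (A *ᵥ u) i * w i = ∑ i ∈ S, ∑ j ∈ S, (A i j * u j) * w i :=
    Finset.sum_congr rfl fun i hi => by rw [hmul u i hi, Finset.sum_mul]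
  rw [Finset.sum_add_distrib, e1, e2, Finset.sum_comm, ← Finset.sum_add_distrib]
  refine Finset.sum_eq_zero fun i _ => ?_
  rw [← Finset.sum_add_distrib]
  refine Finset.sum_eq_zero fun j _ => ?_
  rw [ht j i]; ring

theorem posZ_cotLift (Ξ : Matrix (Fin r) (Fin r) ℂ)
    (A : Matrix (Fin (n - 2 * r)) (Fin (n - 2 * r)) ℝ) (x : Ph n) :
    posZ h (cotLift (rot h Ξ A) x) = Ξ *ᵥ posZ h x := cz_rot h Ξ A x.1

theorem momZ_cotLift (Ξ : Matrix (Fin r) (Fin r) ℂ)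
    (A : Matrix (Fin (n - 2 * r)) (Fin (n - 2 * r)) ℝ) (x : Ph n) :
    momZ h ε (cotLift (rot h Ξ A) x) = Ξ *ᵥ momZ h ε x := by
  have e : ∀ y : Ph n, momZ h ε y = cz h y.2 + (Complex.I * (ε / 2)) • cz h y.1 := fun y => rfl
  rw [e, e]
  change cz h (rot h Ξ A x.2) + _ • cz h (rot h Ξ A x.1) = _
  rw [cz_rot, cz_rot, Matrix.mulVec_add, Matrix.mulVec_smul]

theorem posT_cotLift (Ξ : Matrix (Fin r) (Fin r) ℂ)
    (A : Matrix (Fin (n - 2 * r)) (Fin (n - 2 * r)) ℝ) (x : Ph n) :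
    posT h (cotLift (rot h Ξ A) x) = A *ᵥ posT h x := ct_rot h Ξ A x.1

theorem momT_cotLift (Ξ : Matrix (Fin r) (Fin r) ℂ)
    (A : Matrix (Fin (n - 2 * r)) (Fin (n - 2 * r)) ℝ) (x : Ph n) :
    momT h (cotLift (rot h Ξ A) x) = A *ᵥ momT h x := ct_rot h Ξ A x.2

/-- The Casimir function is a polynomial in Hermitian products over S, each of which is invariant
under the rotation. -/
theorem diff_casU_cotLift {Ξ : Matrix (Fin r) (Fin r) ℂ} (hΞ : Ξᴴ = -Ξ)
    (A : Matrix (Fin (n - 2 * r)) (Fin (n - 2 * r)) ℝ) {S : Finset (Fin r)}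
    (hS : ∀ i ∈ S, ∀ j ∉ S, Ξ i j = 0) (x : Ph n) :
    diff (casU h ε S) x (cotLift (rot h Ξ A) x) = 0 := by
  rw [diff_casU]
  simp only [diff_zz, diff_vv, diff_zv, diff_zvIm, posZ_cotLift, momZ_cotLift, herm_mulVec_add hΞ hS,
    map_zero]
  ring

theorem diff_casT_cotLift (Ξ : Matrix (Fin r) (Fin r) ℂ)
    {A : Matrix (Fin (n - 2 * r)) (Fin (n - 2 * r)) ℝ} (hA : Aᵀ = -A)
    {S : Finset (Fin (n - 2 * r))}
    (hS : ∀ i ∈ S, ∀ j ∉ S, A i j = 0) (x : Ph n) :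
    diff (casT h S) x (cotLift (rot h Ξ A) x) = 0 := by
  rw [diff_casT]
  simp only [diff_gg, diff_hh, diff_gh, posT_cotLift, momT_cotLift, sum_mulVec_add hA hS]
  ring

theorem sum_normSq_umom (S : Finset (Fin r)) (x : Ph n) :
    ∑ i ∈ S, ∑ j ∈ S, Complex.normSq (umom h ε i j x) = 2 * casU h ε S x :=
  sum_normSq_wedge S (posZ h x) (momZ h ε x)

theorem sum_sq_tmom (S : Finset (Fin (n - 2 * r))) (x : Ph n) :
    ∑ i ∈ S, ∑ j ∈ S, tmom h i j x ^ 2 = 2 * casT h S x :=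
  sum_sq_wedge S (posT h x) (momT h x)

/-- Lagrange's identity evaluates the sum over all pairs; restricting to i < j halves it and leaves
the diagonal entries, which are purely imaginary and equal to the integrals Φ up to a factor 2i. -/
theorem sum_lt_normSq_umom (S : Finset (Fin r)) (x : Ph n) :
    (∑ i ∈ S, ∑ j ∈ S, if i < j then Complex.normSq (umom h ε i j x) else 0)
      = casU h ε S x - 2 * ∑ i ∈ S, (1 / 2 * (umom h ε i i x).im) ^ 2 := by
  have h1 := sum_symm_eq S (fun i j => Complex.normSq (umom h ε i j x)) (fun i j => by
    rw [← Complex.normSq_conj, conj_umom, Complex.normSq_neg])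
  have h2 : ∀ i, Complex.normSq (umom h ε i i x) = 4 * (1 / 2 * (umom h ε i i x).im) ^ 2 := by
    intro i
    have := congrArg Complex.re (conj_umom h ε i i x)
    simp only [Complex.conj_re, Complex.neg_re] at this
    have h0 : (umom h ε i i x).re = 0 := by linarith
    rw [Complex.normSq_apply, h0]; ring
  rw [sum_normSq_umom] at h1
  simp only [h2, ← Finset.mul_sum] at h1
  linarith

theorem sum_lt_sq_tmom (S : Finset (Fin (n - 2 * r))) (x : Ph n) :
    (∑ i ∈ S, ∑ j ∈ S, if i < j then tmom h i j x ^ 2 else 0) = casT h S x := by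
  have h1 := sum_symm_eq S (fun i j => tmom h i j x ^ 2) (fun i j => by
    simp only [tmom]; ring)
  have h2 : ∀ i, tmom h i i x ^ 2 = 0 := fun i => by simp [tmom]
  rw [sum_sq_tmom] at h1
  simp only [h2, Finset.sum_const_zero] at h1
  linarith

end

end MagneticSphere

namespace MagneticSphere

open scoped ComplexConjugate

variable {n r : ℕ} {κ : Fin (n / 2) → ℝ} {κ₀ : ℝ}

/-! ### The given integrals as moments; closure of the algebra -/

theorem Phi_eq (hb : IsBlockField r κ κ₀) (s : ℝ) (k : Fin (n / 2)) (hk : k.1 < r) (x : Ph n) :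
    Phi s κ k x = 1 / 2 * (umom hb.le (s * κ₀) ⟨k.1, hk⟩ ⟨k.1, hk⟩ x).im := by
  have h1 : x.1 (od k) = (cz hb.le x.1 ⟨k.1, hk⟩).re := rfl
  have h2 : x.1 (ev k) = (cz hb.le x.1 ⟨k.1, hk⟩).im := rfl
  have h3 : x.2 (od k) = (cz hb.le x.2 ⟨k.1, hk⟩).re := rfl
  have h4 : x.2 (ev k) = (cz hb.le x.2 ⟨k.1, hk⟩).im := rfl
  rw [Phi, h1, h2, h3, h4, hb.eq k hk, umom, cv]
  simp only [Complex.sub_im, Complex.mul_im, Complex.mul_re, Complex.add_re, Complex.add_im,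
    Complex.conj_re, Complex.conj_im, Complex.I_re, Complex.I_im, Complex.div_ofNat_re,
    Complex.div_ofNat_im, Complex.ofReal_re, Complex.ofReal_im]
  ring

theorem Psi1_eq (hb : IsBlockField r κ κ₀) (s : ℝ) (i j : Fin (n / 2)) (hi : i.1 < r)
    (hj : j.1 < r) (x : Ph n) :
    Psi1 s κ i j x = -(umom hb.le (s * κ₀) ⟨i.1, hi⟩ ⟨j.1, hj⟩ x).im := by
  have h1 : ∀ (k : Fin (n / 2)) (hk : k.1 < r), x.1 (od k) = (cz hb.le x.1 ⟨k.1, hk⟩).re :=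
    fun _ _ => rfl
  have h2 : ∀ (k : Fin (n / 2)) (hk : k.1 < r), x.1 (ev k) = (cz hb.le x.1 ⟨k.1, hk⟩).im :=
    fun _ _ => rfl
  have h3 : ∀ (k : Fin (n / 2)) (hk : k.1 < r), x.2 (od k) = (cz hb.le x.2 ⟨k.1, hk⟩).re :=
    fun _ _ => rfl
  have h4 : ∀ (k : Fin (n / 2)) (hk : k.1 < r), x.2 (ev k) = (cz hb.le x.2 ⟨k.1, hk⟩).im :=
    fun _ _ => rfl
  rw [Psi1, h1 i hi, h1 j hj, h2 i hi, h2 j hj, h3 i hi, h3 j hj, h4 i hi, h4 j hj, hb.eq i hi,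
    umom, cv, cv]
  simp only [Complex.sub_im, Complex.mul_im, Complex.mul_re, Complex.add_re, Complex.add_im,
    Complex.conj_re, Complex.conj_im, Complex.I_re, Complex.I_im, Complex.div_ofNat_re,
    Complex.div_ofNat_im, Complex.ofReal_re, Complex.ofReal_im]
  ring

theorem Psi2_eq (hb : IsBlockField r κ κ₀) (s : ℝ) (i j : Fin (n / 2)) (hi : i.1 < r)
    (hj : j.1 < r) (x : Ph n) :
    Psi2 s κ i j x = (umom hb.le (s * κ₀) ⟨i.1, hi⟩ ⟨j.1, hj⟩ x).re := by
  have h1 : ∀ (k : Fin (n / 2)) (hk : k.1 < r), x.1 (od k) = (cz hb.le x.1 ⟨k.1, hk⟩).re :=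
    fun _ _ => rfl
  have h2 : ∀ (k : Fin (n / 2)) (hk : k.1 < r), x.1 (ev k) = (cz hb.le x.1 ⟨k.1, hk⟩).im :=
    fun _ _ => rfl
  have h3 : ∀ (k : Fin (n / 2)) (hk : k.1 < r), x.2 (od k) = (cz hb.le x.2 ⟨k.1, hk⟩).re :=
    fun _ _ => rfl
  have h4 : ∀ (k : Fin (n / 2)) (hk : k.1 < r), x.2 (ev k) = (cz hb.le x.2 ⟨k.1, hk⟩).im :=
    fun _ _ => rfl
  rw [Psi2, h1 i hi, h1 j hj, h2 i hi, h2 j hj, h3 i hi, h3 j hj, h4 i hi, h4 j hj, hb.eq i hi,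
    umom, cv, cv]
  simp only [Complex.sub_re, Complex.mul_im, Complex.mul_re, Complex.add_re, Complex.add_im,
    Complex.conj_re, Complex.conj_im, Complex.I_re, Complex.I_im, Complex.div_ofNat_re,
    Complex.div_ofNat_im, Complex.ofReal_re, Complex.ofReal_im]
  ring

theorem angular_eq (h : 2 * r ≤ n) (i j : Fin n) (hi : 2 * r ≤ i.1) (hj : 2 * r ≤ j.1) (x : Ph n) :
    angular i j x = tmom h ⟨i.1 - 2 * r, by omega⟩ ⟨j.1 - 2 * r, by omega⟩ x := by
  have e : ∀ (k : Fin n) (_ : 2 * r ≤ k.1) (y : Fin n → ℝ),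
      ct h y ⟨k.1 - 2 * r, by omega⟩ = y k := by
    intro k hk y
    rw [ct_apply]
    congr 1
    exact Fin.ext (by simp only; omega)
  rw [angular, tmom, e i hi, e j hj, e i hi, e j hj]

/-- The moments of the unitary algebra, as functions on the phase space. -/
noncomputable def umoment (hb : IsBlockField r κ κ₀) (s : ℝ) (c : ℂ) (i j : Fin r) : Ph n → ℝ :=
  gaugeMoment s κ (rot hb.le (ugen c i j) 0)

/-- The moments of the orthogonal algebra, as functions on the phase space. -/
noncomputable def tmoment (hb : IsBlockField r κ κ₀) (s : ℝ) (i j : Fin (n - 2 * r)) : Ph n → ℝ :=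
  gaugeMoment s κ (rot hb.le 0 (tgen i j))

theorem umom_re (hb : IsBlockField r κ κ₀) (s : ℝ) (i j : Fin r) (x : Ph n) :
    (umom hb.le (s * κ₀) i j x).re = umoment hb s (-1) i j x := by
  rw [umoment, gaugeMoment_ugen hb]; simp

theorem umom_im (hb : IsBlockField r κ κ₀) (s : ℝ) (i j : Fin r) (x : Ph n) :
    (umom hb.le (s * κ₀) i j x).im = umoment hb s Complex.I i j x := by
  rw [umoment, gaugeMoment_ugen hb]; simp

theorem umom_half_im (hb : IsBlockField r κ κ₀) (s : ℝ) (i j : Fin r) (x : Ph n) :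
    1 / 2 * (umom hb.le (s * κ₀) i j x).im = umoment hb s (Complex.I / 2) i j x := by
  rw [umoment, gaugeMoment_ugen hb]; simp [Complex.mul_re]

theorem noncommutativeFamily_cases (hb : IsBlockField r κ κ₀) {m s : ℝ} {f : Ph n → ℝ}
    (hf : f ∈ noncommutativeFamily m s κ r) :
    f = energy m ∨ f = integralJ m s κ ∨ (∃ c i j, f = umoment hb s c i j) ∨
      ∃ i j, f = tmoment hb s i j := by
  rcases hf with (((h | h) | ⟨k, hk, rfl⟩) | ⟨i, j, hij, hj, h⟩) | ⟨i, j, hi, hij, rfl⟩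
  · exact Or.inl h
  · exact Or.inr (Or.inl h)
  · refine Or.inr (Or.inr (Or.inl ⟨Complex.I / 2, ⟨k.1, hk⟩, ⟨k.1, hk⟩, funext fun x => ?_⟩))
    rw [Phi_eq hb s k hk, umom_half_im hb]
  · have hi : i.1 < r := lt_trans hij hj
    rcases h with rfl | rfl
    · refine Or.inr (Or.inr (Or.inl ⟨-Complex.I, ⟨i.1, hi⟩, ⟨j.1, hj⟩, funext fun x => ?_⟩))
      rw [Psi1_eq hb s i j hi hj, umoment, gaugeMoment_ugen hb]; simp
    · refine Or.inr (Or.inr (Or.inl ⟨-1, ⟨i.1, hi⟩, ⟨j.1, hj⟩, funext fun x => ?_⟩))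
      rw [Psi2_eq hb s i j hi hj, umom_re hb]
  · refine Or.inr (Or.inr (Or.inr ⟨⟨i.1 - 2 * r, by omega⟩, ⟨j.1 - 2 * r, by omega⟩,
      funext fun x => ?_⟩))
    have hij' : i.1 < j.1 := hij
    rw [angular_eq hb.le i j hi (by omega), tmoment, gaugeMoment_tgen hb]

theorem zero_skew {q : ℕ} : (0 : Matrix (Fin q) (Fin q) ℝ)ᵀ = -0 := by simp

theorem zero_antiherm {q : ℕ} : (0 : Matrix (Fin q) (Fin q) ℂ)ᴴ = -0 := by simp

/-- The family lists only i < j and the diagonal. The lower half follows from skew-Hermitian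
symmetry, and a diagonal entry has zero real part. -/
theorem umom_mem_adjoin (hb : IsBlockField r κ κ₀) (m s : ℝ) (i j : Fin r) :
    (fun x => (umom hb.le (s * κ₀) i j x).re) ∈ Algebra.adjoin ℝ (noncommutativeFamily m s κ r) ∧
    (fun x => (umom hb.le (s * κ₀) i j x).im) ∈ Algebra.adjoin ℝ (noncommutativeFamily m s κ r) := by
  have hr := hb.lt
  have key : ∀ i j : Fin r, i < j →
      (fun x => (umom hb.le (s * κ₀) i j x).re) ∈ Algebra.adjoin ℝ (noncommutativeFamily m s κ r) ∧
      (fun x => (umom hb.le (s * κ₀) i j x).im) ∈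
        Algebra.adjoin ℝ (noncommutativeFamily m s κ r) := by
    intro i j hij
    have hmem : ∀ f, (f = Psi1 s κ ⟨i.1, by omega⟩ ⟨j.1, by omega⟩ ∨
        f = Psi2 s κ ⟨i.1, by omega⟩ ⟨j.1, by omega⟩) →
        f ∈ Algebra.adjoin ℝ (noncommutativeFamily m s κ r) := fun f hf =>
      Algebra.subset_adjoin (Or.inl (Or.inr ⟨⟨i.1, by omega⟩, ⟨j.1, by omega⟩, hij, j.2, hf⟩))
    refine ⟨?_, ?_⟩
    · convert hmem _ (Or.inr rfl) using 1
      funext x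
      rw [Psi2_eq hb s _ _ i.2 j.2]
    · convert (Algebra.adjoin ℝ (noncommutativeFamily m s κ r)).neg_mem (hmem _ (Or.inl rfl)) using 1
      funext x
      rw [Pi.neg_apply, Psi1_eq hb s _ _ i.2 j.2, neg_neg]
  rcases lt_trichotomy i j with hij | rfl | hij
  · exact key i j hij
  · refine ⟨?_, ?_⟩
    · have : (fun x => (umom hb.le (s * κ₀) i i x).re) = (0 : Ph n → ℝ) := by
        funext x
        have := congrArg Complex.re (conj_umom hb.le (s * κ₀) i i x)
        simp only [Complex.conj_re, Complex.neg_re] at this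
        simp only [Pi.zero_apply]; linarith
      rw [this]; exact zero_mem _
    · have hmem : Phi s κ ⟨i.1, by omega⟩ ∈ Algebra.adjoin ℝ (noncommutativeFamily m s κ r) :=
        Algebra.subset_adjoin (Or.inl (Or.inl (Or.inr ⟨⟨i.1, by omega⟩, i.2, rfl⟩)))
      convert (Algebra.adjoin ℝ (noncommutativeFamily m s κ r)).smul_mem hmem (2 : ℝ) using 1
      funext x
      rw [Pi.smul_apply, Phi_eq hb s _ i.2, smul_eq_mul]; ring
  · have h := key j i hij
    have e : ∀ x, umom hb.le (s * κ₀) i j x = -conj (umom hb.le (s * κ₀) j i x) := fun x => by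
      rw [conj_umom, neg_neg]
    refine ⟨?_, ?_⟩
    · convert (Algebra.adjoin ℝ (noncommutativeFamily m s κ r)).neg_mem h.1 using 1
      funext x; rw [e]; simp
    · convert h.2 using 1
      funext x; rw [e]; simp

theorem tmom_mem_adjoin (hb : IsBlockField r κ κ₀) (m s : ℝ) (i j : Fin (n - 2 * r)) :
    (fun x => tmom hb.le i j x) ∈ Algebra.adjoin ℝ (noncommutativeFamily m s κ r) := by
  have key : ∀ i j : Fin (n - 2 * r), i < j →
      (fun x => tmom hb.le i j x) ∈ Algebra.adjoin ℝ (noncommutativeFamily m s κ r) := by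
    intro i j hij
    have hmem : angular ⟨2 * r + i.1, by omega⟩ ⟨2 * r + j.1, by omega⟩ ∈
        Algebra.adjoin ℝ (noncommutativeFamily m s κ r) := by
      refine Algebra.subset_adjoin (Or.inr ⟨⟨2 * r + i.1, by omega⟩, ⟨2 * r + j.1, by omega⟩,
        by simp, ?_, rfl⟩)
      rw [Fin.lt_def]; simp only; omega
    exact hmem
  rcases lt_trichotomy i j with hij | rfl | hij
  · exact key i j hij
  · have : (fun x => tmom hb.le i i x) = (0 : Ph n → ℝ) := by
      funext x; simp [tmom]
    rw [this]; exact zero_mem _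
  · convert (Algebra.adjoin ℝ (noncommutativeFamily m s κ r)).neg_mem (key j i hij) using 1
    funext x; simp [tmom]

theorem gaugeMoment_mem_adjoin (hb : IsBlockField r κ κ₀) (m s : ℝ)
    {Ξ : Matrix (Fin r) (Fin r) ℂ} (hΞ : Ξᴴ = -Ξ)
    {S : Matrix (Fin (n - 2 * r)) (Fin (n - 2 * r)) ℝ} (hS : Sᵀ = -S) :
    gaugeMoment s κ (rot hb.le Ξ S) ∈ Algebra.adjoin ℝ (noncommutativeFamily m s κ r) := by
  have e : gaugeMoment s κ (rot hb.le Ξ S) =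
      ∑ i, ∑ j, ((-(1 / 2) * (Ξ i j).re) • (fun x => (umom hb.le (s * κ₀) i j x).re)
        + (1 / 2 * (Ξ i j).im) • (fun x => (umom hb.le (s * κ₀) i j x).im))
      + ∑ i, ∑ j, (1 / 2 * S i j) • (fun x => tmom hb.le j i x) := by
    funext x
    rw [gaugeMoment_rot_eq_sum hb s hΞ hS]
    simp only [Pi.add_apply, Finset.sum_apply, Pi.smul_apply, smul_eq_mul]
  rw [e]
  refine add_mem (sum_mem fun i _ => sum_mem fun j _ => add_mem ?_ ?_)
    (sum_mem fun i _ => sum_mem fun j _ => ?_)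
  · exact Subalgebra.smul_mem _ (umom_mem_adjoin hb m s i j).1 _
  · exact Subalgebra.smul_mem _ (umom_mem_adjoin hb m s i j).2 _
  · exact Subalgebra.smul_mem _ (tmom_mem_adjoin hb m s j i) _

theorem isGauge_umoment (hb : IsBlockField r κ κ₀) (c : ℂ) (i j : Fin r) :
    IsGaugeRotation κ (rot hb.le (ugen c i j) 0) :=
  isGaugeRotation_rot hb (ugen_conjTranspose c i j) zero_skew

theorem isGauge_tmoment (hb : IsBlockField r κ κ₀) (i j : Fin (n - 2 * r)) :
    IsGaugeRotation κ (rot hb.le 0 (tgen i j)) :=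
  isGaugeRotation_rot hb zero_antiherm (tgen_transpose i j)

theorem noncommutativeFamily_moment (hb : IsBlockField r κ κ₀) {m s : ℝ} {f : Ph n → ℝ}
    (hf : f ∈ noncommutativeFamily m s κ r) :
    f = energy m ∨ f = integralJ m s κ ∨ ∃ Ξ : Matrix (Fin r) (Fin r) ℂ, Ξᴴ = -Ξ ∧
      ∃ S : Matrix (Fin (n - 2 * r)) (Fin (n - 2 * r)) ℝ, Sᵀ = -S ∧
        f = gaugeMoment s κ (rot hb.le Ξ S) := by
  rcases noncommutativeFamily_cases hb hf with h | h | ⟨c, i, j, h⟩ | ⟨i, j, h⟩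
  · exact Or.inl h
  · exact Or.inr (Or.inl h)
  · exact Or.inr (Or.inr ⟨_, ugen_conjTranspose c i j, _, zero_skew, h⟩)
  · exact Or.inr (Or.inr ⟨_, zero_antiherm, _, tgen_transpose i j, h⟩)

theorem isFirstIntegral_noncommutativeFamily (hb : IsBlockField r κ κ₀) {m : ℝ} (hm : m ≠ 0)
    (s : ℝ) : ∀ f ∈ noncommutativeFamily m s κ r, IsFirstIntegral m s κ f := by
  intro f hf
  rcases noncommutativeFamily_moment hb hf with rfl | rfl | ⟨Ξ, hΞ, S, hS, rfl⟩
  · exact isFirstIntegral_energy s κ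
  · exact isFirstIntegral_integralJ s κ
  · exact isFirstIntegral_gaugeMoment hm s (isGaugeRotation_rot hb hΞ hS)

/-- Moments bracket to moments of commutators, which are again skew; every bracket involving H or J
vanishes by invariance or antisymmetry. -/
theorem bracket_closed (hb : IsBlockField r κ κ₀) {m : ℝ} (hm : m ≠ 0) (s : ℝ) :
    ∀ f ∈ noncommutativeFamily m s κ r, ∀ g ∈ noncommutativeFamily m s κ r,
      ∃ h ∈ Algebra.adjoin ℝ (noncommutativeFamily m s κ r), ∀ x ∈ cotangentSphere n,
        diracBracket s κ f g x = h x := by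
  intro f hf g hg
  have hfi := isFirstIntegral_noncommutativeFamily hb hm s f hf
  have hgi := isFirstIntegral_noncommutativeFamily hb hm s g hg
  rcases noncommutativeFamily_moment hb hf with rfl | rfl | ⟨Ξ, hΞ, S, hS, rfl⟩
  · refine ⟨0, zero_mem _, fun x hx => ?_⟩
    rw [diracBracket_energy hm s hx, hgi.2 x hx, neg_zero]; rfl
  · refine ⟨0, zero_mem _, fun x hx => ?_⟩
    rw [diracBracket_antisymm]
    rcases noncommutativeFamily_moment hb hg with rfl | rfl | ⟨Ξ, hΞ, S, hS, rfl⟩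
    · rw [diracBracket_energy hm s hx, hfi.2 x hx, neg_zero, neg_zero]; rfl
    · have := diracBracket_antisymm s κ (integralJ m s κ) (integralJ m s κ) x
      rw [Pi.zero_apply]; linarith
    · have hρ := isGaugeRotation_rot hb hΞ hS
      rw [diracBracket_gaugeMoment s hρ hx, diff_integralJ_cotLift m s hρ, neg_zero, neg_zero]; rfl
  · have hρ := isGaugeRotation_rot hb hΞ hS
    rcases noncommutativeFamily_moment hb hg with rfl | rfl | ⟨Ξ', hΞ', S', hS', rfl⟩
    · refine ⟨0, zero_mem _, fun x hx => ?_⟩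
      rw [diracBracket_gaugeMoment s hρ hx, diff_energy_cotLift m hρ, neg_zero]; rfl
    · refine ⟨0, zero_mem _, fun x hx => ?_⟩
      rw [diracBracket_gaugeMoment s hρ hx, diff_integralJ_cotLift m s hρ, neg_zero]; rfl
    · refine ⟨-gaugeMoment s κ (rot hb.le (Ξ' * Ξ - Ξ * Ξ') (S' * S - S * S')),
        neg_mem (gaugeMoment_mem_adjoin hb m s ?_ ?_), fun x hx => ?_⟩
      · rw [Matrix.conjTranspose_sub, Matrix.conjTranspose_mul, Matrix.conjTranspose_mul, hΞ, hΞ']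
        noncomm_ring
      · rw [Matrix.transpose_sub, Matrix.transpose_mul, Matrix.transpose_mul, hS, hS']
        noncomm_ring
      · rw [diracBracket_gaugeMoment s hρ hx, diff_gaugeMoment_cotLift hb s hΞ hS hΞ' hS']; rfl

/-! ### The commuting family -/

/-- The partial sums of squares of the off-diagonal moments of the unitary algebra. -/
noncomputable def uCas (h : 2 * r ≤ n) (ε : ℝ) (S : Finset (Fin r)) (x : Ph n) : ℝ :=
  ∑ i ∈ S, ∑ j ∈ S, if i < j then Complex.normSq (umom h ε i j x) else 0

theorem sum_planes (hr : r ≤ n / 2) (F : Fin (n / 2) → ℝ) (hF : ∀ i, r ≤ i.1 → F i = 0) :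
    ∑ i, F i = ∑ i : Fin r, F ⟨i.1, by omega⟩ := by
  symm
  refine Finset.sum_of_injOn (fun i : Fin r => (⟨i.1, by omega⟩ : Fin (n / 2))) ?_ ?_ ?_ ?_
  · intro i _ j _ hij
    exact Fin.ext (Fin.mk.inj_iff.1 hij)
  · intro i _; simp
  · intro i _ hi
    apply hF
    by_contra hlt
    exact hi ⟨⟨i.1, by omega⟩, by simp, rfl⟩
  · intro i _; rfl

theorem unitaryCasimir_eq (hb : IsBlockField r κ κ₀) (s : ℝ) {k : ℕ} (hk : k ≤ r) (x : Ph n) :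
    unitaryCasimir s κ k x = uCas hb.le (s * κ₀) (below r k) x := by
  have hr := hb.lt
  rw [unitaryCasimir, sum_planes hr.le, uCas, below, Finset.sum_filter]
  · refine Finset.sum_congr rfl fun i _ => ?_
    rw [sum_planes hr.le, Finset.sum_filter]
    · by_cases hi : i.1 < k
      · rw [if_pos hi]
        refine Finset.sum_congr rfl fun j _ => ?_
        have e : (⟨i.1, by omega⟩ : Fin (n / 2)) < ⟨j.1, by omega⟩ ↔ i < j := Iff.rfl
        by_cases hj : j.1 < k
        · by_cases hij : i < j
          · rw [if_pos ⟨e.2 hij, hj⟩, if_pos hj, if_pos hij, Psi1_eq hb s _ _ i.2 j.2,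
              Psi2_eq hb s _ _ i.2 j.2, Complex.normSq_apply]
            ring
          · rw [if_neg (fun h => hij (e.1 h.1)), if_pos hj, if_neg hij]
        · rw [if_neg (fun h => hj h.2), if_neg hj]
      · rw [if_neg hi]
        refine Finset.sum_eq_zero fun j _ => if_neg fun h => hi ?_
        have h1 : i.1 < j.1 := h.1
        have h2 : j.1 < k := h.2
        omega
    · intro j hj
      refine if_neg fun h => ?_
      have := h.2
      omega
  · intro i hi
    refine Finset.sum_eq_zero fun j _ => if_neg fun h => ?_
    have h1 : i.1 < j.1 := h.1
    have h2 := h.2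
    omega

theorem orthogonalCasimir_eq (h : 2 * r ≤ n) (k : ℕ) (x : Ph n) :
    orthogonalCasimir r k x = casT h (below (n - 2 * r) (k + 2)) x := by
  rw [← sum_lt_sq_tmom, orthogonalCasimir, sum_block h, below, Finset.sum_filter]
  have h0 : ∀ (a : Fin n), a.1 < 2 * r → (∑ j : Fin n, if 2 * r ≤ a.1 ∧ a < j ∧ j.1 < 2 * r + 2 + k
      then angular a j x ^ 2 else 0) = 0 := fun a ha =>
    Finset.sum_eq_zero fun j _ => if_neg fun hh => by have := hh.1; omega
  rw [Finset.sum_eq_zero fun i _ => ?_, zero_add]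
  · refine Finset.sum_congr rfl fun i _ => ?_
    rw [sum_block h, Finset.sum_eq_zero fun j _ => ?_, zero_add, Finset.sum_filter]
    · have e : ∀ j : Fin (n - 2 * r), ((⟨2 * r + i.1, by omega⟩ : Fin n) < ⟨2 * r + j.1, by omega⟩
          ↔ i < j) := fun j => by rw [Fin.lt_def, Fin.lt_def]; simp
      by_cases hi : i.1 < k + 2
      · rw [if_pos hi]
        refine Finset.sum_congr rfl fun j _ => ?_
        by_cases hj : j.1 < k + 2
        · by_cases hij : i < j
          · rw [if_pos ⟨by simp, (e j).2 hij, by simp only; omega⟩, if_pos hj, if_pos hij]; rfl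
          · rw [if_neg (fun hh => hij ((e j).1 hh.2.1)), if_pos hj, if_neg hij]
        · rw [if_neg (fun hh => hj (by have := hh.2.2; simp only at this; omega)), if_neg hj]
      · rw [if_neg hi]
        refine Finset.sum_eq_zero fun j _ => if_neg fun hh => hi ?_
        have h1 : i.1 < j.1 := (e j).1 hh.2.1
        have h2 := hh.2.2
        simp only at h2
        omega
    · have h1 : ∀ (a : Fin n), a.1 < 2 * r → (if 2 * r ≤ 2 * r + i.1 ∧
          (⟨2 * r + i.1, by omega⟩ : Fin n) < a ∧ a.1 < 2 * r + 2 + k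
          then angular ⟨2 * r + i.1, by omega⟩ a x ^ 2 else 0) = 0 := fun a ha =>
        if_neg fun hh => by have := hh.2.1; rw [Fin.lt_def] at this; simp only at this; omega
      rw [h1 _ (by simp only; omega), h1 _ (by simp only; omega), add_zero]
  · rw [h0 _ (by simp only; omega), h0 _ (by simp only; omega), add_zero]

theorem uCas_eq_moments (hb : IsBlockField r κ κ₀) (s : ℝ) (S : Finset (Fin r)) :
    uCas hb.le (s * κ₀) S = fun x => ∑ i ∈ S, ∑ j ∈ S, (if i < j then (1 : ℝ) else 0) *
      (umoment hb s (-1) i j x ^ 2 + umoment hb s Complex.I i j x ^ 2) := by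
  funext x
  refine Finset.sum_congr rfl fun i _ => Finset.sum_congr rfl fun j _ => ?_
  rw [Complex.normSq_apply, umom_re hb, umom_im hb]
  split_ifs <;> ring

/-- The partial sums have two useful forms. As sums of squares of moments they commute with whatever
commutes with those moments; as a Casimir function minus squares of diagonal moments they show their
own invariance. -/
theorem uCas_eq_casU (hb : IsBlockField r κ κ₀) (s : ℝ) (S : Finset (Fin r)) :
    uCas hb.le (s * κ₀) S = fun x => casU hb.le (s * κ₀) S x -
      2 * ∑ i ∈ S, umoment hb s (Complex.I / 2) i i x ^ 2 := by
  funext x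
  rw [uCas, sum_lt_normSq_umom]
  simp only [umom_half_im hb]

theorem casT_eq_moments (hb : IsBlockField r κ κ₀) (s : ℝ) (S : Finset (Fin (n - 2 * r))) :
    casT hb.le S = fun x => ∑ i ∈ S, ∑ j ∈ S, (if i < j then (1 : ℝ) else 0) *
      tmoment hb s i j x ^ 2 := by
  funext x
  rw [← sum_lt_sq_tmom]
  refine Finset.sum_congr rfl fun i _ => Finset.sum_congr rfl fun j _ => ?_
  rw [tmoment, gaugeMoment_tgen hb]
  split_ifs <;> ring

theorem contDiff_umoment {k : WithTop ℕ∞} (hb : IsBlockField r κ κ₀) (s : ℝ) (c : ℂ)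
    (i j : Fin r) : ContDiff ℝ k (umoment hb s c i j) := contDiff_gaugeMoment s κ _

theorem contDiff_tmoment {k : WithTop ℕ∞} (hb : IsBlockField r κ κ₀) (s : ℝ)
    (i j : Fin (n - 2 * r)) : ContDiff ℝ k (tmoment hb s i j) := contDiff_gaugeMoment s κ _

theorem contDiff_uCas {k : WithTop ℕ∞} (hb : IsBlockField r κ κ₀) (s : ℝ) (S : Finset (Fin r)) :
    ContDiff ℝ k (uCas hb.le (s * κ₀) S) := by
  rw [uCas_eq_casU hb]
  exact (contDiff_casU hb.le _ S).sub (contDiff_const.mul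
    (ContDiff.sum fun i _ => (contDiff_umoment hb s _ i i).pow 2))

theorem diff_uCas (hb : IsBlockField r κ κ₀) (s : ℝ) (S : Finset (Fin r)) (x v : Ph n) :
    diff (uCas hb.le (s * κ₀) S) x v = diff (casU hb.le (s * κ₀) S) x v - 2 * ∑ i ∈ S,
      2 * umoment hb s (Complex.I / 2) i i x * diff (umoment hb s (Complex.I / 2) i i) x v := by
  have hd : ∀ i, DifferentiableAt ℝ (umoment hb s (Complex.I / 2) i i) x := fun i =>
    differentiableAt_of_contDiff (contDiff_umoment hb s _ i i) x
  have hs : DifferentiableAt ℝ (fun x => ∑ i ∈ S, umoment hb s (Complex.I / 2) i i x ^ 2) x :=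
    DifferentiableAt.fun_sum fun i _ => (hd i).fun_pow 2
  rw [uCas_eq_casU hb, diff_sub (differentiableAt_of_contDiff (contDiff_casU hb.le _ S) x)
    (hs.const_mul 2), diff_const_mul hs, diff_sum S (fun i _ => (hd i).fun_pow 2)]
  simp only [diff_sq (hd _)]

theorem diff_uCas_eq_zero (hb : IsBlockField r κ κ₀) (s : ℝ) (S : Finset (Fin r)) (x v : Ph n)
    (hv : ∀ c, ∀ i ∈ S, ∀ j ∈ S, diff (umoment hb s c i j) x v = 0) :
    diff (uCas hb.le (s * κ₀) S) x v = 0 := by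
  have hd : ∀ c i j, DifferentiableAt ℝ (umoment hb s c i j) x := fun c i j =>
    differentiableAt_of_contDiff (contDiff_umoment hb s c i j) x
  have h2 : ∀ i j, DifferentiableAt ℝ (fun x => umoment hb s (-1) i j x ^ 2
      + umoment hb s Complex.I i j x ^ 2) x := fun i j =>
    ((hd _ i j).fun_pow 2).fun_add ((hd _ i j).fun_pow 2)
  rw [uCas_eq_moments hb, diff_sum S fun i _ => DifferentiableAt.fun_sum fun j _ =>
    (h2 i j).const_mul _]
  refine Finset.sum_eq_zero fun i hi => ?_
  rw [diff_sum S fun j _ => (h2 i j).const_mul _]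
  refine Finset.sum_eq_zero fun j hj => ?_
  rw [diff_const_mul (h2 i j), diff_add ((hd _ i j).fun_pow 2) ((hd _ i j).fun_pow 2),
    diff_sq (hd _ i j), diff_sq (hd _ i j), hv _ i hi j hj, hv _ i hi j hj]
  ring

theorem diff_casT_eq_zero (hb : IsBlockField r κ κ₀) (s : ℝ) (S : Finset (Fin (n - 2 * r)))
    (x v : Ph n) (hv : ∀ i ∈ S, ∀ j ∈ S, diff (tmoment hb s i j) x v = 0) :
    diff (casT hb.le S) x v = 0 := by
  have hd : ∀ i j, DifferentiableAt ℝ (tmoment hb s i j) x := fun i j =>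
    differentiableAt_of_contDiff (contDiff_tmoment hb s i j) x
  rw [casT_eq_moments hb s, diff_sum S fun i _ => DifferentiableAt.fun_sum fun j _ =>
    ((hd i j).fun_pow 2).const_mul _]
  refine Finset.sum_eq_zero fun i hi => ?_
  rw [diff_sum S fun j _ => ((hd i j).fun_pow 2).const_mul _]
  refine Finset.sum_eq_zero fun j hj => ?_
  rw [diff_const_mul ((hd i j).fun_pow 2), diff_sq (hd i j), hv i hi j hj]
  ring

theorem diracBracket_eq_diff (s : ℝ) (κ : Fin (n / 2) → ℝ) (f g : Ph n → ℝ) {x : Ph n}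
    (hx : x ∈ cotangentSphere n) :
    diracBracket s κ f g x = -diff g x (diracHam s κ x (diff f x)) :=
  diracBivector_eq s κ hx _ _

theorem diff_diracHam (s : ℝ) (κ : Fin (n / 2) → ℝ) (f g : Ph n → ℝ) {x : Ph n}
    (hx : x ∈ cotangentSphere n) :
    diff g x (diracHam s κ x (diff f x)) = diracBracket s κ g f x := by
  rw [diracBracket_antisymm, diracBracket_eq_diff s κ f g hx, neg_neg]

/-- Enough is invariance of f under the unitary algebra of S: the Hamiltonian vector of f then
preserves every moment of that algebra, hence any sum of their squares. -/
theorem diracBracket_uCas (hb : IsBlockField r κ κ₀) (s : ℝ) (S : Finset (Fin r)) (f : Ph n → ℝ)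
    {x : Ph n} (hx : x ∈ cotangentSphere n)
    (hf : ∀ c, ∀ i ∈ S, ∀ j ∈ S, diff f x (cotLift (rot hb.le (ugen c i j) 0) x) = 0) :
    diracBracket s κ f (uCas hb.le (s * κ₀) S) x = 0 := by
  rw [diracBracket_eq_diff s κ _ _ hx, diff_uCas_eq_zero hb s S, neg_zero]
  intro c i hi j hj
  rw [diff_diracHam s κ _ _ hx, umoment, diracBracket_gaugeMoment s (isGauge_umoment hb c i j) hx,
    hf c i hi j hj, neg_zero]

theorem diracBracket_casT (hb : IsBlockField r κ κ₀) (s : ℝ) (S : Finset (Fin (n - 2 * r)))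
    (f : Ph n → ℝ) {x : Ph n} (hx : x ∈ cotangentSphere n)
    (hf : ∀ i ∈ S, ∀ j ∈ S, diff f x (cotLift (rot hb.le 0 (tgen i j)) x) = 0) :
    diracBracket s κ f (casT hb.le S) x = 0 := by
  rw [diracBracket_eq_diff s κ _ _ hx, diff_casT_eq_zero hb s S, neg_zero]
  intro i hi j hj
  rw [diff_diracHam s κ _ _ hx, tmoment, diracBracket_gaugeMoment s (isGauge_tmoment hb i j) hx,
    hf i hi j hj, neg_zero]

theorem gaugeMoment_rot_zero (h : 2 * r ≤ n) (s : ℝ) (x : Ph n) :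
    gaugeMoment s κ (rot h 0 0) x = 0 := by
  have e : ∀ y, rot h 0 0 y = 0 := fun y => block_ext h (by simp) (by simp)
  simp [gaugeMoment, e]

theorem ugen_diag_comm {m : ℕ} (c c' : ℂ) (i j : Fin m) :
    ugen c i i * ugen c' j j = ugen c' j j * ugen c i i := by
  have e : ∀ (c : ℂ) (i : Fin m), ugen c i i = Matrix.single i i (c - conj c) := fun c i => by
    ext a b
    simp only [ugen, Matrix.sub_apply, Matrix.single_apply]
    split_ifs <;> simp
  rw [e, e]
  by_cases hij : i = j
  · subst hij
    rw [Matrix.single_mul_single_same, Matrix.single_mul_single_same, mul_comm]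
  · rw [Matrix.single_mul_single_of_ne _ _ _ _ hij, Matrix.single_mul_single_of_ne _ _ _ _ (Ne.symm hij)]

/-- The rotations of a single coordinate plane form a one-dimensional algebra: each generator is
zero or plus or minus a fixed one. -/
theorem tgen_comm_of_two {q : ℕ} {o l i j a b : Fin q} (hi : i = o ∨ i = l) (hj : j = o ∨ j = l)
    (ha : a = o ∨ a = l) (hb : b = o ∨ b = l) : tgen i j * tgen a b = tgen a b * tgen i j := by
  have h2 : ∀ u v : Fin q, (u = o ∨ u = l) → (v = o ∨ v = l) →
      tgen u v = 0 ∨ tgen u v = tgen o l ∨ tgen u v = -tgen o l := by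
    rintro u v (rfl | rfl) (rfl | rfl) <;> simp [tgen]
  rcases h2 i j hi hj with h | h | h <;> rcases h2 a b ha hb with h' | h' | h' <;>
    rw [h, h'] <;> simp

theorem diff_umoment_diag (hb : IsBlockField r κ κ₀) (s : ℝ) (c c' : ℂ) (i j : Fin r) (x : Ph n) :
    diff (umoment hb s c' j j) x (cotLift (rot hb.le (ugen c i i) 0) x) = 0 := by
  rw [umoment, diff_gaugeMoment_cotLift hb s (ugen_conjTranspose _ _ _) zero_skew
    (ugen_conjTranspose _ _ _) zero_skew, ugen_diag_comm, sub_self, sub_self,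
    gaugeMoment_rot_zero]

theorem diff_umoment_tmoment (hb : IsBlockField r κ κ₀) (s : ℝ) (c : ℂ) (i j : Fin r)
    (a b : Fin (n - 2 * r)) (x : Ph n) :
    diff (umoment hb s c i j) x (cotLift (rot hb.le 0 (tgen a b)) x) = 0 := by
  rw [umoment, diff_gaugeMoment_cotLift hb s zero_antiherm (tgen_transpose _ _)
    (ugen_conjTranspose _ _ _) zero_skew]
  simp only [Matrix.mul_zero, Matrix.zero_mul, sub_self]
  exact gaugeMoment_rot_zero _ s x

theorem diff_tmoment_umoment (hb : IsBlockField r κ κ₀) (s : ℝ) (c : ℂ) (i j : Fin r)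
    (a b : Fin (n - 2 * r)) (x : Ph n) :
    diff (tmoment hb s a b) x (cotLift (rot hb.le (ugen c i j) 0) x) = 0 := by
  rw [tmoment, diff_gaugeMoment_cotLift hb s (ugen_conjTranspose _ _ _) zero_skew
    zero_antiherm (tgen_transpose _ _)]
  simp only [Matrix.mul_zero, Matrix.zero_mul, sub_self]
  exact gaugeMoment_rot_zero _ s x

/-- A diagonal generator leaves every coordinate subspace invariant; an off-diagonal one needs both
indices inside S. -/
theorem ugen_compat {m : ℕ} (c : ℂ) {i j : Fin m} {S : Finset (Fin m)} (h : i = j ∨ (i ∈ S ∧ j ∈ S)) :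
    ∀ a ∈ S, ∀ b ∉ S, ugen c i j a b = 0 := by
  intro a ha b hb
  simp only [ugen, Matrix.sub_apply, Matrix.single_apply]
  have h1 : ¬(i = a ∧ j = b) := by
    rintro ⟨rfl, rfl⟩
    rcases h with rfl | h
    · exact hb ha
    · exact hb h.2
  have h2 : ¬(j = a ∧ i = b) := by
    rintro ⟨rfl, rfl⟩
    rcases h with rfl | h
    · exact hb ha
    · exact hb h.1
  rw [if_neg h1, if_neg h2, sub_zero]

theorem tgen_compat {m : ℕ} {i j : Fin m} {S : Finset (Fin m)} (hi : i ∈ S) (hj : j ∈ S) :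
    ∀ a ∈ S, ∀ b ∉ S, tgen i j a b = 0 := by
  intro a ha b hb
  simp only [tgen, Matrix.sub_apply, Matrix.single_apply]
  have h1 : ¬(j = a ∧ i = b) := fun h => hb (h.2 ▸ hi)
  have h2 : ¬(i = a ∧ j = b) := fun h => hb (h.2 ▸ hj)
  rw [if_neg h1, if_neg h2, sub_zero]

theorem diff_uCas_diag (hb : IsBlockField r κ κ₀) (s : ℝ) (c : ℂ) (i : Fin r) (S : Finset (Fin r))
    (x : Ph n) :
    diff (uCas hb.le (s * κ₀) S) x (cotLift (rot hb.le (ugen c i i) 0) x) = 0 := by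
  rw [diff_uCas hb, diff_casU_cotLift hb.le _ (ugen_conjTranspose _ _ _) 0
    (ugen_compat c (Or.inl rfl))]
  simp only [diff_umoment_diag hb, mul_zero, Finset.sum_const_zero, sub_zero]

theorem diff_uCas_tmoment (hb : IsBlockField r κ κ₀) (s : ℝ) (a b : Fin (n - 2 * r))
    (S : Finset (Fin r)) (x : Ph n) :
    diff (uCas hb.le (s * κ₀) S) x (cotLift (rot hb.le 0 (tgen a b)) x) = 0 :=
  diff_uCas_eq_zero hb s S x _ fun c i _ j _ => diff_umoment_tmoment hb s c i j a b x

/-- The filtration argument. The Casimir function of the larger set T is invariant under the unitary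
algebra of S, hence commutes with the partial sum over S. The diagonal moments by which the partial
sum over T differs from that Casimir function act by diagonal rotations, which leave the partial sum
over S invariant. -/
theorem diracBracket_uCas_uCas (hb : IsBlockField r κ κ₀) (s : ℝ) {S T : Finset (Fin r)}
    (hST : S ⊆ T) {x : Ph n} (hx : x ∈ cotangentSphere n) :
    diracBracket s κ (uCas hb.le (s * κ₀) S) (uCas hb.le (s * κ₀) T) x = 0 := by
  have h1 : ∀ i, diff (umoment hb s (Complex.I / 2) i i) x
      (diracHam s κ x (diff (uCas hb.le (s * κ₀) S) x)) = 0 := by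
    intro i
    rw [diff_diracHam s κ _ _ hx, umoment,
      diracBracket_gaugeMoment s (isGauge_umoment hb _ i i) hx, diff_uCas_diag hb s, neg_zero]
  have h2 : diff (casU hb.le (s * κ₀) T) x (diracHam s κ x (diff (uCas hb.le (s * κ₀) S) x)) = 0 := by
    rw [diff_diracHam s κ _ _ hx]
    refine diracBracket_uCas hb s S _ hx fun c i hi j hj => ?_
    exact diff_casU_cotLift hb.le _ (ugen_conjTranspose _ _ _) 0
      (ugen_compat c (Or.inr ⟨hST hi, hST hj⟩)) x
  rw [diracBracket_eq_diff s κ _ _ hx, diff_uCas hb, h2]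
  simp only [h1, mul_zero, Finset.sum_const_zero, sub_zero, neg_zero]

theorem diracBracket_casT_casT (hb : IsBlockField r κ κ₀) (s : ℝ) {S T : Finset (Fin (n - 2 * r))}
    (hST : S ⊆ T) {x : Ph n} (hx : x ∈ cotangentSphere n) :
    diracBracket s κ (casT hb.le S) (casT hb.le T) x = 0 := by
  rw [diracBracket_antisymm, diracBracket_casT hb s S _ hx, neg_zero]
  intro i hi j hj
  exact diff_casT_cotLift hb.le 0 (tgen_transpose i j) (tgen_compat (hST hi) (hST hj)) x

theorem below_mono {m k l : ℕ} (h : k ≤ l) : below m k ⊆ below m l := fun i hi => by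
  rw [mem_below] at *; omega

/-- The members of the commuting family, in block coordinates. -/
theorem filtrationFamily_cases (hb : IsBlockField r κ κ₀) {m s : ℝ} {f : Ph n → ℝ}
    (hf : f ∈ insert (angular (od ⟨r, hb.lt⟩) (ev ⟨r, hb.lt⟩)) (filtrationFamily m s κ r)) :
    f = energy m ∨ f = integralJ m s κ ∨ (∃ i, f = umoment hb s (Complex.I / 2) i i) ∨
      (∃ i j : Fin (n - 2 * r), i.1 < 2 ∧ j.1 < 2 ∧ f = tmoment hb s i j) ∨
      (∃ k ≤ r, f = uCas hb.le (s * κ₀) (below r k)) ∨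
      ∃ k ≥ 2, f = casT hb.le (below (n - 2 * r) k) := by
  have hr := hb.lt
  rcases hf with h | (((h | h) | ⟨k, hk, rfl⟩) | ⟨k, hk, hkr, rfl⟩) | ⟨k, hk, hkn, rfl⟩
  · refine Or.inr (Or.inr (Or.inr (Or.inl ⟨⟨0, by omega⟩, ⟨1, by omega⟩, by simp, by simp, ?_⟩)))
    rw [h]
    funext x
    rw [tmoment, gaugeMoment_tgen hb, angular_eq hb.le _ _ (by simp [od]) (by simp [ev])]
    congr 1
    · exact Fin.ext (by simp [od])
    · exact Fin.ext (by simp [ev])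
  · exact Or.inl h
  · exact Or.inr (Or.inl h)
  · exact Or.inr (Or.inr (Or.inl ⟨⟨k.1, hk⟩, funext fun x => by
      rw [Phi_eq hb s k hk, umom_half_im hb]⟩))
  · exact Or.inr (Or.inr (Or.inr (Or.inr (Or.inl ⟨k, hkr, funext fun x =>
      unitaryCasimir_eq hb s hkr x⟩))))
  · exact Or.inr (Or.inr (Or.inr (Or.inr (Or.inr ⟨k + 2, by omega, funext fun x =>
      orthogonalCasimir_eq hb.le k x⟩))))

theorem isFirstIntegral_filtrationFamily (hb : IsBlockField r κ κ₀) {m : ℝ} (hm : m ≠ 0) (s : ℝ) :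
    ∀ f ∈ insert (angular (od ⟨r, hb.lt⟩) (ev ⟨r, hb.lt⟩)) (filtrationFamily m s κ r),
      IsFirstIntegral m s κ f := by
  intro f hf
  rcases filtrationFamily_cases hb hf with rfl | rfl | ⟨i, rfl⟩ | ⟨i, j, _, _, rfl⟩ | ⟨k, _, rfl⟩ |
    ⟨k, _, rfl⟩
  · exact isFirstIntegral_energy s κ
  · exact isFirstIntegral_integralJ s κ
  · exact isFirstIntegral_gaugeMoment hm s (isGauge_umoment hb _ i i)
  · exact isFirstIntegral_gaugeMoment hm s (isGauge_tmoment hb i j)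
  · exact ⟨contDiff_uCas hb s _, fun x hx => diff_uCas_eq_zero hb s _ x _ fun c i _ j _ =>
      (isFirstIntegral_gaugeMoment hm s (isGauge_umoment hb c i j)).2 x hx⟩
  · exact ⟨contDiff_casT hb.le _, fun x hx => diff_casT_eq_zero hb s _ x _ fun i _ j _ =>
      (isFirstIntegral_gaugeMoment hm s (isGauge_tmoment hb i j)).2 x hx⟩

theorem commute_filtrationFamily (hb : IsBlockField r κ κ₀) {m : ℝ} (hm : m ≠ 0) (s : ℝ) :
    ∀ f ∈ insert (angular (od ⟨r, hb.lt⟩) (ev ⟨r, hb.lt⟩)) (filtrationFamily m s κ r),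
    ∀ g ∈ insert (angular (od ⟨r, hb.lt⟩) (ev ⟨r, hb.lt⟩)) (filtrationFamily m s κ r),
    ∀ x ∈ cotangentSphere n, diracBracket s κ f g x = 0 := by
  intro f hf g hg x hx
  have hE : ∀ g ∈ insert (angular (od ⟨r, hb.lt⟩) (ev ⟨r, hb.lt⟩)) (filtrationFamily m s κ r),
      diracBracket s κ (energy m) g x = 0 := fun g hg => by
    rw [diracBracket_energy hm s hx, (isFirstIntegral_filtrationFamily hb hm s g hg).2 x hx,
      neg_zero]
  have hJ : ∀ g ∈ insert (angular (od ⟨r, hb.lt⟩) (ev ⟨r, hb.lt⟩)) (filtrationFamily m s κ r),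
      diracBracket s κ (integralJ m s κ) g x = 0 := by
    intro g hg
    rcases filtrationFamily_cases hb hg with rfl | rfl | ⟨i, rfl⟩ | ⟨i, j, _, _, rfl⟩ |
      ⟨k, _, rfl⟩ | ⟨k, _, rfl⟩
    · rw [diracBracket_antisymm, diracBracket_energy hm s hx,
        (isFirstIntegral_integralJ s κ).2 x hx, neg_zero, neg_zero]
    · have := diracBracket_antisymm s κ (integralJ m s κ) (integralJ m s κ) x
      linarith
    · rw [diracBracket_antisymm, umoment, diracBracket_gaugeMoment s (isGauge_umoment hb _ i i) hx,
        diff_integralJ_cotLift m s (isGauge_umoment hb _ i i), neg_zero, neg_zero]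
    · rw [diracBracket_antisymm, tmoment, diracBracket_gaugeMoment s (isGauge_tmoment hb i j) hx,
        diff_integralJ_cotLift m s (isGauge_tmoment hb i j), neg_zero, neg_zero]
    · exact diracBracket_uCas hb s _ _ hx fun c i _ j _ =>
        diff_integralJ_cotLift m s (isGauge_umoment hb c i j) x
    · exact diracBracket_casT hb s _ _ hx fun i _ j _ =>
        diff_integralJ_cotLift m s (isGauge_tmoment hb i j) x
  have hU : ∀ i, ∀ g ∈ insert (angular (od ⟨r, hb.lt⟩) (ev ⟨r, hb.lt⟩)) (filtrationFamily m s κ r),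
      diracBracket s κ (umoment hb s (Complex.I / 2) i i) g x = 0 := by
    intro a g hg
    rw [umoment, diracBracket_gaugeMoment s (isGauge_umoment hb _ a a) hx, neg_eq_zero]
    rcases filtrationFamily_cases hb hg with rfl | rfl | ⟨i, rfl⟩ | ⟨i, j, _, _, rfl⟩ |
      ⟨k, _, rfl⟩ | ⟨k, _, rfl⟩
    · exact diff_energy_cotLift m (isGauge_umoment hb _ a a) x
    · exact diff_integralJ_cotLift m s (isGauge_umoment hb _ a a) x
    · exact diff_umoment_diag hb s _ _ a i x
    · exact diff_tmoment_umoment hb s _ a a i j x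
    · exact diff_uCas_diag hb s _ a _ x
    · exact diff_casT_cotLift hb.le _ zero_skew (fun _ _ _ _ => rfl) x
  have hT : ∀ i j : Fin (n - 2 * r), i.1 < 2 → j.1 < 2 → ∀ g ∈
      insert (angular (od ⟨r, hb.lt⟩) (ev ⟨r, hb.lt⟩)) (filtrationFamily m s κ r),
      diracBracket s κ (tmoment hb s i j) g x = 0 := by
    intro a b ha hb' g hg
    rw [tmoment, diracBracket_gaugeMoment s (isGauge_tmoment hb a b) hx, neg_eq_zero]
    rcases filtrationFamily_cases hb hg with rfl | rfl | ⟨i, rfl⟩ | ⟨i, j, hi, hj, rfl⟩ |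
      ⟨k, _, rfl⟩ | ⟨k, hk, rfl⟩
    · exact diff_energy_cotLift m (isGauge_tmoment hb a b) x
    · exact diff_integralJ_cotLift m s (isGauge_tmoment hb a b) x
    · exact diff_umoment_tmoment hb s _ i i a b x
    · rw [tmoment, diff_gaugeMoment_cotLift hb s zero_antiherm (tgen_transpose _ _)
        zero_antiherm (tgen_transpose _ _)]
      have h2 : ∀ u : Fin (n - 2 * r), u.1 < 2 →
          u = ⟨0, Nat.zero_lt_of_lt a.2⟩ ∨ u = ⟨1, by have := hb.lt; omega⟩ := by
        intro u hu
        rcases Nat.lt_succ_iff_lt_or_eq.1 hu with h | h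
        · exact Or.inl (Fin.ext (by simp only; omega))
        · exact Or.inr (Fin.ext h)
      have hc := tgen_comm_of_two (h2 i hi) (h2 j hj) (h2 a ha) (h2 b hb')
      rw [hc, sub_self, sub_self]
      exact gaugeMoment_rot_zero _ s x
    · exact diff_uCas_tmoment hb s a b _ x
    -- The bound k ≥ 2 places both indices of the first plane inside the block, so that the rotation
    -- of that plane preserves its Casimir function.
    · exact diff_casT_cotLift hb.le _ (tgen_transpose a b) (tgen_compat
        (by rw [mem_below]; omega) (by rw [mem_below]; omega)) x
  have hUT : ∀ S T, diracBracket s κ (uCas hb.le (s * κ₀) S) (casT hb.le T) x = 0 := fun S T =>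
    diracBracket_casT hb s T _ hx fun i _ j _ => diff_uCas_tmoment hb s i j S x
  rcases filtrationFamily_cases hb hf with rfl | rfl | ⟨i, rfl⟩ | ⟨i, j, hi, hj, rfl⟩ |
      ⟨k, _, hk⟩ | ⟨k, _, hk⟩
  · exact hE g hg
  · exact hJ g hg
  · exact hU i g hg
  · exact hT i j hi hj g hg
  · rcases filtrationFamily_cases hb hg with rfl | rfl | ⟨i, rfl⟩ | ⟨i, j, hi, hj, rfl⟩ |
      ⟨l, _, rfl⟩ | ⟨l, _, rfl⟩
    · rw [diracBracket_antisymm, hE f hf, neg_zero]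
    · rw [diracBracket_antisymm, hJ f hf, neg_zero]
    · rw [diracBracket_antisymm, hU i f hf, neg_zero]
    · rw [diracBracket_antisymm, hT i j hi hj f hf, neg_zero]
    · subst hk
      rcases le_total k l with h | h
      · exact diracBracket_uCas_uCas hb s (below_mono h) hx
      · rw [diracBracket_antisymm, diracBracket_uCas_uCas hb s (below_mono h) hx, neg_zero]
    · subst hk
      exact hUT _ _
  · rcases filtrationFamily_cases hb hg with rfl | rfl | ⟨i, rfl⟩ | ⟨i, j, hi, hj, rfl⟩ |
      ⟨l, _, rfl⟩ | ⟨l, _, rfl⟩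
    · rw [diracBracket_antisymm, hE f hf, neg_zero]
    · rw [diracBracket_antisymm, hJ f hf, neg_zero]
    · rw [diracBracket_antisymm, hU i f hf, neg_zero]
    · rw [diracBracket_antisymm, hT i j hi hj f hf, neg_zero]
    · subst hk
      rw [diracBracket_antisymm, hUT, neg_zero]
    · subst hk
      rcases le_total k l with h | h
      · exact diracBracket_casT_casT hb s (below_mono h) hx
      · rw [diracBracket_antisymm, diracBracket_casT_casT hb s (below_mono h) hx, neg_zero]

/-! ### Constraints, energy and J in block coordinates -/

section
variable (h : 2 * r ≤ n) (ε : ℝ)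

theorem dot_fst_fst (x : Ph n) : x.1 ⬝ᵥ x.1 = zz h Finset.univ x + gg h Finset.univ x :=
  dot_block h x.1 x.1

theorem cz_snd (x : Ph n) : cz h x.2 = momZ h ε x - (Complex.I * (ε / 2)) • posZ h x := by
  funext i
  simp only [momZ_apply, posZ_apply, cv, Pi.sub_apply, Pi.smul_apply, smul_eq_mul]; ring

theorem dot_snd_fst (x : Ph n) : x.2 ⬝ᵥ x.1 = zv h ε Finset.univ x + gh h Finset.univ x := by
  rw [dotProduct_comm, dot_block h, zv, gh]
  congr 1
  change (herm Finset.univ (posZ h x) (cz h x.2)).re = (herm Finset.univ (posZ h x) (momZ h ε x)).re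
  rw [cz_snd h ε, herm_sub_right, herm_smul_right, herm_self]
  simp [Complex.mul_re, Complex.mul_im]

/-- The complex part of `⟨p, p⟩`. -/
noncomputable def ww (S : Finset (Fin r)) (x : Ph n) : ℝ :=
  vv h ε S x - ε * zvIm h ε S x + ε ^ 2 / 4 * zz h S x

theorem herm_cz_snd (x : Ph n) (S : Finset (Fin r)) :
    (herm S (cz h x.2) (cz h x.2)).re = ww h ε S x := by
  have h1 : (herm S (momZ h ε x) (posZ h x)).im = -zvIm h ε S x := by
    rw [← conj_herm]; rfl
  have h2 : (herm S (momZ h ε x) (posZ h x)).re = zv h ε S x := by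
    rw [← conj_herm]; rfl
  have h3 : (herm S (posZ h x) (momZ h ε x)).im = zvIm h ε S x := rfl
  have h4 : (herm S (posZ h x) (momZ h ε x)).re = zv h ε S x := rfl
  rw [cz_snd h ε, herm_sub_left, herm_sub_right, herm_sub_right, herm_smul_left, herm_smul_right,
    herm_smul_left, herm_smul_right, herm_self S (posZ h x)]
  simp only [Complex.sub_re, Complex.mul_re, Complex.mul_im, Complex.I_re, Complex.I_im, h1, h2,
    h3, h4, map_mul, Complex.conj_I, map_div₀, Complex.conj_ofReal, map_ofNat,
    Complex.ofReal_re, Complex.ofReal_im, Complex.div_ofNat_re, Complex.div_ofNat_im, Complex.neg_re,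
    Complex.neg_im, ww]
  change vv h ε S x - _ - _ = _
  rw [zz]
  simp only [Complex.reLm_coe]
  ring

theorem dot_snd_snd (x : Ph n) : x.2 ⬝ᵥ x.2 = ww h ε Finset.univ x + hh h Finset.univ x := by
  rw [dot_block h, ← herm_cz_snd]; rfl

end

theorem energy_eq (h : 2 * r ≤ n) (ε m : ℝ) (x : Ph n) :
    energy m x = 1 / (2 * m) * (ww h ε Finset.univ x + hh h Finset.univ x) := by
  rw [energy, dot_snd_snd h ε]

theorem dot_field_block (hb : IsBlockField r κ κ₀) (s : ℝ) (x : Ph n) :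
    s * (x.2 ⬝ᵥ (fieldMatrix κ *ᵥ x.1)) = -(s * κ₀) * (zvIm hb.le (s * κ₀) Finset.univ x
      - s * κ₀ / 2 * zz hb.le Finset.univ x) := by
  have e : cz hb.le (fieldMatrix κ *ᵥ x.1) = (-(Complex.I * κ₀)) • cz hb.le x.1 :=
    funext fun i => by rw [hb.cz_mulVec]; rfl
  rw [dot_block hb.le, hb.ct_mulVec]
  simp only [Pi.zero_apply, mul_zero, Finset.sum_const_zero, add_zero]
  change s * (herm Finset.univ (cz hb.le x.2) (cz hb.le (fieldMatrix κ *ᵥ x.1))).re = _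
  rw [e, herm_smul_right, ← conj_herm, cz_snd hb.le (s * κ₀), herm_sub_right, herm_smul_right,
    ← posZ_apply, herm_self _ (posZ hb.le x)]
  simp only [Complex.mul_re, Complex.neg_re, Complex.neg_im, Complex.mul_im, Complex.I_re,
    Complex.I_im, Complex.ofReal_re, Complex.ofReal_im, Complex.conj_re, Complex.conj_im,
    Complex.sub_re, Complex.sub_im, Complex.div_ofNat_re, Complex.div_ofNat_im, Complex.ofReal_mul]
  rw [zvIm, zz]
  simp only [Complex.reLm_coe, Complex.imLm_coe]
  ring

theorem multiplier_eq (hb : IsBlockField r κ κ₀) (m s : ℝ) (x : Ph n) :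
    multiplier m s κ x = (-(s * κ₀) * (zvIm hb.le (s * κ₀) Finset.univ x
      - s * κ₀ / 2 * zz hb.le Finset.univ x) -
      (ww hb.le (s * κ₀) Finset.univ x + hh hb.le Finset.univ x)) / m := by
  rw [multiplier, dot_field_block hb, dot_snd_snd hb.le (s * κ₀)]

theorem integralJ_block (hb : IsBlockField r κ κ₀) (m s : ℝ) (x : Ph n) :
    integralJ m s κ x = (s * κ₀) ^ 2 / m ^ 2 * ww hb.le (s * κ₀) Finset.univ x
      - multiplier m s κ x ^ 2 := by
  have e : cz hb.le (fieldMatrix κ *ᵥ x.2) = (-(Complex.I * κ₀)) • cz hb.le x.2 :=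
    funext fun i => by rw [hb.cz_mulVec]; rfl
  rw [integralJ_eq, dot_block hb.le, hb.ct_mulVec]
  simp only [Pi.zero_apply, mul_zero, Finset.sum_const_zero, add_zero]
  change s ^ 2 / m ^ 2 * (herm Finset.univ (cz hb.le (fieldMatrix κ *ᵥ x.2))
    (cz hb.le (fieldMatrix κ *ᵥ x.2))).re - _ = _
  rw [e, herm_smul_left, herm_smul_right, ← herm_cz_snd, herm_self _ (cz hb.le x.2)]
  simp only [map_neg, map_mul, Complex.conj_I, Complex.conj_ofReal]
  simp only [Complex.mul_re, Complex.neg_re, Complex.neg_im, Complex.mul_im, Complex.I_re,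
    Complex.I_im, Complex.ofReal_re, Complex.ofReal_im]
  ring

/-- The integral `J` is a function of the other integrals on the phase space. -/
theorem integralJ_relation (hb : IsBlockField r κ κ₀) {m : ℝ} (hm : m ≠ 0) (s : ℝ) (x : Ph n) :
    m ^ 2 * integralJ m s κ x = (s * κ₀) ^ 2 * (casU hb.le (s * κ₀) Finset.univ x
        - zvIm hb.le (s * κ₀) Finset.univ x ^ 2 - casT hb.le Finset.univ x)
      + (s * κ₀) ^ 2 * (2 * m * energy m x)
      - (2 * m * energy m x + s * κ₀ * zvIm hb.le (s * κ₀) Finset.univ x) ^ 2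
      + (s * κ₀) ^ 2 * (hh hb.le Finset.univ x * (phi1 x - 1)
        + phi2 x * (zv hb.le (s * κ₀) Finset.univ x - gh hb.le Finset.univ x)) := by
  -- The constraints are not assumed. The last summand of the identity records how far they fail and
  -- vanishes on the phase space; this makes the relation valid on all of ℝ²ⁿ, where it can be
  -- differentiated.
  have h1 : phi1 x = zz hb.le Finset.univ x + gg hb.le Finset.univ x := dot_fst_fst hb.le x
  have h2 : phi2 x = zv hb.le (s * κ₀) Finset.univ x + gh hb.le Finset.univ x :=
    dot_snd_fst hb.le _ x
  rw [integralJ_block hb, multiplier_eq hb, energy_eq hb.le (s * κ₀), h1, h2, casU, casT, ww]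
  field_simp
  ring

/-! ### The generic conditions -/

/-- The set that consists of the `j`-th index. -/
def only (m j : ℕ) : Finset (Fin m) := Finset.univ.filter fun i => i.1 = j

theorem only_eq {m j : ℕ} (hj : j < m) : only m j = {⟨j, hj⟩} := by
  ext i; simp [only, Fin.ext_iff]

/-- The functions that are required not to vanish at a generic point. -/
noncomputable def genericFunction (h : 2 * r ≤ n) (ε : ℝ) :
    (Fin r ⊕ Fin (r - 1)) ⊕ Fin (n - 2 * r - 1) ⊕ Fin 6 → Ph n → ℝ
  | Sum.inl (Sum.inl i), x => zvIm h ε {i} x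
  | Sum.inl (Sum.inr k), x => zv h ε (below r (k.1 + 1)) x * zz h (only r (k.1 + 1)) x
      - zz h (below r (k.1 + 1)) x * zv h ε (only r (k.1 + 1)) x
  | Sum.inr (Sum.inl k), x => gh h (below (n - 2 * r) (k.1 + 1)) x
        * gg h (only (n - 2 * r) (k.1 + 1)) x
      - gg h (below (n - 2 * r) (k.1 + 1)) x * gh h (only (n - 2 * r) (k.1 + 1)) x
  | Sum.inr (Sum.inr i), x => ![zv h ε Finset.univ x, zz h (only r 0) x,
      gg h (only (n - 2 * r) 0) x, casT h Finset.univ x, zvIm h ε Finset.univ x,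
      if r = 1 then 1 else zz h Finset.univ x * vv h ε Finset.univ x - zv h ε Finset.univ x ^ 2
        - zvIm h ε Finset.univ x ^ 2] i

theorem contDiff_genericFunction {k : WithTop ℕ∞} (h : 2 * r ≤ n) (ε : ℝ)
    (i : (Fin r ⊕ Fin (r - 1)) ⊕ Fin (n - 2 * r - 1) ⊕ Fin 6) :
    ContDiff ℝ k (genericFunction h ε i) := by
  rcases i with (i | j) | j | i
  · exact contDiff_zvIm h ε _
  · exact ((contDiff_zv h ε _).mul (contDiff_zz h _)).sub
      ((contDiff_zz h _).mul (contDiff_zv h ε _))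
  · exact ((contDiff_gh h _).mul (contDiff_gg h _)).sub
      ((contDiff_gg h _).mul (contDiff_gh h _))
  · fin_cases i
    · exact contDiff_zv h ε _
    · exact contDiff_zz h _
    · exact contDiff_gg h (only (n - 2 * r) 0)
    · exact contDiff_casT h _
    · exact contDiff_zvIm h ε _
    · change ContDiff ℝ k fun x => if r = 1 then (1 : ℝ) else _
      split_ifs
      · exact contDiff_const
      · exact (((contDiff_zz h _).mul (contDiff_vv h ε _)).sub ((contDiff_zv h ε _).pow 2)).sub
          ((contDiff_zvIm h ε _).pow 2)

theorem herm_neg_neg {ι : Type*} (S : Finset ι) (u w : ι → ℂ) : herm S (-u) (-w) = herm S u w := by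
  simp [herm]

theorem genericFunction_neg (h : 2 * r ≤ n) (ε : ℝ)
    (i : (Fin r ⊕ Fin (r - 1)) ⊕ Fin (n - 2 * r - 1) ⊕ Fin 6) (x : Ph n) :
    genericFunction h ε i (-x) = genericFunction h ε i x := by
  have e1 : ∀ S, zz h S (-x) = zz h S x := fun S => by simp only [zz, map_neg, herm_neg_neg]
  have e2 : ∀ S, vv h ε S (-x) = vv h ε S x := fun S => by simp only [vv, map_neg, herm_neg_neg]
  have e3 : ∀ S, zv h ε S (-x) = zv h ε S x := fun S => by simp only [zv, map_neg, herm_neg_neg]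
  have e4 : ∀ S, zvIm h ε S (-x) = zvIm h ε S x := fun S => by
    simp only [zvIm, map_neg, herm_neg_neg]
  have e5 : ∀ S, gg h S (-x) = gg h S x := fun S => by simp [gg]
  have e6 : ∀ S, hh h S (-x) = hh h S x := fun S => by simp [hh]
  have e7 : ∀ S, gh h S (-x) = gh h S x := fun S => by simp [gh]
  rcases i with (i | j) | j | i <;>
    simp only [genericFunction, casT, e1, e2, e3, e4, e5, e6, e7]

/-- Lagrange's identity over the complex numbers. -/
theorem sum_normSq_minor {ι : Type*} (S : Finset ι) (z v : ι → ℂ) :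
    ∑ i ∈ S, ∑ j ∈ S, Complex.normSq (z i * v j - v i * z j)
      = 2 * ((herm S z z).re * (herm S v v).re - (herm S z v).re ^ 2 - (herm S z v).im ^ 2) := by
  have h : ∀ i j, Complex.normSq (z i * v j - v i * z j)
      = Complex.normSq (z i) * Complex.normSq (v j) + Complex.normSq (v i) * Complex.normSq (z j)
        - 2 * ((conj (z i) * v i) * conj (conj (z j) * v j)).re := by
    intro i j
    simp only [Complex.normSq_apply, Complex.mul_re, Complex.mul_im, Complex.sub_re,
      Complex.sub_im, Complex.conj_re, Complex.conj_im]
    ring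
  have h2 : ∑ i ∈ S, ∑ j ∈ S, ((conj (z i) * v i) * conj (conj (z j) * v j)).re
      = (herm S z v * conj (herm S z v)).re := by
    simp only [herm, map_sum, Finset.sum_mul_sum, Complex.re_sum]
  simp only [h, Finset.sum_sub_distrib, Finset.sum_add_distrib, ← Finset.mul_sum, h2]
  simp only [← Finset.sum_mul, ← Finset.mul_sum, herm_self_re, Complex.mul_re, Complex.conj_re,
    Complex.conj_im]
  ring

/-- A point of the phase space at which none of the generic functions vanishes. -/
noncomputable def witness (n : ℕ) (ε : ℝ) : Ph n :=
  (fun _ => (Real.sqrt n)⁻¹, fun a => ε * (a.1 - (n - 1) / 2))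

theorem witness_mem {n : ℕ} (hn : 0 < n) (ε : ℝ) : witness n ε ∈ cotangentSphere n := by
  have hn' : (0 : ℝ) < n := by exact_mod_cast hn
  refine ⟨?_, ?_⟩
  · simp only [witness, dotProduct, Finset.sum_const, Finset.card_univ, Fintype.card_fin,
      nsmul_eq_mul]
    rw [← mul_inv, Real.mul_self_sqrt hn'.le]
    exact mul_inv_cancel₀ hn'.ne'
  · simp only [witness, dotProduct, ← Finset.sum_mul, ← Finset.mul_sum]
    have : ∑ i : Fin n, ((i.1 : ℝ) - (n - 1) / 2) = 0 := by
      rw [Finset.sum_sub_distrib, Fin.sum_univ_eq_sum_range (fun i => (i : ℝ)) n]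
      have h2 := Finset.sum_range_id_mul_two n
      have h3 : (∑ i ∈ Finset.range n, (i : ℝ)) * 2 = n * (n - 1) := by
        have := congrArg (Nat.cast (R := ℝ)) h2
        push_cast [Nat.cast_sub (show 1 ≤ n from hn)] at this
        exact this
      simp only [Finset.sum_const, Finset.card_univ, Fintype.card_fin, nsmul_eq_mul]
      linarith
    rw [this]; ring

/-- At the witness all positions equal 1/√n and the momenta are an arithmetic progression with mean
zero. The mixed expressions become ε times sums of i - (k + 1) over i ≤ k, negative termwise. The
total radial momentum is proportional to r(2r - n), nonzero because 2r < n. Casimir and minor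
expressions are positive because one minor is visibly nonzero. -/
theorem genericFunction_witness (h : 2 * r + 2 ≤ n) (hr : 1 ≤ r) {ε : ℝ} (hε : ε ≠ 0)
    (i : (Fin r ⊕ Fin (r - 1)) ⊕ Fin (n - 2 * r - 1) ⊕ Fin 6) :
    genericFunction (by omega : 2 * r ≤ n) ε i (witness n ε) ≠ 0 := by
  have hle : 2 * r ≤ n := by omega
  have hn' : (0 : ℝ) < n := by exact_mod_cast (by omega : 0 < n)
  set t : ℝ := (Real.sqrt n)⁻¹ with ht
  have htpos : 0 < t := inv_pos.2 (Real.sqrt_pos.2 hn')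
  have hz : ∀ i, posZ hle (witness n ε) i = ⟨t, t⟩ := fun i => rfl
  have hv : ∀ i : Fin r, momZ hle ε (witness n ε) i =
      ⟨ε * (2 * i.1 - (n - 1) / 2 - t / 2), ε * (2 * i.1 + 1 - (n - 1) / 2 + t / 2)⟩ := by
    intro i
    have e : momZ hle ε (witness n ε) i = ⟨ε * (((2 * i.1 : ℕ) : ℝ) - (n - 1) / 2),
        ε * (((2 * i.1 + 1 : ℕ) : ℝ) - (n - 1) / 2)⟩ + Complex.I * (ε / 2) * ⟨t, t⟩ := rfl
    rw [e]
    apply Complex.ext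
    · simp [Complex.mul_re, Complex.mul_im]; ring
    · simp [Complex.mul_re, Complex.mul_im]; ring
  have hg : ∀ j, posT hle (witness n ε) j = t := fun j => rfl
  have hp : ∀ j : Fin (n - 2 * r), momT hle (witness n ε) j
      = ε * (2 * r + j.1 - (n - 1) / 2) := by
    intro j
    have e : momT hle (witness n ε) j = ε * (((2 * r + j.1 : ℕ) : ℝ) - (n - 1) / 2) := rfl
    rw [e]; push_cast; ring
  have hzz : ∀ S, zz hle S (witness n ε) = ∑ i ∈ S, 2 * t ^ 2 := by
    intro S
    rw [zz, Complex.reLm_coe, herm_self_re]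
    refine Finset.sum_congr rfl fun i _ => ?_
    rw [hz, Complex.normSq_mk]; ring
  have hzv : ∀ S, zv hle ε S (witness n ε) =
      ∑ i ∈ S, t * ε * (4 * i.1 + 1 - (n - 1)) := by
    intro S
    rw [zv, Complex.reLm_coe, herm, Complex.re_sum]
    refine Finset.sum_congr rfl fun i _ => ?_
    rw [hz, hv, Complex.mul_re, Complex.conj_re, Complex.conj_im]; ring
  have hzvIm : ∀ S, zvIm hle ε S (witness n ε) = ∑ i ∈ S, ε * (t + t ^ 2) := by
    intro S
    rw [zvIm, Complex.imLm_coe, herm, Complex.im_sum]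
    refine Finset.sum_congr rfl fun i _ => ?_
    rw [hz, hv, Complex.mul_im, Complex.conj_re, Complex.conj_im]; ring
  have hgg : ∀ S, gg hle S (witness n ε) = ∑ i ∈ S, t ^ 2 := by
    intro S
    refine Finset.sum_congr rfl fun i _ => ?_
    rw [hg]; ring
  have hgh : ∀ S, gh hle S (witness n ε) = ∑ j ∈ S, t * ε * (2 * r + j.1 - (n - 1) / 2) := by
    intro S
    refine Finset.sum_congr rfl fun j _ => ?_
    rw [hg, hp]; ring
  rcases i with (i | k) | k | i
  · change zvIm hle ε {i} (witness n ε) ≠ 0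
    rw [hzvIm, Finset.sum_singleton]
    positivity
  · change zv hle ε _ (witness n ε) * zz hle _ (witness n ε) -
      zz hle _ (witness n ε) * zv hle ε _ (witness n ε) ≠ 0
    have hk : k.1 + 1 < r := by omega
    rw [hzv, hzv, hzz, hzz, only_eq hk, Finset.sum_singleton, Finset.sum_singleton,
      Finset.sum_mul, Finset.sum_mul, ← Finset.sum_sub_distrib]
    have e : ∑ i ∈ below r (k.1 + 1), (t * ε * (4 * i.1 + 1 - (n - 1)) * (2 * t ^ 2)
        - 2 * t ^ 2 * (t * ε * (4 * ((k.1 + 1 : ℕ) : ℝ) + 1 - (n - 1))))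
        = ε * ∑ i ∈ below r (k.1 + 1), 8 * t ^ 3 * ((i.1 : ℝ) - (k.1 + 1)) := by
      rw [Finset.mul_sum]
      refine Finset.sum_congr rfl fun i _ => ?_
      push_cast; ring
    rw [e]
    refine mul_ne_zero hε (ne_of_lt ?_)
    refine Finset.sum_neg (fun i hi => ?_) ⟨⟨0, by omega⟩, by simp⟩
    rw [mem_below] at hi
    have : (i.1 : ℝ) < k.1 + 1 := by exact_mod_cast hi
    exact mul_neg_of_pos_of_neg (by positivity) (by linarith)
  · change gh hle _ (witness n ε) * gg hle _ (witness n ε) -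
      gg hle _ (witness n ε) * gh hle _ (witness n ε) ≠ 0
    have hk : k.1 + 1 < n - 2 * r := by omega
    rw [hgh, hgh, hgg, hgg, only_eq hk, Finset.sum_singleton, Finset.sum_singleton,
      Finset.sum_mul, Finset.sum_mul, ← Finset.sum_sub_distrib]
    have e : ∑ i ∈ below (n - 2 * r) (k.1 + 1), (t * ε * (2 * r + i.1 - (n - 1) / 2) * t ^ 2
        - t ^ 2 * (t * ε * (2 * r + ((k.1 + 1 : ℕ) : ℝ) - (n - 1) / 2)))
        = ε * ∑ i ∈ below (n - 2 * r) (k.1 + 1), t ^ 3 * ((i.1 : ℝ) - (k.1 + 1)) := by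
      rw [Finset.mul_sum]
      refine Finset.sum_congr rfl fun i _ => ?_
      push_cast; ring
    rw [e]
    refine mul_ne_zero hε (ne_of_lt ?_)
    refine Finset.sum_neg (fun i hi => ?_) ⟨⟨0, by omega⟩, by simp⟩
    rw [mem_below] at hi
    have : (i.1 : ℝ) < k.1 + 1 := by exact_mod_cast hi
    exact mul_neg_of_pos_of_neg (by positivity) (by linarith)
  · fin_cases i
    · change zv hle ε Finset.univ (witness n ε) ≠ 0
      rw [hzv]
      have e : ∑ i : Fin r, t * ε * (4 * (i.1 : ℝ) + 1 - (n - 1)) = t * ε * (r * (2 * r - n)) := by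
        rw [← Finset.mul_sum]
        congr 1
        have h2 := Finset.sum_range_id_mul_two r
        have h3 : (∑ i ∈ Finset.range r, (i : ℝ)) * 2 = r * (r - 1) := by
          have := congrArg (Nat.cast (R := ℝ)) h2
          push_cast [Nat.cast_sub hr] at this
          exact this
        rw [Fin.sum_univ_eq_sum_range (fun i => 4 * (i : ℝ) + 1 - (n - 1)) r,
          Finset.sum_sub_distrib, Finset.sum_add_distrib, ← Finset.mul_sum]
        simp only [Finset.sum_const, Finset.card_range, nsmul_eq_mul]
        linarith
      rw [e]
      have h1 : (r : ℝ) ≠ 0 := by exact_mod_cast (by omega : r ≠ 0)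
      have h2 : (2 * r - n : ℝ) ≠ 0 := by
        have : (2 * r + 2 : ℝ) ≤ n := by exact_mod_cast h
        intro h0; linarith
      exact mul_ne_zero (mul_ne_zero htpos.ne' hε) (mul_ne_zero h1 h2)
    · change zz hle (only r 0) (witness n ε) ≠ 0
      rw [hzz, only_eq (by omega : 0 < r), Finset.sum_singleton]
      positivity
    · change gg hle (only (n - 2 * r) 0) (witness n ε) ≠ 0
      rw [hgg, only_eq (by omega : 0 < n - 2 * r), Finset.sum_singleton]
      positivity
    · change casT hle Finset.univ (witness n ε) ≠ 0
      have h2 := sum_sq_tmom hle Finset.univ (witness n ε)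
      have hpos : 0 < ∑ i, ∑ j, tmom hle i j (witness n ε) ^ 2 := by
        refine Finset.sum_pos' (fun i _ => Finset.sum_nonneg fun j _ => sq_nonneg _)
          ⟨⟨0, by omega⟩, Finset.mem_univ _, ?_⟩
        refine Finset.sum_pos' (fun j _ => sq_nonneg _) ⟨⟨1, by omega⟩, Finset.mem_univ _, ?_⟩
        refine sq_pos_of_ne_zero ?_
        have e : tmom hle ⟨0, by omega⟩ ⟨1, by omega⟩ (witness n ε) = t * ε := by
          rw [tmom, ← posT_apply, ← momT_apply, hg, hg, hp, hp]
          push_cast; ring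
        rw [e]
        exact mul_ne_zero htpos.ne' hε
      intro h0
      rw [h0] at h2
      linarith
    · change zvIm hle ε Finset.univ (witness n ε) ≠ 0
      rw [hzvIm, Finset.sum_const, Finset.card_univ, Fintype.card_fin, nsmul_eq_mul]
      have h1 : (r : ℝ) ≠ 0 := by exact_mod_cast (by omega : r ≠ 0)
      positivity
    · change (if r = 1 then (1 : ℝ) else _) ≠ 0
      split_ifs with h1
      · exact one_ne_zero
      · have h2 := sum_normSq_minor Finset.univ (posZ hle (witness n ε)) (momZ hle ε (witness n ε))
        have hpos : 0 < ∑ i, ∑ j, Complex.normSq (posZ hle (witness n ε) i *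
            momZ hle ε (witness n ε) j - momZ hle ε (witness n ε) i *
            posZ hle (witness n ε) j) := by
          refine Finset.sum_pos' (fun i _ => Finset.sum_nonneg fun j _ => Complex.normSq_nonneg _)
            ⟨⟨0, by omega⟩, Finset.mem_univ _, ?_⟩
          refine Finset.sum_pos' (fun j _ => Complex.normSq_nonneg _)
            ⟨⟨1, by omega⟩, Finset.mem_univ _, ?_⟩
          rw [Complex.normSq_pos]
          intro h0
          have := congrArg Complex.im h0
          rw [hz, hz, hv, hv] at this
          simp only [Complex.sub_im, Complex.mul_im, Complex.zero_im] at this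
          have h3 : 4 * (t * ε) = 0 := by
            rw [← this]; push_cast; ring
          exact mul_ne_zero (by norm_num) (mul_ne_zero htpos.ne' hε) h3
        intro h0
        rw [h2] at hpos
        have h0' : (herm Finset.univ (posZ hle (witness n ε)) (posZ hle (witness n ε))).re *
          (herm Finset.univ (momZ hle ε (witness n ε)) (momZ hle ε (witness n ε))).re -
          (herm Finset.univ (posZ hle (witness n ε)) (momZ hle ε (witness n ε))).re ^ 2 -
          (herm Finset.univ (posZ hle (witness n ε)) (momZ hle ε (witness n ε))).im ^ 2 = 0 := h0
        rw [h0'] at hpos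
        linarith

theorem generically_generic (h : 2 * r + 2 ≤ n) (hr : 1 ≤ r) {ε : ℝ} (hε : ε ≠ 0) :
    Generically fun x : Ph n => ∀ i, genericFunction (by omega : 2 * r ≤ n) ε i x ≠ 0 :=
  generically_of_witness _ (contDiff_genericFunction _ ε) (genericFunction_neg _ ε)
    (witness_mem (by omega) ε) (genericFunction_witness h hr hε)

theorem mem_tangentAt_iff {x v : Ph n} :
    v ∈ tangentAt x ↔ diff phi1 x v = 0 ∧ diff phi2 x v = 0 := by
  rw [mem_tangentAt, diff_phi1, diff_phi2, mul_eq_zero, or_iff_right two_ne_zero]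

/-! ### Independence of the commuting integrals -/

section
variable (h : 2 * r ≤ n) (ε : ℝ)

/-- A phase vector is given by its block coordinates. -/
theorem exists_block (Z V : Fin r → ℂ) (G H : Fin (n - 2 * r) → ℝ) :
    ∃ y : Ph n, posZ h y = Z ∧ momZ h ε y = V ∧ posT h y = G ∧ momT h y = H := by
  refine ⟨(ofBlock h Z G, ofBlock h (V - (Complex.I * (ε / 2)) • Z) H), ?_, ?_, ?_, ?_⟩
  · simp [posZ_apply]
  · funext i; simp [momZ_apply, cv]
  · simp [posT_apply]
  · simp [momT_apply]

theorem diff_phi1_block (x v : Ph n) :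
    diff phi1 x v = diff (zz h Finset.univ) x v + diff (gg h Finset.univ) x v := by
  rw [show phi1 = fun x : Ph n => zz h Finset.univ x + gg h Finset.univ x from
    funext fun x => dot_fst_fst h x]
  exact diff_add (differentiableAt_of_contDiff (contDiff_zz h _) x)
    (differentiableAt_of_contDiff (contDiff_gg h _) x) v

theorem diff_phi2_block (x v : Ph n) :
    diff phi2 x v = diff (zv h ε Finset.univ) x v + diff (gh h Finset.univ) x v := by
  rw [show phi2 = fun x : Ph n => zv h ε Finset.univ x + gh h Finset.univ x from
    funext fun x => dot_snd_fst h ε x]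
  exact diff_add (differentiableAt_of_contDiff (contDiff_zv h ε _) x)
    (differentiableAt_of_contDiff (contDiff_gh h _) x) v

theorem diff_energy_block (m : ℝ) (x v : Ph n) :
    diff (energy m) x v = 1 / (2 * m) * (diff (vv h ε Finset.univ) x v
      - ε * diff (zvIm h ε Finset.univ) x v + ε ^ 2 / 4 * diff (zz h Finset.univ) x v
      + diff (hh h Finset.univ) x v) := by
  have h1 := differentiableAt_of_contDiff (contDiff_vv h ε Finset.univ) x
  have h2 := differentiableAt_of_contDiff (contDiff_zvIm h ε Finset.univ) x
  have h3 := differentiableAt_of_contDiff (contDiff_zz h Finset.univ) x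
  have h4 := differentiableAt_of_contDiff (contDiff_hh h Finset.univ) x
  rw [show energy m = fun x : Ph n => 1 / (2 * m) * (vv h ε Finset.univ x
      - ε * zvIm h ε Finset.univ x + ε ^ 2 / 4 * zz h Finset.univ x + hh h Finset.univ x) from
    funext fun x => energy_eq h ε m x,
    diff_const_mul (((h1.fun_sub (h2.const_mul ε)).fun_add (h3.const_mul _)).fun_add h4),
    diff_add ((h1.fun_sub (h2.const_mul ε)).fun_add (h3.const_mul _)) h4,
    diff_add (h1.fun_sub (h2.const_mul ε)) (h3.const_mul _), diff_sub h1 (h2.const_mul ε),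
    diff_const_mul h2, diff_const_mul h3]

/-- Infinitesimal linear transformations of the pairs `(z, v)` and `(γ, p)` change the constraints
and the energy arbitrarily, but none of the moments. -/
theorem exists_symplectic_direction {m : ℝ} (hm : m ≠ 0) {x : Ph n} (hx : x ∈ cotangentSphere n)
    (hA : zz h Finset.univ x ≠ 0) (hC : zv h ε Finset.univ x ≠ 0) (a b c : ℝ) :
    ∃ S : Ph n, (∃ p s s' : ℝ, posZ h S = (p : ℂ) • posZ h x ∧
        momZ h ε S = (s : ℂ) • posZ h x - (p : ℂ) • momZ h ε x ∧
        posT h S = 0 ∧ momT h S = s' • posT h x) ∧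
      diff phi1 x S = a ∧ diff phi2 x S = b ∧ diff (energy m) x S = c ∧
      (∀ T, diff (zvIm h ε T) x S = 0) ∧ (∀ T, diff (casU h ε T) x S = 0) ∧
      ∀ T, diff (casT h T) x S = 0 := by
  set A := zz h Finset.univ x with hAdef
  set C := zv h ε Finset.univ x with hCdef
  have hG : gg h Finset.univ x = 1 - A := by
    have := dot_fst_fst h x; rw [hx.1] at this; linarith
  have hGH : gh h Finset.univ x = -C := by
    have := dot_snd_fst h ε x; rw [hx.2] at this; linarith
  -- The direction comes from real traceless matrices acting on the pairs (z, v) and (γ, p); these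
  -- commute with the rotations and leave the moments alone. Prescribing the three derivatives gives
  -- 2pA = a, sA + s'(1 - A) = b and 2C(s - s') = d, with d the part of the energy condition left
  -- after p; the values below solve this system.
  set p : ℝ := a / (2 * A) with hp
  set d : ℝ := 2 * m * c - (-2 * vv h ε Finset.univ x + ε ^ 2 / 2 * A) * p with hd
  set s : ℝ := b + (1 - A) * d / (2 * C) with hs
  set s' : ℝ := b - A * d / (2 * C) with hs'
  obtain ⟨S, hZ, hV, hG', hH⟩ := exists_block h ε ((p : ℂ) • posZ h x)
    ((s : ℂ) • posZ h x - (p : ℂ) • momZ h ε x) 0 (s' • posT h x)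
  have hcj : ∀ T, herm T (momZ h ε x) (posZ h x) = conj (herm T (posZ h x) (momZ h ε x)) :=
    fun T => (conj_herm _ _ _).symm
  have e1 : ∀ T, diff (zz h T) x S = 2 * p * zz h T x := by
    intro T
    rw [diff_zz, hZ, herm_smul_left, herm_smul_right, herm_self, Complex.conj_ofReal, zz]
    simp; ring
  have e2 : ∀ T, diff (zv h ε T) x S = s * zz h T x := by
    intro T
    rw [diff_zv, hZ, hV, herm_smul_left, herm_sub_right, herm_smul_right, herm_smul_right,
      Complex.conj_ofReal, zz]
    simp
  have e3 : ∀ T, diff (zvIm h ε T) x S = 0 := by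
    intro T
    rw [diff_zvIm, hZ, hV, herm_smul_left, herm_sub_right, herm_smul_right, herm_smul_right,
      Complex.conj_ofReal, herm_self]
    simp
  have e4 : ∀ T, diff (vv h ε T) x S = 2 * s * zv h ε T x - 2 * p * vv h ε T x := by
    intro T
    rw [diff_vv, hV, herm_sub_left, herm_sub_right, herm_smul_right, herm_smul_right,
      herm_smul_left, herm_smul_left, hcj, Complex.conj_ofReal, Complex.conj_ofReal,
      herm_self _ (momZ h ε x), zv, vv]
    simp; ring
  have e5 : ∀ T, diff (gg h T) x S = 0 := by
    intro T; rw [diff_gg, hG']; simp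
  have e6 : ∀ T, diff (gh h T) x S = s' * gg h T x := by
    intro T; rw [diff_gh, hG', hH, gg, Finset.mul_sum]
    exact Finset.sum_congr rfl fun j _ => by simp; ring
  have e7 : ∀ T, diff (hh h T) x S = 2 * s' * gh h T x := by
    intro T; rw [diff_hh, hH, gh, Finset.mul_sum]
    exact Finset.sum_congr rfl fun j _ => by simp; ring
  refine ⟨S, ⟨p, s, s', hZ, hV, hG', hH⟩, ?_, ?_, ?_, e3, fun T => ?_, fun T => ?_⟩
  · rw [diff_phi1_block h, e1, e5, ← hAdef, hp]; field_simp; ring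
  · rw [diff_phi2_block h ε, e2, e6, ← hAdef, hG, hs, hs']; field_simp; ring
  · rw [diff_energy_block h ε, e4, e3, e1, e7, ← hAdef, ← hCdef, hGH]
    have : 2 * s * C - 2 * s' * C = d := by rw [hs, hs']; field_simp; ring
    have e : 2 * s * C - 2 * p * vv h ε Finset.univ x - ε * 0 + ε ^ 2 / 4 * (2 * p * A)
        + 2 * s' * -C = 2 * m * c := by
      rw [show 2 * m * c = d + (-2 * vv h ε Finset.univ x + ε ^ 2 / 2 * A) * p by rw [hd]; ring,
        ← this]
      ring
    rw [e]; field_simp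
  · rw [diff_casU, e1, e2, e3, e4]; ring
  · rw [diff_casT, e5, e6, e7]; ring

end

/-- Back substitution: equation k involves only unknowns with index at least k, so the last unknown
vanishes first. -/
theorem eq_zero_of_triangular {N : ℕ} {α : Fin N → ℝ} {M : Fin N → Fin N → ℝ}
    (h0 : ∀ k, ∑ i, α i * M k i = 0) (hlt : ∀ k i, i < k → M k i = 0) (hd : ∀ k, M k k ≠ 0) :
    α = 0 := by
  have key : ∀ d, ∀ k : Fin N, N - k.1 ≤ d → α k = 0 := by
    intro d
    induction d with
    | zero => intro k hk; have := k.2; omega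
    | succ d ih =>
      intro k hk
      have h1 := h0 k
      rw [Finset.sum_eq_single k] at h1
      · exact (mul_eq_zero.1 h1).resolve_right (hd k)
      · intro i _ hik
        rcases lt_or_gt_of_ne hik with hi | hi
        · rw [hlt k i hi, mul_zero]
        · rw [ih i (by have : k.1 < i.1 := hi; omega), zero_mul]
      · simp
  exact funext fun k => key N k (by omega)

theorem herm_single_right {ι : Type*} [DecidableEq ι] (S : Finset ι) (u : ι → ℂ) (j : ι) (w : ℂ) :
    herm S u (Pi.single j w) = if j ∈ S then conj (u j) * w else 0 := by
  rw [herm]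
  split_ifs with hj
  · rw [Finset.sum_eq_single_of_mem j hj]
    · simp
    · intro i _ hi; simp [hi]
  · refine Finset.sum_eq_zero fun i hi => ?_
    rw [Pi.single_eq_of_ne (fun e : i = j => hj (e ▸ hi)), mul_zero]

theorem herm_singleton {ι : Type*} (u w : ι → ℂ) (j : ι) :
    herm {j} u w = conj (u j) * w j := Finset.sum_singleton _ _

theorem herm_zero_left {ι : Type*} (S : Finset ι) (w : ι → ℂ) : herm S 0 w = 0 := by simp [herm]

theorem herm_single_left {ι : Type*} [DecidableEq ι] (S : Finset ι) (u : ι → ℂ) (j : ι) (w : ℂ) :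
    herm S (Pi.single j w) u = if j ∈ S then conj w * u j else 0 := by
  rw [← conj_herm, herm_single_right]
  split_ifs <;> simp [mul_comm]

theorem below_succ (m k : ℕ) : below m (k + 1) = below m k ∪ only m k := by
  ext i; simp [only]; omega

theorem disjoint_below_only (m k : ℕ) : Disjoint (below m k) (only m k) := by
  rw [Finset.disjoint_left]
  intro i hi; simp only [mem_below] at hi; simp [only]; omega

theorem umoment_diag_eq (hb : IsBlockField r κ κ₀) (s : ℝ) (i : Fin r) :
    umoment hb s (Complex.I / 2) i i = zvIm hb.le (s * κ₀) {i} := by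
  funext x
  rw [← umom_half_im, umom, zvIm, herm, Finset.sum_singleton, posZ_apply, momZ_apply]
  simp [Complex.mul_im]; ring

/-- The commuting integrals are independent, before the restriction to the phase space. -/
theorem coefficients_eq_zero (hb : IsBlockField r κ κ₀) (s : ℝ) {x : Ph n}
    (hgen : ∀ i, genericFunction hb.le (s * κ₀) i x ≠ 0)
    {β : Fin r → ℝ} {α : Fin (r - 1) → ℝ} {α' : Fin (n - 2 * r - 1) → ℝ}
    (h0 : ∀ v, ∑ i, β i * diff (zvIm hb.le (s * κ₀) {i}) x v
      + ∑ k, α k * diff (uCas hb.le (s * κ₀) (below r (k.1 + 2))) x v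
      + ∑ k, α' k * diff (casT hb.le (below (n - 2 * r) (k.1 + 2))) x v = 0) :
    β = 0 ∧ α = 0 ∧ α' = 0 := by
  have h := hb.le
  set ε := s * κ₀ with hε
  -- Test vectors change only the momentum of plane k + 1, in the direction of its own position.
  -- They leave the Φ and the orthogonal Casimir functions unchanged and act on exactly those
  -- unitary sums whose range contains the plane, whence triangularity.
  have hα : α = 0 := by
    refine eq_zero_of_triangular (M := fun k i => if k.1 < i.1 + 1 then
      2 * (zz hb.le (below r (i.1 + 2)) x * zv hb.le ε (only r (k.1 + 1)) x
        - zv hb.le ε (below r (i.1 + 2)) x * zz hb.le (only r (k.1 + 1)) x) else 0)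
      (fun k => ?_) (fun k i hik => ?_) (fun k => ?_)
    · have hk : k.1 + 1 < r := by omega
      obtain ⟨D, hZ, hV, hG, hH⟩ := exists_block hb.le ε 0
        (Pi.single ⟨k.1 + 1, hk⟩ (posZ hb.le x ⟨k.1 + 1, hk⟩)) 0 0
      have f1 : ∀ T, diff (zz hb.le T) x D = 0 := fun T => by rw [diff_zz, hZ]; simp [herm]
      have f2 : ∀ T, diff (zv hb.le ε T) x D =
          if (⟨k.1 + 1, hk⟩ : Fin r) ∈ T then zz hb.le (only r (k.1 + 1)) x else 0 := fun T => by
        rw [diff_zv, hZ, hV, herm_single_right, only_eq hk, zz, herm_singleton, herm_zero_left]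
        split_ifs <;> simp
      have f3 : ∀ T, diff (zvIm hb.le ε T) x D = 0 := fun T => by
        rw [diff_zvIm, hZ, hV, herm_single_right]
        split_ifs <;> simp [herm, Complex.mul_im, mul_comm]
      have f4 : ∀ T, diff (vv hb.le ε T) x D =
          if (⟨k.1 + 1, hk⟩ : Fin r) ∈ T then 2 * zv hb.le ε (only r (k.1 + 1)) x else 0 := by
        intro T
        rw [diff_vv, hV, herm_single_right, herm_single_left, only_eq hk, zv, herm_singleton]
        split_ifs
        · simp [Complex.mul_re]; ring
        · simp
      have f5 : ∀ T, diff (casT hb.le T) x D = 0 := fun T => by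
        rw [diff_casT, diff_gg, diff_hh, diff_gh, hG, hH]; simp
      have f6 : ∀ T, diff (uCas hb.le ε T) x D = diff (casU hb.le ε T) x D := fun T => by
        rw [hε, diff_uCas hb]
        simp only [umoment_diag_eq hb, ← hε, f3]; simp
      have := h0 D
      simp only [f3, f5, f6, diff_casU, f1, f2, f4, mem_below, mul_zero, Finset.sum_const_zero,
        zero_add, add_zero, zero_mul] at this
      refine Eq.trans ?_ this
      refine Finset.sum_congr rfl fun i _ => ?_
      have : k.1 < i.1 + 1 ↔ k.1 + 1 < i.1 + 2 := by omega
      simp only [this]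
      split_ifs <;> ring
    · have : ¬ k.1 < i.1 + 1 := by have : i.1 < k.1 := hik; omega
      simp [this]
    -- On the diagonal the contributions of plane k + 1 to the sums over its block cancel, leaving
    -- -2 times the generic function.
    · have := hgen (Sum.inl (Sum.inr k))
      simp only [genericFunction] at this
      have e1 : zz hb.le (below r (k.1 + 2)) x
          = zz hb.le (below r (k.1 + 1)) x + zz hb.le (only r (k.1 + 1)) x := by
        rw [below_succ, zz, herm, Finset.sum_union (disjoint_below_only _ _), map_add]; rfl
      have e2 : zv hb.le ε (below r (k.1 + 2)) x
          = zv hb.le ε (below r (k.1 + 1)) x + zv hb.le ε (only r (k.1 + 1)) x := by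
        rw [below_succ, zv, herm, Finset.sum_union (disjoint_below_only _ _), map_add]; rfl
      simp only [Nat.lt_succ_self, if_true, e1, e2]
      intro h1
      exact this (by linarith)
  -- The same scheme with the real coordinates; the unitary integrals do not see these test vectors.
  have hα' : α' = 0 := by
    refine eq_zero_of_triangular (M := fun k i => if k.1 < i.1 + 1 then
      2 * (gg hb.le (below (n - 2 * r) (i.1 + 2)) x * gh hb.le (only (n - 2 * r) (k.1 + 1)) x
        - gh hb.le (below (n - 2 * r) (i.1 + 2)) x * gg hb.le (only (n - 2 * r) (k.1 + 1)) x)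
        else 0) (fun k => ?_) (fun k i hik => ?_) (fun k => ?_)
    · have hk : k.1 + 1 < n - 2 * r := by omega
      obtain ⟨D, hZ, hV, hG, hH⟩ := exists_block hb.le ε 0 0 0
        (Pi.single ⟨k.1 + 1, hk⟩ (posT hb.le x ⟨k.1 + 1, hk⟩))
      have f1 : ∀ T, diff (gg hb.le T) x D = 0 := fun T => by rw [diff_gg, hG]; simp
      have f2 : ∀ T, diff (gh hb.le T) x D = if (⟨k.1 + 1, hk⟩ : Fin (n - 2 * r)) ∈ T then
          gg hb.le (only (n - 2 * r) (k.1 + 1)) x else 0 := fun T => by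
        rw [diff_gh, hG, hH, only_eq hk, gg, Finset.sum_singleton]
        simp [Pi.single_apply]
      have f4 : ∀ T, diff (hh hb.le T) x D = if (⟨k.1 + 1, hk⟩ : Fin (n - 2 * r)) ∈ T then
          2 * gh hb.le (only (n - 2 * r) (k.1 + 1)) x else 0 := fun T => by
        rw [diff_hh, hH, only_eq hk, gh, Finset.sum_singleton]
        simp only [Pi.single_apply, mul_ite, ite_mul, mul_zero, zero_mul, Finset.sum_add_distrib,
          Finset.sum_ite_eq']
        split_ifs
        · ring
        · simp
      have f3 : ∀ T, diff (zvIm hb.le ε T) x D = 0 := fun T => by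
        rw [diff_zvIm, hZ, hV]; simp [herm]
      have f6 : ∀ T, diff (uCas hb.le ε T) x D = 0 := fun T => by
        rw [hε, diff_uCas hb]
        simp only [umoment_diag_eq hb, ← hε, f3, diff_casU, diff_zz, diff_zv, diff_vv, hZ, hV]
        simp [herm]
      have := h0 D
      simp only [f3, f6, diff_casT, f1, f2, f4, mem_below, mul_zero, Finset.sum_const_zero,
        zero_add, add_zero, zero_mul] at this
      refine Eq.trans ?_ this
      refine Finset.sum_congr rfl fun i _ => ?_
      have : k.1 < i.1 + 1 ↔ k.1 + 1 < i.1 + 2 := by omega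
      simp only [this]
      split_ifs <;> ring
    · have : ¬ k.1 < i.1 + 1 := by have : i.1 < k.1 := hik; omega
      simp [this]
    · have := hgen (Sum.inr (Sum.inl k))
      simp only [genericFunction] at this
      have e1 : gg hb.le (below (n - 2 * r) (k.1 + 2)) x
          = gg hb.le (below (n - 2 * r) (k.1 + 1)) x + gg hb.le (only (n - 2 * r) (k.1 + 1)) x := by
        rw [below_succ, gg, Finset.sum_union (disjoint_below_only _ _)]; rfl
      have e2 : gh hb.le (below (n - 2 * r) (k.1 + 2)) x
          = gh hb.le (below (n - 2 * r) (k.1 + 1)) x + gh hb.le (only (n - 2 * r) (k.1 + 1)) x := by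
        rw [below_succ, gh, Finset.sum_union (disjoint_below_only _ _)]; rfl
      simp only [Nat.lt_succ_self, if_true, e1, e2]
      intro h1
      exact this (by linarith)
  refine ⟨funext fun j => ?_, hα, hα'⟩
  subst hα hα'
  -- Scaling the position in plane j changes only the j-th integral Φ, at a rate equal to its own
  -- value.
  obtain ⟨D, hZ, hV, hG, hH⟩ := exists_block hb.le ε (Pi.single j (posZ hb.le x j)) 0 0 0
  have := h0 D
  simp only [Pi.zero_apply, zero_mul, Finset.sum_const_zero, add_zero, diff_zvIm, hZ, hV,
    herm_single_left, Finset.mem_singleton] at this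
  rw [Finset.sum_eq_single_of_mem j (Finset.mem_univ _) (fun i _ hi => by
    rw [if_neg (fun e => hi e.symm)]; simp [herm])] at this
  rw [if_pos rfl] at this
  have hg := hgen (Sum.inl (Sum.inl j))
  simp only [genericFunction, zvIm, herm, Finset.sum_singleton] at hg
  simp only [herm, Pi.zero_apply, mul_zero, Finset.sum_const_zero, zero_add] at this
  exact (mul_eq_zero.1 this).resolve_right hg

/-- A symplectic direction tangent to the phase space changes H and none of the other integrals, so
the coefficient of H vanishes. Any vector can then be corrected by such directions to a tangent one
without affecting the remaining integrals, which removes the constraints from the problem. -/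
theorem liouville_coefficients_eq_zero (hb : IsBlockField r κ κ₀) {m : ℝ} (hm : m ≠ 0) (s : ℝ)
    {x : Ph n} (hx : x ∈ cotangentSphere n) (hA : zz hb.le Finset.univ x ≠ 0)
    (hgen : ∀ i, genericFunction hb.le (s * κ₀) i x ≠ 0)
    {η : ℝ} {β : Fin r → ℝ} {α : Fin (r - 1) → ℝ} {α' : Fin (n - 2 * r - 1) → ℝ}
    (h0 : ∀ v ∈ tangentAt x, η * diff (energy m) x v
      + (∑ i, β i * diff (zvIm hb.le (s * κ₀) {i}) x v
      + ∑ k, α k * diff (uCas hb.le (s * κ₀) (below r (k.1 + 2))) x v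
      + ∑ k, α' k * diff (casT hb.le (below (n - 2 * r) (k.1 + 2))) x v) = 0) :
    η = 0 ∧ β = 0 ∧ α = 0 ∧ α' = 0 := by
  have hC : zv hb.le (s * κ₀) Finset.univ x ≠ 0 := hgen (Sum.inr (Sum.inr 0))
  have hU : ∀ S, (∀ T, diff (zvIm hb.le (s * κ₀) T) x S = 0) →
      (∀ T, diff (casU hb.le (s * κ₀) T) x S = 0) →
      ∀ T, diff (uCas hb.le (s * κ₀) T) x S = 0 := fun S h1 h2 T => by
    rw [diff_uCas hb]
    simp only [umoment_diag_eq hb, h1, h2]; simp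
  have hη : η = 0 := by
    obtain ⟨S, -, h1, h2, h3, h4, h5, h6⟩ :=
      exists_symplectic_direction hb.le (s * κ₀) hm hx hA hC 0 0 1
    have := h0 S (mem_tangentAt_iff.2 ⟨h1, h2⟩)
    simpa [h3, h4, hU S h4 h5, h6] using this
  refine ⟨hη, coefficients_eq_zero hb s hgen fun v => ?_⟩
  obtain ⟨S, -, h1, h2, h3, h4, h5, h6⟩ :=
    exists_symplectic_direction hb.le (s * κ₀) hm hx hA hC (-diff phi1 x v) (-diff phi2 x v) 0
  have := h0 (v + S) (mem_tangentAt_iff.2 ⟨by rw [map_add, h1]; ring, by rw [map_add, h2]; ring⟩)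
  simpa [hη, h4, hU S h4 h5, h6] using this

/-- Functions with independent restricted differentials bound the differential dimension. -/
theorem card_le_ddimAt {ι : Type*} [Fintype ι] {𝓕 : Set (Ph n → ℝ)} {x : Ph n}
    (ℓ : ι → Module.Dual ℝ (Ph n))
    (hmem : ∀ i, ∃ β ∈ diffSpan 𝓕 x, ∀ v ∈ tangentAt x, ℓ i v = β v)
    (hind : ∀ c : ι → ℝ, (∀ v ∈ tangentAt x, ∑ i, c i * ℓ i v = 0) → c = 0) :
    Fintype.card ι ≤ ddimAt 𝓕 x := by
  have hli : LinearIndependent ℝ fun i => (tangentAt x).dualRestrict (ℓ i) := by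
    rw [Fintype.linearIndependent_iff]
    intro c hc
    have := hind c fun v hv => by
      have := congrArg (fun f => f ⟨v, hv⟩) hc
      simpa [LinearMap.sum_apply] using this
    exact fun i => congrFun this i
  rw [← finrank_span_eq_card hli, ddimAt]
  refine Submodule.finrank_mono (Submodule.span_le.2 ?_)
  rintro _ ⟨i, rfl⟩
  obtain ⟨β, hβ, h⟩ := hmem i
  exact ⟨β, hβ, LinearMap.ext fun v => (h v v.2).symm⟩

/-- The count is 1 + r + (r - 1) + (n - 2r - 1) = n - 1, without J. The smallest orthogonal Casimir
function is not in the family; `hT` supplies its differential, from Φ_{2r+1,2r+2} in one application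
and from J in the other. -/
theorem ddimAt_filtrationFamily (hb : IsBlockField r κ κ₀) (hr : 1 ≤ r) {m : ℝ} (hm : m ≠ 0)
    (s : ℝ) {x : Ph n} (hx : x ∈ cotangentSphere n) (hA : zz hb.le Finset.univ x ≠ 0)
    (hgen : ∀ i, genericFunction hb.le (s * κ₀) i x ≠ 0) {𝓕 : Set (Ph n → ℝ)}
    (hsub : filtrationFamily m s κ r ⊆ 𝓕)
    (hT : ∃ β ∈ diffSpan 𝓕 x, ∀ v ∈ tangentAt x,
      diff (casT hb.le (below (n - 2 * r) 2)) x v = β v) :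
    n - 1 ≤ ddimAt 𝓕 x := by
  have hrn := hb.lt
  have hmem : ∀ f ∈ filtrationFamily m s κ r, ∃ β ∈ diffSpan 𝓕 x, ∀ v ∈ tangentAt x,
      diff f x v = β v := fun f hf =>
    ⟨_, Submodule.subset_span ⟨f, hsub hf, rfl⟩, fun v _ => rfl⟩
  have hcard : Fintype.card (Unit ⊕ Fin r ⊕ Fin (r - 1) ⊕ Fin (n - 2 * r - 1)) = n - 1 := by
    simp; omega
  rw [← hcard]
  refine card_le_ddimAt (Sum.elim (fun _ => diff (energy m) x)
    (Sum.elim (fun i => diff (zvIm hb.le (s * κ₀) {i}) x)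
      (Sum.elim (fun k => diff (uCas hb.le (s * κ₀) (below r (k.1 + 2))) x)
        fun k => diff (casT hb.le (below (n - 2 * r) (k.1 + 2))) x))) ?_ ?_
  · rintro (_ | i | k | k)
    · exact hmem _ (Or.inl (Or.inl (Or.inl (Or.inl rfl))))
    · refine hmem (zvIm hb.le (s * κ₀) {i})
        (Or.inl (Or.inl (Or.inr ⟨⟨i.1, by omega⟩, i.2, ?_⟩)))
      funext y
      rw [← umoment_diag_eq hb, ← umom_half_im hb, Phi_eq hb s _ i.2]
    · refine hmem (uCas hb.le (s * κ₀) (below r (k.1 + 2)))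
        (Or.inl (Or.inr ⟨k.1 + 2, by omega, by omega, ?_⟩))
      funext y
      rw [unitaryCasimir_eq hb s (by omega)]
    · rcases Nat.eq_zero_or_pos k.1 with hk | hk
      · simpa [hk] using hT
      · refine hmem (casT hb.le (below (n - 2 * r) (k.1 + 2))) (Or.inr ⟨k.1, hk, by omega, ?_⟩)
        funext y
        rw [orthogonalCasimir_eq hb.le]
  · intro c hc
    obtain ⟨h1, h2, h3, h4⟩ := liouville_coefficients_eq_zero hb hm s hx hA hgen
      (η := c (Sum.inl ())) (β := fun i => c (Sum.inr (Sum.inl i)))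
      (α := fun k => c (Sum.inr (Sum.inr (Sum.inl k))))
      (α' := fun k => c (Sum.inr (Sum.inr (Sum.inr k)))) fun v hv => by
        have := hc v hv
        simpa [Fintype.sum_sum_type, add_assoc] using this
    funext i
    rcases i with _ | i | k | k
    · exact h1
    · exact congrFun h2 i
    · exact congrFun h3 k
    · exact congrFun h4 k

theorem zz_univ_ne_zero (h : 2 * r ≤ n) {x : Ph n} (hr : 0 < r) (hx : zz h (only r 0) x ≠ 0) :
    0 < zz h Finset.univ x := by
  rw [only_eq hr, zz, Complex.reLm_coe, herm_self_re, Finset.sum_singleton] at hx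
  rw [zz, Complex.reLm_coe, herm_self_re]
  exact lt_of_lt_of_le (lt_of_le_of_ne (Complex.normSq_nonneg _) (Ne.symm hx))
    (Finset.single_le_sum (f := fun i => Complex.normSq (posZ h x i))
      (fun i _ => Complex.normSq_nonneg _) (Finset.mem_univ _))

/-- On the phase space, the orthogonal Casimir function is determined by the other integrals. -/
theorem diff_casT_univ (hb : IsBlockField r κ κ₀) {m : ℝ} (hm : m ≠ 0) {s : ℝ} (hε : s * κ₀ ≠ 0)
    {x : Ph n} (hx : x ∈ cotangentSphere n) {v : Ph n} (hv : v ∈ tangentAt x) :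
    diff (casT hb.le Finset.univ) x v = diff (casU hb.le (s * κ₀) Finset.univ) x v
      - 2 * zvIm hb.le (s * κ₀) Finset.univ x * diff (zvIm hb.le (s * κ₀) Finset.univ) x v
      - m ^ 2 / (s * κ₀) ^ 2 * diff (integralJ m s κ) x v + 2 * m * diff (energy m) x v
      - 2 / (s * κ₀) ^ 2 * (2 * m * energy m x + s * κ₀ * zvIm hb.le (s * κ₀) Finset.univ x) *
        (2 * m * diff (energy m) x v
          + s * κ₀ * diff (zvIm hb.le (s * κ₀) Finset.univ) x v) := by
  set ε := s * κ₀ with hεd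
  have hv' := mem_tangentAt_iff.1 hv
  have d1 := differentiableAt_of_contDiff (contDiff_casU hb.le ε Finset.univ) x
  have d2 := differentiableAt_of_contDiff (contDiff_zvIm hb.le ε Finset.univ) x
  have d3 := differentiableAt_of_contDiff (contDiff_energy m) x
  have d4 := differentiableAt_of_contDiff (contDiff_casT hb.le Finset.univ) x
  have d5 := differentiableAt_of_contDiff (contDiff_hh hb.le Finset.univ) x
  have d6 := (differentiableAt_of_contDiff (contDiff_zv hb.le ε Finset.univ) x).fun_sub
    (differentiableAt_of_contDiff (contDiff_gh hb.le Finset.univ) x)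
  have d7 : DifferentiableAt ℝ (fun x : Ph n => phi1 x - 1) x :=
    (differentiableAt_of_contDiff (contDiff_dot contDiff_fst contDiff_fst) x).sub_const 1
  have d8 : DifferentiableAt ℝ (phi2 (n := n)) x :=
    differentiableAt_of_contDiff (contDiff_dot contDiff_snd contDiff_fst) x
  have dJ := differentiableAt_of_contDiff (contDiff_integralJ m s κ) x
  have p1 : phi1 x - 1 = 0 := sub_eq_zero.2 hx.1
  have p2 : phi2 x = 0 := hx.2
  have e7 : diff (fun x : Ph n => phi1 x - 1) x v = 0 := by
    have : diff (fun x : Ph n => phi1 x - 1) x v = diff phi1 x v := by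
      rw [diff, diff, fderiv_sub_const]
    rw [this, hv'.1]
  have hfun : (fun x => m ^ 2 * integralJ m s κ x) = fun x => ε ^ 2 * (casU hb.le ε Finset.univ x
        - zvIm hb.le ε Finset.univ x ^ 2 - casT hb.le Finset.univ x)
      + ε ^ 2 * (2 * m * energy m x)
      - (2 * m * energy m x + ε * zvIm hb.le ε Finset.univ x) ^ 2
      + ε ^ 2 * (hh hb.le Finset.univ x * (phi1 x - 1)
        + phi2 x * (zv hb.le ε Finset.univ x - gh hb.le Finset.univ x)) :=
    funext fun x => integralJ_relation hb hm s x
  have := congrArg (fun f => diff f x v) hfun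
  have g1 := (d1.fun_sub (d2.fun_pow 2)).fun_sub d4
  have g2 := (d3.const_mul (2 * m)).const_mul (ε ^ 2)
  have g3 := (d3.const_mul (2 * m)).fun_add (d2.const_mul ε)
  have g4 := (d5.fun_mul d7).fun_add (d8.fun_mul d6)
  rw [diff_const_mul dJ, diff_add (((g1.const_mul _).fun_add g2).fun_sub (g3.fun_pow 2))
      (g4.const_mul _), diff_sub ((g1.const_mul _).fun_add g2) (g3.fun_pow 2),
    diff_add (g1.const_mul _) g2, diff_const_mul g1, diff_const_mul (d3.const_mul (2 * m)),
    diff_const_mul g4, diff_sq g3, diff_sub (d1.fun_sub (d2.fun_pow 2)) d4,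
    diff_sub d1 (d2.fun_pow 2), diff_sq d2, diff_add (d5.fun_mul d7) (d8.fun_mul d6),
    diff_mul d5 d7, diff_mul d8 d6, diff_add (d3.const_mul (2 * m)) (d2.const_mul ε),
    diff_const_mul d3, diff_const_mul d2, p1, p2, e7, hv'.2] at this
  field_simp
  linarith

/-- Solving the relation for J for the full orthogonal Casimir function needs ε ≠ 0 and only
functions of the commuting family. -/
theorem exists_diff_casT (hb : IsBlockField r κ κ₀) {m : ℝ} (hm : m ≠ 0) {s : ℝ}
    (hε : s * κ₀ ≠ 0) {x : Ph n} (hx : x ∈ cotangentSphere n) {𝓕 : Set (Ph n → ℝ)}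
    (hsub : filtrationFamily m s κ r ⊆ 𝓕) :
    ∃ β ∈ diffSpan 𝓕 x, ∀ v ∈ tangentAt x, diff (casT hb.le Finset.univ) x v = β v := by
  have hrn := hb.lt
  have hmem : ∀ f ∈ filtrationFamily m s κ r, diff f x ∈ diffSpan 𝓕 x := fun f hf =>
    Submodule.subset_span ⟨f, hsub hf, rfl⟩
  have hH : diff (energy m) x ∈ diffSpan 𝓕 x := hmem _ (Or.inl (Or.inl (Or.inl (Or.inl rfl))))
  have hJ : diff (integralJ m s κ) x ∈ diffSpan 𝓕 x :=
    hmem _ (Or.inl (Or.inl (Or.inl (Or.inr rfl))))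
  have hΦ : ∀ i, diff (zvIm hb.le (s * κ₀) {i}) x ∈ diffSpan 𝓕 x := by
    refine fun i => hmem (zvIm hb.le (s * κ₀) {i})
      (Or.inl (Or.inl (Or.inr ⟨⟨i.1, by omega⟩, i.2, ?_⟩)))
    funext y
    rw [← umoment_diag_eq hb, ← umom_half_im hb, Phi_eq hb s _ i.2]
  have hP : diff (zvIm hb.le (s * κ₀) Finset.univ) x ∈ diffSpan 𝓕 x := by
    have e : diff (zvIm hb.le (s * κ₀) Finset.univ) x
        = ∑ i, diff (zvIm hb.le (s * κ₀) {i}) x := by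
      refine LinearMap.ext fun v => ?_
      simp [LinearMap.sum_apply, diff_zvIm, herm, Finset.sum_add_distrib]
    rw [e]
    exact Submodule.sum_mem _ fun i _ => hΦ i
  have hU : diff (uCas hb.le (s * κ₀) Finset.univ) x ∈ diffSpan 𝓕 x := by
    -- For r = 1 there is no sum I_k in the family, but the sum over pairs of planes is empty, so
    -- its differential is zero.
    by_cases h2 : 2 ≤ r
    · refine hmem (uCas hb.le (s * κ₀) Finset.univ) (Or.inl (Or.inr ⟨r, h2, le_rfl, ?_⟩))
      funext y
      rw [unitaryCasimir_eq hb s le_rfl, below_self]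
    · have e : uCas hb.le (s * κ₀) Finset.univ = fun _ => 0 := by
        funext y
        refine Finset.sum_eq_zero fun i _ => Finset.sum_eq_zero fun j _ => if_neg fun hij => ?_
        have : i.1 < j.1 := hij
        omega
      rw [e]
      simp [diff]
  have hA : diff (casU hb.le (s * κ₀) Finset.univ) x ∈ diffSpan 𝓕 x := by
    have e : diff (casU hb.le (s * κ₀) Finset.univ) x = diff (uCas hb.le (s * κ₀) Finset.univ) x
        + (2 : ℝ) • ∑ i, (2 * zvIm hb.le (s * κ₀) {i} x) • diff (zvIm hb.le (s * κ₀) {i}) x := by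
      refine LinearMap.ext fun v => ?_
      rw [LinearMap.add_apply, diff_uCas hb]
      simp [umoment_diag_eq hb]
    rw [e]
    exact add_mem hU (Submodule.smul_mem _ _ (Submodule.sum_mem _ fun i _ =>
      Submodule.smul_mem _ _ (hΦ i)))
  refine ⟨diff (casU hb.le (s * κ₀) Finset.univ) x
      - (2 * zvIm hb.le (s * κ₀) Finset.univ x) • diff (zvIm hb.le (s * κ₀) Finset.univ) x
      - (m ^ 2 / (s * κ₀) ^ 2) • diff (integralJ m s κ) x + (2 * m) • diff (energy m) x
      - (2 / (s * κ₀) ^ 2 * (2 * m * energy m x + s * κ₀ * zvIm hb.le (s * κ₀) Finset.univ x)) •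
        ((2 * m) • diff (energy m) x
          + (s * κ₀) • diff (zvIm hb.le (s * κ₀) Finset.univ) x), ?_, fun v hv => ?_⟩
  · exact sub_mem (add_mem (sub_mem (sub_mem hA (Submodule.smul_mem _ _ hP))
      (Submodule.smul_mem _ _ hJ)) (Submodule.smul_mem _ _ hH))
      (Submodule.smul_mem _ _ (add_mem (Submodule.smul_mem _ _ hH) (Submodule.smul_mem _ _ hP)))
  · rw [diff_casT_univ hb hm hε hx hv]; rfl

theorem isLiouvilleIntegrable_insert (hb : IsBlockField r κ κ₀) (hr : 1 ≤ r) {m : ℝ} (hm : m ≠ 0)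
    {s : ℝ} (hε : s * κ₀ ≠ 0) : IsLiouvilleIntegrable m s κ
      (insert (angular (od ⟨r, hb.lt⟩) (ev ⟨r, hb.lt⟩)) (filtrationFamily m s κ r)) := by
  have hrn := hb.lt
  refine ⟨isFirstIntegral_filtrationFamily hb hm s, commute_filtrationFamily hb hm s,
    (generically_generic (by omega) hr hε).mono fun x hx hgen => le_antisymm
      (ddimAt_le_of_commute s κ hx _ fun f hf g hg => commute_filtrationFamily hb hm s f hf g hg x hx)
      (ddimAt_filtrationFamily hb hr hm s hx
        (zz_univ_ne_zero hb.le hr (hgen (Sum.inr (Sum.inr 1)))).ne' hgen (Set.subset_insert _ _) ?_)⟩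
  -- The Casimir function of two coordinates is the square of their angular momentum.
  refine ⟨(2 * angular (od ⟨r, hb.lt⟩) (ev ⟨r, hb.lt⟩) x) •
    diff (angular (od ⟨r, hb.lt⟩) (ev ⟨r, hb.lt⟩)) x, Submodule.smul_mem _ _
      (Submodule.subset_span ⟨_, Set.mem_insert _ _, rfl⟩), fun v _ => ?_⟩
  have e0 : angular (od ⟨r, hb.lt⟩) (ev ⟨r, hb.lt⟩) =
      tmoment hb s ⟨0, by omega⟩ ⟨1, by omega⟩ := by
    funext y
    rw [tmoment, gaugeMoment_tgen hb, angular_eq hb.le _ _ (by simp [od]) (by simp [ev])]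
    congr 1 <;> · ext; simp [od, ev]
  have e : casT hb.le (below (n - 2 * r) 2) = fun y =>
      angular (od ⟨r, hb.lt⟩) (ev ⟨r, hb.lt⟩) y ^ 2 := by
    funext y
    rw [e0, casT_eq_moments hb s]
    have hS : below (n - 2 * r) 2 = {⟨0, by omega⟩, ⟨1, by omega⟩} := by
      ext i; simp [Fin.ext_iff]; omega
    have hne : (⟨0, by omega⟩ : Fin (n - 2 * r)) ≠ ⟨1, by omega⟩ := by simp
    simp only [hS, Finset.sum_pair hne]
    simp
  rw [e, diff_sq (differentiableAt_of_contDiff (by rw [e0]; exact contDiff_gaugeMoment s κ _) x)]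
  rfl

/-- With only two nonmagnetic coordinates the smallest orthogonal Casimir function is also the
largest, so J takes the place of Φ_{2r+1,2r+2}. -/
theorem isLiouvilleIntegrable_of_eq (hb : IsBlockField r κ κ₀) (hr : 1 ≤ r) {m : ℝ} (hm : m ≠ 0)
    {s : ℝ} (hε : s * κ₀ ≠ 0) (hn : n = 2 * r + 2) :
    IsLiouvilleIntegrable m s κ (filtrationFamily m s κ r) := by
  have hrn := hb.lt
  have hcom := fun f (hf : f ∈ filtrationFamily m s κ r) g (hg : g ∈ filtrationFamily m s κ r) =>
    commute_filtrationFamily hb hm s f (Set.mem_insert_of_mem _ hf) g (Set.mem_insert_of_mem _ hg)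
  refine ⟨fun f hf => isFirstIntegral_filtrationFamily hb hm s f (Set.mem_insert_of_mem _ hf), hcom,
    (generically_generic (by omega) hr hε).mono fun x hx hgen => le_antisymm
      (ddimAt_le_of_commute s κ hx _ fun f hf g hg => hcom f hf g hg x hx)
      (ddimAt_filtrationFamily hb hr hm s hx
        (zz_univ_ne_zero hb.le hr (hgen (Sum.inr (Sum.inr 1)))).ne' hgen subset_rfl ?_)⟩
  have hS : below (n - 2 * r) 2 = Finset.univ := by
    ext i; simp; omega
  rw [hS]
  exact exists_diff_casT hb hm hε hx subset_rfl

/-! ### Modes of the unitary momentum -/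

/-- The entries of the unitary momentum of a pair of complex vectors. -/
noncomputable def wedgeH {μ : Type*} (z v : μ → ℂ) (i j : μ) : ℂ := conj (z i) * v j - conj (v i) * z j

theorem wedgeH_sum {μ ι : Type*} [Fintype ι] (A : ι → μ → ℂ) (ζ η : ι → ℂ) (i j : μ) :
    wedgeH (∑ k, ζ k • A k) (∑ k, η k • A k) i j =
      ∑ k, ∑ l, (conj (ζ k) * η l - conj (η k) * ζ l) * (conj (A k i) * A l j) := by
  simp only [wedgeH, Finset.sum_apply, Pi.smul_apply, smul_eq_mul, map_sum, map_mul,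
    Finset.sum_mul_sum]
  rw [← Finset.sum_sub_distrib]
  refine Finset.sum_congr rfl fun k _ => ?_
  rw [← Finset.sum_sub_distrib]
  exact Finset.sum_congr rfl fun l _ => by ring

/-- When the mixed products of amplitudes vanish, the momentum is diagonal in the modes and depends
on each amplitude pair only through conj(ζ) η. -/
theorem wedgeH_sum_of_cross {μ ι : Type*} [Fintype ι] (A : ι → μ → ℂ) (ζ η : ι → ℂ)
    (hc : ∀ k l, k ≠ l → conj (ζ k) * η l - conj (η k) * ζ l = 0) (i j : μ) :
    wedgeH (∑ k, ζ k • A k) (∑ k, η k • A k) i j =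
      ∑ k, (conj (ζ k) * η k - conj (η k) * ζ k) * (conj (A k i) * A k j) := by
  rw [wedgeH_sum]
  refine Finset.sum_congr rfl fun k _ => Finset.sum_eq_single_of_mem k (Finset.mem_univ k) ?_
  intro l _ hl
  rw [hc k l hl.symm, zero_mul]

section
variable {μ ι : Type*} [Fintype μ] [Fintype ι]

theorem herm_sum_left (A : ι → μ → ℂ) (ζ : ι → ℂ) (w : μ → ℂ) :
    herm Finset.univ (∑ k, ζ k • A k) w = ∑ k, conj (ζ k) * herm Finset.univ (A k) w := by
  simp only [herm, Finset.sum_apply, Pi.smul_apply, smul_eq_mul, map_sum, map_mul, Finset.mul_sum,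
    Finset.sum_mul]
  rw [Finset.sum_comm]
  exact Finset.sum_congr rfl fun _ _ => Finset.sum_congr rfl fun _ _ => by ring

theorem herm_sum_right (A : ι → μ → ℂ) (ζ : ι → ℂ) (w : μ → ℂ) :
    herm Finset.univ w (∑ k, ζ k • A k) = ∑ k, ζ k * herm Finset.univ w (A k) := by
  rw [← conj_herm, herm_sum_left, map_sum]
  exact Finset.sum_congr rfl fun k _ => by rw [map_mul, Complex.conj_conj, conj_herm]

/-- The squared norm of a complex vector. -/
noncomputable def sqNorm (u : μ → ℂ) : ℝ := (herm Finset.univ u u).re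

theorem herm_self_eq (u : μ → ℂ) : herm Finset.univ u u = (sqNorm u : ℂ) := herm_self _ _

theorem sum_mul_wedgeH (z v u : μ → ℂ) (j : μ) : ∑ i, u i * wedgeH z v i j =
    herm Finset.univ z u * v j - herm Finset.univ v u * z j := by
  simp only [wedgeH, herm, Finset.sum_mul, mul_sub, Finset.sum_sub_distrib]
  congr 1 <;> exact Finset.sum_congr rfl fun _ _ => by ring

theorem sum_wedgeH_diag (z v : μ → ℂ) :
    ∑ i, wedgeH z v i i = 2 * Complex.I * ((herm Finset.univ z v).im : ℂ) := by
  have h : ∑ i, wedgeH z v i i = herm Finset.univ z v - conj (herm Finset.univ z v) := by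
    rw [conj_herm]; simp [wedgeH, herm]
  rw [h, Complex.sub_conj]; push_cast; ring

/-- Decomposition of the unitary momentum of `(z, v)` into orthogonal modes. -/
structure IsModes (z v : μ → ℂ) (N : ℝ) (A : ι → μ → ℂ) (ν : ι → ℝ) : Prop where
  orth : ∀ k l, k ≠ l → herm Finset.univ (A k) (A l) = 0
  norm_pos : ∀ k, 0 < sqNorm (A k)
  sum_norm : ∑ k, sqNorm (A k) = 1
  freq_sq : ∀ k, ν k ^ 2 = N
  freq_add : ∀ k l, k ≠ l → ν k + ν l = 0
  freq_mul : ∀ k, 2 * ν k * sqNorm (A k) - (herm Finset.univ z v).im = ν k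
  freq_ne : ∀ k, ν k ≠ 0
  wedge_eq : ∀ i j, wedgeH z v i j = ∑ k, 2 * Complex.I * ν k * (conj (A k i) * A k j)
  eq_sq : N = sqNorm z * sqNorm v - (herm Finset.univ z v).re ^ 2
  pos : 0 < N
  spans : ∀ Z V, wedgeH Z V = wedgeH z v → ∃ ζ : ι → ℂ, Z = ∑ k, ζ k • A k

/-- The amplitude of the position of a mode. -/
noncomputable def posAmp (a θ : ℝ) : ℂ := Real.sqrt a * Complex.exp (θ * Complex.I)

/-- The amplitude of the momentum of a mode. -/
noncomputable def momAmp (a c ν θ : ℝ) : ℂ :=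
  (c + Complex.I * ν) / Real.sqrt a * Complex.exp (θ * Complex.I)

theorem exp_conj_mul (θ : ℝ) :
    conj (Complex.exp (θ * Complex.I)) * Complex.exp (θ * Complex.I) = 1 := by
  rw [← Complex.exp_conj, ← Complex.exp_add]
  simp

theorem conj_posAmp_mul_momAmp {a : ℝ} (ha : 0 < a) (c ν θ : ℝ) :
    conj (posAmp a θ) * momAmp a c ν θ = c + Complex.I * ν := by
  have hs : (Real.sqrt a : ℂ) ≠ 0 := by exact_mod_cast (Real.sqrt_pos.2 ha).ne'
  rw [posAmp, momAmp, map_mul, Complex.conj_ofReal]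
  calc _ = (Real.sqrt a / Real.sqrt a : ℂ) * (c + Complex.I * ν) *
        (conj (Complex.exp (θ * Complex.I)) * Complex.exp (θ * Complex.I)) := by ring
    _ = _ := by rw [exp_conj_mul, div_self hs]; ring

theorem conj_posAmp_mul_posAmp {a : ℝ} (ha : 0 < a) (θ : ℝ) :
    conj (posAmp a θ) * posAmp a θ = a := by
  rw [posAmp, map_mul, Complex.conj_ofReal]
  calc _ = (Real.sqrt a * Real.sqrt a : ℂ) *
        (conj (Complex.exp (θ * Complex.I)) * Complex.exp (θ * Complex.I)) := by ring
    _ = _ := by rw [exp_conj_mul, mul_one, ← Complex.ofReal_mul, Real.mul_self_sqrt ha.le]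

theorem momAmp_eq {a : ℝ} (ha : 0 < a) (c ν θ : ℝ) :
    momAmp a c ν θ = (c + Complex.I * ν) / a * posAmp a θ := by
  have hs : (Real.sqrt a : ℂ) ≠ 0 := by exact_mod_cast (Real.sqrt_pos.2 ha).ne'
  have h : (a : ℂ) = Real.sqrt a * Real.sqrt a := by
    rw [← Complex.ofReal_mul, Real.mul_self_sqrt ha.le]
  rw [momAmp, posAmp, h]; field_simp

namespace IsModes

variable {z v : μ → ℂ} {N : ℝ} {A : ι → μ → ℂ} {ν : ι → ℝ} (hA : IsModes z v N A ν)

theorem herm_amp (hA : IsModes z v N A ν) (ζ η : ι → ℂ) :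
    herm Finset.univ (∑ k, ζ k • A k) (∑ k, η k • A k)
      = ∑ k, conj (ζ k) * η k * (sqNorm (A k) : ℂ) := by
  rw [herm_sum_left]
  refine Finset.sum_congr rfl fun k _ => ?_
  rw [herm_sum_right, Finset.sum_eq_single_of_mem k (Finset.mem_univ k), herm_self_eq]
  · ring
  · intro l _ hl; rw [hA.orth k l hl.symm, mul_zero]

theorem amp_injective (hA : IsModes z v N A ν) {ζ η : ι → ℂ}
    (h : ∑ k, ζ k • A k = ∑ k, η k • A k) : ζ = η := by
  funext l
  have := congrArg (herm Finset.univ (A l)) h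
  rw [herm_sum_right, herm_sum_right, Finset.sum_eq_single_of_mem l (Finset.mem_univ l),
    Finset.sum_eq_single_of_mem l (Finset.mem_univ l), herm_self_eq] at this
  · exact mul_right_cancel₀ (by exact_mod_cast (hA.norm_pos l).ne') this
  · intro k _ hk; rw [hA.orth l k hk.symm, mul_zero]
  · intro k _ hk; rw [hA.orth l k hk.symm, mul_zero]

/-- Comparison of the traces of the two expressions for the momentum matrix. -/
theorem sum_freq (hA : IsModes z v N A ν) :
    ∑ k, ν k * sqNorm (A k) = (herm Finset.univ z v).im := by
  have h1 := sum_wedgeH_diag z v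
  simp only [hA.wedge_eq] at h1
  rw [Finset.sum_comm] at h1
  simp only [← Finset.mul_sum] at h1
  have h2 : ∀ k, ∑ i, conj (A k i) * A k i = (sqNorm (A k) : ℂ) := fun k => herm_self_eq (A k)
  simp only [h2] at h1
  have h3 : (2 * Complex.I) * ((∑ k, ν k * sqNorm (A k) : ℝ) : ℂ)
      = 2 * Complex.I * ((herm Finset.univ z v).im : ℂ) := by
    rw [← h1]; push_cast; rw [Finset.mul_sum]
    exact Finset.sum_congr rfl fun _ _ => by ring
  have h4 := mul_left_cancel₀ (by simp [Complex.I_ne_zero]) h3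
  exact_mod_cast h4

/-- Distinct modes have opposite frequencies. The quotient (c + iν)/a of momentum by position
amplitude in one mode is therefore the conjugate of the quotient in the other. -/
theorem cross (hA : IsModes z v N A ν) {a : ℝ} (ha : 0 < a) (c : ℝ) (θ : ι → ℝ) (k l : ι)
    (hkl : k ≠ l) : conj (posAmp a (θ k)) * momAmp a c (ν l) (θ l)
      - conj (momAmp a c (ν k) (θ k)) * posAmp a (θ l) = 0 := by
  have h := hA.freq_add k l hkl
  have hl : (ν l : ℂ) = -ν k := by rw [← Complex.ofReal_neg]; congr 1; linarith
  rw [momAmp_eq ha, momAmp_eq ha, hl]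
  simp only [map_mul, map_div₀, map_add, Complex.conj_ofReal, Complex.conj_I]
  ring

/-- The mixed terms cancel, and in each mode conj(ζ) η = c + iν for every phase, so the momentum is
independent of a, c and the phases. -/
theorem wedge_amp (hA : IsModes z v N A ν) {a : ℝ} (ha : 0 < a) (c : ℝ) (θ : ι → ℝ) :
    wedgeH (∑ k, posAmp a (θ k) • A k) (∑ k, momAmp a c (ν k) (θ k) • A k) = wedgeH z v := by
  funext i j
  rw [wedgeH_sum_of_cross A _ _ (hA.cross ha c θ), hA.wedge_eq]
  refine Finset.sum_congr rfl fun k _ => ?_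
  rw [show conj (momAmp a c (ν k) (θ k)) * posAmp a (θ k)
    = conj (conj (posAmp a (θ k)) * momAmp a c (ν k) (θ k)) by
      rw [map_mul, Complex.conj_conj]; ring, conj_posAmp_mul_momAmp ha]
  simp only [map_add, map_mul, Complex.conj_ofReal, Complex.conj_I]
  ring

theorem herm_pos_amp (hA : IsModes z v N A ν) {a : ℝ} (ha : 0 < a) (θ : ι → ℝ) :
    sqNorm (∑ k, posAmp a (θ k) • A k) = a := by
  rw [sqNorm, hA.herm_amp]
  simp only [conj_posAmp_mul_posAmp ha]
  rw [← Finset.mul_sum, ← Complex.ofReal_sum, hA.sum_norm]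
  simp

theorem herm_mom_amp (hA : IsModes z v N A ν) {a : ℝ} (ha : 0 < a) (c : ℝ) (θ : ι → ℝ) :
    herm Finset.univ (∑ k, posAmp a (θ k) • A k) (∑ k, momAmp a c (ν k) (θ k) • A k)
      = c + Complex.I * ((herm Finset.univ z v).im : ℂ) := by
  rw [hA.herm_amp]
  simp only [conj_posAmp_mul_momAmp ha, add_mul, Finset.sum_add_distrib]
  rw [← Finset.mul_sum, ← Complex.ofReal_sum, hA.sum_norm, ← hA.sum_freq, Complex.ofReal_sum,
    Finset.mul_sum]
  simp [mul_assoc]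

theorem eq_posAmp {a : ℝ} (ha : 0 < a) {ζ : ℂ} (h : Complex.normSq ζ = a) :
    ζ = posAmp a ζ.arg := by
  rw [posAmp, ← h, Complex.normSq_eq_norm_sq, Real.sqrt_sq (norm_nonneg _),
    Complex.norm_mul_exp_arg_mul_I]

/-- The pairs of vectors with a given unitary momentum are given by phases of the modes. -/
theorem exists_phase (hA : IsModes z v N A ν) {Z V : μ → ℂ} (h : wedgeH Z V = wedgeH z v) :
    0 < sqNorm Z ∧ ∃ θ : ι → ℝ, Z = ∑ k, posAmp (sqNorm Z) (θ k) • A k ∧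
      V = ∑ k, momAmp (sqNorm Z) (herm Finset.univ Z V).re (ν k) (θ k) • A k := by
  -- The trace of the momentum determines Im⟨Z, V⟩.
  have hP : (herm Finset.univ Z V).im = (herm Finset.univ z v).im := by
    have h1 := sum_wedgeH_diag Z V
    rw [h, sum_wedgeH_diag z v] at h1
    have := mul_left_cancel₀ (by simp [Complex.I_ne_zero]) h1
    exact_mod_cast this.symm
  -- The sum of the squared moduli of the entries, evaluated by Lagrange's identity, determines N.
  have hN : sqNorm Z * sqNorm V - (herm Finset.univ Z V).re ^ 2 = N := by
    have h1 := sum_normSq_wedge Finset.univ Z V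
    have h2 := sum_normSq_wedge Finset.univ z v
    have h3 : ∀ i j, conj (Z i) * V j - conj (V i) * Z j = conj (z i) * v j - conj (v i) * z j :=
      fun i j => congrFun (congrFun h i) j
    simp only [h3] at h1
    rw [h1, hP] at h2
    rw [hA.eq_sq, sqNorm, sqNorm, sqNorm, sqNorm]
    linarith
  have ha : 0 < sqNorm Z := by
    have h0 : 0 ≤ sqNorm Z := by
      rw [sqNorm, herm_self_re]; exact Finset.sum_nonneg fun _ _ => Complex.normSq_nonneg _
    refine lt_of_le_of_ne h0 fun h1 => ?_
    rw [← h1] at hN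
    nlinarith [hA.pos, sq_nonneg (herm Finset.univ Z V).re]
  refine ⟨ha, ?_⟩
  obtain ⟨ζ, hζ⟩ := hA.spans Z V h
  set a := sqNorm Z with had
  set c := (herm Finset.univ Z V).re with hc
  have hAZ : ∀ k, herm Finset.univ (A k) Z = ζ k * (sqNorm (A k) : ℂ) := by
    intro k
    rw [hζ, herm_sum_right, Finset.sum_eq_single_of_mem k (Finset.mem_univ k), herm_self_eq]
    intro l _ hl; rw [hA.orth k l hl.symm, mul_zero]
  have haC : (a : ℂ) ≠ 0 := by exact_mod_cast ha.ne'
  have hVZ : herm Finset.univ V Z = c - Complex.I * ((herm Finset.univ z v).im : ℂ) := by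
    rw [← conj_herm, ← Complex.re_add_im (herm Finset.univ Z V), hP, ← hc]
    simp; ring
  -- Contract the momentum with Z. One side is |Z|² V - ⟨V, Z⟩ Z, the other is diagonal in the
  -- modes; `freq_mul` turns the coefficient c - iP + 2iν|A|² into c + iν.
  have hV : V = ∑ k, ((c + Complex.I * ν k) / a * ζ k) • A k := by
    funext j
    have h1 := sum_mul_wedgeH Z V Z j
    rw [h, herm_self_eq, ← had, hVZ] at h1
    have h2 : ∑ i, Z i * wedgeH z v i j = ∑ k, 2 * Complex.I * ν k * herm Finset.univ (A k) Z * A k j := by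
      simp only [hA.wedge_eq, Finset.mul_sum, herm, Finset.sum_mul]
      rw [Finset.sum_comm]
      exact Finset.sum_congr rfl fun _ _ => Finset.sum_congr rfl fun _ _ => by ring
    have h3 : (a : ℂ) * V j = ∑ k, (c + Complex.I * ν k) * ζ k * A k j := by
      rw [h2] at h1
      have h4 : Z j = ∑ k, ζ k * A k j := by
        rw [hζ]; simp only [Finset.sum_apply, Pi.smul_apply, smul_eq_mul]
      rw [h4] at h1
      rw [eq_comm, sub_eq_iff_eq_add] at h1
      rw [h1, Finset.mul_sum, ← Finset.sum_add_distrib]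
      refine Finset.sum_congr rfl fun k _ => ?_
      have h5 := congrArg (Complex.ofReal) (hA.freq_mul k)
      push_cast at h5
      rw [hAZ]
      linear_combination Complex.I * ζ k * A k j * h5
    rw [Finset.sum_apply]
    apply mul_left_cancel₀ haC
    rw [h3, Finset.mul_sum]
    refine Finset.sum_congr rfl fun k _ => ?_
    simp only [Pi.smul_apply, smul_eq_mul]
    field_simp
  -- Comparing the coefficients of mode l in the two expansions of the momentum forces |ζ_l|² =
  -- |Z|²; the normalization ∑ |A_k|² = 1 is what makes all amplitudes equal in modulus.
  have hnorm : ∀ k, Complex.normSq (ζ k) = a := by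
    intro l
    have hw : ∀ i j, wedgeH Z V i j
        = ∑ k, 2 * Complex.I * ν k * (Complex.normSq (ζ k) / a) * (conj (A k i) * A k j) := by
      intro i j
      conv_lhs => rw [hζ, hV]
      rw [wedgeH_sum_of_cross]
      · refine Finset.sum_congr rfl fun k _ => ?_
        rw [Complex.normSq_eq_conj_mul_self]
        simp only [map_mul, map_div₀, map_add, Complex.conj_ofReal, Complex.conj_I]
        ring
      · intro k l hkl
        have h1 : (ν l : ℂ) = -ν k := by
          rw [← Complex.ofReal_neg]; congr 1; linarith [hA.freq_add k l hkl]
        rw [h1]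
        simp only [map_mul, map_div₀, map_add, Complex.conj_ofReal, Complex.conj_I]
        ring
    have hcon : ∀ (t : ι → ℂ) (j : μ), ∑ i, A l i * ∑ k, t k * (conj (A k i) * A k j)
        = t l * sqNorm (A l) * A l j := by
      intro t j
      have e : ∑ i, A l i * ∑ k, t k * (conj (A k i) * A k j)
          = ∑ k, t k * herm Finset.univ (A k) (A l) * A k j := by
        simp only [Finset.mul_sum, herm, Finset.sum_mul]
        rw [Finset.sum_comm]
        exact Finset.sum_congr rfl fun _ _ => Finset.sum_congr rfl fun _ _ => by ring
      rw [e, Finset.sum_eq_single_of_mem l (Finset.mem_univ l), herm_self_eq]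
      intro k _ hk; rw [hA.orth k l hk]; ring
    have h1 : ∀ j, 2 * Complex.I * ν l * (Complex.normSq (ζ l) / a) * sqNorm (A l) * A l j
        = 2 * Complex.I * ν l * sqNorm (A l) * A l j := by
      intro j
      rw [← hcon (fun k => 2 * Complex.I * ν k * (Complex.normSq (ζ k) / a)) j,
        ← hcon (fun k => 2 * Complex.I * ν k) j]
      refine Finset.sum_congr rfl fun i _ => ?_
      rw [← hw, h, hA.wedge_eq]
    obtain ⟨j, hj⟩ : ∃ j, A l j ≠ 0 := by
      by_contra! hz
      have : sqNorm (A l) = 0 := by rw [sqNorm, herm]; simp [hz]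
      exact (hA.norm_pos l).ne' this
    have h2 := mul_right_cancel₀ hj (h1 j)
    have hn : (sqNorm (A l) : ℂ) ≠ 0 := by exact_mod_cast (hA.norm_pos l).ne'
    have h3 := mul_right_cancel₀ hn h2
    have hν : (ν l : ℂ) ≠ 0 := by exact_mod_cast hA.freq_ne l
    have h4 : (Complex.normSq (ζ l) / a : ℂ) = 1 :=
      mul_left_cancel₀ (mul_ne_zero (mul_ne_zero two_ne_zero Complex.I_ne_zero) hν)
        (by rw [h3, mul_one])
    rw [div_eq_one_iff_eq haC] at h4
    exact_mod_cast h4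
  refine ⟨fun k => (ζ k).arg, ?_, ?_⟩
  · conv_lhs => rw [hζ]
    exact Finset.sum_congr rfl fun k _ => by rw [← eq_posAmp ha (hnorm k)]
  · conv_lhs => rw [hV]
    exact Finset.sum_congr rfl fun k _ => by rw [momAmp_eq ha, ← eq_posAmp ha (hnorm k)]

end IsModes

end

section
variable {μ : Type*} [Fintype μ]

/-- In one complex dimension there is a single mode. -/
theorem isModes_of_unique {z v : μ → ℂ} (i₀ : μ) (hμ : ∀ i, i = i₀)
    (hz : 0 < sqNorm z) (hP : (herm Finset.univ z v).im ≠ 0) :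
    IsModes z v (sqNorm z * sqNorm v - (herm Finset.univ z v).re ^ 2)
      (fun _ : Fin 1 => ((Real.sqrt (sqNorm z))⁻¹ : ℂ) • z)
      (fun _ => (herm Finset.univ z v).im) := by
  have hherm : ∀ u w : μ → ℂ, herm Finset.univ u w = conj (u i₀) * w i₀ := fun u w => by
    rw [herm, Finset.sum_eq_single_of_mem i₀ (Finset.mem_univ _)]
    exact fun i _ hi => absurd (hμ i) hi
  have hs : (Real.sqrt (sqNorm z) : ℂ) ≠ 0 := by exact_mod_cast (Real.sqrt_pos.2 hz).ne'
  have hs2 : (Real.sqrt (sqNorm z) : ℂ) * Real.sqrt (sqNorm z) = conj (z i₀) * z i₀ := by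
    rw [← Complex.ofReal_mul, Real.mul_self_sqrt hz.le, ← hherm, herm_self_eq]
  have hn : sqNorm (((Real.sqrt (sqNorm z))⁻¹ : ℂ) • z) = 1 := by
    have h1 : (sqNorm (((Real.sqrt (sqNorm z))⁻¹ : ℂ) • z) : ℂ) = 1 := by
      rw [← herm_self_eq, herm_smul_left, herm_smul_right, hherm, ← hs2, map_inv₀,
        Complex.conj_ofReal]
      field_simp
    exact_mod_cast h1
  have hN : sqNorm z * sqNorm v - (herm Finset.univ z v).re ^ 2
      = (herm Finset.univ z v).im ^ 2 := by
    rw [sqNorm, sqNorm, hherm, hherm, hherm]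
    simp only [Complex.mul_re, Complex.mul_im, Complex.conj_re, Complex.conj_im]
    ring
  refine ⟨fun k l hkl => absurd (Subsingleton.elim k l) hkl, fun k => by rw [hn]; exact one_pos,
    by simp [hn], fun _ => hN.symm, fun k l hkl => absurd (Subsingleton.elim k l) hkl,
    fun _ => by rw [hn]; ring, fun _ => hP, fun i j => ?_, rfl, ?_, fun Z V _ => ?_⟩
  · rw [hμ i, hμ j, Finset.univ_unique, Finset.sum_singleton]
    have h1 := sum_wedgeH_diag z v
    rw [Finset.sum_eq_single_of_mem i₀ (Finset.mem_univ _)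
      (fun i _ hi => absurd (hμ i) hi)] at h1
    rw [h1]
    simp only [Pi.smul_apply, smul_eq_mul, map_mul, map_inv₀, Complex.conj_ofReal]
    rw [show (Real.sqrt (sqNorm z) : ℂ)⁻¹ * conj (z i₀) * ((Real.sqrt (sqNorm z) : ℂ)⁻¹ * z i₀)
      = (Real.sqrt (sqNorm z) * Real.sqrt (sqNorm z) : ℂ)⁻¹ * (conj (z i₀) * z i₀) by
        rw [mul_inv]; ring, ← hs2, inv_mul_cancel₀ (mul_ne_zero hs hs), mul_one]
  · rw [hN]; positivity
  · have hz0 : z i₀ ≠ 0 := by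
      intro h0
      rw [h0, mul_zero] at hs2
      exact mul_ne_zero hs hs hs2
    refine ⟨fun _ => Z i₀ * Real.sqrt (sqNorm z) / z i₀, funext fun i => ?_⟩
    rw [hμ i, Finset.univ_unique, Finset.sum_singleton]
    simp only [Pi.smul_apply, smul_eq_mul]
    field_simp

/-- In general position there are two modes. -/
theorem isModes_pair {z v : μ → ℂ} (hz : 0 < sqNorm z)
    (hN : (herm Finset.univ z v).im ^ 2 < sqNorm z * sqNorm v - (herm Finset.univ z v).re ^ 2) :
    ∃ (A : Fin 2 → μ → ℂ) (ν : Fin 2 → ℝ),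
      IsModes z v (sqNorm z * sqNorm v - (herm Finset.univ z v).re ^ 2) A ν := by
  set a := sqNorm z with ha
  set b := sqNorm v with hb
  set c := (herm Finset.univ z v).re with hc
  set P := (herm Finset.univ z v).im with hP
  set N := a * b - c ^ 2 with hNd
  have hNpos : 0 < N := lt_of_le_of_lt (sq_nonneg _) hN
  set ν := Real.sqrt N with hν
  have hνpos : 0 < ν := Real.sqrt_pos.2 hNpos
  have hν2 : ν ^ 2 = N := Real.sq_sqrt hNpos.le
  have habs : |P| < ν := by
    rw [hν]; exact Real.lt_sqrt_of_sq_lt (by rwa [sq_abs])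
  have hP1 : P < ν := lt_of_le_of_lt (le_abs_self _) habs
  have hP2 : -P < ν := lt_of_le_of_lt (neg_le_abs _) habs
  have hzz : herm Finset.univ z z = (a : ℂ) := herm_self_eq z
  have hvv : herm Finset.univ v v = (b : ℂ) := herm_self_eq v
  have hzv : herm Finset.univ z v = c + Complex.I * P := by
    rw [mul_comm]; exact (Complex.re_add_im _).symm
  have hvz : herm Finset.univ v z = c - Complex.I * P := by
    rw [← conj_herm, hzv]; simp [sub_eq_add_neg]
  set t : ℂ := Real.sqrt a / (2 * Complex.I * ν) with ht
  set σ : ℂ := (c + Complex.I * ν) / a with hσ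
  set σ' : ℂ := (c - Complex.I * ν) / a with hσ'
  have hcσ : conj σ = σ' := by simp [hσ, hσ', sub_eq_add_neg]
  have hcσ' : conj σ' = σ := by simp [hσ, hσ']
  have haC : (a : ℂ) ≠ 0 := by exact_mod_cast hz.ne'
  have hνC : (ν : ℂ) ≠ 0 := by exact_mod_cast hνpos.ne'
  have hsC : (Real.sqrt a : ℂ) ≠ 0 := by exact_mod_cast (Real.sqrt_pos.2 hz).ne'
  have hs2 : (Real.sqrt a : ℂ) * Real.sqrt a = a := by
    rw [← Complex.ofReal_mul, Real.mul_self_sqrt hz.le]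
  have hI : Complex.I ^ 2 = -1 := Complex.I_sq
  have htt : conj t * t = a / (4 * ν ^ 2) := by
    have : conj t = -t := by
      rw [ht]; simp only [map_div₀, map_mul, Complex.conj_ofReal, Complex.conj_I, map_ofNat]
      field_simp
    rw [this, ht, ← hs2]; field_simp; rw [hI]; ring
  have hbC : (a : ℂ) * b = c ^ 2 + ν ^ 2 := by
    have : a * b = c ^ 2 + ν ^ 2 := by rw [hν2]; ring
    exact_mod_cast this
  set A0 : μ → ℂ := t • (v - σ' • z) with hA0
  set A1 : μ → ℂ := (-t) • (v - σ • z) with hA1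
  have key : ∀ p q p' q' : ℂ, herm Finset.univ (p • (v - q • z)) (p' • (v - q' • z))
      = conj p * p' * (b - q' * (c - Complex.I * P) - conj q * (c + Complex.I * P)
        + conj q * q' * a) := by
    intro p q p' q'
    rw [herm_smul_left, herm_smul_right, herm_sub_left, herm_sub_right, herm_sub_right,
      herm_smul_left, herm_smul_left, herm_smul_right, herm_smul_right, hzz, hvv, hzv, hvz]
    ring
  have hbC' : (b : ℂ) = (c ^ 2 + ν ^ 2) / a := by rw [← hbC]; field_simp
  have n0 : herm Finset.univ A0 A0 = ((ν + P) / (2 * ν) : ℝ) := by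
    rw [hA0, key, htt, hcσ', hbC', hσ, hσ']
    push_cast
    field_simp
    ring_nf
    rw [hI]; ring
  have n1 : herm Finset.univ A1 A1 = ((ν - P) / (2 * ν) : ℝ) := by
    rw [hA1, key, map_neg, neg_mul_neg, htt, hcσ, hbC', hσ, hσ']
    push_cast
    field_simp
    ring_nf
    rw [hI]; ring
  have o01 : herm Finset.univ A0 A1 = 0 := by
    rw [hA0, hA1, key, hcσ', hbC', hσ]
    have : ((c ^ 2 + ν ^ 2 : ℂ) / a - (c + Complex.I * ν) / a * (c - Complex.I * P)
        - (c + Complex.I * ν) / a * (c + Complex.I * P)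
        + (c + Complex.I * ν) / a * ((c + Complex.I * ν) / a) * a) = 0 := by
      field_simp
      ring_nf
      rw [hI]; ring
    rw [this, mul_zero]
  have o10 : herm Finset.univ A1 A0 = 0 := by rw [← conj_herm, o01, map_zero]
  have s0 : sqNorm A0 = (ν + P) / (2 * ν) := by
    have := herm_self_eq A0; rw [n0] at this; exact_mod_cast this.symm
  have s1 : sqNorm A1 = (ν - P) / (2 * ν) := by
    have := herm_self_eq A1; rw [n1] at this; exact_mod_cast this.symm
  have hzA : z = (Real.sqrt a : ℂ) • (A0 + A1) := by
    funext i
    simp only [hA0, hA1, Pi.smul_apply, Pi.add_apply, Pi.sub_apply, smul_eq_mul, ht, hσ, hσ']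
    field_simp
    linear_combination (-2 * ν * Complex.I * z i : ℂ) * hs2
  have hvA : v = (Real.sqrt a : ℂ) • (σ • A0 + σ' • A1) := by
    funext i
    simp only [hA0, hA1, Pi.smul_apply, Pi.add_apply, Pi.sub_apply, smul_eq_mul, ht, hσ, hσ']
    field_simp
    linear_combination (-2 * ν * Complex.I * v i * a : ℂ) * hs2
  refine ⟨![A0, A1], ![ν, -ν], ?_, ?_, ?_, ?_, ?_, ?_, ?_, ?_, rfl, hNpos, ?_⟩
  · intro k l hkl
    fin_cases k <;> fin_cases l <;> first | exact absurd rfl hkl | exact o01 | exact o10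
  · intro k
    fin_cases k
    -- The squared norms (ν ± P)/(2ν) are positive by the strict inequality P² < N assumed on z and
    -- v.
    · change 0 < sqNorm A0
      rw [s0]; exact div_pos (by linarith) (by linarith)
    · change 0 < sqNorm A1
      rw [s1]; exact div_pos (by linarith) (by linarith)
  · rw [Fin.sum_univ_two]
    change sqNorm A0 + sqNorm A1 = 1
    rw [s0, s1]; field_simp; ring
  · intro k; fin_cases k
    · exact hν2
    · change (-ν) ^ 2 = N; rw [neg_sq, hν2]
  · intro k l hkl
    fin_cases k <;> fin_cases l <;> first | exact absurd rfl hkl | simp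
  · intro k; fin_cases k
    · change 2 * ν * sqNorm A0 - P = ν
      rw [s0]; field_simp; ring
    · change 2 * -ν * sqNorm A1 - P = -ν
      rw [s1]; field_simp; ring
  · intro k; fin_cases k
    · exact hνpos.ne'
    · exact neg_ne_zero.2 hνpos.ne'
  · intro i j
    rw [Fin.sum_univ_two]
    change _ = 2 * Complex.I * ν * (conj (A0 i) * A0 j)
      + 2 * Complex.I * ((-ν : ℝ) : ℂ) * (conj (A1 i) * A1 j)
    have e1 : ∀ i, z i = Real.sqrt a * (A0 i + A1 i) := fun i => congrFun hzA i
    have e2 : ∀ i, v i = Real.sqrt a * (σ * A0 i + σ' * A1 i) := fun i => congrFun hvA i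
    rw [wedgeH, e1, e1, e2, e2]
    simp only [map_mul, map_add, Complex.conj_ofReal, hcσ, hcσ']
    have e3 : (Real.sqrt a : ℂ) * Real.sqrt a * (σ - σ') = 2 * Complex.I * ν := by
      rw [hs2, hσ, hσ']; field_simp; ring
    push_cast
    linear_combination (conj (A0 i) * A0 j - conj (A1 i) * A1 j) * e3
  · intro Z V h
    have hIm : (herm Finset.univ Z V).im = P := by
      have h1 := sum_wedgeH_diag Z V
      rw [h, sum_wedgeH_diag z v] at h1
      have := mul_left_cancel₀ (by simp [Complex.I_ne_zero]) h1
      exact_mod_cast this.symm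
    have hN' : sqNorm Z * sqNorm V - (herm Finset.univ Z V).re ^ 2 = N := by
      have h1 := sum_normSq_wedge Finset.univ Z V
      have h2 := sum_normSq_wedge Finset.univ z v
      have h3 : ∀ i j, conj (Z i) * V j - conj (V i) * Z j
          = conj (z i) * v j - conj (v i) * z j := fun i j => congrFun (congrFun h i) j
      simp only [h3] at h1
      rw [h1, hIm, ← hP] at h2
      have h4 : (herm Finset.univ z z).re * (herm Finset.univ v v).re
        - (herm Finset.univ z v).re ^ 2 = N := rfl
      rw [sqNorm, sqNorm]
      linarith
    -- Contracting the equal momenta with Z and with V gives two linear equations for Z and V over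
    -- the span of z and v. Their determinant is N - P² up to sign, nonzero, so Z lies in that span.
    have e1 : ∀ j, (sqNorm Z : ℂ) * V j - herm Finset.univ V Z * Z j
        = herm Finset.univ z Z * v j - herm Finset.univ v Z * z j := fun j => by
      rw [← herm_self_eq, ← sum_mul_wedgeH, ← sum_mul_wedgeH, h]
    have e2 : ∀ j, herm Finset.univ Z V * V j - (sqNorm V : ℂ) * Z j
        = herm Finset.univ z V * v j - herm Finset.univ v V * z j := fun j => by
      rw [← herm_self_eq, ← sum_mul_wedgeH, ← sum_mul_wedgeH, h]
    have hdet : (sqNorm Z : ℂ) * sqNorm V - herm Finset.univ Z V * herm Finset.univ V Z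
        = ((N - P ^ 2 : ℝ) : ℂ) := by
      rw [← conj_herm Finset.univ Z V, Complex.mul_conj, Complex.normSq_apply, hIm, ← hN']
      push_cast; ring
    have hne : ((N - P ^ 2 : ℝ) : ℂ) ≠ 0 := by exact_mod_cast (by linarith : N - P ^ 2 ≠ 0)
    have e3 : ∃ x y : ℂ, ∀ j, Z j = x * v j + y * z j := by
      refine ⟨(herm Finset.univ Z V * herm Finset.univ z Z - sqNorm Z * herm Finset.univ z V) /
        ((N - P ^ 2 : ℝ) : ℂ), (sqNorm Z * herm Finset.univ v V
          - herm Finset.univ Z V * herm Finset.univ v Z) / ((N - P ^ 2 : ℝ) : ℂ), fun j => ?_⟩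
      have : ((N - P ^ 2 : ℝ) : ℂ) * Z j
          = (herm Finset.univ Z V * herm Finset.univ z Z - sqNorm Z * herm Finset.univ z V) * v j
          + (sqNorm Z * herm Finset.univ v V - herm Finset.univ Z V * herm Finset.univ v Z)
            * z j := by
        rw [← hdet]
        linear_combination herm Finset.univ Z V * e1 j - (sqNorm Z : ℂ) * e2 j
      rw [div_mul_eq_mul_div, div_mul_eq_mul_div, ← add_div, eq_div_iff hne, mul_comm, this]
    obtain ⟨x, y, hxy⟩ := e3
    refine ⟨![Real.sqrt a * (x * σ + y), Real.sqrt a * (x * σ' + y)], funext fun j => ?_⟩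
    rw [Fin.sum_univ_two]
    change Z j = Real.sqrt a * (x * σ + y) * A0 j + Real.sqrt a * (x * σ' + y) * A1 j
    have e1 : z j = Real.sqrt a * (A0 j + A1 j) := congrFun hzA j
    have e2 : v j = Real.sqrt a * (σ * A0 j + σ' * A1 j) := congrFun hvA j
    rw [hxy, e1, e2]; ring

/-! ### The real counterpart: planes of angular momentum -/

/-- The real vector with a given complex coordinate in a plane. -/
def planeVec (D₀ D₁ : μ → ℝ) (ζ : ℂ) (j : μ) : ℝ := ζ.re * D₀ j + ζ.im * D₁ j

/-- Description of an orthogonal momentum by a plane with an orthonormal basis. -/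
structure IsPlane (g p : μ → ℝ) (ℓ : ℝ) (D₀ D₁ : μ → ℝ) : Prop where
  pos : 0 < ℓ
  self₀ : D₀ ⬝ᵥ D₀ = 1
  self₁ : D₁ ⬝ᵥ D₁ = 1
  orth : D₀ ⬝ᵥ D₁ = 0
  sq : ℓ ^ 2 = (g ⬝ᵥ g) * (p ⬝ᵥ p) - (g ⬝ᵥ p) ^ 2
  wedge_eq : ∀ i j, g i * p j - g j * p i = ℓ * (D₀ i * D₁ j - D₀ j * D₁ i)

/-- Gram–Schmidt applied to the pair (g, p); positivity of the Gram determinant also gives g ≠ 0. -/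
theorem exists_isPlane {g p : μ → ℝ} (h : 0 < (g ⬝ᵥ g) * (p ⬝ᵥ p) - (g ⬝ᵥ p) ^ 2) :
    ∃ D₀ D₁ : μ → ℝ, IsPlane g p (Real.sqrt ((g ⬝ᵥ g) * (p ⬝ᵥ p) - (g ⬝ᵥ p) ^ 2)) D₀ D₁ := by
  set a := g ⬝ᵥ g with ha
  set b := p ⬝ᵥ p with hb
  set c := g ⬝ᵥ p with hc
  set ℓ := Real.sqrt (a * b - c ^ 2) with hℓ
  have hℓpos : 0 < ℓ := Real.sqrt_pos.2 h
  have hℓ2 : ℓ ^ 2 = a * b - c ^ 2 := Real.sq_sqrt h.le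
  have ha0 : 0 < a := by
    have h0 : 0 ≤ a := Finset.sum_nonneg fun i _ => mul_self_nonneg (g i)
    refine lt_of_le_of_ne h0 fun h1 => ?_
    rw [← h1] at h; nlinarith [sq_nonneg c]
  have hs : 0 < Real.sqrt a := Real.sqrt_pos.2 ha0
  have hs2 : Real.sqrt a ^ 2 = a := Real.sq_sqrt ha0.le
  have hpg : p ⬝ᵥ g = c := dotProduct_comm _ _
  refine ⟨(Real.sqrt a)⁻¹ • g, (Real.sqrt a * ℓ)⁻¹ • (a • p - c • g), hℓpos, ?_, ?_, ?_, hℓ2, ?_⟩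
  · rw [smul_dotProduct, dotProduct_smul, ← ha, smul_eq_mul, smul_eq_mul]
    field_simp; exact hs2.symm
  · simp only [smul_dotProduct, dotProduct_smul, dotProduct_sub, sub_dotProduct, smul_eq_mul,
      ← ha, ← hb, ← hc, hpg]
    field_simp
    rw [hs2, hℓ2]; ring
  · simp only [smul_dotProduct, dotProduct_smul, dotProduct_sub, smul_eq_mul, ← ha, ← hc]
    ring
  · intro i j
    simp only [Pi.smul_apply, Pi.sub_apply, smul_eq_mul]
    field_simp
    rw [hs2]; ring

namespace IsPlane

variable {g p : μ → ℝ} {ℓ : ℝ} {D₀ D₁ : μ → ℝ}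

theorem dot_planeVec (hD : IsPlane g p ℓ D₀ D₁) (ζ η : ℂ) :
    planeVec D₀ D₁ ζ ⬝ᵥ planeVec D₀ D₁ η = (conj ζ * η).re := by
  have e : ∀ ζ, planeVec D₀ D₁ ζ = ζ.re • D₀ + ζ.im • D₁ := fun ζ => rfl
  have h : D₁ ⬝ᵥ D₀ = 0 := by rw [dotProduct_comm]; exact hD.orth
  simp only [e, add_dotProduct, dotProduct_add, smul_dotProduct, dotProduct_smul, hD.self₀,
    hD.self₁, hD.orth, h, smul_eq_mul, Complex.mul_re, Complex.conj_re, Complex.conj_im]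
  ring

theorem planeVec_injective (hD : IsPlane g p ℓ D₀ D₁) {ζ η : ℂ}
    (h : planeVec D₀ D₁ ζ = planeVec D₀ D₁ η) : ζ = η := by
  have e : planeVec D₀ D₁ (ζ - η) = 0 := by
    have h1 : planeVec D₀ D₁ (ζ - η) = planeVec D₀ D₁ ζ - planeVec D₀ D₁ η := by
      funext j; simp only [planeVec, Pi.sub_apply, Complex.sub_re, Complex.sub_im]; ring
    rw [h1, h, sub_self]
  have h2 := hD.dot_planeVec (ζ - η) (ζ - η)
  rw [e, zero_dotProduct, ← Complex.normSq_eq_conj_mul_self, Complex.ofReal_re, eq_comm,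
    Complex.normSq_eq_zero, sub_eq_zero] at h2
  exact h2

theorem wedge_planeVec {μ : Type*} (D₀ D₁ : μ → ℝ) (ζ η : ℂ) (i j : μ) :
    planeVec D₀ D₁ ζ i * planeVec D₀ D₁ η j - planeVec D₀ D₁ ζ j * planeVec D₀ D₁ η i
      = (conj ζ * η).im * (D₀ i * D₁ j - D₀ j * D₁ i) := by
  simp only [planeVec, Complex.mul_im, Complex.conj_re, Complex.conj_im]; ring

/-- The pairs of vectors with a given orthogonal momentum are given by a phase. -/
theorem exists_phase (hD : IsPlane g p ℓ D₀ D₁) {G H : μ → ℝ}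
    (h : ∀ i j, G i * H j - G j * H i = g i * p j - g j * p i) :
    0 < G ⬝ᵥ G ∧ ∃ θ : ℝ, G = planeVec D₀ D₁ (posAmp (G ⬝ᵥ G) θ) ∧
      H = planeVec D₀ D₁ (momAmp (G ⬝ᵥ G) (G ⬝ᵥ H) ℓ θ) := by
  set a := G ⬝ᵥ G with ha
  set b := H ⬝ᵥ H with hb
  set c := G ⬝ᵥ H with hc
  have hw : ∀ i j, G i * H j - G j * H i = ℓ * (D₀ i * D₁ j - D₀ j * D₁ i) := fun i j => by
    rw [h, hD.wedge_eq]
  have hdet : a * b - c ^ 2 = ℓ ^ 2 := by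
    have h1 := sum_sq_wedge Finset.univ G H
    have h2 := sum_sq_wedge Finset.univ g p
    simp only [h] at h1
    rw [hD.sq]
    have h3 : a * b - c ^ 2 = (∑ i, G i * G i) * (∑ i, H i * H i) - (∑ i, G i * H i) ^ 2 := rfl
    have h4 : (g ⬝ᵥ g) * (p ⬝ᵥ p) - (g ⬝ᵥ p) ^ 2
      = (∑ i, g i * g i) * (∑ i, p i * p i) - (∑ i, g i * p i) ^ 2 := rfl
    rw [h3, h4]; linarith
  have e : ∀ (u : μ → ℝ) (j : μ), (u ⬝ᵥ G) * H j - (u ⬝ᵥ H) * G j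
      = ℓ * ((u ⬝ᵥ D₀) * D₁ j - (u ⬝ᵥ D₁) * D₀ j) := by
    intro u j
    have : ∑ i, u i * (G i * H j - G j * H i) = ∑ i, u i * (ℓ * (D₀ i * D₁ j - D₀ j * D₁ i)) :=
      Finset.sum_congr rfl fun i _ => by rw [hw]
    simp only [dotProduct, Finset.sum_mul, Finset.mul_sum, ← Finset.sum_sub_distrib]
    rw [Finset.sum_congr rfl fun i _ => (by ring : u i * G i * H j - u i * H i * G j
      = u i * (G i * H j - G j * H i)), this]
    exact Finset.sum_congr rfl fun i _ => by ring
  have hℓ := hD.pos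
  have ha0 : 0 < a := by
    have h0 : 0 ≤ a := Finset.sum_nonneg fun i _ => mul_self_nonneg (G i)
    refine lt_of_le_of_ne h0 fun h1 => ?_
    rw [← h1] at hdet; nlinarith [sq_nonneg c, pow_pos hℓ 2]
  have hHG : H ⬝ᵥ G = c := dotProduct_comm _ _
  -- Contracting the bivector with G and with H gives two equations whose combination with
  -- determinant ℓ² expresses G in the plane.
  have hspan : ∃ x y : ℝ, G = planeVec D₀ D₁ ⟨x, y⟩ := by
    refine ⟨(a * (H ⬝ᵥ D₁) - c * (G ⬝ᵥ D₁)) / ℓ, (c * (G ⬝ᵥ D₀) - a * (H ⬝ᵥ D₀)) / ℓ,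
      funext fun j => ?_⟩
    have e1 := e G j
    have e2 := e H j
    rw [← ha, ← hc] at e1
    rw [hHG, ← hb] at e2
    have : ℓ * (ℓ * G j) = ℓ * ((a * (H ⬝ᵥ D₁) - c * (G ⬝ᵥ D₁)) * D₀ j
        + (c * (G ⬝ᵥ D₀) - a * (H ⬝ᵥ D₀)) * D₁ j) := by
      linear_combination c * e1 - a * e2 - G j * hdet
    rw [planeVec, div_mul_eq_mul_div, div_mul_eq_mul_div, ← add_div, eq_div_iff hℓ.ne', mul_comm,
      mul_left_cancel₀ hℓ.ne' this]
  obtain ⟨x, y, hxy⟩ := hspan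
  have hax : Complex.normSq ⟨x, y⟩ = a := by
    have := hD.dot_planeVec ⟨x, y⟩ ⟨x, y⟩
    rw [← hxy, ← ha, ← Complex.normSq_eq_conj_mul_self, Complex.ofReal_re] at this
    exact this.symm
  have hζ := IsModes.eq_posAmp ha0 hax
  refine ⟨ha0, (⟨x, y⟩ : ℂ).arg, by rw [← hζ]; exact hxy, funext fun j => ?_⟩
  rw [momAmp_eq ha0, ← hζ]
  have e1 := e G j
  have hG0 : G ⬝ᵥ D₀ = x := by
    have := hD.dot_planeVec ⟨x, y⟩ 1
    rw [← hxy] at this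
    simpa [planeVec, dotProduct] using this
  have hG1 : G ⬝ᵥ D₁ = y := by
    have := hD.dot_planeVec ⟨x, y⟩ Complex.I
    rw [← hxy] at this
    simpa [planeVec, dotProduct] using this
  have hGj : G j = x * D₀ j + y * D₁ j := congrFun hxy j
  rw [← ha, ← hc, hG0, hG1] at e1
  have : ((c + Complex.I * ℓ) / a * ⟨x, y⟩ : ℂ) = ⟨(c * x - ℓ * y) / a, (c * y + ℓ * x) / a⟩ := by
    have haC : (a : ℂ) ≠ 0 := by exact_mod_cast ha0.ne'
    apply Complex.ext
    · rw [div_mul_eq_mul_div, Complex.div_ofReal_re]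
      simp [Complex.mul_re]
    · rw [div_mul_eq_mul_div, Complex.div_ofReal_im]
      simp [Complex.mul_im]
  rw [this, planeVec]
  apply mul_left_cancel₀ ha0.ne'
  have : a * H j = c * G j + ℓ * (x * D₁ j - y * D₀ j) := by linarith
  rw [this, hGj]
  field_simp
  ring

end IsPlane

end

end MagneticSphere

namespace MagneticSphere

open scoped ComplexConjugate

/-! ### One-dimensional oscillations -/

theorem exists_primitive {f : ℝ → ℝ} (hf : ContDiff ℝ ∞ f) :
    ∃ F : ℝ → ℝ, ContDiff ℝ ∞ F ∧ F 0 = 0 ∧ ∀ x, HasDerivAt F (f x) x := by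
  have h : ∀ x, HasDerivAt (fun x => ∫ t in (0 : ℝ)..x, f t) (f x) x := fun x =>
    (hf.continuous.integral_hasStrictDerivAt 0 x).hasDerivAt
  refine ⟨fun x => ∫ t in (0 : ℝ)..x, f t, ?_, by simp, h⟩
  rw [contDiff_infty_iff_deriv]
  refine ⟨fun x => (h x).differentiableAt, ?_⟩
  rw [show deriv (fun x => ∫ t in (0 : ℝ)..x, f t) = f from funext fun x => (h x).deriv]
  exact hf

theorem primitive_add_period {f F : ℝ → ℝ} {p : ℝ} (hp : ∀ x, f (x + p) = f x) (h0 : F 0 = 0)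
    (hF : ∀ x, HasDerivAt F (f x) x) (x : ℝ) : F (x + p) = F x + F p := by
  have h1 : ∀ x, HasDerivAt (fun x => F (x + p) - F x) 0 x := fun x => by
    have := ((hF (x + p)).comp_add_const x p).sub (hF x)
    rwa [hp, sub_self] at this
  have h2 := is_const_of_deriv_eq_zero (fun x => (h1 x).differentiableAt)
    (fun x => (h1 x).deriv) x 0
  simp only [zero_add, h0, sub_zero] at h2
  linarith

/-- The oscillating part of a periodic rate. -/
theorem exists_periodic_primitive {f : ℝ → ℝ} (hf : ContDiff ℝ ∞ f) (hp : ∀ x, f (x + 1) = f x) :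
    ∃ (q : ℝ → ℝ) (M : ℝ), ContDiff ℝ ∞ q ∧ (∀ x, q (x + 1) = q x) ∧
      ∀ x, HasDerivAt q (f x - M) x := by
  obtain ⟨F, hF, h0, hd⟩ := exists_primitive hf
  -- With period 1, F 1 is the mean of f, and subtracting the linear drift leaves a periodic
  -- function.
  refine ⟨fun x => F x - F 1 * x, F 1, hF.sub (contDiff_const.mul contDiff_id), fun x => ?_,
    fun x => ?_⟩
  · simp only [primitive_add_period hp h0 hd]; ring
  · exact ((hd x).fun_sub ((hasDerivAt_id x).const_mul (F 1))).congr_deriv (by simp)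

/-- A positive periodic vector field on the line has solutions that advance by one period in unit
time, after a rescaling. -/
theorem exists_rotation {w : ℝ → ℝ} (hw : ContDiff ℝ ∞ w) (hpos : ∀ x, 0 < w x) {p : ℝ}
    (hp0 : 0 < p) (hp : ∀ x, w (x + p) = w x) :
    ∃ (T : ℝ) (φ : ℝ → ℝ), 0 < T ∧ ContDiff ℝ ∞ φ ∧ (∀ τ, HasDerivAt φ (T * w (φ τ)) τ) ∧
      (∀ τ, φ (τ + 1) = φ τ + p) ∧ Function.Bijective φ := by
  -- F measures the time needed to reach a point, and T = F p is the time of one period; the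
  -- solution is the inverse of F, run at speed T.
  obtain ⟨F, hF, h0, hd⟩ := exists_primitive (f := fun x => (w x)⁻¹) (hw.inv fun x => (hpos x).ne')
  have hadd : ∀ x, F (x + p) = F x + F p :=
    primitive_add_period (fun x => by rw [hp]) h0 hd
  have hmono : StrictMono F := strictMono_of_deriv_pos fun x => by
    rw [(hd x).deriv]; exact inv_pos.2 (hpos x)
  have hT : 0 < F p := by rw [← h0]; exact hmono hp0
  have hnat : ∀ k : ℕ, F (k * p) = k * F p := by
    intro k
    induction k with
    | zero => simp [h0]
    | succ k ih => push_cast; rw [add_mul, one_mul, hadd, ih]; ring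
  have hneg : ∀ k : ℕ, F (-(k * p)) = -(k * F p) := by
    intro k
    induction k with
    | zero => simp [h0]
    | succ k ih =>
      have := hadd (-((k + 1 : ℕ) * p))
      rw [show -(((k + 1 : ℕ) : ℝ) * p) + p = -(k * p) by push_cast; ring, ih] at this
      push_cast at this ⊢; linarith
  -- Each period adds the fixed positive amount F p, so F is unbounded in both directions.
  have hsurj : Function.Surjective F := by
    intro y
    obtain ⟨k, hk⟩ := exists_nat_gt (|y| / F p)
    have hk' : |y| < k * F p := (div_lt_iff₀ hT).1 hk
    have h1 := abs_lt.1 hk'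
    obtain ⟨x, -, hx⟩ := intermediate_value_Icc (f := F)
      (show -(k * p) ≤ k * p by have : 0 ≤ (k : ℝ) * p := by positivity
                                linarith) hF.continuous.continuousOn
      (show y ∈ Set.Icc _ _ by rw [hneg, hnat]; exact ⟨h1.1.le, h1.2.le⟩)
    exact ⟨x, hx⟩
  set e := (StrictMono.orderIsoOfSurjective F hmono hsurj).toHomeomorph with he
  have heF : ∀ x, e x = F x := fun x => rfl
  have hsm : ContDiff ℝ ∞ e.symm :=
    e.contDiff_symm_deriv (fun x => inv_ne_zero (hpos x).ne') hd hF
  have hFe : ∀ y, F (e.symm y) = y := fun y => e.apply_symm_apply y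
  have hds : ∀ y, HasDerivAt e.symm (w (e.symm y)) y := fun y => by
    have := HasDerivAt.of_local_left_inverse e.symm.continuous.continuousAt (hd (e.symm y))
      (inv_ne_zero (hpos _).ne') (Filter.Eventually.of_forall hFe)
    rwa [inv_inv] at this
  refine ⟨F p, fun τ => e.symm (F p * τ), hT, hsm.comp (contDiff_const.mul contDiff_id),
    fun τ => ?_, fun τ => ?_, ?_⟩
  · have h1 : HasDerivAt (fun τ : ℝ => F p * τ) (F p) τ := by
      simpa using (hasDerivAt_id τ).const_mul (F p)
    have := (hds (F p * τ)).comp τ h1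
    rwa [mul_comm] at this
  · apply hmono.injective
    change F (e.symm _) = F (e.symm _ + p)
    rw [hadd, hFe, hFe]; ring
  · refine ⟨fun a b hab => ?_, fun y => ⟨F y / F p, ?_⟩⟩
    · exact mul_left_cancel₀ hT.ne' (e.symm.injective hab)
    · change e.symm (F p * (F y / F p)) = y
      rw [mul_div_cancel₀ _ hT.ne', ← heF, e.symm_apply_apply]

/-! ### The radial motion on the curve c² = f(a) -/

/-- The cubic polynomial that governs the radial motion. -/
def radialCubic (k e N L a : ℝ) : ℝ := a * (1 - a) * (e - k * a) - (1 - a) * N - a * L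

/-- The derivative of the radial cubic. -/
def radialCubic' (k e N L a : ℝ) : ℝ := (1 - 2 * a) * (e - k * a) - k * (a * (1 - a)) + N - L

/-- The values at 0 and 1 are -N and -L, both negative; f is positive at a₀ between them and again
for large a, as its leading coefficient is k. Three sign changes give three roots. -/
theorem radialCubic_factor {k e N L a₀ : ℝ} (hk : 0 < k) (hN : 0 < N) (hL : 0 < L) (h0 : 0 < a₀)
    (h1 : a₀ < 1) (hf : 0 < radialCubic k e N L a₀) :
    ∃ a₁ a₂ a₃, 0 < a₁ ∧ a₁ < a₂ ∧ a₂ < 1 ∧ 1 < a₃ ∧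
      ∀ a, radialCubic k e N L a = k * ((a - a₁) * (a₂ - a) * (a₃ - a)) := by
  set f := radialCubic k e N L with hfdef
  have hc : Continuous f := by
    rw [hfdef]; unfold radialCubic; fun_prop
  have f0 : f 0 = -N := by simp [hfdef, radialCubic]
  have f1 : f 1 = -L := by simp [hfdef, radialCubic]
  obtain ⟨a₁, ha₁, e₁⟩ := intermediate_value_Ioo h0.le hc.continuousOn
    (show (0 : ℝ) ∈ Set.Ioo (f 0) (f a₀) from ⟨by rw [f0]; linarith, hf⟩)
  obtain ⟨a₂, ha₂, e₂⟩ := intermediate_value_Ioo' h1.le hc.continuousOn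
    (show (0 : ℝ) ∈ Set.Ioo (f 1) (f a₀) from ⟨by rw [f1]; linarith, hf⟩)
  -- R is chosen so that R - 1 ≥ 1 and kR - e ≥ L + 1, which makes the cubic term exceed R L.
  set R : ℝ := max 2 ((|e| + L + 1) / k) with hR
  have hR2 : 2 ≤ R := le_max_left _ _
  have hRk : |e| + L + 1 ≤ k * R := by
    have := le_max_right 2 ((|e| + L + 1) / k)
    rw [div_le_iff₀ hk] at this
    linarith
  have fR : 0 < f R := by
    have h2 : L + 1 ≤ k * R - e := by linarith [le_abs_self e]
    have h3 : R * (L + 1) ≤ R * (R - 1) * (k * R - e) := by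
      have : R * 1 * (L + 1) ≤ R * (R - 1) * (k * R - e) := by
        gcongr
        · exact mul_nonneg (by linarith) (by linarith)
        · linarith
      linarith
    have h4 : 0 ≤ (R - 1) * N := mul_nonneg (by linarith) hN.le
    have : f R = R * (R - 1) * (k * R - e) + (R - 1) * N - R * L := by
      rw [hfdef]; unfold radialCubic; ring
    nlinarith
  obtain ⟨a₃, ha₃, e₃⟩ := intermediate_value_Ioo (by linarith : (1 : ℝ) ≤ R) hc.continuousOn
    (show (0 : ℝ) ∈ Set.Ioo (f 1) (f R) from ⟨by rw [f1]; linarith, fR⟩)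
  have h12 : a₁ < a₂ := ha₁.2.trans ha₂.1
  have h23 : a₂ < a₃ := ha₂.2.trans ha₃.1
  refine ⟨a₁, a₂, a₃, ha₁.1, h12, ha₂.2, ha₃.1, fun a => ?_⟩
  -- The leading terms agree, so the difference of the cubic and the product is at most quadratic;
  -- vanishing at three distinct points, it is zero.
  have hu : ∃ x y z : ℝ, ∀ a, f a - k * ((a - a₁) * (a₂ - a) * (a₃ - a))
      = x * a ^ 2 + y * a + z :=
    ⟨-k - e + k * (a₁ + a₂ + a₃), e + N - L - k * (a₁ * a₂ + a₁ * a₃ + a₂ * a₃),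
      -N + k * (a₁ * a₂ * a₃), fun a => by rw [hfdef]; unfold radialCubic; ring⟩
  obtain ⟨x, y, z, hxyz⟩ := hu
  have r1 := hxyz a₁
  have r2 := hxyz a₂
  have r3 := hxyz a₃
  rw [e₁, sub_self] at r1
  rw [e₂, sub_self a₂] at r2
  rw [e₃, sub_self a₃] at r3
  have q12 : (a₂ - a₁) * (x * (a₁ + a₂) + y) = 0 := by linarith
  have q23 : (a₃ - a₂) * (x * (a₂ + a₃) + y) = 0 := by linarith
  have p12 := (mul_eq_zero.1 q12).resolve_left (by linarith)
  have p23 := (mul_eq_zero.1 q23).resolve_left (by linarith)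
  have qx : (a₃ - a₁) * x = 0 := by linarith
  have px : x = 0 := (mul_eq_zero.1 qx).resolve_left (by linarith)
  have py : y = 0 := by rw [px] at p12; linarith
  have pz : z = 0 := by rw [px, py] at r1; linarith
  have := hxyz a
  rw [px, py, pz] at this
  linarith

/-- A closed orbit of the system `a' = 2c/m`, `c' = f'(a)/m` on the curve `c² = f(a)`,
parametrized by the circle `ℝ / ℤ`. -/
structure IsOscillation (m : ℝ) (f f' : ℝ → ℝ) (T : ℝ) (α c : ℝ → ℝ) : Prop where
  pos : 0 < T
  smooth_fst : ContDiff ℝ ∞ α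
  smooth_snd : ContDiff ℝ ∞ c
  period_fst : ∀ τ, α (τ + 1) = α τ
  period_snd : ∀ τ, c (τ + 1) = c τ
  deriv_fst : ∀ τ, HasDerivAt α (T * (2 * c τ / m)) τ
  deriv_snd : ∀ τ, HasDerivAt c (T * (f' (α τ) / m)) τ
  curve : ∀ τ, c τ ^ 2 = f (α τ)
  mem : ∀ τ, α τ ∈ Set.Ioo (0 : ℝ) 1
  regular : ∀ τ, c τ = 0 → f' (α τ) ≠ 0
  inj : ∀ τ τ', α τ = α τ' → c τ = c τ' → ∃ z : ℤ, τ' = τ + z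
  surj : ∀ a b : ℝ, a ∈ Set.Ioo (0 : ℝ) 1 → b ^ 2 = f a → ∃ τ, α τ = a ∧ c τ = b

/-- With a = M - D cos φ between the two inner roots, (a - a₁)(a₂ - a) = D² sin² φ. The oval is then
smoothly parametrized by φ with c = D sin φ √(k(a₃ - a)), and the third factor stays positive
because a₃ > 1. -/
theorem exists_isOscillation {m k e N L a₀ : ℝ} (hm : 0 < m) (hk : 0 < k) (hN : 0 < N)
    (hL : 0 < L) (h0 : 0 < a₀) (h1 : a₀ < 1) (hf : 0 < radialCubic k e N L a₀) :
    ∃ (T : ℝ) (α c : ℝ → ℝ),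
      IsOscillation m (radialCubic k e N L) (radialCubic' k e N L) T α c := by
  obtain ⟨a₁, a₂, a₃, p1, p12, p2, p3, hfac⟩ := radialCubic_factor hk hN hL h0 h1 hf
  have hfac' : ∀ a, radialCubic' k e N L a
      = k * ((a₂ - a) * (a₃ - a) - (a - a₁) * (a₃ - a) - (a - a₁) * (a₂ - a)) := by
    intro a
    have d1 : HasDerivAt (radialCubic k e N L) (radialCubic' k e N L a) a := by
      have hid := hasDerivAt_id a
      have := (((hid.mul (hid.const_sub 1)).mul ((hid.const_mul k).const_sub e)).sub
        ((hid.const_sub 1).mul_const N)).sub (hid.mul_const L)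
      refine this.congr_deriv ?_
      simp only [radialCubic', id, Pi.mul_apply]; ring
    have d2 : HasDerivAt (radialCubic k e N L)
        (k * ((a₂ - a) * (a₃ - a) - (a - a₁) * (a₃ - a) - (a - a₁) * (a₂ - a))) a := by
      rw [show radialCubic k e N L = fun a => k * ((a - a₁) * (a₂ - a) * (a₃ - a)) from
        funext hfac]
      have hid := hasDerivAt_id a
      have := (((hid.sub_const a₁).mul (hid.const_sub a₂)).mul (hid.const_sub a₃)).const_mul k
      refine this.congr_deriv ?_
      simp only [id, Pi.mul_apply]; ring
    exact d1.unique d2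
  set D := (a₂ - a₁) / 2 with hD
  set M := (a₁ + a₂) / 2 with hM
  have hDpos : 0 < D := by rw [hD]; linarith
  clear_value D M
  set A : ℝ → ℝ := fun φ => M - D * Real.cos φ with hA
  set g : ℝ → ℝ := fun φ => k * (a₃ - A φ) with hg
  have hAle : ∀ φ, a₁ ≤ A φ ∧ A φ ≤ a₂ := fun φ => by
    have c1 := Real.cos_le_one φ
    have c2 := Real.neg_one_le_cos φ
    have e1 : a₁ = M - D := by rw [hM, hD]; ring
    have e2 : a₂ = M + D := by rw [hM, hD]; ring
    rw [e1, e2, hA]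
    constructor <;> simp only <;> nlinarith
  have hgpos : ∀ φ, 0 < g φ := fun φ => mul_pos hk (by linarith [(hAle φ).2])
  have hAs : ContDiff ℝ ∞ A := contDiff_const.sub (contDiff_const.mul Real.contDiff_cos)
  have hgs : ContDiff ℝ ∞ g := contDiff_const.mul (contDiff_const.sub hAs)
  have hsq : ContDiff ℝ ∞ fun φ => Real.sqrt (g φ) := hgs.sqrt fun φ => (hgpos φ).ne'
  have hAp : ∀ φ, A (φ + 2 * Real.pi) = A φ := fun φ => by simp [hA, Real.cos_add_two_pi]
  have hgp : ∀ φ, g (φ + 2 * Real.pi) = g φ := fun φ => by simp only [hg, hAp]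
  -- The angular speed (2/m)√g is what makes a' = 2c/m; `exists_rotation` normalizes the period to
  -- 1.
  obtain ⟨T, φ, hT, hφ, hφd, hφp, hφb⟩ := exists_rotation (w := fun φ => 2 / m * Real.sqrt (g φ))
    (contDiff_const.mul hsq) (fun φ => mul_pos (by positivity) (Real.sqrt_pos.2 (hgpos φ)))
    Real.two_pi_pos (fun φ => by rw [hgp])
  set C : ℝ → ℝ := fun φ => D * Real.sin φ * Real.sqrt (g φ) with hC
  have hCs : ContDiff ℝ ∞ C := (contDiff_const.mul Real.contDiff_sin).mul hsq
  have hss : ∀ φ, Real.sqrt (g φ) * Real.sqrt (g φ) = g φ := fun φ =>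
    Real.mul_self_sqrt (hgpos φ).le
  have hAd : ∀ φ, HasDerivAt A (D * Real.sin φ) φ := fun φ => by
    have := ((Real.hasDerivAt_cos φ).const_mul D).const_sub M
    simpa using this
  have hgd : ∀ φ, HasDerivAt g (-(k * (D * Real.sin φ))) φ := fun φ => by
    have := ((hAd φ).const_sub a₃).const_mul k
    simpa using this
  have hCd : ∀ φ, HasDerivAt C (D * Real.cos φ * Real.sqrt (g φ)
      + D * Real.sin φ * (-(k * (D * Real.sin φ)) / (2 * Real.sqrt (g φ)))) φ := fun φ =>
    ((Real.hasDerivAt_sin φ).const_mul D).mul ((hgd φ).sqrt (hgpos φ).ne')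
  have hAM : ∀ φ, (A φ - a₁) * (a₂ - A φ) = D ^ 2 * Real.sin φ ^ 2 := fun φ => by
    rw [Real.sin_sq]; simp only [hA, hM, hD]; ring
  have hf'A : ∀ φ, radialCubic' k e N L (A φ)
      = 2 * D * Real.cos φ * g φ - k * D ^ 2 * Real.sin φ ^ 2 := fun φ => by
    have h3 : a₂ - A φ - (A φ - a₁) = 2 * (D * Real.cos φ) := by simp only [hA, hM, hD]; ring
    rw [hfac']
    calc _ = k * ((a₂ - A φ - (A φ - a₁)) * (a₃ - A φ) - (A φ - a₁) * (a₂ - A φ)) := by ring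
      _ = _ := by rw [h3, hAM, hg]; ring
  refine ⟨T, fun τ => A (φ τ), fun τ => C (φ τ), hT, hAs.comp hφ, hCs.comp hφ, fun τ => ?_,
    fun τ => ?_, fun τ => ?_, fun τ => ?_, fun τ => ?_, fun τ => ?_, fun τ hτ => ?_,
    fun τ τ' h1 h2 => ?_, fun a b ha hb => ?_⟩
  · simp only [hφp, hAp]
  · simp only [hφp, hC, Real.sin_add_two_pi, hgp]
  · have := (hAd (φ τ)).comp τ (hφd τ)
    refine this.congr_deriv ?_
    simp only [hC]; ring
  · have := (hCd (φ τ)).comp τ (hφd τ)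
    refine this.congr_deriv ?_
    have hs : Real.sqrt (g (φ τ)) ≠ 0 := (Real.sqrt_pos.2 (hgpos _)).ne'
    rw [hf'A]
    field_simp
    rw [Real.sq_sqrt (hgpos _).le]
    ring
  · simp only [hC, mul_pow, Real.sq_sqrt (hgpos _).le]
    rw [hfac, ← hAM, hg]; ring
  · exact ⟨by linarith [(hAle (φ τ)).1], by linarith [(hAle (φ τ)).2]⟩
  · have hs : Real.sin (φ τ) = 0 := by
      have h1 : D * Real.sin (φ τ) * Real.sqrt (g (φ τ)) = 0 := hτ
      have h2 := (mul_eq_zero.1 h1).resolve_right (Real.sqrt_pos.2 (hgpos _)).ne'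
      exact (mul_eq_zero.1 h2).resolve_left hDpos.ne'
    have hcos : Real.cos (φ τ) ≠ 0 := fun h0 => by
      have := Real.sin_sq_add_cos_sq (φ τ)
      rw [hs, h0] at this; norm_num at this
    rw [hf'A, hs]
    have := mul_ne_zero (mul_ne_zero (mul_ne_zero two_ne_zero hDpos.ne') hcos) (hgpos (φ τ)).ne'
    simpa using this
  · have hcos : Real.cos (φ τ) = Real.cos (φ τ') := by
      have : M - D * Real.cos (φ τ) = M - D * Real.cos (φ τ') := h1
      exact mul_left_cancel₀ hDpos.ne' (by linarith)
    have hgg : g (φ τ) = g (φ τ') := by simp only [hg, hA, hcos]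
    have hsin : Real.sin (φ τ) = Real.sin (φ τ') := by
      have h3 : D * Real.sin (φ τ) * Real.sqrt (g (φ τ))
        = D * Real.sin (φ τ') * Real.sqrt (g (φ τ')) := h2
      rw [hgg] at h3
      exact mul_left_cancel₀ hDpos.ne' (mul_right_cancel₀ (Real.sqrt_pos.2 (hgpos _)).ne' h3)
    have hang : ((φ τ' : ℝ) : Real.Angle) = (φ τ : ℝ) := Real.Angle.cos_sin_inj hcos.symm hsin.symm
    obtain ⟨z, hz⟩ := Real.Angle.angle_eq_iff_two_pi_dvd_sub.1 hang
    refine ⟨z, hφb.1 ?_⟩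
    have hzp : ∀ (z : ℤ) (τ : ℝ), φ (τ + z) = φ τ + 2 * Real.pi * z := by
      intro z τ
      induction z with
      | zero => simp
      | succ k ih =>
        have := hφp (τ + (k : ℤ))
        push_cast at this ih ⊢
        rw [← add_assoc, this, ih]; ring
      | pred k ih =>
        have := hφp (τ + ((-(k : ℤ) - 1 : ℤ) : ℝ))
        rw [show τ + ((-(k : ℤ) - 1 : ℤ) : ℝ) + 1 = τ + ((-(k : ℤ) : ℤ) : ℝ) by push_cast; ring,
          ih] at this
        push_cast at this ⊢
        linarith
    rw [hzp]; linarith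
  -- A point of the curve over (0, 1) yields a point of the unit circle, whose argument is the
  -- required angle.
  · have hge : ∀ φ, A φ = a → g φ = k * (a₃ - a) := fun φ h => by simp only [hg, h]
    have hG : 0 < k * (a₃ - a) := mul_pos hk (by linarith [ha.2])
    set G := k * (a₃ - a) with hGd
    have hsG : 0 < Real.sqrt G := Real.sqrt_pos.2 hG
    have hcirc : ((M - a) / D) ^ 2 + (b / (D * Real.sqrt G)) ^ 2 = 1 := by
      have h3 : b ^ 2 = G * ((a - a₁) * (a₂ - a)) := by rw [hb, hfac, hGd]; ring
      rw [div_pow, div_pow, mul_pow, Real.sq_sqrt hG.le, h3]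
      have e1 : a₁ = M - D := by rw [hM, hD]; ring
      have e2 : a₂ = M + D := by rw [hM, hD]; ring
      rw [e1, e2]
      field_simp
      ring
    have hn : ‖(⟨(M - a) / D, b / (D * Real.sqrt G)⟩ : ℂ)‖ = 1 := by
      rw [← sq_eq_sq₀ (norm_nonneg _) zero_le_one, ← Complex.normSq_eq_norm_sq,
        Complex.normSq_mk]
      linarith
    set ζ : ℂ := ⟨(M - a) / D, b / (D * Real.sqrt G)⟩ with hζ
    have hexp : Complex.exp (ζ.arg * Complex.I) = ζ := by
      have := Complex.norm_mul_exp_arg_mul_I ζ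
      rwa [hn, Complex.ofReal_one, one_mul] at this
    have hc : Real.cos ζ.arg = (M - a) / D := by
      have := congrArg Complex.re hexp
      rwa [Complex.exp_ofReal_mul_I_re] at this
    have hs : Real.sin ζ.arg = b / (D * Real.sqrt G) := by
      have := congrArg Complex.im hexp
      rwa [Complex.exp_ofReal_mul_I_im] at this
    obtain ⟨τ, hτ⟩ := hφb.2 ζ.arg
    have hAa : A (φ τ) = a := by
      simp only [hA, hτ, hc]; field_simp; ring
    refine ⟨τ, hAa, ?_⟩
    simp only [hC, hge _ hAa]
    rw [hτ, hs]; field_simp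

end MagneticSphere

namespace MagneticSphere

open scoped ComplexConjugate

variable {n r : ℕ} {κ : Fin (n / 2) → ℝ} {κ₀ : ℝ}

/-! ### Common level sets -/

theorem umom_eq_wedgeH (h : 2 * r ≤ n) (ε : ℝ) (i j : Fin r) (x : Ph n) :
    umom h ε i j x = wedgeH (posZ h x) (momZ h ε x) i j := rfl

/-- J imposes no further condition: on the phase space it is determined by H and by quantities
computed from the moments. -/
theorem level_iff (hb : IsBlockField r κ κ₀) {m : ℝ} (hm : m ≠ 0) (s : ℝ) {x y : Ph n}
    (hx : x ∈ cotangentSphere n) (hy : y ∈ cotangentSphere n) :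
    (∀ f ∈ noncommutativeFamily m s κ r, f y = f x) ↔
      (∀ i j, umom hb.le (s * κ₀) i j y = umom hb.le (s * κ₀) i j x) ∧
      (∀ i j, tmom hb.le i j y = tmom hb.le i j x) ∧ energy m y = energy m x := by
  have hrn := hb.lt
  constructor
  · intro hf
    have hlt : ∀ i j : Fin r, i < j →
        umom hb.le (s * κ₀) i j y = umom hb.le (s * κ₀) i j x := by
      intro i j hij
      have h1 := hf _ (Or.inl (Or.inr ⟨⟨i.1, by omega⟩, ⟨j.1, by omega⟩, hij, j.2, Or.inl rfl⟩))
      have h2 := hf _ (Or.inl (Or.inr ⟨⟨i.1, by omega⟩, ⟨j.1, by omega⟩, hij, j.2, Or.inr rfl⟩))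
      rw [Psi1_eq hb s _ _ i.2 j.2, Psi1_eq hb s _ _ i.2 j.2, neg_inj] at h1
      rw [Psi2_eq hb s _ _ i.2 j.2, Psi2_eq hb s _ _ i.2 j.2] at h2
      exact Complex.ext h2 h1
    refine ⟨fun i j => ?_, ?_, hf _ (Or.inl (Or.inl (Or.inl (Or.inl rfl))))⟩
    · rcases lt_trichotomy i j with hij | rfl | hij
      · exact hlt i j hij
      · have h1 := hf _ (Or.inl (Or.inl (Or.inr ⟨⟨i.1, by omega⟩, i.2, rfl⟩)))
        rw [Phi_eq hb s _ i.2, Phi_eq hb s _ i.2] at h1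
        have hre : ∀ w : Ph n, (umom hb.le (s * κ₀) i i w).re = 0 := fun w => by
          have := congrArg Complex.re (conj_umom hb.le (s * κ₀) i i w)
          simp only [Complex.conj_re, Complex.neg_re] at this
          linarith
        refine Complex.ext (by rw [hre, hre]) ?_
        have : (umom hb.le (s * κ₀) ⟨i.1, i.2⟩ ⟨i.1, i.2⟩ y).im
          = (umom hb.le (s * κ₀) ⟨i.1, i.2⟩ ⟨i.1, i.2⟩ x).im := by linarith
        exact this
      · have := hlt j i hij
        have h2 := congrArg conj this
        rw [conj_umom, conj_umom, neg_inj] at h2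
        exact h2
    · have hlt : ∀ i j : Fin (n - 2 * r), i < j → tmom hb.le i j y = tmom hb.le i j x := by
        intro i j hij
        have h1 := hf _ (Or.inr ⟨⟨2 * r + i.1, by omega⟩, ⟨2 * r + j.1, by omega⟩, by simp,
          by simpa using hij, rfl⟩)
        rw [angular_eq hb.le _ _ (by simp) (by simp), angular_eq hb.le _ _ (by simp) (by simp)] at h1
        simpa using h1
      intro i j
      rcases lt_trichotomy i j with hij | rfl | hij
      · exact hlt i j hij
      · simp [tmom]
      · have := hlt j i hij
        simp only [tmom] at this ⊢
        linarith
  · rintro ⟨hU, hT, hE⟩ f hf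
    rcases noncommutativeFamily_cases hb hf with rfl | rfl | ⟨c, i, j, rfl⟩ | ⟨i, j, rfl⟩
    · exact hE
    -- The Casimir functions and Im⟨z, v⟩ depend only on the moments, so every term in the relation
    -- for J agrees at the two points.
    · have e1 : casU hb.le (s * κ₀) Finset.univ y = casU hb.le (s * κ₀) Finset.univ x := by
        have h1 := sum_normSq_umom hb.le (s * κ₀) Finset.univ y
        rw [Finset.sum_congr rfl fun i _ => Finset.sum_congr rfl fun j _ => by rw [hU i j],
          sum_normSq_umom] at h1
        linarith
      have e2 : casT hb.le Finset.univ y = casT hb.le Finset.univ x := by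
        have h1 := sum_sq_tmom hb.le Finset.univ y
        rw [Finset.sum_congr rfl fun i _ => Finset.sum_congr rfl fun j _ => by rw [hT i j],
          sum_sq_tmom] at h1
        linarith
      have e3 : zvIm hb.le (s * κ₀) Finset.univ y = zvIm hb.le (s * κ₀) Finset.univ x := by
        have h1 := sum_wedgeH_diag (posZ hb.le y) (momZ hb.le (s * κ₀) y)
        simp only [← umom_eq_wedgeH, hU] at h1
        have h2 := sum_wedgeH_diag (posZ hb.le x) (momZ hb.le (s * κ₀) x)
        have := mul_left_cancel₀ (by simp [Complex.I_ne_zero]) (h1.symm.trans h2)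
        exact_mod_cast this
      have r1 := integralJ_relation hb hm s y
      have r2 := integralJ_relation hb hm s x
      have c1 : phi1 y = 1 := hy.1
      have c2 : phi2 y = 0 := hy.2
      have c3 : phi1 x = 1 := hx.1
      have c4 : phi2 x = 0 := hx.2
      rw [e1, e2, e3, hE, c1, c2] at r1
      rw [c3, c4] at r2
      refine mul_left_cancel₀ (pow_ne_zero 2 hm) ?_
      rw [r1, r2]; ring
    · rw [umoment, gaugeMoment_ugen hb, gaugeMoment_ugen hb, hU]
    · rw [tmoment, gaugeMoment_tgen hb, gaugeMoment_tgen hb, hT]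

/-! ### The flow in block coordinates -/

section
variable (h : 2 * r ≤ n) (ε : ℝ)

theorem ph_ext {x y : Ph n} (h1 : posZ h x = posZ h y) (h2 : momZ h ε x = momZ h ε y)
    (h3 : posT h x = posT h y) (h4 : momT h x = momT h y) : x = y := by
  refine Prod.ext (block_ext h h1 h3) (block_ext h ?_ h4)
  rw [cz_snd h ε, cz_snd h ε, h1, h2]

/-- The block coordinates of phase vectors, as a linear isomorphism. -/
noncomputable def phEquiv : Ph n ≃ₗ[ℝ]
    (Fin r → ℂ) × (Fin r → ℂ) × (Fin (n - 2 * r) → ℝ) × (Fin (n - 2 * r) → ℝ) :=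
  LinearEquiv.ofBijective ((posZ h).prod ((momZ h ε).prod ((posT h).prod (momT h)))) <| by
    constructor
    · intro x y hxy
      simp only [LinearMap.prod_apply, Function.prod_apply, Prod.mk.injEq] at hxy
      exact ph_ext h ε hxy.1 hxy.2.1 hxy.2.2.1 hxy.2.2.2
    · rintro ⟨Z, V, G, H⟩
      obtain ⟨y, h1, h2, h3, h4⟩ := exists_block h ε Z V G H
      exact ⟨y, by simp only [LinearMap.prod_apply, Function.prod_apply, h1, h2, h3, h4]⟩

variable (Z V : Fin r → ℂ) (G H : Fin (n - 2 * r) → ℝ)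

theorem phEquiv_apply (x : Ph n) :
    phEquiv h ε x = (posZ h x, momZ h ε x, posT h x, momT h x) := rfl

theorem phEquiv_symm_components : posZ h ((phEquiv h ε).symm (Z, V, G, H)) = Z ∧
    momZ h ε ((phEquiv h ε).symm (Z, V, G, H)) = V ∧
    posT h ((phEquiv h ε).symm (Z, V, G, H)) = G ∧
    momT h ((phEquiv h ε).symm (Z, V, G, H)) = H := by
  have := (phEquiv h ε).apply_symm_apply (Z, V, G, H)
  rw [phEquiv_apply] at this
  simpa only [Prod.mk.injEq] using this

@[simp] theorem posZ_symm : posZ h ((phEquiv h ε).symm (Z, V, G, H)) = Z :=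
  (phEquiv_symm_components h ε Z V G H).1

@[simp] theorem momZ_symm : momZ h ε ((phEquiv h ε).symm (Z, V, G, H)) = V :=
  (phEquiv_symm_components h ε Z V G H).2.1

@[simp] theorem posT_symm : posT h ((phEquiv h ε).symm (Z, V, G, H)) = G :=
  (phEquiv_symm_components h ε Z V G H).2.2.1

@[simp] theorem momT_symm : momT h ((phEquiv h ε).symm (Z, V, G, H)) = H :=
  (phEquiv_symm_components h ε Z V G H).2.2.2

end

/-- Apart from a common rotation at rate -ε/(2m), the equations for (z, v) and for the real pair
have real scalar coefficients depending only on the phase point. All components thus obey the same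
scalar system, which lets the modes evolve separately. -/
theorem phEquiv_magneticField (hb : IsBlockField r κ κ₀) {m : ℝ} (hm : m ≠ 0) (s : ℝ)
    (x : Ph n) : phEquiv hb.le (s * κ₀) (magneticField m s κ x) =
      ((1 / m : ℂ) • (momZ hb.le (s * κ₀) x - (Complex.I * (s * κ₀ / 2)) • posZ hb.le x),
        (1 / m : ℂ) • ((-(Complex.I * (s * κ₀ / 2))) • momZ hb.le (s * κ₀) x
          + ((m * multiplier m s κ x - (s * κ₀) ^ 2 / 4 : ℝ) : ℂ) • posZ hb.le x),
        (1 / m) • momT hb.le x, multiplier m s κ x • posT hb.le x) := by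
  have hmC : (m : ℂ) ≠ 0 := by exact_mod_cast hm
  rw [phEquiv_apply]
  have e1 : cz hb.le (magneticField m s κ x).1 = (1 / m : ℂ) • cz hb.le x.2 := by
    rw [magneticField, cz_smul]
    funext i; simp
  have e2 : cz hb.le (magneticField m s κ x).2 = (s / m : ℂ) • ((-(Complex.I * κ₀)) • cz hb.le x.2)
      + (multiplier m s κ x : ℂ) • cz hb.le x.1 := by
    rw [magneticField, cz_add, cz_smul, cz_smul]
    funext i
    simp [hb.cz_mulVec]
  have hcz := cz_snd hb.le (s * κ₀) x
  refine Prod.ext ?_ (Prod.ext ?_ (Prod.ext ?_ ?_))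
  · change cz hb.le (magneticField m s κ x).1 = _
    rw [e1, hcz]; push_cast; rfl
  · funext i
    have e3 := congrFun hcz i
    simp only [Pi.sub_apply, Pi.smul_apply, smul_eq_mul] at e3
    change cz hb.le (magneticField m s κ x).2 i + Complex.I * ((s * κ₀ : ℝ) / 2)
      * cz hb.le (magneticField m s κ x).1 i = _
    rw [e1, e2]
    simp only [Pi.add_apply, Pi.smul_apply, smul_eq_mul, e3, ← posZ_apply]
    push_cast
    field_simp
    linear_combination ((s : ℂ) ^ 2 * κ₀ ^ 2 * posZ hb.le x i * 4) * Complex.I_sq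
  · change ct hb.le (magneticField m s κ x).1 = _
    rw [magneticField, ct_smul]; rfl
  · change ct hb.le (magneticField m s κ x).2 = _
    rw [magneticField, ct_add, ct_smul, ct_smul, hb.ct_mulVec, smul_zero, zero_add]; rfl

/-- Derivatives of the amplitudes of a mode along the radial motion. -/
theorem hasDerivAt_amp {m ε ν lam t c' : ℝ} (hm : m ≠ 0) {a c ψ : ℝ → ℝ} (ha0 : 0 < a t)
    (ha : HasDerivAt a (2 * c t / m) t) (hψ : HasDerivAt ψ ((ν / a t - ε / 2) / m) t)
    (hc : HasDerivAt c c' t) (hc' : m * c' = (c t ^ 2 + ν ^ 2) / a t + lam * a t) :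
    HasDerivAt (fun t => posAmp (a t) (ψ t))
      (1 / m * (momAmp (a t) (c t) ν (ψ t) - Complex.I * (ε / 2) * posAmp (a t) (ψ t))) t ∧
    HasDerivAt (fun t => momAmp (a t) (c t) ν (ψ t))
      (1 / m * (-(Complex.I * (ε / 2)) * momAmp (a t) (c t) ν (ψ t)
        + lam * posAmp (a t) (ψ t))) t := by
  have hs : HasDerivAt (fun t => (Real.sqrt (a t) : ℂ))
      ((2 * c t / m / (2 * Real.sqrt (a t)) : ℝ) : ℂ) t := (ha.sqrt ha0.ne').ofReal_comp
  have he : HasDerivAt (fun t => Complex.exp (ψ t * Complex.I))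
      (Complex.exp (ψ t * Complex.I) * (((ν / a t - ε / 2) / m : ℝ) * Complex.I)) t :=
    (hψ.ofReal_comp.mul_const Complex.I).cexp
  have hcC : HasDerivAt (fun t => (c t : ℂ) + Complex.I * ν) (c' : ℂ) t :=
    hc.ofReal_comp.add_const _
  have hspos : 0 < Real.sqrt (a t) := Real.sqrt_pos.2 ha0
  have hsC : (Real.sqrt (a t) : ℂ) ≠ 0 := by exact_mod_cast hspos.ne'
  have hmC : (m : ℂ) ≠ 0 := by exact_mod_cast hm
  have hs2 : (a t : ℂ) = (Real.sqrt (a t) : ℂ) ^ 2 := by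
    rw [← Complex.ofReal_pow, Real.sq_sqrt ha0.le]
  have hc'' : (c' : ℂ) = ((c t ^ 2 + ν ^ 2) / (Real.sqrt (a t) : ℂ) ^ 2
      + lam * (Real.sqrt (a t) : ℂ) ^ 2) / m := by
    rw [eq_div_iff hmC, ← hs2, mul_comm]; exact_mod_cast hc'
  constructor
  · refine (hs.mul he).congr_deriv ?_
    rw [momAmp, posAmp]
    push_cast
    rw [hs2]
    field_simp
    ring
  · refine ((hcC.fun_div hs hsC).mul he).congr_deriv ?_
    rw [momAmp, posAmp, hc'']
    push_cast
    rw [hs2]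
    field_simp
    linear_combination (2 * ν ^ 2 : ℂ) * Complex.I_sq

/-! ### The invariant tori -/

/-- The linear map that sends a complex number to the vector with that coordinate in a plane. -/
noncomputable def planeMap {μ : Type*} [Fintype μ] (D₀ D₁ : μ → ℝ) : ℂ →ₗ[ℝ] (μ → ℝ) where
  toFun := planeVec D₀ D₁
  map_add' ζ η := by
    funext j; simp only [planeVec, Pi.add_apply, Complex.add_re, Complex.add_im]; ring
  map_smul' c ζ := by
    funext j; simp [planeVec]; ring

theorem conj_momAmp_mul_momAmp {a : ℝ} (ha : 0 < a) (c ν θ : ℝ) :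
    conj (momAmp a c ν θ) * momAmp a c ν θ = ((c ^ 2 + ν ^ 2) / a : ℝ) := by
  have haC : (a : ℂ) ≠ 0 := by exact_mod_cast ha.ne'
  rw [momAmp_eq ha]
  calc _ = (conj (c + Complex.I * ν) * (c + Complex.I * ν)) / (a * a)
        * (conj (posAmp a θ) * posAmp a θ) := by
        simp only [map_mul, map_div₀, Complex.conj_ofReal]; field_simp
    _ = _ := by
      rw [conj_posAmp_mul_posAmp ha]
      simp only [map_add, map_mul, Complex.conj_ofReal, Complex.conj_I]
      push_cast
      field_simp
      linear_combination (-(ν : ℂ) ^ 2) * Complex.I_sq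

/-- The data that describe an invariant torus: the modes of the momenta, the radial oscillation,
and the periodic parts and the means of the phases. -/
structure TorusData (h : 2 * r ≤ n) (ε m : ℝ) (x : Ph n) (K : ℕ) where
  N : ℝ
  A : Fin K → Fin r → ℂ
  ν : Fin K → ℝ
  D₀ : Fin (n - 2 * r) → ℝ
  D₁ : Fin (n - 2 * r) → ℝ
  ℓ : ℝ
  T : ℝ
  α : ℝ → ℝ
  c : ℝ → ℝ
  q : Fin K → ℝ → ℝ
  M : Fin K → ℝ
  q₀ : ℝ → ℝ
  M₀ : ℝ
  m_pos : 0 < m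
  mem : x ∈ cotangentSphere n
  modes : IsModes (posZ h x) (momZ h ε x) N A ν
  plane : IsPlane (posT h x) (momT h x) ℓ D₀ D₁
  osc : IsOscillation m
    (radialCubic (ε ^ 2 / 4) (2 * m * energy m x + ε * zvIm h ε Finset.univ x) N (ℓ ^ 2))
    (radialCubic' (ε ^ 2 / 4) (2 * m * energy m x + ε * zvIm h ε Finset.univ x) N (ℓ ^ 2)) T α c
  smooth_q : ∀ k, ContDiff ℝ ∞ (q k)
  period_q : ∀ k τ, q k (τ + 1) = q k τ
  deriv_q : ∀ k τ, HasDerivAt (q k) (T * ((ν k / α τ - ε / 2) / m) - M k) τ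
  smooth_q₀ : ContDiff ℝ ∞ q₀
  period_q₀ : ∀ τ, q₀ (τ + 1) = q₀ τ
  deriv_q₀ : ∀ τ, HasDerivAt q₀ (T * (ℓ / (1 - α τ) / m) - M₀) τ

namespace TorusData

variable {h : 2 * r ≤ n} {ε m : ℝ} {x : Ph n} {K : ℕ} (d : TorusData h ε m x K)

/-- The phase point with given amplitudes of the modes. -/
noncomputable def point (ζ η : Fin K → ℂ) (ζ₀ η₀ : ℂ) : Ph n :=
  (phEquiv h ε).symm (∑ k, ζ k • d.A k, ∑ k, η k • d.A k,
    planeVec d.D₀ d.D₁ ζ₀, planeVec d.D₀ d.D₁ η₀)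

/-- The phase point with given radial coordinates and phases. -/
noncomputable def modePoint (a c : ℝ) (θ : Fin K → ℝ) (θ₀ : ℝ) : Ph n :=
  d.point (fun k => posAmp a (θ k)) (fun k => momAmp a c (d.ν k) (θ k))
    (posAmp (1 - a) θ₀) (momAmp (1 - a) (-c) d.ℓ θ₀)

theorem zz_modePoint {a : ℝ} (ha : 0 < a) (c : ℝ) (θ : Fin K → ℝ) (θ₀ : ℝ) :
    zz h Finset.univ (d.modePoint a c θ θ₀) = a := by
  simp only [zz, modePoint, point, posZ_symm]
  exact d.modes.herm_pos_amp ha θ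

theorem herm_modePoint {a : ℝ} (ha : 0 < a) (c : ℝ) (θ : Fin K → ℝ) (θ₀ : ℝ) :
    herm Finset.univ (posZ h (d.modePoint a c θ θ₀)) (momZ h ε (d.modePoint a c θ θ₀))
      = c + Complex.I * (zvIm h ε Finset.univ x : ℂ) := by
  simp only [modePoint, point, posZ_symm, momZ_symm]
  exact d.modes.herm_mom_amp ha c θ

theorem zv_modePoint {a : ℝ} (ha : 0 < a) (c : ℝ) (θ : Fin K → ℝ) (θ₀ : ℝ) :
    zv h ε Finset.univ (d.modePoint a c θ θ₀) = c := by
  rw [zv, d.herm_modePoint ha]; simp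

theorem zvIm_modePoint {a : ℝ} (ha : 0 < a) (c : ℝ) (θ : Fin K → ℝ) (θ₀ : ℝ) :
    zvIm h ε Finset.univ (d.modePoint a c θ θ₀) = zvIm h ε Finset.univ x := by
  rw [zvIm, d.herm_modePoint ha]; simp

theorem vv_modePoint {a : ℝ} (ha : 0 < a) (c : ℝ) (θ : Fin K → ℝ) (θ₀ : ℝ) :
    vv h ε Finset.univ (d.modePoint a c θ θ₀) = (c ^ 2 + d.N) / a := by
  simp only [vv, modePoint, point, momZ_symm]
  rw [d.modes.herm_amp]
  simp only [conj_momAmp_mul_momAmp ha, d.modes.freq_sq]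
  rw [← Finset.mul_sum, ← Complex.ofReal_sum, d.modes.sum_norm, Complex.ofReal_one, mul_one]
  simp only [Complex.reLm_coe, Complex.ofReal_re]

theorem gg_modePoint {a : ℝ} (ha : a < 1) (c : ℝ) (θ : Fin K → ℝ) (θ₀ : ℝ) :
    gg h Finset.univ (d.modePoint a c θ θ₀) = 1 - a := by
  simp only [gg, modePoint, point, posT_symm]
  refine (d.plane.dot_planeVec _ _).trans ?_
  rw [conj_posAmp_mul_posAmp (sub_pos.2 ha), Complex.ofReal_re]

theorem gh_modePoint {a : ℝ} (ha : a < 1) (c : ℝ) (θ : Fin K → ℝ) (θ₀ : ℝ) :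
    gh h Finset.univ (d.modePoint a c θ θ₀) = -c := by
  simp only [gh, modePoint, point, posT_symm, momT_symm]
  refine (d.plane.dot_planeVec _ _).trans ?_
  rw [conj_posAmp_mul_momAmp (sub_pos.2 ha)]
  simp

theorem hh_modePoint {a : ℝ} (ha : a < 1) (c : ℝ) (θ : Fin K → ℝ) (θ₀ : ℝ) :
    hh h Finset.univ (d.modePoint a c θ θ₀) = (c ^ 2 + d.ℓ ^ 2) / (1 - a) := by
  simp only [hh, modePoint, point, momT_symm]
  refine (d.plane.dot_planeVec _ _).trans ?_
  rw [conj_momAmp_mul_momAmp (sub_pos.2 ha), Complex.ofReal_re, neg_sq]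

theorem modePoint_mem {a : ℝ} (ha : 0 < a) (ha' : a < 1) (c : ℝ) (θ : Fin K → ℝ) (θ₀ : ℝ) :
    d.modePoint a c θ θ₀ ∈ cotangentSphere n := by
  refine ⟨?_, ?_⟩
  · rw [dot_fst_fst h, d.zz_modePoint ha, d.gg_modePoint ha']; ring
  · rw [dot_snd_fst h ε, d.zv_modePoint ha, d.gh_modePoint ha']; ring

theorem umom_modePoint {a : ℝ} (ha : 0 < a) (c : ℝ) (θ : Fin K → ℝ) (θ₀ : ℝ) (i j : Fin r) :
    umom h ε i j (d.modePoint a c θ θ₀) = umom h ε i j x := by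
  rw [umom_eq_wedgeH, umom_eq_wedgeH]
  simp only [modePoint, point, posZ_symm, momZ_symm]
  rw [d.modes.wedge_amp ha]

theorem tmom_modePoint {a : ℝ} (ha : a < 1) (c : ℝ) (θ : Fin K → ℝ) (θ₀ : ℝ)
    (i j : Fin (n - 2 * r)) : tmom h i j (d.modePoint a c θ θ₀) = tmom h i j x := by
  have e : ∀ y : Ph n, tmom h i j y = posT h y i * momT h y j - posT h y j * momT h y i :=
    fun _ => rfl
  rw [e, e, d.plane.wedge_eq]
  simp only [modePoint, point, posT_symm, momT_symm]
  rw [IsPlane.wedge_planeVec, conj_posAmp_mul_momAmp (sub_pos.2 ha)]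
  simp

/-- The conserved quantity that appears in the radial cubic. -/
noncomputable def shift (_ : TorusData h ε m x K) : ℝ :=
  2 * m * energy m x + ε * zvIm h ε Finset.univ x

/-- The radial curve is the energy equation (c² + N)/a + (c² + ℓ²)/(1 - a) - εP + ε²a/4 = 2mH
multiplied by a(1 - a). -/
theorem kinetic_modePoint {a c : ℝ} (ha : 0 < a) (ha' : a < 1)
    (hc : c ^ 2 = radialCubic (ε ^ 2 / 4) d.shift d.N (d.ℓ ^ 2) a) (θ : Fin K → ℝ) (θ₀ : ℝ) :
    ww h ε Finset.univ (d.modePoint a c θ θ₀) + hh h Finset.univ (d.modePoint a c θ θ₀)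
      = 2 * m * energy m x := by
  have h1 : 1 - a ≠ 0 := (sub_pos.2 ha').ne'
  rw [ww, d.vv_modePoint ha, d.zvIm_modePoint ha, d.zz_modePoint ha, d.hh_modePoint ha', hc,
    radialCubic, shift]
  field_simp
  ring

theorem energy_modePoint {a c : ℝ} (ha : 0 < a) (ha' : a < 1)
    (hc : c ^ 2 = radialCubic (ε ^ 2 / 4) d.shift d.N (d.ℓ ^ 2) a) (θ : Fin K → ℝ) (θ₀ : ℝ) :
    energy m (d.modePoint a c θ θ₀) = energy m x := by
  have hm := d.m_pos.ne'
  rw [energy_eq h ε, d.kinetic_modePoint ha ha' hc]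
  field_simp

/-- The phase of a mode as a function of the angles. -/
noncomputable def phase (u : Fin (K + 2) → ℝ) (k : Fin K) : ℝ :=
  2 * Real.pi * u k.succ.succ + d.q k (u 0)

/-- The phase of the real mode as a function of the angles. -/
noncomputable def phase₀ (u : Fin (K + 2) → ℝ) : ℝ := 2 * Real.pi * u 1 + d.q₀ (u 0)

/-- The parametrization of the invariant torus. -/
noncomputable def torus (u : Fin (K + 2) → ℝ) : Ph n :=
  d.modePoint (d.α (u 0)) (d.c (u 0)) (d.phase u) (d.phase₀ u)

/-- The moments force y to be a `modePoint`, the constraints fix its real radial data, and the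
energy puts (a, c) on the oval, which the oscillation covers. -/
theorem mem_torus_iff (y : Ph n) : y ∈ Set.range d.torus ↔ y ∈ cotangentSphere n ∧
    (∀ i j, umom h ε i j y = umom h ε i j x) ∧ (∀ i j, tmom h i j y = tmom h i j x) ∧
    energy m y = energy m x := by
  constructor
  · rintro ⟨u, rfl⟩
    obtain ⟨h0, h1⟩ := d.osc.mem (u 0)
    exact ⟨d.modePoint_mem h0 h1 _ _ _, d.umom_modePoint h0 _ _ _, d.tmom_modePoint h1 _ _ _,
      d.energy_modePoint h0 h1 (d.osc.curve _) _ _⟩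
  · rintro ⟨hy, hU, hT, hE⟩
    obtain ⟨ha, θ, hZ, hV⟩ := d.modes.exists_phase
      (Z := posZ h y) (V := momZ h ε y) (funext fun i => funext fun j => hU i j)
    obtain ⟨hg, θ₀, hG, hH⟩ := d.plane.exists_phase (G := posT h y) (H := momT h y)
      fun i j => hT i j
    set a := sqNorm (posZ h y) with hadef
    set c := (herm Finset.univ (posZ h y) (momZ h ε y)).re with hcdef
    -- The two constraints give |γ|² = 1 - a and ⟨γ, p⟩ = -c for the real part.
    have hga : posT h y ⬝ᵥ posT h y = 1 - a := by
      have h1 := dot_fst_fst h y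
      rw [hy.1] at h1
      have h2 : zz h Finset.univ y = a := rfl
      have h3 : gg h Finset.univ y = posT h y ⬝ᵥ posT h y := rfl
      rw [← h3]; linarith
    have hgc : posT h y ⬝ᵥ momT h y = -c := by
      have h1 := dot_snd_fst h ε y
      rw [hy.2] at h1
      have h2 : zv h ε Finset.univ y = c := rfl
      have h3 : gh h Finset.univ y = posT h y ⬝ᵥ momT h y := rfl
      rw [← h3]; linarith
    rw [hga] at hg hG hH
    rw [hgc] at hH
    have ha' : a < 1 := by linarith
    have hyp : y = d.modePoint a c θ θ₀ := by
      apply ph_ext h ε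
      · simp only [modePoint, point, posZ_symm]; exact hZ
      · simp only [modePoint, point, momZ_symm]; exact hV
      · simp only [modePoint, point, posT_symm]; exact hG
      · simp only [modePoint, point, momT_symm]; exact hH
    have hc : c ^ 2 = radialCubic (ε ^ 2 / 4) d.shift d.N (d.ℓ ^ 2) a := by
      have hm := d.m_pos.ne'
      have h1 : 1 - a ≠ 0 := hg.ne'
      have e1 := energy_eq h ε m y
      rw [hE, hyp, ww, d.vv_modePoint ha, d.zvIm_modePoint ha, d.zz_modePoint ha,
        d.hh_modePoint ha'] at e1
      rw [radialCubic, shift, e1]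
      field_simp
      ring
    obtain ⟨τ, hτ, hτ'⟩ := d.osc.surj a c ⟨ha, ha'⟩ hc
    -- The angles are obtained by inverting θ = 2πu + q(τ).
    refine ⟨Fin.cons τ (Fin.cons ((θ₀ - d.q₀ τ) / (2 * Real.pi))
      fun k => (θ k - d.q k τ) / (2 * Real.pi)), ?_⟩
    have hpi := Real.two_pi_pos.ne'
    rw [hyp, torus, Fin.cons_zero, hτ, hτ']
    congr 1
    · funext k
      rw [phase, Fin.cons_succ, Fin.cons_succ, Fin.cons_zero, mul_div_cancel₀ _ hpi]; ring
    · rw [phase₀, Fin.cons_zero, show (1 : Fin (K + 2)) = Fin.succ 0 from rfl, Fin.cons_succ,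
        Fin.cons_zero, mul_div_cancel₀ _ hpi]; ring

theorem exp_eq_of_posAmp {a : ℝ} (ha : 0 < a) {θ θ' : ℝ} (h : posAmp a θ = posAmp a θ') :
    ∃ z : ℤ, θ' = θ + z * (2 * Real.pi) := by
  have hs : (Real.sqrt a : ℂ) ≠ 0 := by exact_mod_cast (Real.sqrt_pos.2 ha).ne'
  have h1 := mul_left_cancel₀ hs h
  obtain ⟨z, hz⟩ := Complex.exp_eq_exp_iff_exists_int.1 h1.symm
  refine ⟨z, ?_⟩
  have := congrArg Complex.im hz
  simpa using this

theorem periodic_int {f : ℝ → ℝ} (hf : ∀ τ, f (τ + 1) = f τ) (τ : ℝ) (z : ℤ) :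
    f (τ + z) = f τ := by
  have := (show Function.Periodic f 1 from hf).int_mul z τ
  simpa using this

/-- The functions a and c determine the first angle modulo 1. Orthogonality of the modes and of the
plane basis recovers each position amplitude, hence each phase modulo 2π; the periodic parts q agree
because the first angles do modulo 1. -/
theorem torus_eq_iff (u w : Fin (K + 2) → ℝ) :
    d.torus u = d.torus w ↔ ∃ z : Fin (K + 2) → ℤ, ∀ i, w i = u i + (z i : ℝ) := by
  have hpi := Real.two_pi_pos.ne'
  constructor
  · intro huw
    obtain ⟨h0, h1⟩ := d.osc.mem (u 0)
    obtain ⟨h0', h1'⟩ := d.osc.mem (w 0)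
    have ea : d.α (u 0) = d.α (w 0) := by
      rw [← d.zz_modePoint h0 (d.c (u 0)) (d.phase u) (d.phase₀ u),
        ← d.zz_modePoint h0' (d.c (w 0)) (d.phase w) (d.phase₀ w)]
      exact congrArg _ huw
    have ec : d.c (u 0) = d.c (w 0) := by
      rw [← d.zv_modePoint h0 (d.c (u 0)) (d.phase u) (d.phase₀ u),
        ← d.zv_modePoint h0' (d.c (w 0)) (d.phase w) (d.phase₀ w)]
      exact congrArg _ huw
    obtain ⟨z, hz⟩ := d.osc.inj _ _ ea ec
    have eZ := congrArg (posZ h) huw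
    have eG := congrArg (posT h) huw
    simp only [torus, modePoint, point, posZ_symm, posT_symm] at eZ eG
    have eζ := d.modes.amp_injective eZ
    have eζ₀ := d.plane.planeVec_injective eG
    rw [← ea] at eζ₀
    have hk : ∀ k, ∃ y : ℤ, d.phase w k = d.phase u k + y * (2 * Real.pi) := fun k => by
      have := congrFun eζ k
      simp only [← ea] at this
      exact exp_eq_of_posAmp h0 this
    obtain ⟨z₀, hz₀⟩ := exp_eq_of_posAmp (sub_pos.2 h1) eζ₀
    choose y hy using hk
    refine ⟨Fin.cons z (Fin.cons z₀ y), fun i => ?_⟩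
    refine Fin.cases ?_ (fun i => Fin.cases ?_ (fun k => ?_) i) i
    · simpa using hz
    · have e1 : d.q₀ (w 0) = d.q₀ (u 0) := by rw [hz, periodic_int d.period_q₀]
      rw [phase₀, phase₀, e1] at hz₀
      have e2 : 2 * Real.pi * w 1 = 2 * Real.pi * (u 1 + z₀) := by linarith
      simpa using mul_left_cancel₀ hpi e2
    · have e1 : d.q k (w 0) = d.q k (u 0) := by rw [hz, periodic_int (d.period_q k)]
      have e3 := hy k
      rw [phase, phase, e1] at e3
      have e2 : 2 * Real.pi * w k.succ.succ = 2 * Real.pi * (u k.succ.succ + y k) := by linarith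
      simpa using mul_left_cancel₀ hpi e2
  · rintro ⟨z, hz⟩
    have e0 : w 0 = u 0 + z 0 := hz 0
    have ea : d.α (w 0) = d.α (u 0) := by rw [e0, periodic_int d.osc.period_fst]
    have ec : d.c (w 0) = d.c (u 0) := by rw [e0, periodic_int d.osc.period_snd]
    have hexp : ∀ (θ θ' : ℝ) (z : ℤ), θ' = θ + z * (2 * Real.pi) →
        Complex.exp (θ' * Complex.I) = Complex.exp (θ * Complex.I) := by
      intro θ θ' z hθ
      refine Complex.exp_eq_exp_iff_exists_int.2 ⟨z, ?_⟩
      rw [hθ]; push_cast; ring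
    have e1 : Complex.exp (d.phase₀ w * Complex.I) = Complex.exp (d.phase₀ u * Complex.I) := by
      refine hexp _ _ (z 1) ?_
      rw [phase₀, phase₀, e0, periodic_int d.period_q₀, hz 1]; ring
    have e2 : ∀ k, Complex.exp (d.phase w k * Complex.I)
        = Complex.exp (d.phase u k * Complex.I) := fun k => by
      refine hexp _ _ (z k.succ.succ) ?_
      rw [phase, phase, e0, periodic_int (d.period_q k), hz k.succ.succ]; ring
    simp only [torus, modePoint, point, posAmp, momAmp, ea, ec, e1, e2]

end TorusData

/-! ### The flow on the invariant tori -/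

/-- In the gauge momentum the magnetic term disappears and the form is canonical. -/
theorem twistedForm_block (hb : IsBlockField r κ κ₀) (s : ℝ) (u v : Ph n) :
    twistedForm s κ u v = (herm Finset.univ (momZ hb.le (s * κ₀) u) (posZ hb.le v)).re
      - (herm Finset.univ (posZ hb.le u) (momZ hb.le (s * κ₀) v)).re
      + (momT hb.le u ⬝ᵥ posT hb.le v - posT hb.le u ⬝ᵥ momT hb.le v) := by
  have e : cz hb.le (fieldMatrix κ *ᵥ v.1) = (-(Complex.I * κ₀)) • cz hb.le v.1 :=
    funext fun i => by rw [hb.cz_mulVec]; rfl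
  rw [twistedForm, dot_block hb.le, dot_block hb.le, dot_block hb.le, hb.ct_mulVec, e]
  obtain ⟨c, hc⟩ : ∃ c : ℝ, s * κ₀ = 2 * c := ⟨s * κ₀ / 2, by ring⟩
  have hcC : ((s * κ₀ : ℝ) : ℂ) / 2 = c := by rw [hc]; push_cast; ring
  have hz : ∀ w : Ph n, posZ hb.le w = cz hb.le w.1 := fun _ => rfl
  have hv : ∀ (w : Ph n) i, momZ hb.le (s * κ₀) w i
      = cz hb.le w.2 i + Complex.I * c * cz hb.le w.1 i := fun _ _ => by rw [← hcC]; rfl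
  have hg : ∀ w : Ph n, posT hb.le w = ct hb.le w.1 := fun _ => rfl
  have hh : ∀ w : Ph n, momT hb.le w = ct hb.le w.2 := fun _ => rfl
  simp only [herm, hz, hg, hh, hv, dotProduct, Pi.smul_apply, smul_eq_mul, Pi.zero_apply, mul_zero,
    Finset.sum_const_zero, add_zero, Complex.re_sum, Finset.mul_sum]
  have key : ∀ i, (conj (cz hb.le u.2 i + Complex.I * c * cz hb.le u.1 i)
        * cz hb.le v.1 i).re
      - (conj (cz hb.le u.1 i) * (cz hb.le v.2 i
        + Complex.I * c * cz hb.le v.1 i)).re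
      = (conj (cz hb.le u.2 i) * cz hb.le v.1 i).re - (conj (cz hb.le u.1 i) * cz hb.le v.2 i).re
        + s * (conj (cz hb.le u.1 i) * (-(Complex.I * κ₀) * cz hb.le v.1 i)).re := by
    intro i
    simp only [map_add, map_mul, Complex.conj_I, Complex.conj_ofReal, Complex.add_re,
      Complex.add_im, Complex.mul_re, Complex.mul_im, Complex.neg_re, Complex.neg_im,
      Complex.I_re, Complex.I_im, Complex.ofReal_re, Complex.ofReal_im, Complex.conj_re,
      Complex.conj_im]
    linear_combination (-(cz hb.le u.1 i).re * (cz hb.le v.1 i).im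
      + (cz hb.le u.1 i).im * (cz hb.le v.1 i).re) * hc
  have := Finset.sum_congr (rfl : (Finset.univ : Finset (Fin r)) = _) fun i _ => key i
  simp only [Finset.sum_sub_distrib, Finset.sum_add_distrib] at this
  linarith

namespace TorusData

variable {h : 2 * r ≤ n} {ε m : ℝ} {x : Ph n} {K : ℕ} (d : TorusData h ε m x K)

theorem sum_smul_eq (A : Fin K → Fin r → ℂ) (ζ : Fin K → ℂ) (c : ℝ) :
    ∑ k, (c • ζ) k • A k = c • ∑ k, ζ k • A k := by
  rw [Finset.smul_sum]
  exact Finset.sum_congr rfl fun k _ => by rw [Pi.smul_apply, smul_assoc]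

/-- The point with given amplitudes, as a continuous linear map. -/
noncomputable def pointMap : (Fin K → ℂ) × (Fin K → ℂ) × ℂ × ℂ →L[ℝ] Ph n :=
  LinearMap.toContinuousLinearMap <| IsLinearMap.mk'
    (fun p => d.point p.1 p.2.1 p.2.2.1 p.2.2.2)
    { map_add := fun p q => by
        simp only [point]
        rw [← map_add]
        refine congrArg _ (Prod.ext ?_ (Prod.ext ?_ (Prod.ext ?_ ?_)))
        · simp [add_smul, Finset.sum_add_distrib]
        · simp [add_smul, Finset.sum_add_distrib]
        · exact (planeMap d.D₀ d.D₁).map_add _ _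
        · exact (planeMap d.D₀ d.D₁).map_add _ _
      map_smul := fun c p => by
        simp only [point]
        rw [← map_smul]
        refine congrArg _ (Prod.ext ?_ (Prod.ext ?_ (Prod.ext ?_ ?_)))
        · exact sum_smul_eq _ _ _
        · exact sum_smul_eq _ _ _
        · exact (planeMap d.D₀ d.D₁).map_smul _ _
        · exact (planeMap d.D₀ d.D₁).map_smul _ _ }

theorem pointMap_apply (ζ η : Fin K → ℂ) (ζ₀ η₀ : ℂ) :
    d.pointMap (ζ, η, ζ₀, η₀) = d.point ζ η ζ₀ η₀ := rfl

theorem hasDerivAt_point {ζ η : ℝ → Fin K → ℂ} {ζ₀ η₀ : ℝ → ℂ} {ζ' η' : Fin K → ℂ}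
    {ζ₀' η₀' : ℂ} {t : ℝ} (h1 : ∀ k, HasDerivAt (fun t => ζ t k) (ζ' k) t)
    (h2 : ∀ k, HasDerivAt (fun t => η t k) (η' k) t) (h3 : HasDerivAt ζ₀ ζ₀' t)
    (h4 : HasDerivAt η₀ η₀' t) :
    HasDerivAt (fun t => d.point (ζ t) (η t) (ζ₀ t) (η₀ t)) (d.point ζ' η' ζ₀' η₀') t := by
  have h5 : HasDerivAt (fun t => (ζ t, η t, ζ₀ t, η₀ t)) (ζ', η', ζ₀', η₀') t :=
    (hasDerivAt_pi.2 h1).prodMk ((hasDerivAt_pi.2 h2).prodMk (h3.prodMk h4))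
  have h6 := d.pointMap.hasFDerivAt.comp_hasDerivAt t h5
  simpa only [Function.comp_def, pointMap_apply] using h6

theorem contDiff_posAmp {E : Type*} [NormedAddCommGroup E] [NormedSpace ℝ E] {a θ : E → ℝ}
    (ha : ContDiff ℝ ∞ a) (hθ : ContDiff ℝ ∞ θ) (h0 : ∀ u, 0 < a u) :
    ContDiff ℝ ∞ fun u => posAmp (a u) (θ u) := by
  have h1 : ContDiff ℝ ∞ fun u => ((Real.sqrt (a u) : ℝ) : ℂ) :=
    Complex.ofRealCLM.contDiff.comp (ha.sqrt fun u => (h0 u).ne')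
  have h2 : ContDiff ℝ ∞ fun u => ((θ u : ℝ) : ℂ) := Complex.ofRealCLM.contDiff.comp hθ
  exact h1.mul (h2.mul contDiff_const).cexp

theorem contDiff_momAmp {E : Type*} [NormedAddCommGroup E] [NormedSpace ℝ E] {a c θ : E → ℝ}
    (ha : ContDiff ℝ ∞ a) (hc : ContDiff ℝ ∞ c) (hθ : ContDiff ℝ ∞ θ) (h0 : ∀ u, 0 < a u)
    (ν : ℝ) : ContDiff ℝ ∞ fun u => momAmp (a u) (c u) ν (θ u) := by
  have h1 : ContDiff ℝ ∞ fun u => ((a u : ℝ) : ℂ) := Complex.ofRealCLM.contDiff.comp ha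
  have h2 : ContDiff ℝ ∞ fun u => ((c u : ℝ) : ℂ) := Complex.ofRealCLM.contDiff.comp hc
  have h3 : ∀ u, ((a u : ℝ) : ℂ) ≠ 0 := fun u => by exact_mod_cast (h0 u).ne'
  have : (fun u => momAmp (a u) (c u) ν (θ u))
      = fun u => (c u + Complex.I * ν : ℂ) / (a u : ℂ) * posAmp (a u) (θ u) :=
    funext fun u => momAmp_eq (h0 u) _ _ _
  rw [this]
  exact ((h2.add contDiff_const).mul (h1.inv h3)).mul (contDiff_posAmp ha hθ h0)

theorem contDiff_torus : ContDiff ℝ ∞ d.torus := by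
  have e0 : ContDiff ℝ ∞ fun u : Fin (K + 2) → ℝ => u 0 := contDiff_apply ℝ ℝ 0
  have ha : ContDiff ℝ ∞ fun u : Fin (K + 2) → ℝ => d.α (u 0) := d.osc.smooth_fst.comp e0
  have hc : ContDiff ℝ ∞ fun u : Fin (K + 2) → ℝ => d.c (u 0) := d.osc.smooth_snd.comp e0
  have hθ : ∀ k, ContDiff ℝ ∞ fun u => d.phase u k := fun k =>
    (contDiff_const.mul (contDiff_apply ℝ ℝ k.succ.succ)).add ((d.smooth_q k).comp e0)
  have hθ₀ : ContDiff ℝ ∞ d.phase₀ :=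
    (contDiff_const.mul (contDiff_apply ℝ ℝ 1)).add (d.smooth_q₀.comp e0)
  have p0 := fun u : Fin (K + 2) → ℝ => (d.osc.mem (u 0)).1
  have p1 := fun u : Fin (K + 2) → ℝ => sub_pos.2 (d.osc.mem (u 0)).2
  have hb : ContDiff ℝ ∞ fun u : Fin (K + 2) → ℝ => 1 - d.α (u 0) := contDiff_const.sub ha
  have h1 : ContDiff ℝ ∞ fun u => fun k => posAmp (d.α (u 0)) (d.phase u k) :=
    contDiff_pi.2 fun k => contDiff_posAmp ha (hθ k) p0
  have h2 : ContDiff ℝ ∞ fun u => fun k => momAmp (d.α (u 0)) (d.c (u 0)) (d.ν k) (d.phase u k) :=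
    contDiff_pi.2 fun k => contDiff_momAmp ha hc (hθ k) p0 _
  have h3 := contDiff_posAmp hb hθ₀ p1
  have h4 : ContDiff ℝ ∞ fun u => momAmp (1 - d.α (u 0)) (-d.c (u 0)) d.ℓ (d.phase₀ u) :=
    contDiff_momAmp hb hc.neg hθ₀ p1 _
  have h5 := d.pointMap.contDiff.comp (h1.prodMk (h2.prodMk (h3.prodMk h4)))
  exact h5

/-- The direction of the flow on the torus. -/
noncomputable def flowDir : Fin (K + 2) → ℝ :=
  Fin.cons (1 / d.T) (Fin.cons (d.M₀ / (2 * Real.pi * d.T))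
    fun k => d.M k / (2 * Real.pi * d.T))

/-- Moving the first angle at rate 1/T runs the radial oscillation in true time. The drift M/(2πT)
of each other angle plus the derivative of the periodic part q restores the exact rate of the phase.
-/
theorem hasDerivAt_torus_flowDir (hb : IsBlockField r κ κ₀) (s : ℝ)
    (d : TorusData hb.le (s * κ₀) m x K) (u : Fin (K + 2) → ℝ) (t : ℝ) :
    HasDerivAt (fun τ : ℝ => d.torus (u + τ • d.flowDir))
      (magneticField m s κ (d.torus (u + t • d.flowDir))) t := by
  have hm := d.m_pos.ne'
  have hT := d.osc.pos.ne'
  have hpi := Real.two_pi_pos.ne'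
  set w := u + t • d.flowDir with hw
  obtain ⟨p0, p1⟩ := d.osc.mem (w 0)
  have p1' := sub_pos.2 p1
  have h0 : HasDerivAt (fun τ : ℝ => (u + τ • d.flowDir) 0) (1 / d.T) t := by
    simpa [flowDir] using ((hasDerivAt_id t).mul_const (1 / d.T)).const_add (u 0)
  have h1 : HasDerivAt (fun τ : ℝ => (u + τ • d.flowDir) 1) (d.M₀ / (2 * Real.pi * d.T)) t := by
    have e : d.flowDir 1 = d.M₀ / (2 * Real.pi * d.T) := rfl
    simpa [e] using ((hasDerivAt_id t).mul_const (d.M₀ / (2 * Real.pi * d.T))).const_add (u 1)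
  have h2 : ∀ k : Fin K, HasDerivAt (fun τ : ℝ => (u + τ • d.flowDir) k.succ.succ)
      (d.M k / (2 * Real.pi * d.T)) t := fun k => by
    simpa [flowDir] using
      ((hasDerivAt_id t).mul_const (d.M k / (2 * Real.pi * d.T))).const_add (u k.succ.succ)
  have ha : HasDerivAt (fun τ : ℝ => d.α ((u + τ • d.flowDir) 0)) (2 * d.c (w 0) / m) t :=
    ((d.osc.deriv_fst (w 0)).comp t h0).congr_deriv (by field_simp)
  have hc : HasDerivAt (fun τ : ℝ => d.c ((u + τ • d.flowDir) 0))
      (radialCubic' ((s * κ₀) ^ 2 / 4) d.shift d.N (d.ℓ ^ 2) (d.α (w 0)) / m) t :=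
    ((d.osc.deriv_snd (w 0)).comp t h0).congr_deriv (by rw [shift]; field_simp)
  have hψ : ∀ k, HasDerivAt (fun τ : ℝ => d.phase (u + τ • d.flowDir) k)
      ((d.ν k / d.α (w 0) - (s * κ₀) / 2) / m) t := fun k =>
    (((h2 k).const_mul (2 * Real.pi)).add ((d.deriv_q k (w 0)).comp t h0)).congr_deriv
      (by field_simp; ring)
  -- The summand 0 / 2 matches `hasDerivAt_amp` with zero field strength, as the real block carries
  -- no field.
  have hψ₀ : HasDerivAt (fun τ : ℝ => d.phase₀ (u + τ • d.flowDir))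
      ((d.ℓ / (1 - d.α (w 0)) - 0 / 2) / m) t :=
    ((h1.const_mul (2 * Real.pi)).add ((d.deriv_q₀ (w 0)).comp t h0)).congr_deriv
      (by field_simp; ring)
  -- On the torus the multiplier is an affine function of a, since the kinetic energy and Im⟨z, v⟩
  -- are constant there.
  have hmul : m * multiplier m s κ (d.torus w) = (s * κ₀) ^ 2 / 2 * d.α (w 0) - d.shift := by
    rw [multiplier_eq hb, torus, d.kinetic_modePoint p0 p1 (d.osc.curve _),
      d.zvIm_modePoint p0, d.zz_modePoint p0, shift]
    field_simp
    ring
  have hcurve : d.c (w 0) ^ 2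
    = radialCubic ((s * κ₀) ^ 2 / 4) d.shift d.N (d.ℓ ^ 2) (d.α (w 0)) := d.osc.curve _
  have hA := fun k => hasDerivAt_amp (a := fun τ : ℝ => d.α ((u + τ • d.flowDir) 0))
    (c := fun τ : ℝ => d.c ((u + τ • d.flowDir) 0)) (lam := m * multiplier m s κ (d.torus w) - (s * κ₀) ^ 2 / 4)
    hm p0 ha (hψ k) hc (by
      simp only [← hw]
      rw [hcurve, d.modes.freq_sq, hmul, radialCubic, radialCubic']; field_simp; ring)
  -- The real plane behaves as a mode with squared radius 1 - a, radial momentum -c and frequency ℓ.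
  have hB := hasDerivAt_amp (a := fun τ : ℝ => 1 - d.α ((u + τ • d.flowDir) 0))
    (c := fun τ : ℝ => -d.c ((u + τ • d.flowDir) 0))
    (lam := m * multiplier m s κ (d.torus w)) hm p1'
    ((ha.const_sub 1).congr_deriv (g' := 2 * (-d.c (w 0)) / m) (by ring)) hψ₀ hc.neg (by
      simp only [← hw]
      rw [neg_sq, hcurve, hmul, radialCubic, radialCubic']; field_simp; ring)
  refine (d.hasDerivAt_point (fun k => (hA k).1) (fun k => (hA k).2) hB.1 hB.2).congr_deriv ?_
  apply (phEquiv hb.le (s * κ₀)).injective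
  rw [phEquiv_magneticField hb hm, point, LinearEquiv.apply_symm_apply]
  simp only [← hw]
  refine Prod.ext ?_ (Prod.ext ?_ (Prod.ext ?_ ?_))
  · simp only [torus, modePoint, point, posZ_symm, momZ_symm, Finset.smul_sum, smul_smul,
      ← Finset.sum_sub_distrib, ← sub_smul]
    refine Finset.sum_congr rfl fun k _ => ?_
    congr 1
    push_cast
    ring
  · have e : (m * multiplier m s κ (d.torus w) - (s * κ₀) ^ 2 / 4 : ℝ)
      = m * multiplier m s κ (d.torus w) - (s * κ₀) ^ 2 / 4 := rfl
    generalize m * multiplier m s κ (d.torus w) - (s * κ₀) ^ 2 / 4 = lam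
    simp only [torus, modePoint, point, posZ_symm, momZ_symm, Finset.smul_sum, smul_smul,
      ← Finset.sum_add_distrib, ← add_smul]
    refine Finset.sum_congr rfl fun k _ => ?_
    congr 1
    push_cast
    ring
  · simp only [torus, modePoint, point, momT_symm]
    refine Eq.trans ?_ ((planeMap d.D₀ d.D₁).map_smul (1 / m) _)
    refine congrArg (planeMap d.D₀ d.D₁) ?_
    rw [Complex.real_smul]
    push_cast
    ring
  · generalize multiplier m s κ (d.torus w) = lam
    simp only [torus, modePoint, point, posT_symm]
    refine Eq.trans ?_ ((planeMap d.D₀ d.D₁).map_smul lam _)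
    refine congrArg (planeMap d.D₀ d.D₁) ?_
    rw [Complex.real_smul]
    have hmC : (m : ℂ) ≠ 0 := by exact_mod_cast hm
    push_cast
    field_simp
    ring

/-- The tangent vector of the torus along which the phases of the modes move with given speeds. -/
noncomputable def modeVec (u : Fin (K + 2) → ℝ) (b : Fin K → ℝ) (b₀ : ℝ) : Ph n :=
  d.point (fun k => b k * Complex.I * posAmp (d.α (u 0)) (d.phase u k))
    (fun k => b k * Complex.I * momAmp (d.α (u 0)) (d.c (u 0)) (d.ν k) (d.phase u k))
    (b₀ * Complex.I * posAmp (1 - d.α (u 0)) (d.phase₀ u))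
    (b₀ * Complex.I * momAmp (1 - d.α (u 0)) (-d.c (u 0)) d.ℓ (d.phase₀ u))

theorem fderiv_torus_of_hasDerivAt {u w : Fin (K + 2) → ℝ} {y : Ph n}
    (hy : HasDerivAt (fun τ : ℝ => d.torus (u + τ • w)) y 0) : fderiv ℝ d.torus u w = y := by
  have h1 : HasFDerivAt d.torus (fderiv ℝ d.torus u) (u + (0 : ℝ) • w) := by
    rw [zero_smul, add_zero]
    exact (d.contDiff_torus.differentiable (by simp) u).hasFDerivAt
  have h2 : HasDerivAt (fun τ : ℝ => u + τ • w) w 0 := by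
    simpa using ((hasDerivAt_id (0 : ℝ)).smul_const w).const_add u
  have h3 := h1.comp_hasDerivAt (0 : ℝ) h2
  rw [Function.comp_def] at h3
  exact h3.unique hy

theorem fderiv_torus_mode {u w : Fin (K + 2) → ℝ} (hw : w 0 = 0) : fderiv ℝ d.torus u w =
    d.modeVec u (fun k => 2 * Real.pi * w k.succ.succ) (2 * Real.pi * w 1) := by
  apply d.fderiv_torus_of_hasDerivAt
  have e0 : ∀ τ : ℝ, (u + τ • w) 0 = u 0 := fun τ => by simp [hw]
  have hk : ∀ k, HasDerivAt (fun τ : ℝ => d.phase (u + τ • w) k)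
      (2 * Real.pi * w k.succ.succ) 0 := fun k => by
    simp only [phase, e0]
    have := ((((hasDerivAt_id (0 : ℝ)).mul_const (w k.succ.succ)).const_add
      (u k.succ.succ)).const_mul (2 * Real.pi)).add_const (d.q k (u 0))
    simpa using this
  have h0 : HasDerivAt (fun τ : ℝ => d.phase₀ (u + τ • w)) (2 * Real.pi * w 1) 0 := by
    simp only [phase₀, e0]
    have := ((((hasDerivAt_id (0 : ℝ)).mul_const (w 1)).const_add
      (u 1)).const_mul (2 * Real.pi)).add_const (d.q₀ (u 0))
    simpa using this
  have hexp : ∀ (z : ℂ) {θ : ℝ → ℝ} {θ' : ℝ}, HasDerivAt θ θ' 0 →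
      HasDerivAt (fun τ => z * Complex.exp (θ τ * Complex.I))
        (θ' * Complex.I * (z * Complex.exp (θ 0 * Complex.I))) 0 := by
    intro z θ θ' hθ
    exact (((hθ.ofReal_comp.mul_const Complex.I).cexp).const_mul z).congr_deriv (by ring)
  have key := d.hasDerivAt_point (fun k => hexp (Real.sqrt (d.α (u 0)) : ℂ) (hk k))
    (fun k => hexp ((d.c (u 0) + Complex.I * d.ν k) / (Real.sqrt (d.α (u 0)) : ℂ)) (hk k))
    (hexp (Real.sqrt (1 - d.α (u 0)) : ℂ) h0)
    (hexp (((-d.c (u 0) : ℝ) + Complex.I * d.ℓ) / (Real.sqrt (1 - d.α (u 0)) : ℂ)) h0)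
  have e1 : (fun τ : ℝ => d.torus (u + τ • w)) = fun τ => d.point
      (fun k => (Real.sqrt (d.α (u 0)) : ℂ) * Complex.exp (d.phase (u + τ • w) k * Complex.I))
      (fun k => ((d.c (u 0) + Complex.I * d.ν k) / (Real.sqrt (d.α (u 0)) : ℂ))
        * Complex.exp (d.phase (u + τ • w) k * Complex.I))
      ((Real.sqrt (1 - d.α (u 0)) : ℂ) * Complex.exp (d.phase₀ (u + τ • w) * Complex.I))
      ((((-d.c (u 0) : ℝ) + Complex.I * d.ℓ) / (Real.sqrt (1 - d.α (u 0)) : ℂ))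
        * Complex.exp (d.phase₀ (u + τ • w) * Complex.I)) := by
    funext τ
    rw [torus, e0]; rfl
  rw [e1]
  refine key.congr_deriv ?_
  simp only [zero_smul, add_zero]
  rfl

/-- Subtracting w₀ T times the flow direction removes the radial component, and what is left moves
only phases. This avoids an explicit radial tangent vector. -/
theorem fderiv_torus (hb : IsBlockField r κ κ₀) (s : ℝ) (d : TorusData hb.le (s * κ₀) m x K)
    (u w : Fin (K + 2) → ℝ) : ∃ (b : Fin K → ℝ) (b₀ : ℝ), fderiv ℝ d.torus u w =
      (w 0 * d.T) • magneticField m s κ (d.torus u) + d.modeVec u b b₀ := by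
  have hT := d.osc.pos.ne'
  have hf : fderiv ℝ d.torus u d.flowDir = magneticField m s κ (d.torus u) := by
    apply d.fderiv_torus_of_hasDerivAt
    have := hasDerivAt_torus_flowDir hb s d u 0
    rwa [zero_smul, add_zero] at this
  have e : w = (w 0 * d.T) • d.flowDir + (w - (w 0 * d.T) • d.flowDir) := by abel
  refine ⟨fun k => 2 * Real.pi * (w - (w 0 * d.T) • d.flowDir) k.succ.succ,
    2 * Real.pi * (w - (w 0 * d.T) • d.flowDir) 1, ?_⟩
  conv_lhs => rw [e]
  rw [map_add, map_smul, hf, d.fderiv_torus_mode (by simp [flowDir, hT])]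

theorem modeVec_eq_zero {u : Fin (K + 2) → ℝ} {b : Fin K → ℝ} {b₀ : ℝ}
    (hv : d.modeVec u b b₀ = 0) : (∀ k, b k = 0) ∧ b₀ = 0 := by
  obtain ⟨p0, p1⟩ := d.osc.mem (u 0)
  have p1' := sub_pos.2 p1
  have hamp : ∀ {a : ℝ} (_ : 0 < a) (b θ : ℝ), (b : ℂ) * Complex.I * posAmp a θ = 0 → b = 0 := by
    intro a ha b θ h0
    have h1 : posAmp a θ ≠ 0 := mul_ne_zero
      (by exact_mod_cast (Real.sqrt_pos.2 ha).ne') (Complex.exp_ne_zero _)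
    simpa [h1, Complex.I_ne_zero] using h0
  have eZ := congrArg (posZ h) hv
  have eG := congrArg (posT h) hv
  simp only [modeVec, point, posZ_symm, posT_symm, map_zero] at eZ eG
  constructor
  · intro k
    have := congrFun (d.modes.amp_injective (η := 0) (eZ.trans (by simp))) k
    exact hamp p0 _ _ this
  · exact hamp p1' _ _ (d.plane.planeVec_injective (η := 0)
      (eG.trans ((planeMap d.D₀ d.D₁).map_zero).symm))

/-- The functions |z|² and Re⟨z, v⟩ depend on the first angle alone. Their derivatives do not vanish
together: where c = 0, the cubic has nonzero slope. So a kernel vector has no radial component, and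
the phases move independently. -/
theorem fderiv_torus_injective (u : Fin (K + 2) → ℝ) :
    Function.Injective (fderiv ℝ d.torus u) := by
  refine (injective_iff_map_eq_zero _).2 fun w hw => ?_
  have hm := d.m_pos.ne'
  have hT := d.osc.pos.ne'
  have hd := (d.contDiff_torus.differentiable (by simp) u).hasFDerivAt
  have key : ∀ {F : Ph n → ℝ} {f : ℝ → ℝ} {f' : ℝ}, ContDiff ℝ ∞ F →
      (∀ u, F (d.torus u) = f (u 0)) → HasDerivAt f f' (u 0) → f' * w 0 = 0 := by
    intro F f f' hF he hf
    have h1 : HasFDerivAt (fun u => F (d.torus u)) ((fderiv ℝ F (d.torus u)).comp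
        (fderiv ℝ d.torus u)) u :=
      (hF.differentiable (by simp) _).hasFDerivAt.comp u hd
    have h2 : HasFDerivAt (fun u : Fin (K + 2) → ℝ => f (u 0))
        ((ContinuousLinearMap.toSpanSingleton ℝ f').comp
          (ContinuousLinearMap.proj (R := ℝ) (φ := fun _ : Fin (K + 2) => ℝ) 0)) u :=
      hf.hasFDerivAt.comp u
        (ContinuousLinearMap.proj (R := ℝ) (φ := fun _ : Fin (K + 2) => ℝ) 0).hasFDerivAt
    simp only [he] at h1
    have := congrArg (fun L : (Fin (K + 2) → ℝ) →L[ℝ] ℝ => L w) (h1.unique h2)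
    simp only [ContinuousLinearMap.comp_apply, hw, map_zero] at this
    simpa [mul_comm] using this.symm
  have k1 := key (contDiff_zz h Finset.univ)
    (fun u => d.zz_modePoint (d.osc.mem (u 0)).1 _ _ _) (d.osc.deriv_fst (u 0))
  have k2 := key (contDiff_zv h ε Finset.univ)
    (fun u => d.zv_modePoint (d.osc.mem (u 0)).1 _ _ _) (d.osc.deriv_snd (u 0))
  have hw0 : w 0 = 0 := by
    by_contra h0
    have c0 : d.c (u 0) = 0 := by
      rcases mul_eq_zero.1 k1 with h1 | h1
      · simpa [hT, hm] using h1
      · exact absurd h1 h0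
    rcases mul_eq_zero.1 k2 with h1 | h1
    · rcases mul_eq_zero.1 h1 with h2 | h2
      · exact hT h2
      · exact d.osc.regular _ c0 ((div_eq_zero_iff.1 h2).resolve_right hm)
    · exact h0 h1
  rw [d.fderiv_torus_mode hw0] at hw
  obtain ⟨h1, h2⟩ := d.modeVec_eq_zero hw
  have hpi := Real.two_pi_pos.ne'
  funext i
  refine Fin.cases hw0 (fun i => Fin.cases ?_ (fun k => ?_) i) i
  · exact (mul_eq_zero.1 h2).resolve_left hpi
  · exact (mul_eq_zero.1 (h1 k)).resolve_left hpi

theorem torus_mem (u : Fin (K + 2) → ℝ) : d.torus u ∈ cotangentSphere n :=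
  ((d.mem_torus_iff _).1 ⟨u, rfl⟩).1

theorem diff_fderiv_torus {F : Ph n → ℝ} (hF : ContDiff ℝ ∞ F) {c : ℝ}
    (he : ∀ u, F (d.torus u) = c) (u w : Fin (K + 2) → ℝ) :
    diff F (d.torus u) (fderiv ℝ d.torus u w) = 0 := by
  have hd := (d.contDiff_torus.differentiable (by simp) u).hasFDerivAt
  have h1 : HasFDerivAt (fun u => F (d.torus u)) ((fderiv ℝ F (d.torus u)).comp
      (fderiv ℝ d.torus u)) u :=
    (hF.differentiable (by simp) _).hasFDerivAt.comp u hd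
  simp only [he] at h1
  exact congrArg (fun L : (Fin (K + 2) → ℝ) →L[ℝ] ℝ => L w) (h1.unique (hasFDerivAt_const c u))

theorem fderiv_torus_mem (u w : Fin (K + 2) → ℝ) :
    fderiv ℝ d.torus u w ∈ tangentAt (d.torus u) :=
  mem_tangentAt_iff.2 ⟨d.diff_fderiv_torus (contDiff_dot contDiff_fst contDiff_fst) (fun u => (d.torus_mem u).1) u w,
    d.diff_fderiv_torus (contDiff_dot contDiff_snd contDiff_fst) (fun u => (d.torus_mem u).2) u w⟩

/-- Orthogonality of the modes leaves one term for each mode, in which a common factor b b'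
multiplies the difference of Re⟨η, ζ⟩ and Re⟨ζ, η⟩. -/
theorem twistedForm_modeVec (hb : IsBlockField r κ κ₀) (s : ℝ)
    (d : TorusData hb.le (s * κ₀) m x K) (u : Fin (K + 2) → ℝ) (b b' : Fin K → ℝ) (b₀ b₀' : ℝ) :
    twistedForm s κ (d.modeVec u b b₀) (d.modeVec u b' b₀') = 0 := by
  have hre : ∀ (b b' : ℝ) (ζ η : ℂ), (conj (b * Complex.I * ζ) * (b' * Complex.I * η)).re
      = b * b' * (conj ζ * η).re := by
    intro b b' ζ η
    simp
    ring
  rw [twistedForm_block hb]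
  simp only [modeVec, point, posZ_symm, momZ_symm, posT_symm, momT_symm, d.modes.herm_amp,
    d.plane.dot_planeVec, Complex.re_sum, Complex.re_mul_ofReal, hre]
  rw [← Finset.sum_sub_distrib]
  have hsym : ∀ ζ η : ℂ, (conj ζ * η).re = (conj η * ζ).re := fun ζ η => by
    simp; ring
  rw [Finset.sum_eq_zero, hsym]
  · ring
  · intro k _
    rw [hsym]; ring

/-- The flow direction pairs with a tangent vector to minus the derivative of H, which is constant
on the torus; the remaining directions only move phases. -/
theorem isotropic_torus (hb : IsBlockField r κ κ₀) (s : ℝ) (d : TorusData hb.le (s * κ₀) m x K)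
    (u v w : Fin (K + 2) → ℝ) :
    twistedForm s κ (fderiv ℝ d.torus u v) (fderiv ℝ d.torus u w) = 0 := by
  have hH : ∀ w, twistedForm s κ (magneticField m s κ (d.torus u)) (fderiv ℝ d.torus u w) = 0 :=
    fun w => by
      rw [twistedForm_magneticField m s κ (d.fderiv_torus_mem u w),
        d.diff_fderiv_torus (contDiff_energy m)
          (fun u => ((d.mem_torus_iff _).1 ⟨u, rfl⟩).2.2.2), neg_zero]
  obtain ⟨b, b₀, e1⟩ := fderiv_torus hb s d u v
  obtain ⟨b', b₀', e2⟩ := fderiv_torus hb s d u w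
  have h1 : twistedForm s κ (magneticField m s κ (d.torus u)) (d.modeVec u b b₀) = 0 := by
    have := hH v
    rw [e1, twistedForm_add_right, twistedForm_smul_right] at this
    have h2 := twistedForm_antisymm s κ (magneticField m s κ (d.torus u))
      (magneticField m s κ (d.torus u))
    replace h2 : twistedForm s κ (magneticField m s κ (d.torus u))
      (magneticField m s κ (d.torus u)) = 0 := by linarith
    rw [h2] at this
    linarith
  rw [e1, twistedForm_add_left, twistedForm_smul_left, hH, e2, twistedForm_add_right,
    twistedForm_smul_right, twistedForm_modeVec hb, twistedForm_antisymm, h1]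
  ring

end TorusData

/-! ### Generic motions -/

/-- The nonvanishing orthogonal Casimir function gives the plane; the oscillation and then the
periodic parts of the phases follow from the radial cubic. -/
theorem nonempty_torusData (h : 2 * r ≤ n) {ε m : ℝ} (hε : ε ≠ 0) (hm : 0 < m) {x : Ph n}
    (hx : x ∈ cotangentSphere n) {K : ℕ} {N : ℝ} {A : Fin K → Fin r → ℂ} {ν : Fin K → ℝ}
    (modes : IsModes (posZ h x) (momZ h ε x) N A ν) (hz : 0 < zz h Finset.univ x)
    (hT : casT h Finset.univ x ≠ 0) (hzv : zv h ε Finset.univ x ≠ 0) :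
    Nonempty (TorusData h ε m x K) := by
  have hdot : ∀ u w : Fin (n - 2 * r) → ℝ, ∑ j, u j * w j = u ⬝ᵥ w := fun _ _ => rfl
  have hcas : casT h Finset.univ x = (posT h x ⬝ᵥ posT h x) * (momT h x ⬝ᵥ momT h x)
    - (posT h x ⬝ᵥ momT h x) ^ 2 := rfl
  have hpos : 0 < casT h Finset.univ x := by
    refine lt_of_le_of_ne ?_ hT.symm
    have h1 := sum_sq_tmom h Finset.univ x
    have h2 : 0 ≤ ∑ i, ∑ j, tmom h i j x ^ 2 :=
      Finset.sum_nonneg fun _ _ => Finset.sum_nonneg fun _ _ => sq_nonneg _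
    linarith
  obtain ⟨D₀, D₁, plane⟩ := exists_isPlane (hcas ▸ hpos)
  set ℓ := Real.sqrt ((posT h x ⬝ᵥ posT h x) * (momT h x ⬝ᵥ momT h x)
    - (posT h x ⬝ᵥ momT h x) ^ 2) with hℓ
  have hℓ2 : ℓ ^ 2 = casT h Finset.univ x := plane.sq
  have hgg : gg h Finset.univ x = 1 - zz h Finset.univ x := by
    have := dot_fst_fst h x; rw [hx.1] at this; linarith
  have hgh : gh h Finset.univ x = -zv h ε Finset.univ x := by
    have := dot_snd_fst h ε x; rw [hx.2] at this; linarith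
  have hgpos : 0 < gg h Finset.univ x := by
    have h0 : 0 ≤ gg h Finset.univ x := Finset.sum_nonneg fun _ _ => mul_self_nonneg _
    refine lt_of_le_of_ne h0 fun h1 => ?_
    rw [casT, ← h1] at hpos
    nlinarith [sq_nonneg (gh h Finset.univ x)]
  have hN : N = zz h Finset.univ x * vv h ε Finset.univ x - zv h ε Finset.univ x ^ 2 :=
    modes.eq_sq
  -- The point itself lies on the radial curve, so f(a) = c² there; the generic condition c ≠ 0
  -- keeps it away from the turning points.
  have hf : 0 < radialCubic (ε ^ 2 / 4) (2 * m * energy m x + ε * zvIm h ε Finset.univ x) N (ℓ ^ 2)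
      (zz h Finset.univ x) := by
    have e : radialCubic (ε ^ 2 / 4) (2 * m * energy m x + ε * zvIm h ε Finset.univ x) N (ℓ ^ 2)
        (zz h Finset.univ x) = zv h ε Finset.univ x ^ 2 := by
      have hmz := hm.ne'
      rw [radialCubic, hℓ2, casT, hN, energy_eq h ε, ww, hgg, hgh]
      field_simp
      ring
    rw [e]; positivity
  obtain ⟨T, α, c, osc⟩ := exists_isOscillation hm (by positivity : 0 < ε ^ 2 / 4) modes.pos
    (pow_pos plane.pos 2) hz (by linarith) hf
  have hα : ∀ τ, α τ ≠ 0 := fun τ => (osc.mem τ).1.ne'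
  have hα' : ∀ τ, 1 - α τ ≠ 0 := fun τ => (sub_pos.2 (osc.mem τ).2).ne'
  have hq := fun k => exists_periodic_primitive (f := fun τ => T * ((ν k / α τ - ε / 2) / m))
    (contDiff_const.mul (((contDiff_const.div osc.smooth_fst hα).sub contDiff_const).div_const m))
    (fun τ => by rw [osc.period_fst])
  obtain ⟨q₀, M₀, s0, p0, d0⟩ := exists_periodic_primitive (f := fun τ => T * (ℓ / (1 - α τ) / m))
    (contDiff_const.mul ((contDiff_const.div (contDiff_const.sub osc.smooth_fst) hα').div_const m))
    (fun τ => by rw [osc.period_fst])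
  choose q M s1 p1 d1 using hq
  exact ⟨⟨N, A, ν, D₀, D₁, ℓ, T, α, c, q, M, q₀, M₀, hm, hx, modes, plane, osc, s1, p1, d1, s0,
    p0, d0⟩⟩

/-- For r = 1 the vectors z and v are proportional and there is one mode. For r ≥ 2 the generic
condition is strict Cauchy–Schwarz for z and v, and there are two. The radial angle and the real
phase add two dimensions. -/
theorem exists_torusData (hb : IsBlockField r κ κ₀) (hr : 1 ≤ r) {m s : ℝ} (hm : 0 < m)
    (hε : s * κ₀ ≠ 0) {x : Ph n} (hx : x ∈ cotangentSphere n)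
    (hgen : ∀ i, genericFunction hb.le (s * κ₀) i x ≠ 0) :
    ∃ K, K + 2 = (if r = 1 then 3 else 4) ∧ Nonempty (TorusData hb.le (s * κ₀) m x K) := by
  have hz := zz_univ_ne_zero hb.le hr (hgen (Sum.inr (Sum.inr 1)))
  have hzv : zv hb.le (s * κ₀) Finset.univ x ≠ 0 := hgen (Sum.inr (Sum.inr 0))
  have hT : casT hb.le Finset.univ x ≠ 0 := hgen (Sum.inr (Sum.inr 3))
  by_cases h1 : r = 1
  · have hP : zvIm hb.le (s * κ₀) Finset.univ x ≠ 0 := hgen (Sum.inr (Sum.inr 4))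
    refine ⟨1, by rw [if_pos h1], nonempty_torusData hb.le hε hm hx
      (isModes_of_unique ⟨0, hr⟩ (fun i => Fin.ext ?_) hz hP) hz hT hzv⟩
    have := i.2
    simp only; omega
  · have hP : (if r = 1 then 1 else zz hb.le Finset.univ x * vv hb.le (s * κ₀) Finset.univ x
        - zv hb.le (s * κ₀) Finset.univ x ^ 2 - zvIm hb.le (s * κ₀) Finset.univ x ^ 2) ≠ 0 :=
      hgen (Sum.inr (Sum.inr 5))
    rw [if_neg h1] at hP
    have hnn := sum_normSq_minor Finset.univ (posZ hb.le x) (momZ hb.le (s * κ₀) x)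
    have h0 : 0 ≤ zz hb.le Finset.univ x * vv hb.le (s * κ₀) Finset.univ x
        - zv hb.le (s * κ₀) Finset.univ x ^ 2 - zvIm hb.le (s * κ₀) Finset.univ x ^ 2 := by
      have h2 : 0 ≤ ∑ i, ∑ j, Complex.normSq (posZ hb.le x i * momZ hb.le (s * κ₀) x j
          - momZ hb.le (s * κ₀) x i * posZ hb.le x j) :=
        Finset.sum_nonneg fun _ _ => Finset.sum_nonneg fun _ _ => Complex.normSq_nonneg _
      rw [hnn] at h2
      exact (mul_nonneg_iff_of_pos_left two_pos).1 h2
    have hlt := lt_of_le_of_ne h0 hP.symm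
    obtain ⟨A, ν, hA⟩ := isModes_pair (v := momZ hb.le (s * κ₀) x) hz (sub_pos.1 hlt)
    exact ⟨2, by rw [if_neg h1], nonempty_torusData hb.le hε hm hx hA hz hT hzv⟩

theorem range_torus (hb : IsBlockField r κ κ₀) {m s : ℝ} {x : Ph n} {K : ℕ}
    (d : TorusData hb.le (s * κ₀) m x K) : Set.range d.torus =
      {y | y ∈ cotangentSphere n ∧ ∀ f ∈ noncommutativeFamily m s κ r, f y = f x} := by
  ext y
  rw [d.mem_torus_iff]
  exact and_congr_right fun hy => (level_iff hb d.m_pos.ne' s d.mem hy).symm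

/-- The whole level set is the image of the torus map, hence connected, and coincides with the
component through x. -/
theorem isQuasiPeriodicIsotropicTorus (hb : IsBlockField r κ κ₀) {m s : ℝ} {x : Ph n} {K : ℕ}
    (d : TorusData hb.le (s * κ₀) m x K) : IsQuasiPeriodicIsotropicTorus m s κ (K + 2)
      (connectedComponentIn
        {y | y ∈ cotangentSphere n ∧ ∀ f ∈ noncommutativeFamily m s κ r, f y = f x} x) := by
  have hpre : IsPreconnected
      {y | y ∈ cotangentSphere n ∧ ∀ f ∈ noncommutativeFamily m s κ r, f y = f x} := by
    rw [← range_torus hb d]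
    exact isPreconnected_range d.contDiff_torus.continuous
  rw [hpre.connectedComponentIn ⟨d.mem, fun _ _ => rfl⟩]
  exact ⟨fun _ hy => hy.1, d.torus, d.contDiff_torus, range_torus hb d, d.torus_eq_iff,
    d.fderiv_torus_injective, TorusData.isotropic_torus hb s d, d.flowDir,
    TorusData.hasDerivAt_torus_flowDir hb s d⟩

theorem genericMotionsOnTori (hb : IsBlockField r κ κ₀) (hr : 1 ≤ r) {m s : ℝ} (hm : 0 < m)
    (hε : s * κ₀ ≠ 0) : GenericMotionsOnTori m s κ (noncommutativeFamily m s κ r)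
      (if r = 1 then 3 else 4) := by
  have hrn := hb.lt
  refine (generically_generic (by omega : 2 * r + 2 ≤ n) hr hε).mono fun x hx hgen => ?_
  obtain ⟨K, hK, ⟨d⟩⟩ := exists_torusData hb hr hm hε hx hgen
  rw [← hK]
  exact isQuasiPeriodicIsotropicTorus hb d

/-! ### The kernel of the differentials of the noncommutative family -/

/-- Contracting the linearized momentum with z and v yields scalar equations for the pairings of δ
and η. They make the remaining imaginary parts vanish, first of ⟨z, η⟩ and then, if the Gram
determinant of z and v is nonzero, of ⟨v, δ⟩. A linear system with that determinant then kills δ and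
η. -/
theorem eq_zero_of_wedgeH_linear {μ : Type*} [Fintype μ] {z v δ η : μ → ℂ}
    (hl : ∀ i j, wedgeH z η i j + wedgeH δ v i j = 0) (hz : sqNorm z ≠ 0)
    (h1 : herm Finset.univ z δ = 0) (h2 : (herm Finset.univ z η).re = 0) :
    herm Finset.univ z η = 0 ∧
      (sqNorm z * sqNorm v - Complex.normSq (herm Finset.univ z v) ≠ 0 →
        (herm Finset.univ v δ).re = 0 → δ = 0 ∧ η = 0) := by
  set A := sqNorm z with hA
  set B := sqNorm v with hB
  set w := herm Finset.univ z v with hw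
  set b := herm Finset.univ z η with hb
  set c := herm Finset.univ v δ with hc
  set e := herm Finset.univ v η with he
  have hAC : (A : ℂ) ≠ 0 := by exact_mod_cast hz
  have key : ∀ (u : μ → ℂ) j, herm Finset.univ z u * η j - herm Finset.univ η u * z j
      + (herm Finset.univ δ u * v j - herm Finset.univ v u * δ j) = 0 := fun u j => by
    rw [← sum_mul_wedgeH, ← sum_mul_wedgeH, ← Finset.sum_add_distrib]
    exact Finset.sum_eq_zero fun i _ => by rw [← mul_add, hl, mul_zero]
  have pair : ∀ u t : μ → ℂ, herm Finset.univ z u * herm Finset.univ t η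
      - herm Finset.univ η u * herm Finset.univ t z
      + (herm Finset.univ δ u * herm Finset.univ t v
        - herm Finset.univ v u * herm Finset.univ t δ) = 0 := fun u t => by
    have e1 := Finset.sum_eq_zero (s := Finset.univ)
      fun j _ => show conj (t j) * (herm Finset.univ z u * η j - herm Finset.univ η u * z j
        + (herm Finset.univ δ u * v j - herm Finset.univ v u * δ j)) = 0 by rw [key, mul_zero]
    have ht : ∀ w, herm Finset.univ t w = ∑ j, conj (t j) * w j := fun _ => rfl
    rw [← e1]
    simp only [ht, Finset.mul_sum, ← Finset.sum_sub_distrib,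
      ← Finset.sum_add_distrib]
    exact Finset.sum_congr rfl fun j _ => by ring
  have c1 : herm Finset.univ η z = conj b := (conj_herm _ _ _).symm
  have c2 : herm Finset.univ v z = conj w := (conj_herm _ _ _).symm
  have c3 : herm Finset.univ δ v = conj c := (conj_herm _ _ _).symm
  have c4 : herm Finset.univ η v = conj e := (conj_herm _ _ _).symm
  have c5 : herm Finset.univ δ z = 0 := by rw [← conj_herm, h1, map_zero]
  have hreal : ∀ t : ℂ, t.re = 0 → t - conj t = 0 → t = 0 := by
    intro t ht h0
    refine Complex.ext ht ?_
    have := congrArg Complex.im h0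
    simp only [Complex.sub_im, Complex.conj_im, Complex.zero_im] at this ⊢
    linarith
  have hb0 : b = 0 := by
    refine hreal b h2 (mul_left_cancel₀ hAC ?_)
    have := pair z z
    rw [herm_self_eq, c1, c5, h1] at this
    linear_combination this
  refine ⟨hb0, fun hD h3 => ?_⟩
  have hDC : (A * B - w * conj w : ℂ) ≠ 0 := by
    rw [Complex.mul_conj]; exact_mod_cast hD
  have p1 := pair v z
  have p2 := pair v v
  rw [herm_self_eq, herm_self_eq, ← hw, ← hb, c3, c4, h1, hb0] at p1
  rw [herm_self_eq, ← hw, ← he, ← hc, c2, c3, c4] at p2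
  have p3 : A * e = c * conj w := by
    have := congrArg conj p1
    simp only [map_add, map_sub, map_mul, Complex.conj_conj, map_zero, Complex.conj_ofReal] at this
    linear_combination -this
  have hc0 : c = 0 := by
    refine hreal c h3 (mul_left_cancel₀ hDC ?_)
    linear_combination (-(A : ℂ)) * p2 + w * p3 + conj w * p1
  have he0 : e = 0 := mul_left_cancel₀ hAC (by rw [p3, hc0]; ring)
  have k1 : ∀ j, A * η j = conj w * δ j := fun j => by
    have := key z j
    rw [herm_self_eq, c1, c2, c5, hb0, map_zero] at this
    linear_combination this
  have k2 : ∀ j, w * η j = B * δ j := fun j => by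
    have := key v j
    rw [herm_self_eq, ← hw, c3, c4, he0, hc0, map_zero] at this
    linear_combination this
  have hδ : δ = 0 := funext fun j =>
    mul_left_cancel₀ hDC (by
      simp only [Pi.zero_apply]; linear_combination w * k1 j - (A : ℂ) * k2 j)
  refine ⟨hδ, funext fun j => mul_left_cancel₀ hAC ?_⟩
  rw [k1, hδ]; simp

/-- The real analogue: three scalar normalizations remove the linearized SL(2) freedom of the pair,
and the Gram determinant does the rest. -/
theorem eq_zero_of_wedge_linear {μ : Type*} [Fintype μ] {g p f k : μ → ℝ}
    (hl : ∀ i j, g i * k j - g j * k i + (f i * p j - f j * p i) = 0)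
    (hD : (g ⬝ᵥ g) * (p ⬝ᵥ p) - (g ⬝ᵥ p) ^ 2 ≠ 0) (h1 : g ⬝ᵥ f = 0) (h2 : p ⬝ᵥ f = 0)
    (h3 : g ⬝ᵥ k = 0) : f = 0 ∧ k = 0 := by
  have hA : g ⬝ᵥ g ≠ 0 := fun h => by
    rw [dotProduct_self_eq_zero] at h
    simp [h] at hD
  have key : ∀ (u : μ → ℝ) j, (u ⬝ᵥ g) * k j - (u ⬝ᵥ k) * g j
      + ((u ⬝ᵥ f) * p j - (u ⬝ᵥ p) * f j) = 0 := fun u j => by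
    have e1 := Finset.sum_eq_zero (s := Finset.univ)
      fun i _ => show u i * (g i * k j - g j * k i + (f i * p j - f j * p i)) = 0 by
        rw [hl, mul_zero]
    rw [← e1]
    simp only [dotProduct, Finset.sum_mul, ← Finset.sum_sub_distrib, ← Finset.sum_add_distrib]
    exact Finset.sum_congr rfl fun i _ => by ring
  have k1 : ∀ j, (g ⬝ᵥ g) * k j = (g ⬝ᵥ p) * f j := fun j => by
    have := key g j
    rw [h1, h3] at this
    linarith
  have h4 : p ⬝ᵥ k = 0 := by
    have e0 : (g ⬝ᵥ g) • k = (g ⬝ᵥ p) • f := funext k1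
    have e := congrArg (p ⬝ᵥ ·) e0
    simp only [dotProduct_smul, smul_eq_mul] at e
    rw [h2, mul_zero] at e
    exact (mul_eq_zero.1 e).resolve_left hA
  have k2 : ∀ j, (g ⬝ᵥ p) * k j = (p ⬝ᵥ p) * f j := fun j => by
    have := key p j
    rw [h2, h4, dotProduct_comm p g] at this
    linarith
  have hf : f = 0 := funext fun j => mul_left_cancel₀ hD (by
    simp only [Pi.zero_apply]; linear_combination (g ⬝ᵥ p) * k1 j - (g ⬝ᵥ g) * k2 j)
  refine ⟨hf, funext fun j => mul_left_cancel₀ hA ?_⟩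
  rw [k1, hf]; simp

section
variable (h : 2 * r ≤ n) (ε : ℝ)

/-- The phase vectors that are annihilated by the differentials of the moments. -/
noncomputable def momentKernel (x : Ph n) : Submodule ℝ (Ph n) where
  carrier := {y | (∀ i j, wedgeH (posZ h x) (momZ h ε y) i j
      + wedgeH (posZ h y) (momZ h ε x) i j = 0) ∧
    ∀ i j, posT h x i * momT h y j - posT h x j * momT h y i
      + (posT h y i * momT h x j - posT h y j * momT h x i) = 0}
  add_mem' := by
    rintro y y' ⟨h1, h2⟩ ⟨h3, h4⟩
    refine ⟨fun i j => ?_, fun i j => ?_⟩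
    · have e1 := h1 i j
      have e2 := h3 i j
      simp only [wedgeH, map_add, Pi.add_apply] at e1 e2 ⊢
      linear_combination e1 + e2
    · simp only [map_add, Pi.add_apply]
      linear_combination h2 i j + h4 i j
  zero_mem' := by simp [wedgeH]
  smul_mem' := by
    rintro c y ⟨h1, h2⟩
    refine ⟨fun i j => ?_, fun i j => ?_⟩
    · have e1 := h1 i j
      simp only [wedgeH, map_smul, Pi.smul_apply, Complex.real_smul, map_mul,
        Complex.conj_ofReal] at e1 ⊢
      linear_combination (c : ℂ) * e1
    · simp only [map_smul, Pi.smul_apply, smul_eq_mul]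
      linear_combination c * h2 i j

/-- The pairing with a complex vector. -/
noncomputable def hermMap {μ : Type*} [Fintype μ] (u : μ → ℂ) : (μ → ℂ) →ₗ[ℝ] ℂ where
  toFun := herm Finset.univ u
  map_add' := herm_add_right _ u
  map_smul' c w := by
    rw [RingHom.id_apply, Complex.real_smul, ← herm_smul_right]
    refine congrArg _ (funext fun i => ?_)
    simp

/-- The pairing with a real vector. -/
noncomputable def dotMap {μ : Type*} [Fintype μ] (u : μ → ℝ) : (μ → ℝ) →ₗ[ℝ] ℝ where
  toFun := dotProduct u
  map_add' := dotProduct_add u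
  map_smul' c w := dotProduct_smul c u w

/-- Four real normalizations for the complex pair and three for the real one determine an element of
the kernel. -/
theorem finrank_momentKernel_le {x : Ph n} (hz : zz h Finset.univ x ≠ 0)
    (hT : casT h Finset.univ x ≠ 0)
    (hU : zz h Finset.univ x * vv h ε Finset.univ x - zv h ε Finset.univ x ^ 2
      - zvIm h ε Finset.univ x ^ 2 ≠ 0) : Module.finrank ℝ (momentKernel h ε x) ≤ 7 := by
  let E : Ph n →ₗ[ℝ] ℂ × ℝ × ℝ × ℝ × ℝ × ℝ :=
    (hermMap (posZ h x) ∘ₗ posZ h).prod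
    ((Complex.reLm ∘ₗ hermMap (posZ h x) ∘ₗ momZ h ε).prod
    ((Complex.reLm ∘ₗ hermMap (momZ h ε x) ∘ₗ posZ h).prod
    ((dotMap (posT h x) ∘ₗ posT h).prod ((dotMap (momT h x) ∘ₗ posT h).prod
      (dotMap (posT h x) ∘ₗ momT h)))))
  have hinj : Function.Injective (E.domRestrict (momentKernel h ε x)) := by
    refine (injective_iff_map_eq_zero _).2 fun y hy => Subtype.ext ?_
    obtain ⟨h1, h2, h3, h4, h5, h6⟩ : herm Finset.univ (posZ h x) (posZ h y) = 0 ∧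
        (herm Finset.univ (posZ h x) (momZ h ε y)).re = 0 ∧
        (herm Finset.univ (momZ h ε x) (posZ h y)).re = 0 ∧ posT h x ⬝ᵥ posT h y = 0 ∧
        momT h x ⬝ᵥ posT h y = 0 ∧ posT h x ⬝ᵥ momT h y = 0 := by
      exact ⟨congrArg Prod.fst hy, congrArg (fun t => t.2.1) hy, congrArg (fun t => t.2.2.1) hy,
        congrArg (fun t => t.2.2.2.1) hy, congrArg (fun t => t.2.2.2.2.1) hy,
        congrArg (fun t => t.2.2.2.2.2) hy⟩
    obtain ⟨e1, e2⟩ := (eq_zero_of_wedgeH_linear y.2.1 hz h1 h2).2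
      (by rw [Complex.normSq_apply, ← sub_sub, ← pow_two, ← pow_two]; exact hU) h3
    obtain ⟨e3, e4⟩ := eq_zero_of_wedge_linear y.2.2 hT h4 h5 h6
    exact ph_ext h ε (by simpa using e1) (by simpa using e2) (by simpa using e3) (by simpa using e4)
  have := LinearMap.finrank_le_finrank_of_injective hinj
  simpa [Module.finrank_prod, Complex.finrank_real_complex] using this

/-- In one complex dimension the Gram determinant of z and v vanishes, but pairing with z ≠ 0
already determines a vector, so three normalizations suffice for the complex pair. -/
theorem finrank_momentKernel_le_of_unique {x : Ph n} (hr : r = 1)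
    (hz : zz h Finset.univ x ≠ 0) (hT : casT h Finset.univ x ≠ 0) :
    Module.finrank ℝ (momentKernel h ε x) ≤ 6 := by
  let E : Ph n →ₗ[ℝ] ℂ × ℝ × ℝ × ℝ × ℝ :=
    (hermMap (posZ h x) ∘ₗ posZ h).prod
    ((Complex.reLm ∘ₗ hermMap (posZ h x) ∘ₗ momZ h ε).prod
    ((dotMap (posT h x) ∘ₗ posT h).prod ((dotMap (momT h x) ∘ₗ posT h).prod
      (dotMap (posT h x) ∘ₗ momT h))))
  have hinj : Function.Injective (E.domRestrict (momentKernel h ε x)) := by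
    refine (injective_iff_map_eq_zero _).2 fun y hy => Subtype.ext ?_
    obtain ⟨h1, h2, h4, h5, h6⟩ : herm Finset.univ (posZ h x) (posZ h y) = 0 ∧
        (herm Finset.univ (posZ h x) (momZ h ε y)).re = 0 ∧ posT h x ⬝ᵥ posT h y = 0 ∧
        momT h x ⬝ᵥ posT h y = 0 ∧ posT h x ⬝ᵥ momT h y = 0 := by
      exact ⟨congrArg Prod.fst hy, congrArg (fun t => t.2.1) hy, congrArg (fun t => t.2.2.1) hy,
        congrArg (fun t => t.2.2.2.1) hy, congrArg (fun t => t.2.2.2.2) hy⟩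
    have h2' := (eq_zero_of_wedgeH_linear y.2.1 hz h1 h2).1
    have hcancel : ∀ u : Fin r → ℂ, herm Finset.univ (posZ h x) u = 0 → u = 0 := by
      intro u hu
      subst hr
      have hz0 : posZ h x 0 ≠ 0 := fun h0 => hz (by simp [zz, herm, h0])
      funext i
      have : i = 0 := Subsingleton.elim _ _
      simpa [herm, hz0, this] using hu
    obtain ⟨e3, e4⟩ := eq_zero_of_wedge_linear y.2.2 hT h4 h5 h6
    exact ph_ext h ε (by simpa using hcancel _ h1) (by simpa using hcancel _ h2')
      (by simpa using e3) (by simpa using e4)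
  have := LinearMap.finrank_le_finrank_of_injective hinj
  simpa [Module.finrank_prod, Complex.finrank_real_complex] using this

theorem exists_momentKernel {m : ℝ} (hm : m ≠ 0) {x : Ph n} (hx : x ∈ cotangentSphere n)
    (hA : zz h Finset.univ x ≠ 0) (hC : zv h ε Finset.univ x ≠ 0) (a b c : ℝ) :
    ∃ S ∈ momentKernel h ε x,
      diff phi1 x S = a ∧ diff phi2 x S = b ∧ diff (energy m) x S = c := by
  obtain ⟨S, ⟨p, s, s', hZ, hV, hG, hH⟩, h1, h2, h3, -⟩ :=
    exists_symplectic_direction h ε hm hx hA hC a b c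
  refine ⟨S, ⟨fun i j => ?_, fun i j => ?_⟩, h1, h2, h3⟩
  · simp only [wedgeH, hZ, hV, Pi.sub_apply, Pi.smul_apply, smul_eq_mul, map_sub, map_mul,
      Complex.conj_ofReal]
    ring
  · simp only [hG, hH, Pi.zero_apply, Pi.smul_apply, smul_eq_mul]
    ring

end

theorem finrank_le_of_surjective {V : Type*} [AddCommGroup V] [Module ℝ V] [FiniteDimensional ℝ V]
    {W U : Submodule ℝ V} {k : ℕ} (hW : Module.finrank ℝ W ≤ k + 3) (f₁ f₂ f₃ : Module.Dual ℝ V)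
    (hs : ∀ a b c : ℝ, ∃ S ∈ W, f₁ S = a ∧ f₂ S = b ∧ f₃ S = c) (hUW : U ≤ W)
    (hU : ∀ v ∈ U, f₁ v = 0 ∧ f₂ v = 0 ∧ f₃ v = 0) : Module.finrank ℝ U ≤ k := by
  let L : W →ₗ[ℝ] ℝ × ℝ × ℝ := (f₁.prod (f₂.prod f₃)).domRestrict W
  have hsurj : LinearMap.range L = ⊤ := by
    refine LinearMap.range_eq_top.2 fun t => ?_
    obtain ⟨S, hS, h1, h2, h3⟩ := hs t.1 t.2.1 t.2.2
    exact ⟨⟨S, hS⟩, Prod.ext h1 (Prod.ext h2 h3)⟩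
  have h1 := L.finrank_range_add_finrank_ker
  rw [hsurj, finrank_top] at h1
  have h2 : Module.finrank ℝ (ℝ × ℝ × ℝ) = 3 := by simp [Module.finrank_prod]
  have h3 : U ≤ (LinearMap.ker L).map W.subtype := fun v hv => by
    obtain ⟨e1, e2, e3⟩ := hU v hv
    exact ⟨⟨v, hUW hv⟩, Prod.ext e1 (Prod.ext e2 e3), rfl⟩
  have h4 := Submodule.finrank_mono h3
  rw [Submodule.finrank_map_subtype_eq] at h4
  omega

/-- The differential of a quadratic function. -/
theorem diff_of_quadratic {f : Ph n → ℝ} (hf : ContDiff ℝ ∞ f) {x v : Ph n} {L Q : ℝ}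
    (he : ∀ t : ℝ, f (x + t • v) = f x + t * L + t ^ 2 * Q) : diff f x v = L := by
  have h1 : HasFDerivAt f (fderiv ℝ f x) (x + (0 : ℝ) • v) := by
    rw [zero_smul, add_zero]; exact (hf.differentiable (by simp) x).hasFDerivAt
  have h2 : HasDerivAt (fun t : ℝ => x + t • v) v 0 := by
    simpa using ((hasDerivAt_id (0 : ℝ)).smul_const v).const_add x
  have h3 := h1.comp_hasDerivAt (0 : ℝ) h2
  rw [Function.comp_def] at h3
  simp only [he] at h3
  have h4 : HasDerivAt (fun t : ℝ => f x + t * L + t ^ 2 * Q) L 0 := by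
    have := (((hasDerivAt_id (0 : ℝ)).mul_const L).const_add (f x)).fun_add
      (((hasDerivAt_id (0 : ℝ)).fun_pow 2).mul_const Q)
    simpa using this
  exact h3.unique h4

theorem diff_umoment (hb : IsBlockField r κ κ₀) (s : ℝ) (c : ℂ) (i j : Fin r) (x v : Ph n) :
    diff (umoment hb s c i j) x v = -(c * (wedgeH (posZ hb.le x) (momZ hb.le (s * κ₀) v) i j
      + wedgeH (posZ hb.le v) (momZ hb.le (s * κ₀) x) i j)).re := by
  refine diff_of_quadratic (Q := -(c * wedgeH (posZ hb.le v) (momZ hb.le (s * κ₀) v) i j).re)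
    (contDiff_umoment hb s c i j) fun t => ?_
  simp only [umoment, gaugeMoment_ugen hb, umom_eq_wedgeH]
  have e : c * wedgeH (posZ hb.le (x + t • v)) (momZ hb.le (s * κ₀) (x + t • v)) i j
      = c * wedgeH (posZ hb.le x) (momZ hb.le (s * κ₀) x) i j
        + (t : ℂ) * (c * (wedgeH (posZ hb.le x) (momZ hb.le (s * κ₀) v) i j
          + wedgeH (posZ hb.le v) (momZ hb.le (s * κ₀) x) i j))
        + ((t ^ 2 : ℝ) : ℂ) * (c * wedgeH (posZ hb.le v) (momZ hb.le (s * κ₀) v) i j) := by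
    simp only [wedgeH, map_add, map_smul, Pi.add_apply, Pi.smul_apply, Complex.real_smul, map_mul,
      Complex.conj_ofReal]
    push_cast
    ring
  rw [e, Complex.add_re, Complex.add_re, Complex.re_ofReal_mul, Complex.re_ofReal_mul]
  ring

theorem diff_tmoment (hb : IsBlockField r κ κ₀) (s : ℝ) (i j : Fin (n - 2 * r)) (x v : Ph n) :
    diff (tmoment hb s i j) x v = posT hb.le x i * momT hb.le v j
      - posT hb.le x j * momT hb.le v i
      + (posT hb.le v i * momT hb.le x j - posT hb.le v j * momT hb.le x i) := by
  refine diff_of_quadratic (Q := tmom hb.le i j v) (contDiff_tmoment hb s i j) fun t => ?_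
  have e : ∀ y : Ph n, tmom hb.le i j y
    = posT hb.le y i * momT hb.le y j - posT hb.le y j * momT hb.le y i := fun _ => rfl
  simp only [tmoment, gaugeMoment_tgen hb, e, map_add, map_smul, Pi.add_apply, Pi.smul_apply,
    smul_eq_mul]
  ring

theorem commonKernel_le_momentKernel (hb : IsBlockField r κ κ₀) (m s : ℝ) (x : Ph n) :
    commonKernel x (diffSpan (noncommutativeFamily m s κ r) x)
      ≤ momentKernel hb.le (s * κ₀) x := by
  intro v hv
  have hrn := hb.lt
  obtain ⟨-, hf⟩ := mem_diffSpan_commonKernel.1 hv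
  set W : Fin r → Fin r → ℂ := fun i j => wedgeH (posZ hb.le x) (momZ hb.le (s * κ₀) v) i j
      + wedgeH (posZ hb.le v) (momZ hb.le (s * κ₀) x) i j with hW
  have hconj : ∀ i j, W j i = -conj (W i j) := fun i j => by
    simp only [hW, wedgeH, map_add, map_sub, map_mul, Complex.conj_conj]; ring
  have hlt : ∀ i j : Fin r, i < j → W i j = 0 := by
    intro i j hij
    have h1 := hf _ (Or.inl (Or.inr ⟨⟨i.1, by omega⟩, ⟨j.1, by omega⟩, hij, j.2, Or.inl rfl⟩))
    have h2 := hf _ (Or.inl (Or.inr ⟨⟨i.1, by omega⟩, ⟨j.1, by omega⟩, hij, j.2, Or.inr rfl⟩))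
    have e1 : Psi1 s κ ⟨i.1, by omega⟩ ⟨j.1, by omega⟩ = umoment hb s (-Complex.I) i j := by
      funext y
      rw [Psi1_eq hb s _ _ i.2 j.2, umoment, gaugeMoment_ugen hb]; simp
    have e2 : Psi2 s κ ⟨i.1, by omega⟩ ⟨j.1, by omega⟩ = umoment hb s (-1) i j := by
      funext y
      rw [Psi2_eq hb s _ _ i.2 j.2, umom_re]
    rw [e1, diff_umoment] at h1
    rw [e2, diff_umoment] at h2
    refine Complex.ext ?_ ?_
    · simpa [hW] using h2
    · have h3 : -(-Complex.I * W i j).re = 0 := h1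
      simpa using h3
  refine ⟨fun i j => ?_, ?_⟩
  · change W i j = 0
    rcases lt_trichotomy i j with hij | rfl | hij
    · exact hlt i j hij
    · have h1 := hf _ (Or.inl (Or.inl (Or.inr ⟨⟨i.1, by omega⟩, i.2, rfl⟩)))
      have e1 : Phi s κ ⟨i.1, by omega⟩ = umoment hb s (Complex.I / 2) i i := by
        funext y
        rw [Phi_eq hb s _ i.2, umom_half_im]
      rw [e1, diff_umoment] at h1
      refine Complex.ext ?_ ?_
      · have := congrArg Complex.re (hconj i i)
        simp only [Complex.neg_re, Complex.conj_re] at this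
        simp only [Complex.zero_re]; linarith
      · have h2 : (Complex.I / 2 * W i i).re = -((W i i).im / 2) := by
          rw [show Complex.I / 2 * W i i = ((1 / 2 : ℝ) : ℂ) * (Complex.I * W i i) by
            push_cast; ring, Complex.re_ofReal_mul]
          simp; ring
        have h3 : -(Complex.I / 2 * W i i).re = 0 := h1
        rw [h2] at h3
        simp only [Complex.zero_im]; linarith
    · rw [hconj j i, hlt j i hij, map_zero, neg_zero]
  · set V : Fin (n - 2 * r) → Fin (n - 2 * r) → ℝ := fun i j =>
      posT hb.le x i * momT hb.le v j - posT hb.le x j * momT hb.le v i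
        + (posT hb.le v i * momT hb.le x j - posT hb.le v j * momT hb.le x i) with hV
    have hlt' : ∀ i j : Fin (n - 2 * r), i < j → V i j = 0 := by
      intro i j hij
      have h1 := hf _ (Or.inr ⟨⟨2 * r + i.1, by omega⟩, ⟨2 * r + j.1, by omega⟩, by simp,
        by simpa using hij, rfl⟩)
      have e1 : angular ⟨2 * r + i.1, by omega⟩ ⟨2 * r + j.1, by omega⟩ = tmoment hb s i j := by
        funext y
        rw [angular_eq hb.le _ _ (by simp) (by simp), tmoment, gaugeMoment_tgen hb]
        simp
      rwa [e1, diff_tmoment] at h1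
    intro i j
    change V i j = 0
    rcases lt_trichotomy i j with hij | rfl | hij
    · exact hlt' i j hij
    · simp [hV]
    · have := hlt' j i hij
      simp only [hV] at this ⊢
      linarith

/-- The two constraints and H take arbitrary derivatives on the kernel of the linearized moments;
imposing that all three vanish lowers its bound, 7 or 6, by three. -/
theorem finrank_commonKernel_le (hb : IsBlockField r κ κ₀) (hr : 1 ≤ r) {m s : ℝ} (hm : m ≠ 0)
    {x : Ph n} (hx : x ∈ cotangentSphere n)
    (hgen : ∀ i, genericFunction hb.le (s * κ₀) i x ≠ 0) :
    Module.finrank ℝ (commonKernel x (diffSpan (noncommutativeFamily m s κ r) x))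
      ≤ if r = 1 then 3 else 4 := by
  have hz := (zz_univ_ne_zero hb.le hr (hgen (Sum.inr (Sum.inr 1)))).ne'
  have hzv : zv hb.le (s * κ₀) Finset.univ x ≠ 0 := hgen (Sum.inr (Sum.inr 0))
  have hT : casT hb.le Finset.univ x ≠ 0 := hgen (Sum.inr (Sum.inr 3))
  refine finrank_le_of_surjective (W := momentKernel hb.le (s * κ₀) x) ?_ (diff phi1 x)
    (diff phi2 x) (diff (energy m) x) (exists_momentKernel hb.le (s * κ₀) hm hx hz hzv)
    (commonKernel_le_momentKernel hb m s x) fun v hv => ?_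
  · have h5 : (if r = 1 then 1 else zz hb.le Finset.univ x * vv hb.le (s * κ₀) Finset.univ x
        - zv hb.le (s * κ₀) Finset.univ x ^ 2 - zvIm hb.le (s * κ₀) Finset.univ x ^ 2) ≠ 0 :=
      hgen (Sum.inr (Sum.inr 5))
    split_ifs with h1
    · exact finrank_momentKernel_le_of_unique _ _ h1 hz hT
    · rw [if_neg h1] at h5
      exact finrank_momentKernel_le _ _ hz hT h5
  · obtain ⟨h1, h2⟩ := mem_diffSpan_commonKernel.1 hv
    obtain ⟨h3, h4⟩ := mem_tangentAt_iff.1 h1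
    exact ⟨h3, h4, h2 _ (Or.inl (Or.inl (Or.inl (Or.inl rfl))))⟩

/-- The integrals are constant on the torus, so its tangent space lies in the common kernel, and the
upper bound on the dimension forces equality. -/
theorem commonKernel_eq_range (hb : IsBlockField r κ κ₀) (hr : 1 ≤ r) {m s : ℝ}
    {x : Ph n} (hgen : ∀ i, genericFunction hb.le (s * κ₀) i x ≠ 0) {K : ℕ}
    (hK : K + 2 = if r = 1 then 3 else 4) (d : TorusData hb.le (s * κ₀) m x K) :
    ∃ u, commonKernel x (diffSpan (noncommutativeFamily m s κ r) x)
      = LinearMap.range (fderiv ℝ d.torus u).toLinearMap ∧ d.torus u = x := by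
  have hmem : x ∈ Set.range d.torus := by
    rw [range_torus hb d]; exact ⟨d.mem, fun _ _ => rfl⟩
  obtain ⟨u, hu⟩ := hmem
  have hle : LinearMap.range (fderiv ℝ d.torus u).toLinearMap
      ≤ commonKernel x (diffSpan (noncommutativeFamily m s κ r) x) := by
    rintro _ ⟨w, rfl⟩
    rw [mem_diffSpan_commonKernel]
    have h1 := d.fderiv_torus_mem u w
    rw [hu] at h1
    refine ⟨h1, fun f hf => ?_⟩
    have h2 := d.diff_fderiv_torus (c := f x)
      (isFirstIntegral_noncommutativeFamily hb d.m_pos.ne' s f hf).1 (fun u' => by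
        have h3 : d.torus u' ∈ Set.range d.torus := ⟨u', rfl⟩
        rw [range_torus hb d] at h3
        exact h3.2 f hf) u w
    rwa [hu] at h2
  have h1 := LinearMap.finrank_range_of_inj (f := (fderiv ℝ d.torus u).toLinearMap)
    (d.fderiv_torus_injective u)
  have h2 := finrank_commonKernel_le hb hr d.m_pos.ne' d.mem hgen
  rw [← hK] at h2
  rw [Module.finrank_fin_fun] at h1
  exact ⟨u, (Submodule.eq_of_le_of_finrank_le hle (h2.trans h1.ge)).symm, hu⟩

theorem isNoncommutativelyIntegrable (hb : IsBlockField r κ κ₀) (hr : 1 ≤ r) {m s : ℝ}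
    (hm : 0 < m) (hε : s * κ₀ ≠ 0) : IsNoncommutativelyIntegrable m s κ
      (noncommutativeFamily m s κ r) (if r = 1 then 3 else 4) := by
  have hrn := hb.lt
  refine ⟨isFirstIntegral_noncommutativeFamily hb hm.ne' s, bracket_closed hb hm.ne' s,
    (generically_generic (by omega : 2 * r + 2 ≤ n) hr hε).mono fun x hx hgen => ?_⟩
  obtain ⟨K, hK, ⟨d⟩⟩ := exists_torusData hb hr hm hε hx hgen
  obtain ⟨u, hu, hux⟩ := commonKernel_eq_range hb hr hgen hK d
  refine ddimAt_add_dindAt s κ hx _ ?_ ?_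
  · rw [hu, LinearMap.finrank_range_of_inj (d.fderiv_torus_injective u), Module.finrank_fin_fun, hK]
  · rw [hu]
    rintro _ ⟨a, rfl⟩ _ ⟨b, rfl⟩
    exact TorusData.isotropic_torus hb s d u a b

end MagneticSphere

theorem theorem6 (n r : ℕ) (hr : 1 ≤ r) (hrn : r < n / 2) (m s : ℝ) (hm : 0 < m) (hs : s ≠ 0)
    (κ : Fin (n / 2) → ℝ) (κ₀ : ℝ) (hκ₀ : κ₀ ≠ 0)
    (hκ : ∀ i : Fin (n / 2), i.1 < r → κ i = κ₀)
    (hκ' : ∀ i : Fin (n / 2), r ≤ i.1 → κ i = 0) :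
    IsNoncommutativelyIntegrable m s κ (noncommutativeFamily m s κ r) (if r = 1 then 3 else 4) ∧
    GenericMotionsOnTori m s κ (noncommutativeFamily m s κ r) (if r = 1 then 3 else 4) ∧
    IsLiouvilleIntegrable m s κ
      (insert (angular (od ⟨r, hrn⟩) (ev ⟨r, hrn⟩)) (filtrationFamily m s κ r)) ∧
    (n = 2 * r + 2 → IsLiouvilleIntegrable m s κ (filtrationFamily m s κ r)) := by
  have hb : IsBlockField r κ κ₀ := ⟨hrn, hκ, hκ'⟩
  have hε : s * κ₀ ≠ 0 := mul_ne_zero hs hκ₀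
  exact ⟨isNoncommutativelyIntegrable hb hr hm hε, genericMotionsOnTori hb hr hm hε,
    isLiouvilleIntegrable_insert hb hr hm.ne' hε, isLiouvilleIntegrable_of_eq hb hr hm.ne' hε⟩
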